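/- Let $0<R_{\min}<R_{\max}<\infty$ and $\nu_{\mathrm{est}}>0$, and let $\mathcal F$ be a compact subset of the real space $L^2((0,1))$ such that $\int_0^1 f(u)\,du=1$ for every $f\in\mathcal F$. For $u\in[0,1]$ put $S(u)=(\cos 2\pi u,\sin 2\pi u)^\top$. Let $$Y_i=C^\star+R^\star S(U_i)+\varepsilon_i\in\mathbb R^2,\qquad i\ge 1,$$ where $C^\star\in\mathbb R^2$, $R^\star\in(R_{\min},R_{\max})$; $(U_i)_{i\ge1}$ are i.i.d. random variables with a probability density $f^\star\in\mathcal F$ on $[0,1]$; $(\varepsilon_i)_{i\ge1}$ are i.i.d. random vectors of $\mathbb R^2$, independent of $(U_i)_{i\ge1}$, such that the two coordinates of $\varepsilon_1$ are independent, centered, and have finite variance. For $f\in L^2((0,1))$, $R>0$ and $t=(t_1,t_2)\in\mathbb R^2$ put $$\Psi_{f,R}(t)=\int_0^1 e^{iR\,t^\top S(u)}f(u)\,du,\qquad \tilde\psi_n(t)=\frac1n\sum_{\ell=1}^n e^{i\,t^\top Y_\ell},$$ $$M_n(f,R)=\int_{[-\nu_{\mathrm{est}},\nu_{\mathrm{est}}]^2}\bigl|\Psi_{f,R}(t_1,t_2)\,\tilde\psi_n(t_1,0)\,\tilde\psi_n(0,t_2)-\tilde\psi_n(t_1,t_2)\,\Psi_{f,R}(t_1,0)\,\Psi_{f,R}(0,t_2)\bigr|^2dt_1\,dt_2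 .$$ For each $n\ge1$ let $(\widehat f,\widehat R)$ (depending on $n$) be any measurable random element of $\mathcal F\times[R_{\min},R_{\max}]$ such that $$M_n(\widehat f,\widehat R)\le\inf_{(f,R)\in\mathcal F\times[R_{\min},R_{\max}]}M_n(f,R)+\frac1n ,$$ and put $$\widehat C=\frac1n\sum_{i=1}^nY_i-\widehat R\int_0^1S(u)\widehat f(u)\,du .$$ Then for every $\delta>0$, $\widehat C-C^\star=O_{\mathbb P}(n^{-1/2+\delta})$ as $n\to\infty$, that is, the sequence $\bigl(n^{1/2-\delta}(\widehat C-C^\star)\bigr)_{n\ge1}$ is tight. -/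

import Mathlib

open MeasureTheory ProbabilityTheory

noncomputable section

namespace CircleDeconv

/-- The plane with its Euclidean norm. -/
abbrev Plane : Type := EuclideanSpace ℝ (Fin 2)

/-- The real Hilbert space of square integrable functions on the interval `(0, 1)`. -/
abbrev L2 : Type := Lp ℝ 2 (volume.restrict (Set.Ioo (0 : ℝ) 1))

/-- The point of the unit circle with angle `2 * π * u`. -/
def circlePoint (u : ℝ) : Plane :=
  !₂[Real.cos (2 * Real.pi * u), Real.sin (2 * Real.pi * u)]

/-- The function `Ψ_{f,R}` at the point `(t₁, t₂)`: for a probability density `f`, this is the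
characteristic function of `R * circlePoint U` where `U` has density `f`. -/
def charCircle (f : L2) (R : ℝ) (t₁ t₂ : ℝ) : ℂ :=
  ∫ u in Set.Ioo (0 : ℝ) 1,
    Complex.exp (Complex.I *
      ((R * (t₁ * circlePoint u 0 + t₂ * circlePoint u 1) : ℝ) : ℂ)) * ((f u : ℝ) : ℂ)

/-- The empirical characteristic function of the first `n` points of `y`, at `(t₁, t₂)`. -/
def empChar (y : ℕ → Plane) (n : ℕ) (t₁ t₂ : ℝ) : ℂ :=
  (1 / (n : ℂ)) * ∑ l ∈ Finset.range n,
    Complex.exp (Complex.I * ((t₁ * y l 0 + t₂ * y l 1 : ℝ) : ℂ))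

/-- The empirical contrast `M_n(f, R)`, computed from the first `n` points of `y` by integration
over the square `[-ν, ν] × [-ν, ν]`. -/
def contrast (ν : ℝ) (y : ℕ → Plane) (n : ℕ) (f : L2) (R : ℝ) : ℝ :=
  ∫ t in Set.Icc (-ν) ν ×ˢ Set.Icc (-ν) ν,
    ‖charCircle f R t.1 t.2 * empChar y n t.1 0 * empChar y n 0 t.2
      - empChar y n t.1 t.2 * charCircle f R t.1 0 * charCircle f R 0 t.2‖ ^ 2

/-- `(f, R)` minimizes the empirical contrast over `F × [Rmin, Rmax]` up to `1 / n`. -/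
def IsNearMinimizer (ν : ℝ) (F : Set L2) (Rmin Rmax : ℝ) (y : ℕ → Plane) (n : ℕ)
    (f : L2) (R : ℝ) : Prop :=
  f ∈ F ∧ R ∈ Set.Icc Rmin Rmax ∧
    ∀ g ∈ F, ∀ r ∈ Set.Icc Rmin Rmax,
      contrast ν y n f R ≤ contrast ν y n g r + 1 / (n : ℝ)

/-- The estimator of the center obtained from the first `n` points of `y` and from the
estimators `f` of the angular density and `R` of the radius. -/
def centerEst (y : ℕ → Plane) (n : ℕ) (f : L2) (R : ℝ) : Plane :=
  (1 / (n : ℝ)) • ∑ l ∈ Finset.range n, y l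
    - R • ∫ u in Set.Ioo (0 : ℝ) 1, (f u : ℝ) • circlePoint u

/-- `X n = O_P(r n)`: the sequence `X n / r n`, `n ≥ 1`, is bounded in probability
(uniformly tight). -/
def IsBigOInProb {Ω : Type*} [MeasurableSpace Ω] (P : Measure Ω)
    (X : ℕ → Ω → Plane) (r : ℕ → ℝ) : Prop :=
  ∀ η : ℝ, 0 < η → ∃ K : ℝ, 0 < K ∧ ∀ n : ℕ, 1 ≤ n →
    P {ω | K * r n < ‖X n ω‖} ≤ ENNReal.ofReal η

end CircleDeconv

end

/-! Write `L(z, w)` for the Laplace transform of the circular law attached to a candidate `(f, R)`,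
extended to complex arguments, and `p`, `q` for its restrictions to `w = 0` and to `z = 0`. Stars
denote the same objects for the true pair.

Reduction. The coordinates of the noise are independent, so its characteristic function is a product
and factors out of the population contrast; near the origin it is bounded below. The empirical
characteristic function has integrated squared error `O_P(1/n)`. Hence a near minimizer makes `G = L
p* q* - L* p q` of order `n^(-1/2)` in `L²` on a small imaginary square (`integral_crossDefect_le`).
The means of the signal and of the noise fluctuate at order `n^(-1/2)`, so it remains to bound the
difference of the first moments of the two circular laws by the size of `G`. No rate for `f` itself
is needed.

Where `δ` comes from. `Q = G / (p* q*) = L - L* (p/p*) (q/q*)` is analytic and uniformly bounded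
near the origin. A bounded analytic function that is small in mean on a segment is small there with
its derivatives, up to an arbitrarily small loss in the exponent (`analytic_interpolation`).

The linear structure. On a circle of radius `R` one has `L_zz + L_ww = R² L`. Applying this operator
to `Q` removes `L` and leaves a relation between `p/p*`, `q/q*` and `R² - R*²`, with a small
right-hand side. The derivative of `p/p*` is `W / p*²`, where `W = p' p* - p p*'`, and `W(0)` is the
difference of the first moments in the first coordinate.

Stability (`DensityOnCircle.stability`) is by contradiction and compactness. If no linear bound
held, a limit pair would have `G = 0`. Identification then gives `R = R*`, `p = p*`, `q = q*`, and
the normalized Wronskians converge to a nonzero solution of the linear equation `α'(s) + 2 m₁ α(s) +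
β'(t) + 2 m₂ β(t) + const = 0`, where `(m₁, m₂)` is the gradient of `log L*` at the real point `(s,
t)`.

Both rigidity statements come from behavior at infinity over the reals. Along the ray through a
support point `x` of the true law, exponential tilts concentrate at `x`, so `(m₁, m₂)` tends to `x`.
After a reflection, four support points lie in the open first quadrant. In the linear equation
(`SeparatedSolution.eq_zero`) the drift forces `α` and `β` to vanish at infinity, and comparing
their exponential rates along four rays leaves only zero. For identification, `A = p/p*` is entire,
has at most one zero, which is simple, and is a quotient of functions of exponential type; so `A(z)
= (1 + a z) exp(c z)`, and the relation above along the rays gives `a = c = 0`. -/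

noncomputable section

/-! ### Laplace transforms of complex densities on a circle -/

namespace CircleDeconv

/-- The two-dimensional Laplace transform of the image under `(X, Y)` of the measure with
density `g` with respect to `μ`. -/
def lap {α : Type*} [MeasurableSpace α] (μ : Measure α) (X Y : α → ℝ) (g : α → ℂ)
    (z w : ℂ) : ℂ :=
  ∫ a, Complex.exp (z * X a + w * Y a) * g a ∂μ

theorem norm_exp_lap_le {α : Type*} {X Y : α → ℝ} {K : ℝ}
    (hX : ∀ a, |X a| ≤ K) (hY : ∀ a, |Y a| ≤ K) (z w : ℂ) (a : α) :
    ‖Complex.exp (z * X a + w * Y a)‖ ≤ Real.exp (K * (‖z‖ + ‖w‖)) := by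
  rw [Complex.norm_exp]
  apply Real.exp_le_exp.2
  have h1 : (z * X a + w * Y a).re ≤ ‖z * X a + w * Y a‖ := Complex.re_le_norm _
  have h2 : ‖z * X a + w * Y a‖ ≤ ‖z‖ * |X a| + ‖w‖ * |Y a| := by
    refine (norm_add_le _ _).trans ?_
    simp
  have h3 := mul_le_mul_of_nonneg_left (hX a) (norm_nonneg z)
  have h4 := mul_le_mul_of_nonneg_left (hY a) (norm_nonneg w)
  nlinarith

section Lap

variable {α : Type*} [MeasurableSpace α] {μ : Measure α} {X Y : α → ℝ} {K : ℝ}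

theorem lap_swap (g : α → ℂ) (z w : ℂ) : lap μ X Y g z w = lap μ Y X g w z := by
  simp only [lap, add_comm]

theorem measurable_exp_lap (hXm : Measurable X) (hYm : Measurable Y) (z w : ℂ) :
    Measurable fun a => Complex.exp (z * X a + w * Y a) := by
  fun_prop

theorem integrable_lap (hXm : Measurable X) (hYm : Measurable Y) (hX : ∀ a, |X a| ≤ K)
    (hY : ∀ a, |Y a| ≤ K) {g : α → ℂ} (hg : Integrable g μ) (z w : ℂ) :
    Integrable (fun a => Complex.exp (z * X a + w * Y a) * g a) μ :=
  hg.bdd_mul (measurable_exp_lap hXm hYm z w).aestronglyMeasurable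
    (Filter.Eventually.of_forall (norm_exp_lap_le hX hY z w))

theorem norm_lap_le (hX : ∀ a, |X a| ≤ K)
    (hY : ∀ a, |Y a| ≤ K) {g : α → ℂ} (hg : Integrable g μ) (z w : ℂ) :
    ‖lap μ X Y g z w‖ ≤ Real.exp (K * (‖z‖ + ‖w‖)) * ∫ a, ‖g a‖ ∂μ := by
  rw [lap, ← integral_const_mul]
  refine norm_integral_le_of_norm_le (hg.norm.const_mul _) (Filter.Eventually.of_forall fun a => ?_)
  rw [norm_mul]
  exact mul_le_mul_of_nonneg_right (norm_exp_lap_le hX hY z w a) (norm_nonneg _)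

theorem integrable_ofReal_mul (hXm : Measurable X) (hX : ∀ a, |X a| ≤ K) {g : α → ℂ}
    (hg : Integrable g μ) : Integrable (fun a => (X a : ℂ) * g a) μ :=
  hg.bdd_mul (c := K) (Complex.measurable_ofReal.comp hXm).aestronglyMeasurable
    (Filter.Eventually.of_forall fun a => by simpa using hX a)

theorem hasDerivAt_lap_left (hXm : Measurable X) (hYm : Measurable Y) (hX : ∀ a, |X a| ≤ K)
    (hY : ∀ a, |Y a| ≤ K) {g : α → ℂ} (hg : Integrable g μ) (z w : ℂ) :
    HasDerivAt (fun z => lap μ X Y g z w) (lap μ X Y (fun a => X a * g a) z w) z := by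
  have hXg := integrable_ofReal_mul hXm hX hg
  refine (hasDerivAt_integral_of_dominated_loc_of_deriv_le
    -- The bound uses `|K|`: if `α` is empty the hypotheses allow `K < 0`, while the exponent must
    -- increase with the norm of the argument.
    (bound := fun a => Real.exp (|K| * ((‖z‖ + 1) + ‖w‖)) * ‖(X a : ℂ) * g a‖)
    (F' := fun z a => Complex.exp (z * X a + w * Y a) * (X a * g a))
    (Metric.ball_mem_nhds z one_pos)
    (Filter.Eventually.of_forall fun z =>
      (integrable_lap hXm hYm hX hY hg z w).aestronglyMeasurable)
    (integrable_lap hXm hYm hX hY hg z w)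
    (integrable_lap hXm hYm hX hY hXg z w).aestronglyMeasurable
    (Filter.Eventually.of_forall fun a z' hz' => ?_) (hXg.norm.const_mul _)
    (Filter.Eventually.of_forall fun a z' hz' => ?_)).2
  · rw [norm_mul]
    refine mul_le_mul_of_nonneg_right ((norm_exp_lap_le hX hY z' w a).trans ?_) (norm_nonneg _)
    apply Real.exp_le_exp.2
    have h1 : ‖z'‖ ≤ ‖z‖ + 1 := by
      have := norm_le_norm_add_norm_sub' z' z
      have h2 : ‖z' - z‖ < 1 := by simpa [dist_eq_norm] using hz'
      linarith
    have := abs_nonneg K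
    have := le_abs_self K
    have := norm_nonneg z'
    have := norm_nonneg w
    apply mul_le_mul <;> linarith
  · have h1 : HasDerivAt (fun z : ℂ => z * (X a : ℂ) + w * Y a) (X a : ℂ) z' := by
      simpa using ((hasDerivAt_id z').mul_const (X a : ℂ)).add_const (w * (Y a : ℂ))
    exact (h1.cexp.mul_const (g a)).congr_deriv (by ring)

theorem hasDerivAt_lap_right (hXm : Measurable X) (hYm : Measurable Y) (hX : ∀ a, |X a| ≤ K)
    (hY : ∀ a, |Y a| ≤ K) {g : α → ℂ} (hg : Integrable g μ) (z w : ℂ) :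
    HasDerivAt (fun w => lap μ X Y g z w) (lap μ X Y (fun a => Y a * g a) z w) w := by
  simp only [lap_swap (X := X)]
  exact hasDerivAt_lap_left hYm hXm hY hX hg w z

theorem differentiable_lap_left (hXm : Measurable X) (hYm : Measurable Y) (hX : ∀ a, |X a| ≤ K)
    (hY : ∀ a, |Y a| ≤ K) {g : α → ℂ} (hg : Integrable g μ) (w : ℂ) :
    Differentiable ℂ (fun z => lap μ X Y g z w) :=
  fun z => (hasDerivAt_lap_left hXm hYm hX hY hg z w).differentiableAt

theorem differentiable_lap_right (hXm : Measurable X) (hYm : Measurable Y) (hX : ∀ a, |X a| ≤ K)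
    (hY : ∀ a, |Y a| ≤ K) {g : α → ℂ} (hg : Integrable g μ) (z : ℂ) :
    Differentiable ℂ (fun w => lap μ X Y g z w) :=
  fun w => (hasDerivAt_lap_right hXm hYm hX hY hg z w).differentiableAt

theorem continuous_lap (hXm : Measurable X) (hYm : Measurable Y) (hX : ∀ a, |X a| ≤ K)
    (hY : ∀ a, |Y a| ≤ K) {g : α → ℂ} (hg : Integrable g μ) :
    Continuous fun p : ℂ × ℂ => lap μ X Y g p.1 p.2 := by
  refine continuous_iff_continuousAt.2 fun p₀ => ?_
  refine continuousAt_of_dominated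
    (bound := fun a => Real.exp (|K| * ((‖p₀‖ + 1) + (‖p₀‖ + 1))) * ‖g a‖)
    (Filter.Eventually.of_forall fun p =>
      (integrable_lap hXm hYm hX hY hg p.1 p.2).aestronglyMeasurable) ?_
    (hg.norm.const_mul _) (Filter.Eventually.of_forall fun a => by fun_prop)
  filter_upwards [Metric.ball_mem_nhds p₀ one_pos] with p hp
  refine Filter.Eventually.of_forall fun a => ?_
  rw [norm_mul]
  refine mul_le_mul_of_nonneg_right ((norm_exp_lap_le hX hY p.1 p.2 a).trans ?_) (norm_nonneg _)
  apply Real.exp_le_exp.2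
  have h1 : ‖p‖ ≤ ‖p₀‖ + 1 := by
    have := norm_le_norm_add_norm_sub' p p₀
    have h2 : ‖p - p₀‖ < 1 := by simpa [dist_eq_norm] using hp
    linarith
  have h2 := norm_fst_le p
  have h3 := norm_snd_le p
  have := abs_nonneg K
  have := le_abs_self K
  have := norm_nonneg p.1
  have := norm_nonneg p.2
  apply mul_le_mul <;> linarith

theorem lap_add (hXm : Measurable X) (hYm : Measurable Y) (hX : ∀ a, |X a| ≤ K)
    (hY : ∀ a, |Y a| ≤ K) {g h : α → ℂ} (hg : Integrable g μ) (hh : Integrable h μ) (z w : ℂ) :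
    lap μ X Y (fun a => g a + h a) z w = lap μ X Y g z w + lap μ X Y h z w := by
  simp only [lap, mul_add]
  exact integral_add (integrable_lap hXm hYm hX hY hg z w) (integrable_lap hXm hYm hX hY hh z w)

theorem lap_const_mul (c : ℂ) (g : α → ℂ) (z w : ℂ) :
    lap μ X Y (fun a => c * g a) z w = c * lap μ X Y g z w := by
  simp only [lap, ← integral_const_mul]
  congr 1; ext a; ring

/-- The Laplace transform of a measure on a circle solves the Helmholtz equation. -/
theorem lap_helmholtz (hXm : Measurable X) (hYm : Measurable Y) (hX : ∀ a, |X a| ≤ K)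
    (hY : ∀ a, |Y a| ≤ K) {R : ℝ} (hXY : ∀ a, X a ^ 2 + Y a ^ 2 = R ^ 2)
    {g : α → ℂ} (hg : Integrable g μ) (z w : ℂ) :
    lap μ X Y (fun a => X a * (X a * g a)) z w + lap μ X Y (fun a => Y a * (Y a * g a)) z w
      = (R : ℂ) ^ 2 * lap μ X Y g z w := by
  rw [← lap_add hXm hYm hX hY (integrable_ofReal_mul hXm hX (integrable_ofReal_mul hXm hX hg))
    (integrable_ofReal_mul hYm hY (integrable_ofReal_mul hYm hY hg)), ← lap_const_mul]
  congr 1; ext a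
  have : (X a : ℂ) ^ 2 + (Y a : ℂ) ^ 2 = (R : ℂ) ^ 2 := by exact_mod_cast hXY a
  rw [← this]; ring

theorem lap_zero_zero (g : α → ℂ) : lap μ X Y g 0 0 = ∫ a, g a ∂μ := by
  simp [lap]

end Lap

end CircleDeconv

end

/-! ### Interpolation of derivatives: Landau's inequality and analytic functions small in mean -/

noncomputable section

namespace CircleDeconv

/-- Landau's inequality on an interval. -/
theorem landau_interval {g g' g'' : ℝ → ℂ} {r h s₀ s₂ : ℝ} (hh : 0 < h) (hhr : h ≤ r)
    (hg : ∀ t ∈ Set.Icc (-r) r, HasDerivAt g (g' t) t)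
    (hg' : ∀ t ∈ Set.Icc (-r) r, HasDerivAt g' (g'' t) t)
    (h₀ : ∀ t ∈ Set.Icc (-r) r, ‖g t‖ ≤ s₀) (h₂ : ∀ t ∈ Set.Icc (-r) r, ‖g'' t‖ ≤ s₂)
    {t : ℝ} (ht : t ∈ Set.Icc (-r) r) : ‖g' t‖ ≤ 2 * s₀ / h + h * s₂ := by
  -- Moving by `h` in the direction of the origin stays in the segment, because `h ≤ r`. The Taylor
  -- remainder of `g` between `t` and `v` is at most `s₂ * h ^ 2`, and division by `h` gives the
  -- inequality.
  obtain ⟨v, hv, hvt⟩ : ∃ v ∈ Set.Icc (-r) r, |v - t| = h := by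
    rcases le_total t 0 with h0 | h0
    · exact ⟨t + h, ⟨by linarith [ht.1], by linarith⟩, by simp [abs_of_pos hh]⟩
    · exact ⟨t - h, ⟨by linarith [ht.1], by linarith [ht.2]⟩, by simp [abs_of_pos hh]⟩
  have hsub : Set.uIcc t v ⊆ Set.Icc (-r) r :=
    Set.uIcc_subset_Icc ht hv
  have hs₂ : 0 ≤ s₂ := (norm_nonneg _).trans (h₂ t ht)
  have hlip : ∀ u ∈ Set.uIcc t v, ‖g' u - g' t‖ ≤ s₂ * h := by
    intro u hu
    have := (convex_uIcc t v).norm_image_sub_le_of_norm_hasDerivWithin_le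
      (fun x hx => (hg' x (hsub hx)).hasDerivWithinAt) (fun x hx => h₂ x (hsub hx))
      Set.left_mem_uIcc hu
    refine this.trans (mul_le_mul_of_nonneg_left ?_ hs₂)
    rw [← hvt]
    exact Set.abs_sub_left_of_mem_uIcc hu
  have hφ : ∀ u ∈ Set.uIcc t v,
      HasDerivWithinAt (fun u : ℝ => g u - (u : ℂ) * g' t) (g' u - g' t) (Set.uIcc t v) u := by
    intro u hu
    have h1 : HasDerivAt (fun u : ℝ => (u : ℂ) * g' t) (g' t) u := by
      simpa using (Complex.ofRealCLM.hasDerivAt (x := u)).mul_const (g' t)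
    exact ((hg u (hsub hu)).sub h1).hasDerivWithinAt
  have hmain := (convex_uIcc t v).norm_image_sub_le_of_norm_hasDerivWithin_le hφ hlip
    Set.left_mem_uIcc Set.right_mem_uIcc
  have heq : ((v - t : ℝ) : ℂ) * g' t
      = g v - g t - ((g v - (v : ℂ) * g' t) - (g t - (t : ℂ) * g' t)) := by
    push_cast; ring
  have hnorm : h * ‖g' t‖ ≤ 2 * s₀ + s₂ * h * h := by
    calc h * ‖g' t‖ = ‖((v - t : ℝ) : ℂ) * g' t‖ := by
          rw [norm_mul, Complex.norm_real, Real.norm_eq_abs, hvt]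
      _ ≤ ‖g v‖ + ‖g t‖ + s₂ * h * h := by
          rw [heq]
          refine (norm_sub_le _ _).trans (add_le_add (norm_sub_le _ _) ?_)
          rw [Real.norm_eq_abs, hvt] at hmain
          exact hmain
      _ ≤ _ := by linarith [h₀ v hv, h₀ t ht]
  have : ‖g' t‖ = h * ‖g' t‖ / h := by field_simp
  rw [this, show 2 * s₀ / h + h * s₂ = (2 * s₀ + s₂ * h * h) / h by field_simp]
  exact div_le_div_of_nonneg_right hnorm hh.le

/-- Sequences of suprema of consecutive derivatives that satisfy Landau's inequality. -/
def LandauSeq (r : ℝ) (s : ℕ → ℝ) : Prop :=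
  (∀ j, 0 ≤ s j) ∧ ∀ j h, 0 < h → h ≤ r → s (j + 1) ≤ 2 * s j / h + h * s (j + 2)

/-- The step length `l * τ` makes Landau's inequality scale invariant: the weights `τ ^ j` absorb
all dependence on `τ`, and the constants involve `l` only. -/
theorem LandauSeq.step {r : ℝ} {s : ℕ → ℝ} (hs : LandauSeq r s) {τ l : ℝ} (hτ : 0 < τ)
    (hτ1 : τ ≤ 1) (hl : 0 < l) (hlr : l ≤ r) (j : ℕ) :
    s (j + 1) * τ ^ (j + 1) ≤ 2 / l * (s j * τ ^ j) + l * (s (j + 2) * τ ^ (j + 2)) := by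
  have h1 := hs.2 j (l * τ) (by positivity) (by nlinarith)
  have h2 := mul_le_mul_of_nonneg_right h1 (by positivity : 0 ≤ τ ^ (j + 1))
  refine h2.trans_eq ?_
  field_simp
  ring

/-- Induction on `j`. In the inequality of order `j + 1` the lower term is bounded by the induction
hypothesis with constant `l / 4`; after multiplication by `2 / l` its upper part has coefficient `1
/ 2` and is absorbed in the left side. -/
theorem landauSeq_absorb {r : ℝ} (hr : 0 < r) (j : ℕ) :
    ∀ c : ℝ, 0 < c → ∃ C : ℝ, 0 ≤ C ∧ ∀ s τ, LandauSeq r s → 0 < τ → τ ≤ 1 →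
      s (j + 1) * τ ^ (j + 1) ≤ C * s 0 + c * (s (j + 2) * τ ^ (j + 2)) := by
  induction j with
  | zero =>
    intro c hc
    have hl : 0 < min c r := lt_min hc hr
    refine ⟨2 / min c r, by positivity, fun s τ hs hτ hτ1 => ?_⟩
    have h1 := hs.step hτ hτ1 hl (min_le_right _ _) 0
    have h2 : min c r * (s (0 + 2) * τ ^ (0 + 2)) ≤ c * (s (0 + 2) * τ ^ (0 + 2)) :=
      mul_le_mul_of_nonneg_right (min_le_left _ _) (mul_nonneg (hs.1 _) (by positivity))
    simp only [pow_zero, mul_one] at h1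
    exact h1.trans (add_le_add le_rfl h2)
  | succ j ih =>
    intro c hc
    set l := min (c / 2) r with hl_def
    have hl : 0 < l := lt_min (by positivity) hr
    obtain ⟨C, hC, h⟩ := ih (l / 4) (by positivity)
    refine ⟨4 * C / l, by positivity, fun s τ hs hτ hτ1 => ?_⟩
    have h1 := hs.step hτ hτ1 hl (min_le_right _ _) (j + 1)
    have h2 := h s τ hs hτ hτ1
    have h3 := mul_le_mul_of_nonneg_left h2 (by positivity : 0 ≤ 2 / l)
    have h4 : 2 / l * (C * s 0 + l / 4 * (s (j + 2) * τ ^ (j + 2)))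
        = 2 * C / l * s 0 + 1 / 2 * (s (j + 2) * τ ^ (j + 2)) := by field_simp; ring
    have h5 : l * (s (j + 3) * τ ^ (j + 3)) ≤ c / 2 * (s (j + 3) * τ ^ (j + 3)) :=
      mul_le_mul_of_nonneg_right (min_le_left _ _) (mul_nonneg (hs.1 _) (by positivity))
    have h6 : 4 * C / l * s 0 = 2 * (2 * C / l * s 0) := by ring
    simp only [add_assoc, Nat.reduceAdd] at h1 h3 h4 ⊢
    rw [h6]
    linarith

/-- The absorbing inequality with `c = 1` is chained `d` times. A high derivative thus enters with a
high power of `τ`, at the cost of a constant that does not depend on `τ`. -/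
theorem landauSeq_interpolation {r : ℝ} (hr : 0 < r) (k d : ℕ) :
    ∃ C : ℝ, 0 ≤ C ∧ ∀ s τ, LandauSeq r s → 0 < τ → τ ≤ 1 →
      s (k + 1) * τ ^ (k + 1) ≤ C * s 0 + s (k + 1 + d) * τ ^ (k + 1 + d) := by
  induction d with
  | zero =>
    exact ⟨0, le_rfl, fun s τ _ _ _ => by simp⟩
  | succ d ih =>
    obtain ⟨C, hC, h⟩ := ih
    obtain ⟨C', hC', h'⟩ := landauSeq_absorb hr (k + d) 1 one_pos
    refine ⟨C + C', by positivity, fun s τ hs hτ hτ1 => ?_⟩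
    have h1 := h s τ hs hτ hτ1
    have h2 := h' s τ hs hτ hτ1
    have e1 : k + d + 1 = k + 1 + d := by ring
    have e2 : k + d + 2 = k + 1 + (d + 1) := by ring
    rw [e1, e2] at h2
    linarith

theorem LandauSeq.exists_of_hasDerivAt {r : ℝ} (hr : 0 < r) {G : ℕ → ℝ → ℂ}
    (hG : ∀ j, ∀ t ∈ Set.Icc (-r) r, HasDerivAt (G j) (G (j + 1) t) t) :
    ∃ s, LandauSeq r s ∧ (∀ j, ∀ t ∈ Set.Icc (-r) r, ‖G j t‖ ≤ s j) ∧
      ∀ j, ∃ t ∈ Set.Icc (-r) r, s j = ‖G j t‖ := by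
  have hne : (Set.Icc (-r) r).Nonempty := ⟨0, by constructor <;> linarith⟩
  have hmax : ∀ j, ∃ t ∈ Set.Icc (-r) r, IsMaxOn (fun t => ‖G j t‖) (Set.Icc (-r) r) t :=
    fun j => isCompact_Icc.exists_isMaxOn hne
      (fun t ht => (hG j t ht).continuousAt.continuousWithinAt.norm)
  choose T hT hTmax using hmax
  refine ⟨fun j => ‖G j (T j)‖, ⟨fun j => norm_nonneg _, fun j h hh hhr => ?_⟩,
    fun j t ht => hTmax j ht, fun j => ⟨T j, hT j, rfl⟩⟩
  exact landau_interval hh hhr (hG j) (hG (j + 1)) (fun t ht => hTmax j ht)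
    (fun t ht => hTmax (j + 2) ht) (hT (j + 1))

/-- A bounded analytic function that is small in mean on a segment is small there together with
its derivatives, with an arbitrarily small loss in the exponent. -/
theorem analytic_interpolation {r δ : ℝ} (hr : 0 < r) (hδ : 0 < δ) (N : ℕ) :
    ∃ C : ℝ, 0 ≤ C ∧ ∀ (q : ℂ → ℂ) (M ε : ℝ), DifferentiableOn ℂ q (Metric.ball 0 (2 * r)) →
      (∀ z ∈ Metric.ball (0 : ℂ) (2 * r), ‖q z‖ ≤ M) → 0 < ε → ε ≤ 1 →
      ∀ k ≤ N, ∀ t ∈ Set.Icc (-r) r, ‖iteratedDeriv k q (Complex.I * t)‖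
        ≤ C * ε ^ (-δ) * ((∫ s in (-r)..r, ‖q (Complex.I * s)‖) + M * ε) := by
  -- With `τ = ε ^ (1 / m)`, the loss `τ ^ (-(k + 1))` for `k ≤ N` is at most `ε ^ (-δ)` as soon as
  -- `(N + 1) / m ≤ δ`.
  obtain ⟨m, hm⟩ := exists_nat_gt ((N + 1) / δ)
  have hm0 : (0 : ℝ) < m := lt_of_le_of_lt (by positivity) hm
  have hmδ : (N + 1) / (m : ℝ) ≤ δ := by
    rw [div_le_iff₀ hm0]; rw [div_lt_iff₀ hδ] at hm; linarith
  choose C hC hCs using fun k => landauSeq_interpolation hr k m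
  -- The second entry of the maximum is the Cauchy constant for the derivative of order `k + m` on
  -- discs of radius `r / 2`.
  set D : ℕ → ℝ := fun k => max (C k) ((k + m).factorial / (r / 2) ^ (k + m)) with hD
  have hD0 : ∀ k, 0 ≤ D k := fun k => (hC k).trans (le_max_left _ _)
  refine ⟨∑ k ∈ Finset.range (N + 1), D k, Finset.sum_nonneg fun k _ => hD0 k, ?_⟩
  intro q M ε hq hqM hε hε1 k hk t ht
  have hM : 0 ≤ M := (norm_nonneg _).trans (hqM 0 (by simp [hr]))
  have hmem : ∀ t ∈ Set.Icc (-r) r, Complex.I * t ∈ Metric.ball (0 : ℂ) (2 * r) := by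
    intro t ht
    simp only [mem_ball_zero_iff, norm_mul, Complex.norm_I, one_mul, Complex.norm_real,
      Real.norm_eq_abs]
    linarith [abs_le.2 ht]
  have han : ∀ t ∈ Set.Icc (-r) r, AnalyticAt ℂ q (Complex.I * t) := fun t ht =>
    hq.analyticAt (Metric.isOpen_ball.mem_nhds (hmem t ht))
  have hcont : ContinuousOn (fun s : ℝ => q (Complex.I * s)) (Set.Icc (-r) r) := by
    intro s hs
    have h1 : ContinuousAt (fun s : ℝ => Complex.I * (s : ℂ)) s := by fun_prop
    exact (ContinuousAt.comp (f := fun s : ℝ => Complex.I * (s : ℂ)) (han s hs).continuousAt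
      h1).continuousWithinAt
  have hcomp : ∀ t : ℝ, HasDerivAt (fun t : ℝ => Complex.I * (t : ℂ)) Complex.I t := fun t => by
    simpa using (Complex.ofRealCLM.hasDerivAt (x := t)).const_mul Complex.I
  -- A mean of `q` does not bound the supremum of `q`, but it bounds that of a primitive vanishing
  -- at `0`. The interpolation is therefore applied to `P`, with all orders shifted by one.
  obtain ⟨P, hP0, hP⟩ := hq.isExactOn_ball.with_val_at 0 0
  have hPdiff : DifferentiableOn ℂ P (Metric.ball 0 (2 * r)) := fun z hz =>
    (hP z hz).differentiableAt.differentiableWithinAt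
  have hPan : ∀ t ∈ Set.Icc (-r) r, AnalyticAt ℂ P (Complex.I * t) := fun t ht =>
    hPdiff.analyticAt (Metric.isOpen_ball.mem_nhds (hmem t ht))
  have hPq : ∀ j, ∀ t ∈ Set.Icc (-r) r,
      iteratedDeriv (j + 1) P (Complex.I * t) = iteratedDeriv j q (Complex.I * t) := by
    intro j t ht
    rw [iteratedDeriv_succ']
    apply Filter.EventuallyEq.iteratedDeriv_eq
    filter_upwards [Metric.isOpen_ball.mem_nhds (hmem t ht)] with z hz
    exact (hP z hz).deriv
  obtain ⟨s, hs, hs1, hs2⟩ := LandauSeq.exists_of_hasDerivAt hr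
    (G := fun j t => Complex.I ^ j * iteratedDeriv j P (Complex.I * t)) (fun j t ht => by
      have h1 : HasDerivAt (iteratedDeriv j P) (iteratedDeriv (j + 1) P (Complex.I * t))
          (Complex.I * t) := by
        have := ((hPan t ht).iterated_deriv j).differentiableAt.hasDerivAt
        rw [← iteratedDeriv_eq_iterate, ← iteratedDeriv_succ] at this
        exact this
      exact ((h1.comp t (hcomp t)).const_mul (Complex.I ^ j)).congr_deriv (by ring))
  simp only [norm_mul, norm_pow, Complex.norm_I, one_pow, one_mul] at hs1 hs2
  have hs0 : s 0 ≤ ∫ s in (-r)..r, ‖q (Complex.I * s)‖ := by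
    obtain ⟨t, ht, hst⟩ := hs2 0
    have hsub : Set.uIcc 0 t ⊆ Set.Icc (-r) r := Set.uIcc_subset_Icc (by constructor <;> linarith) ht
    have h1 : ∫ s in (0 : ℝ)..t, q (Complex.I * s) * Complex.I = P (Complex.I * t) := by
      rw [intervalIntegral.integral_eq_sub_of_hasDerivAt
        (f := fun s : ℝ => P (Complex.I * s)) (fun x hx => (hP _ (hmem x (hsub hx))).comp x (hcomp x))
        ((hcont.mono hsub).mul continuousOn_const).intervalIntegrable]
      simp [hP0]
    rw [hst, iteratedDeriv_zero, ← h1]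
    refine (intervalIntegral.norm_integral_le_abs_integral_norm).trans ?_
    simp only [norm_mul, Complex.norm_I, mul_one]
    refine intervalIntegral.abs_integral_mono_interval ?_ ?_ ?_ |>.trans (le_of_eq (abs_of_nonneg ?_))
    · exact Set.uIoc_subset_uIoc_of_uIcc_subset_uIcc <| Set.uIcc_subset_uIcc (by simpa [Set.uIcc_of_le (by linarith : -r ≤ r)] using hr.le)
        (by simpa [Set.uIcc_of_le (by linarith : -r ≤ r)] using ht)
    · exact Filter.Eventually.of_forall fun _ => norm_nonneg _
    · exact (hcont.norm.mono (by rw [Set.uIcc_of_le (by linarith : -r ≤ r)])).intervalIntegrable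
    · exact intervalIntegral.integral_nonneg (by linarith) fun _ _ => norm_nonneg _
  -- Cauchy's estimate: a disc of radius `r / 2` around a point of the segment stays inside the ball
  -- of radius `2 * r`.
  have hsm : s (k + 1 + m) ≤ (k + m).factorial * M / (r / 2) ^ (k + m) := by
    obtain ⟨t, ht, hst⟩ := hs2 (k + 1 + m)
    rw [hst, show k + 1 + m = (k + m) + 1 by ring, hPq _ t ht]
    have hsubset : Metric.closedBall (Complex.I * t) (r / 2) ⊆ Metric.ball 0 (2 * r) := by
      intro z hz
      rw [mem_ball_zero_iff]
      rw [mem_closedBall_iff_norm] at hz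
      have h1 : ‖Complex.I * t‖ ≤ r := by simpa using abs_le.2 ht
      have h2 := norm_le_norm_add_norm_sub' z (Complex.I * t)
      linarith
    refine Complex.norm_iteratedDeriv_le_of_forall_mem_sphere_norm_le (k + m) (by positivity) ?_
      fun z hz => hqM z (hsubset (Metric.sphere_subset_closedBall hz))
    exact (hq.mono hsubset).diffContOnCl_ball subset_rfl
  set τ : ℝ := ε ^ (1 / (m : ℝ)) with hτ
  have hτ0 : 0 < τ := Real.rpow_pos_of_pos hε _
  have hτ1 : τ ≤ 1 := Real.rpow_le_one hε.le hε1 (by positivity)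
  have hτm : τ ^ m = ε := by
    rw [hτ, ← Real.rpow_natCast, ← Real.rpow_mul hε.le, one_div, inv_mul_cancel₀ hm0.ne',
      Real.rpow_one]
  have hτk : ε ^ δ ≤ τ ^ (k + 1) := by
    rw [hτ, ← Real.rpow_natCast, ← Real.rpow_mul hε.le]
    refine Real.rpow_le_rpow_of_exponent_ge hε hε1 (le_trans ?_ hmδ)
    push_cast
    rw [one_div_mul_eq_div]
    have : (k : ℝ) ≤ N := by exact_mod_cast hk
    gcongr
  have hmain := hCs k s τ hs hτ0 hτ1
  have hint : 0 ≤ ∫ s in (-r)..r, ‖q (Complex.I * s)‖ :=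
    intervalIntegral.integral_nonneg (by linarith) fun _ _ => norm_nonneg _
  have h1 : s (k + 1) * τ ^ (k + 1) ≤ D k * ((∫ s in (-r)..r, ‖q (Complex.I * s)‖) + M * ε) := by
    refine hmain.trans ?_
    rw [mul_add]
    have h2 : τ ^ (k + 1 + m) ≤ ε := by
      rw [pow_add, hτm]
      exact mul_le_of_le_one_left hε.le (pow_le_one₀ hτ0.le hτ1)
    refine add_le_add (mul_le_mul (le_max_left _ _) hs0 (hs.1 0) (hD0 k)) ?_
    calc s (k + 1 + m) * τ ^ (k + 1 + m)
        ≤ ((k + m).factorial * M / (r / 2) ^ (k + m)) * ε :=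
          mul_le_mul hsm h2 (by positivity) (by positivity)
      _ = (k + m).factorial / (r / 2) ^ (k + m) * (M * ε) := by ring
      _ ≤ D k * (M * ε) := mul_le_mul_of_nonneg_right (le_max_right _ _) (by positivity)
  rw [← hPq k t ht]
  refine (hs1 (k + 1) t ht).trans ?_
  have hεδ : 0 < ε ^ δ := Real.rpow_pos_of_pos hε δ
  have h2 : s (k + 1) * ε ^ δ ≤ D k * ((∫ s in (-r)..r, ‖q (Complex.I * s)‖) + M * ε) :=
    (mul_le_mul_of_nonneg_left hτk (hs.1 _)).trans h1
  have h3 : D k ≤ ∑ k ∈ Finset.range (N + 1), D k :=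
    Finset.single_le_sum (fun k _ => hD0 k) (Finset.mem_range.2 (by omega))
  rw [Real.rpow_neg hε.le, ← div_eq_mul_inv, div_mul_eq_mul_div, le_div_iff₀ hεδ]
  exact h2.trans (mul_le_mul_of_nonneg_right h3 (by positivity))

end CircleDeconv

end

/-! ### Entire functions of exponential type: Jensen, Poisson and Borel–Carathéodory -/

noncomputable section

namespace CircleDeconv

open Metric Real in
-- Jensen's formula: for an entire function the divisor is nonnegative, and each zero in the disc
-- contributes a nonnegative logarithm.
theorem log_norm_le_circleAverage {f : ℂ → ℂ} (hf : Differentiable ℂ f) (hf0 : f 0 ≠ 0) {ρ : ℝ}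
    (hρ : 0 < ρ) : Real.log ‖f 0‖ ≤ circleAverage (fun z => Real.log ‖f z‖) 0 ρ := by
  have han : AnalyticOnNhd ℂ f (closedBall 0 |ρ|) := fun z _ => hf.analyticAt z
  rw [han.circleAverage_log_norm hρ.ne' hf0]
  have : 0 ≤ ∑ᶠ u, (MeromorphicOn.divisor f (closedBall 0 |ρ|) u : ℝ)
      * Real.log (ρ * ‖(0 : ℂ) - u‖⁻¹) := by
    refine finsum_nonneg fun u => ?_
    by_cases hu : u ∈ closedBall (0 : ℂ) |ρ|
    · refine mul_nonneg ?_ ?_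
      · exact_mod_cast (MeromorphicOn.AnalyticOnNhd.divisor_nonneg han) u
      · rcases eq_or_ne u 0 with rfl | hu0
        · simp
        · apply Real.log_nonneg
          rw [← div_eq_mul_inv, le_div_iff₀ (by simpa using hu0)]
          simpa [abs_of_pos hρ] using hu
    · rw [Function.locallyFinsuppWithin.apply_eq_zero_of_notMem _ hu]
      simp
  linarith

open Metric Real in
-- The growth hypothesis bounds `|x| + x`, twice the positive part of `x = log ‖f‖`, and Jensen's
-- inequality bounds the mean of `x` from below.
theorem circleAverage_abs_log_norm_le {f : ℂ → ℂ} (hf : Differentiable ℂ f) (hf0 : f 0 ≠ 0)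
    {C K : ℝ} (hC : 0 ≤ C) (hK : 0 ≤ K) (hfb : ∀ z, ‖f z‖ ≤ Real.exp (C + K * ‖z‖)) {ρ : ℝ}
    (hρ : 0 < ρ) :
    circleAverage (fun z => |Real.log ‖f z‖|) 0 ρ ≤ 2 * (C + K * ρ) - Real.log ‖f 0‖ := by
  have hint : CircleIntegrable (fun z => Real.log ‖f z‖) 0 ρ :=
    MeromorphicOn.circleIntegrable_log_norm fun z _ => (hf.analyticAt z).meromorphicAt
  have h1 : circleAverage (fun z => |Real.log ‖f z‖| + Real.log ‖f z‖) 0 ρ ≤ 2 * (C + K * ρ) := by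
    refine circleAverage_mono_on_of_le_circle (hint.abs.add hint) fun z hz => ?_
    have hz' : ‖z‖ = ρ := by simpa [abs_of_pos hρ] using hz
    have hle : Real.log ‖f z‖ ≤ C + K * ρ := by
      rcases eq_or_ne (f z) 0 with h0 | h0
      · simp only [h0, norm_zero, Real.log_zero]; positivity
      · rw [Real.log_le_iff_le_exp (by simpa using h0), ← hz']
        exact hfb z
    have : 0 ≤ C + K * ρ := by positivity
    rcases abs_cases (Real.log ‖f z‖) with h | h <;> linarith
  have h2 := log_norm_le_circleAverage hf hf0 hρ
  have h3 : circleAverage (fun z => |Real.log ‖f z‖| + Real.log ‖f z‖) 0 ρ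
    = circleAverage (fun z => |Real.log ‖f z‖|) 0 ρ + circleAverage (fun z => Real.log ‖f z‖) 0 ρ :=
    circleAverage_add hint.abs hint
  linarith

open Metric Real in
-- Poisson's formula represents the real part; for `‖w‖ ≤ ρ / 2` the kernel is at most `(ρ + ‖w‖) /
-- (ρ - ‖w‖) ≤ 3`.
theorem abs_re_le_circleAverage {g : ℂ → ℂ} (hg : Differentiable ℂ g) {ρ : ℝ} (hρ : 0 < ρ)
    {w : ℂ} (hw : ‖w‖ ≤ ρ / 2) :
    |(g w).re| ≤ 3 * circleAverage (fun z => |(g z).re|) 0 ρ := by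
  have hwb : w ∈ ball (0 : ℂ) ρ := by rw [mem_ball_zero_iff]; linarith
  have h1 := (hg.diffContOnCl (s := ball 0 ρ)).circleAverage_poissonKernel_smul hwb
  have hcontP : ContinuousOn (poissonKernel 0 w) (sphere 0 |ρ|) := by
    rw [poissonKernel_eq_re_herglotzRieszKernel]
    exact Complex.continuous_re.comp_continuousOn (continuousOn_herglotzRieszKernel_sphere hwb)
  have hint : CircleIntegrable (poissonKernel 0 w • g) 0 ρ := by
    apply ContinuousOn.circleIntegrable'
    exact hcontP.smul hg.continuous.continuousOn
  have h2 := Complex.reCLM.circleAverage_comp_comm hint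
  rw [h1] at h2
  simp only [Complex.reCLM_apply] at h2
  rw [← h2]
  refine abs_circleAverage_le_circleAverage_abs.trans ?_
  rw [← smul_eq_mul, ← circleAverage_fun_smul]
  have hre : Continuous fun z => (g z).re := Complex.continuous_re.comp hg.continuous
  refine circleAverage_mono (CircleIntegrable.abs ?_) ?_ fun z hz => ?_
  · apply ContinuousOn.circleIntegrable'
    exact Complex.continuous_re.comp_continuousOn (hcontP.smul hg.continuous.continuousOn)
  · apply ContinuousOn.circleIntegrable'
    exact (continuous_const.mul hre.abs).continuousOn
  · have hz' : z ∈ sphere (0 : ℂ) ρ := by simpa [abs_of_pos hρ] using hz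
    have hub := re_herglotzRieszKernel_le hz' hwb
    have hlb := le_re_herglotzRieszKernel hz' hwb
    have hPz : poissonKernel 0 w z = ((z - 0 + (w - 0)) / ((z - 0) - (w - 0))).re := by
      rw [poissonKernel_eq_re_herglotzRieszKernel]; rfl
    rw [← hPz] at hub hlb
    simp only [sub_zero] at hub hlb
    have hw0 := norm_nonneg w
    have h3 : (ρ + ‖w‖) / (ρ - ‖w‖) ≤ 3 := by
      rw [div_le_iff₀ (by linarith)]; linarith
    have h4 : 0 ≤ (ρ - ‖w‖) / (ρ + ‖w‖) := div_nonneg (by linarith) (by linarith)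
    have h5 : |poissonKernel 0 w z| ≤ 3 := by
      rw [abs_of_nonneg (h4.trans hlb)]; exact hub.trans h3
    simp only [Pi.abs_apply, Function.comp_apply, Pi.smul_apply', Complex.reCLM_apply,
      Complex.smul_re, smul_eq_mul, abs_mul]
    exact mul_le_mul_of_nonneg_right h5 (abs_nonneg _)

open Metric in
/-- An entire function whose real part grows at most linearly in the mean is affine. -/
theorem affine_of_re_le {g : ℂ → ℂ} (hg : Differentiable ℂ g) {E F : ℝ} (hE : 0 ≤ E) (hF : 0 ≤ F)
    (h : ∀ ρ, 0 < ρ → ∀ w, ‖w‖ ≤ ρ / 2 → |(g w).re| ≤ E * ρ + F) :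
    ∃ c : ℂ, ∀ z, g z = g 0 + c * z := by
  -- Borel–Carathéodory from the disc of radius `ρ / 2` to that of radius `ρ / 4`; the summand `1`
  -- makes the bound strictly positive even when `E` and `F` vanish.
  have hgr : ∀ ρ, 0 < ρ → ∀ z, ‖z‖ ≤ ρ / 4 → ‖g z‖ ≤ 2 * (E * ρ + F + 1) + 3 * ‖g 0‖ := by
    intro ρ hρ z hz
    have hpos : 0 < E * ρ + F + 1 := by positivity
    have hzn := norm_nonneg z
    have hg0 := norm_nonneg (g 0)
    have h1 := Complex.borelCaratheodory (f := g) (M := E * ρ + F + 1) (R := ρ / 2) (z := z) hpos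
      hg.differentiableOn
      (fun w hw => by
        have := h ρ hρ w (by simpa using (mem_ball_zero_iff.1 hw).le)
        simp only [Set.mem_ofPred_eq]
        linarith [le_abs_self (g w).re])
      (by positivity) (by rw [mem_ball_zero_iff]; linarith)
    refine h1.trans (add_le_add ?_ ?_)
    · rw [div_le_iff₀ (by linarith)]
      nlinarith
    · rw [div_le_iff₀ (by linarith)]
      nlinarith
  -- Linear growth against the factor `1 / t ^ 2` of Cauchy's estimate on large circles.
  have h2 : ∀ z, iteratedDeriv 2 g z = 0 := by
    intro z
    have hb : ∀ t : ℝ, 0 < t → ‖iteratedDeriv 2 g z‖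
        ≤ 2 * (2 * (E * (4 * (‖z‖ + t)) + F + 1) + 3 * ‖g 0‖) / t ^ 2 := by
      intro t ht
      have := Complex.norm_iteratedDeriv_le_of_forall_mem_sphere_norm_le (c := z) (f := g) 2 ht
        hg.diffContOnCl (C := 2 * (E * (4 * (‖z‖ + t)) + F + 1) + 3 * ‖g 0‖) (fun w hw => by
          apply hgr (4 * (‖z‖ + t)) (by positivity)
          have h3 := norm_le_norm_add_norm_sub' w z
          have h4 : ‖w - z‖ = t := by simpa using hw
          linarith)
      simpa using this
    have hlim : Filter.Tendsto (fun t : ℝ =>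
        2 * (2 * (E * (4 * (‖z‖ + t)) + F + 1) + 3 * ‖g 0‖) / t ^ 2) Filter.atTop (nhds 0) := by
      have h3 : Filter.Tendsto (fun t : ℝ => (4 * E * 4 * ‖z‖ + 4 * F + 4 + 6 * ‖g 0‖) * (t⁻¹ * t⁻¹)
          + 16 * E * t⁻¹) Filter.atTop (nhds ((4 * E * 4 * ‖z‖ + 4 * F + 4 + 6 * ‖g 0‖) * (0 * 0)
          + 16 * E * 0)) :=
        ((tendsto_inv_atTop_zero.mul tendsto_inv_atTop_zero).const_mul _).add
          (tendsto_inv_atTop_zero.const_mul _)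
      simp only [mul_zero, add_zero] at h3
      refine h3.congr' ?_
      filter_upwards [Filter.eventually_gt_atTop 0] with t ht
      field_simp
      ring
    have := ge_of_tendsto hlim (Filter.eventually_atTop.2 ⟨1, fun t ht => hb t (by linarith)⟩)
    exact norm_le_zero_iff.1 this
  have hd : Differentiable ℂ (deriv g) := fun z =>
    ((hg.analyticAt z).deriv).differentiableAt
  have hconst : ∀ z, deriv g z = deriv g 0 := fun z =>
    is_const_of_deriv_eq_zero hd (fun z => by
      have := h2 z
      rwa [iteratedDeriv_succ, iteratedDeriv_one] at this) z 0
  refine ⟨deriv g 0, fun z => ?_⟩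
  have h3 : Differentiable ℂ fun z => g z - deriv g 0 * z := by fun_prop
  have h4 := is_const_of_deriv_eq_zero h3 (fun z => by
    have h5 : HasDerivAt (fun z => g z - deriv g 0 * z) (deriv g z - deriv g 0 * 1) z :=
      (hg z).hasDerivAt.sub ((hasDerivAt_id z).const_mul _)
    rw [h5.deriv, hconst z]; ring) z 0
  simp only [mul_zero, sub_zero] at h4
  rw [← h4]; ring

open Metric Real in
/-- If two entire functions of exponential type differ by a factor `(1 + a z) exp (g z)`, then `g`
is affine. -/
theorem affine_of_exp_quotient {p P g : ℂ → ℂ} (hp : Differentiable ℂ p) (hP : Differentiable ℂ P)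
    (hg : Differentiable ℂ g) (hp0 : p 0 ≠ 0) (hP0 : P 0 ≠ 0) {C K : ℝ} (hC : 0 ≤ C) (hK : 0 ≤ K)
    (hpb : ∀ z, ‖p z‖ ≤ Real.exp (C + K * ‖z‖)) (hPb : ∀ z, ‖P z‖ ≤ Real.exp (C + K * ‖z‖))
    (a : ℂ) (h : ∀ z, p z = P z * ((1 + a * z) * Complex.exp (g z))) :
    ∃ c : ℂ, ∀ z, g z = g 0 + c * z := by
  have ha : Differentiable ℂ fun z => 1 + a * z := by fun_prop
  have hab : ∀ z, ‖1 + a * z‖ ≤ Real.exp (0 + ‖a‖ * ‖z‖) := by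
    intro z
    refine (norm_add_le _ _).trans ?_
    rw [norm_one, norm_mul, zero_add, add_comm]
    exact Real.add_one_le_exp _
  have key : ∀ ρ, 0 < ρ → circleAverage (fun z => |(g z).re|) 0 ρ
      ≤ (2 * (C + K * ρ) - Real.log ‖p 0‖) + (2 * (C + K * ρ) - Real.log ‖P 0‖)
        + (2 * (0 + ‖a‖ * ρ) - Real.log ‖1 + a * 0‖) := by
    intro ρ hρ
    have e1 := circleAverage_abs_log_norm_le hp hp0 hC hK hpb hρ
    have e2 := circleAverage_abs_log_norm_le hP hP0 hC hK hPb hρ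
    have e3 := circleAverage_abs_log_norm_le ha (by simp) le_rfl (norm_nonneg a) hab hρ
    have i1 : CircleIntegrable (fun z => |Real.log ‖p z‖|) 0 ρ := (MeromorphicOn.circleIntegrable_log_norm
      fun z _ => (hp.analyticAt z).meromorphicAt).abs
    have i2 : CircleIntegrable (fun z => |Real.log ‖P z‖|) 0 ρ := (MeromorphicOn.circleIntegrable_log_norm
      fun z _ => (hP.analyticAt z).meromorphicAt).abs
    have i3 : CircleIntegrable (fun z => |Real.log ‖1 + a * z‖|) 0 ρ := (MeromorphicOn.circleIntegrable_log_norm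
      fun z _ => (ha.analyticAt z).meromorphicAt).abs
    -- The identity expressing the real part of `g` through three logarithms fails only at zeros of
    -- `p`. Those met by the circle do not affect averages.
    have hne : ∀ᶠ z in Filter.codiscreteWithin (sphere (0 : ℂ) |ρ|), p z ≠ 0 := by
      have := (AnalyticOnNhd.preimage_zero_mem_codiscreteWithin (x := (0 : ℂ)) (U := Set.univ)
        (f := p) (fun z _ => hp.analyticAt z) hp0 (Set.mem_univ _) isConnected_univ)
      exact Filter.codiscreteWithin_mono (Set.subset_univ _) this
    have hcongr : (fun z => |(g z).re|) =ᶠ[Filter.codiscreteWithin (sphere (0 : ℂ) |ρ|)]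
        fun z => |Real.log ‖p z‖ - Real.log ‖P z‖ - Real.log ‖1 + a * z‖| := by
      filter_upwards [hne] with z hz
      have h1 := hz
      rw [h z] at h1
      have h2 : P z ≠ 0 := left_ne_zero_of_mul h1
      have h3 : 1 + a * z ≠ 0 := left_ne_zero_of_mul (right_ne_zero_of_mul h1)
      rw [h z, norm_mul, norm_mul, Complex.norm_exp, Real.log_mul (by simpa using h2)
        (by simpa using h3), Real.log_mul (by simpa using h3) (Real.exp_pos _).ne', Real.log_exp]
      congr 1; ring
    rw [circleAverage_congr_codiscreteWithin hcongr hρ.ne']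
    refine le_trans (b := circleAverage (fun z => |Real.log ‖p z‖| + |Real.log ‖P z‖|
      + |Real.log ‖1 + a * z‖|) 0 ρ) ?_ ?_
    · refine circleAverage_mono ?_ ((i1.add i2).add i3) fun z _ => ?_
      · refine CircleIntegrable.congr_codiscreteWithin hcongr ?_
        apply ContinuousOn.circleIntegrable'
        exact ((Complex.continuous_re.comp hg.continuous).abs).continuousOn
      · exact (abs_sub _ _).trans (add_le_add (abs_sub _ _) le_rfl)
    · refine le_of_eq_of_le ((circleAverage_add (i1.add i2) i3).trans
        (congrArg (· + _) (circleAverage_add i1 i2))) ?_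
      linarith
  refine affine_of_re_le hg (E := 3 * (4 * K + 2 * ‖a‖))
    (F := 3 * (4 * C + |Real.log ‖p 0‖| + |Real.log ‖P 0‖|)) (by positivity) (by positivity)
    fun ρ hρ w hw => ?_
  have h1 := abs_re_le_circleAverage hg hρ hw
  have h2 := key ρ hρ
  have h3 := neg_abs_le (Real.log ‖p 0‖)
  have h4 := neg_abs_le (Real.log ‖P 0‖)
  simp only [mul_zero, add_zero, norm_one, Real.log_one, zero_add, sub_zero] at h2
  nlinarith

/-- A zero-free entire function has an entire logarithm. -/
theorem exists_entire_log {f : ℂ → ℂ} (hf : Differentiable ℂ f) (h0 : ∀ z, f z ≠ 0) :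
    ∃ g : ℂ → ℂ, Differentiable ℂ g ∧ ∀ z, f z = Complex.exp (g z) := by
  have hd : Differentiable ℂ fun z => deriv f z / f z := fun z =>
    ((hf.analyticAt z).deriv.differentiableAt).div (hf z) (h0 z)
  obtain ⟨G, hG0, hG⟩ := hd.isExactOn_univ.with_val_at 0 (Complex.log (f 0))
  refine ⟨G, fun z => (hG z (Set.mem_univ z)).differentiableAt, fun z => ?_⟩
  have h1 : ∀ z, HasDerivAt (fun z => f z * Complex.exp (-G z)) 0 z := by
    intro z
    refine ((hf z).hasDerivAt.mul (hG z (Set.mem_univ z)).neg.cexp).congr_deriv ?_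
    have := h0 z
    field_simp
    ring
  have h2 := is_const_of_deriv_eq_zero (fun z => (h1 z).differentiableAt)
    (fun z => (h1 z).deriv) z 0
  simp only [hG0, Complex.exp_neg, Complex.exp_log (h0 0), mul_inv_cancel₀ (h0 0)] at h2
  have := Complex.exp_ne_zero (G z)
  field_simp at h2
  exact h2

end CircleDeconv

end

/-! ### Real-variable tools for the dynamics along rays -/

noncomputable section

namespace CircleDeconv

open Filter Topology

/-- The properties, in the first quadrant, of the gradient `(m₁, m₂)` of the logarithm of the
Laplace transform of a measure on the circle of radius `R` whose support contains the four
points `x i`. -/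
structure DriftField (R : ℝ) (m₁ m₂ : ℝ → ℝ → ℝ) (x : Fin 4 → ℝ × ℝ) : Prop where
  radius_pos : 0 < R
  abs_le₁ : ∀ s t, |m₁ s t| ≤ R
  abs_le₂ : ∀ s t, |m₂ s t| ≤ R
  mono₁ : ∀ t, Monotone fun s => m₁ s t
  mono₂ : ∀ s, Monotone fun t => m₂ s t
  pos₁ : ∃ c > 0, ∀ᶠ s in atTop, c ≤ m₁ s 0
  pos₂ : ∃ c > 0, ∀ᶠ t in atTop, c ≤ m₂ 0 t
  inj : Function.Injective x
  fst_pos : ∀ i, 0 < (x i).1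
  snd_pos : ∀ i, 0 < (x i).2
  on_circle : ∀ i, (x i).1 ^ 2 + (x i).2 ^ 2 = R ^ 2
  ray₁ : ∀ i L η, 0 < η → ∀ᶠ r in atTop, ∀ σ τ, |σ| ≤ L → |τ| ≤ L →
    |m₁ (r * (x i).1 + σ) (r * (x i).2 + τ) - (x i).1| ≤ η
  ray₂ : ∀ i L η, 0 < η → ∀ᶠ r in atTop, ∀ σ τ, |σ| ≤ L → |τ| ≤ L →
    |m₂ (r * (x i).1 + σ) (r * (x i).2 + τ) - (x i).2| ≤ η

theorem DriftField.swap {R : ℝ} {m₁ m₂ : ℝ → ℝ → ℝ} {x : Fin 4 → ℝ × ℝ}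
    (h : DriftField R m₁ m₂ x) :
    DriftField R (fun s t => m₂ t s) (fun s t => m₁ t s) (fun i => (x i).swap) where
  radius_pos := h.radius_pos
  abs_le₁ s t := h.abs_le₂ t s
  abs_le₂ s t := h.abs_le₁ t s
  mono₁ := h.mono₂
  mono₂ := h.mono₁
  pos₁ := h.pos₂
  pos₂ := h.pos₁
  inj := Prod.swap_injective.comp h.inj
  fst_pos := h.snd_pos
  snd_pos := h.fst_pos
  on_circle i := by rw [← h.on_circle i]; simp [add_comm]
  ray₁ i L η hη := (h.ray₂ i L η hη).mono fun r hr σ τ hσ hτ => hr τ σ hτ hσ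
  ray₂ i L η hη := (h.ray₁ i L η hη).mono fun r hr σ τ hσ hτ => hr τ σ hτ hσ

/-- A function with `z' + c z` small on an interval of length `L` is small at its right end, up to
a contribution of its value at the left end that decays exponentially in `L`. -/
theorem le_of_relaxation {z z' : ℝ → ℝ} {c η a b : ℝ} (hab : a ≤ b) (hη : 0 ≤ η)
    (hz : ∀ s ∈ Set.Icc a b, HasDerivAt z (z' s) s)
    (hb : ∀ s ∈ Set.Icc a b, z' s + c * z s ≤ c * η) :
    z b ≤ η + Real.exp (-(c * (b - a))) * |z a| := by
  have hd : ∀ s ∈ Set.Icc a b, HasDerivAt (fun s => Real.exp (c * s) * (z s - η))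
      (Real.exp (c * s) * (z' s + c * z s - c * η)) s := by
    intro s hs
    have h1 : HasDerivAt (fun s => Real.exp (c * s)) (Real.exp (c * s) * c) s := by
      simpa using ((hasDerivAt_id s).const_mul c).exp
    exact (h1.mul ((hz s hs).sub_const η)).congr_deriv (by ring)
  have hanti : AntitoneOn (fun s => Real.exp (c * s) * (z s - η)) (Set.Icc a b) := by
    refine antitoneOn_of_deriv_nonpos (convex_Icc a b)
      (fun s hs => (hd s hs).continuousAt.continuousWithinAt)
      (fun s hs => (hd s (interior_subset hs)).differentiableAt.differentiableWithinAt)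
      fun s hs => ?_
    rw [(hd s (interior_subset hs)).deriv]
    exact mul_nonpos_of_nonneg_of_nonpos (Real.exp_pos _).le
      (by linarith [hb s (interior_subset hs)])
  have h1 := hanti (Set.left_mem_Icc.2 hab) (Set.right_mem_Icc.2 hab) hab
  simp only at h1
  have h2 : Real.exp (-(c * (b - a))) = Real.exp (c * a) / Real.exp (c * b) := by
    rw [← Real.exp_sub]; congr 1; ring
  have hpos := Real.exp_pos (c * b)
  have hpos' := Real.exp_pos (c * a)
  have h3 : z b - η ≤ Real.exp (-(c * (b - a))) * (z a - η) := by
    rw [h2, div_mul_eq_mul_div, le_div_iff₀ hpos]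
    linarith
  have h4 : Real.exp (-(c * (b - a))) * (z a - η) ≤ Real.exp (-(c * (b - a))) * |z a| :=
    mul_le_mul_of_nonneg_left (by linarith [le_abs_self (z a)]) (Real.exp_pos _).le
  linarith

theorem abs_le_of_relaxation {z z' : ℝ → ℝ} {c η a b : ℝ} (hab : a ≤ b) (hη : 0 ≤ η)
    (hz : ∀ s ∈ Set.Icc a b, HasDerivAt z (z' s) s)
    (hb : ∀ s ∈ Set.Icc a b, |z' s + c * z s| ≤ c * η) :
    |z b| ≤ η + Real.exp (-(c * (b - a))) * |z a| := by
  refine abs_le'.2 ⟨le_of_relaxation hab hη hz fun s hs => (le_abs_self _).trans (hb s hs), ?_⟩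
  have := le_of_relaxation (z := fun s => -z s) (c := c) hab hη (fun s hs => (hz s hs).neg)
    fun s hs => le_trans (by linarith [neg_abs_le (z' s + c * z s)]) (hb s hs)
  simpa using this

/-- A solution of a linear equation with a uniformly stable drift and a bounded source is
bounded. -/
theorem bounded_of_stable {a a' m g : ℝ → ℝ} {c M S : ℝ} (hc : 0 < c)
    (ha : ∀ s, HasDerivAt a (a' s) s) (hm : ∀ s ≥ S, c ≤ m s) (hg : ∀ s ≥ S, |g s| ≤ M)
    (heq : ∀ s ≥ S, a' s = -(m s * a s) + g s) : ∃ B, ∀ s ≥ S, |a s| ≤ B := by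
  have key : ∀ a a' g : ℝ → ℝ, (∀ s, HasDerivAt a (a' s) s) → (∀ s ≥ S, |g s| ≤ M) →
      (∀ s ≥ S, a' s = -(m s * a s) + g s) → ∀ s ≥ S, a s ≤ |a S| + M / c + 1 := by
    intro a a' g ha hg heq s hs
    have hM : 0 ≤ M := (abs_nonneg _).trans (hg S le_rfl)
    -- The barrier is constant. Where `a` meets it, the drift is at most `-(c * |a S| + M + c)` and
    -- the source at most `M`, so the derivative is negative; the summand `1` makes this strict.
    refine image_le_of_deriv_right_lt_deriv_boundary' (f := a) (f' := a') (a := S) (b := s)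
      (B := fun _ => |a S| + M / c + 1) (B' := fun _ => 0)
      (fun x _ => (ha x).continuousAt.continuousWithinAt) (fun x _ => (ha x).hasDerivWithinAt)
      ?_ continuousOn_const (fun x _ => hasDerivWithinAt_const _ _ _) ?_ (Set.right_mem_Icc.2 hs)
    · have : 0 ≤ M / c := by positivity
      linarith [le_abs_self (a S)]
    · intro x hx hax
      rw [heq x hx.1, hax]
      have h1 := hm x hx.1
      have h2 := (le_abs_self _).trans (hg x hx.1)
      have h3 : c * (|a S| + M / c + 1) = c * |a S| + M + c := by field_simp
      have h4 : c * (|a S| + M / c + 1) ≤ m x * (|a S| + M / c + 1) :=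
        mul_le_mul_of_nonneg_right h1 (by positivity)
      have := abs_nonneg (a S)
      nlinarith
  refine ⟨|a S| + M / c + 1, fun s hs => abs_le'.2 ⟨key a a' g ha hg heq s hs, ?_⟩⟩
  have := key (fun s => -a s) (fun s => -a' s) (fun s => -g s) (fun s => (ha s).neg)
    (fun s hs => by simpa using hg s hs) (fun s hs => by rw [heq s hs]; ring) s hs
  simpa using this

/-- A bounded function with `e (κ s) - q e s → c`, `q < 1 < κ`, converges. -/
theorem tendsto_of_scaling {e : ℝ → ℝ} {κ q c B : ℝ} (hκ : 1 < κ) (hq : 0 ≤ q) (hq1 : q < 1)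
    (hB : ∀ᶠ s in atTop, |e s| ≤ B)
    (h : Tendsto (fun s => e (κ * s) - q * e s) atTop (𝓝 c)) :
    Tendsto e atTop (𝓝 (c / (1 - q))) := by
  have h1q : 0 < 1 - q := by linarith
  set b := c / (1 - q) with hb
  have hbc : c = b - q * b := by rw [hb]; field_simp
  rw [Metric.tendsto_nhds]
  intro ε hε
  -- The tolerance `ε * (1 - q) / 2` is such that the bound `ε / 2` is preserved by the contraction:
  -- `q * (ε / 2) + ε * (1 - q) / 2 = ε / 2`.
  have hstep : ∀ᶠ s in atTop, |(e (κ * s) - b) - q * (e s - b)| ≤ ε * (1 - q) / 2 := by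
    have := (Metric.tendsto_nhds.1 h) (ε * (1 - q) / 2) (by positivity)
    filter_upwards [this] with s hs
    rw [Real.dist_eq, hbc] at hs
    have e1 : (e (κ * s) - b) - q * (e s - b) = e (κ * s) - q * e s - (b - q * b) := by ring
    rw [e1]; exact hs.le
  have hind : ∀ n : ℕ, ∀ᶠ s in atTop, |e s - b| ≤ q ^ n * (B + |b|) + ε / 2 := by
    intro n
    induction n with
    | zero =>
      filter_upwards [hB] with s hs
      have := abs_sub (e s) b
      simp only [pow_zero, one_mul]
      linarith
    | succ n ih =>
      have hdiv : Tendsto (fun s : ℝ => s / κ) atTop atTop :=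
        tendsto_id.atTop_div_const (by linarith)
      filter_upwards [hdiv.eventually ih, hdiv.eventually hstep] with s h1 h2
      rw [mul_div_cancel₀ _ (by linarith : κ ≠ 0)] at h2
      have h3 : |e s - b| ≤ |(e s - b) - q * (e (s / κ) - b)| + |q * (e (s / κ) - b)| := by
        have := abs_add_le ((e s - b) - q * (e (s / κ) - b)) (q * (e (s / κ) - b))
        simpa using this
      rw [abs_mul, abs_of_nonneg hq] at h3
      have h4 := mul_le_mul_of_nonneg_left h1 hq
      rw [pow_succ]
      nlinarith
  have hlim : Tendsto (fun n : ℕ => q ^ n * (B + |b|) + ε / 2) atTop (𝓝 (0 * (B + |b|) + ε / 2)) :=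
    ((tendsto_pow_atTop_nhds_zero_of_lt_one hq hq1).mul_const _).add_const _
  obtain ⟨n, hn⟩ := (hlim.eventually (gt_mem_nhds (by linarith : 0 * (B + |b|) + ε / 2 < ε))).exists
  filter_upwards [hind n] with s hs
  rw [Real.dist_eq]
  linarith

/-- A line does not contain three distinct points of a circle. -/
theorem eq_zero_of_three_points {R u v w : ℝ} {x y z : ℝ × ℝ} (hx : x.1 ^ 2 + x.2 ^ 2 = R ^ 2)
    (hy : y.1 ^ 2 + y.2 ^ 2 = R ^ 2) (hz : z.1 ^ 2 + z.2 ^ 2 = R ^ 2) (hxy : x ≠ y) (hxz : x ≠ z)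
    (hyz : y ≠ z) (ex : u * x.1 + v * x.2 + w = 0) (ey : u * y.1 + v * y.2 + w = 0)
    (ez : u * z.1 + v * z.2 + w = 0) : u = 0 ∧ v = 0 ∧ w = 0 := by
  by_cases hn : u ^ 2 + v ^ 2 = 0
  · have hu : u = 0 := by nlinarith [sq_nonneg u, sq_nonneg v]
    have hv : v = 0 := by nlinarith [sq_nonneg u, sq_nonneg v]
    subst hu hv
    exact ⟨rfl, rfl, by linarith⟩
  exfalso
  -- `u * p.2 - v * p.1` is, up to scale, the position of `p` along the line. The circle determines
  -- its square, so it takes at most two values on the three points.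
  have hsame : ∀ p q : ℝ × ℝ, u * p.1 + v * p.2 + w = 0 → u * q.1 + v * q.2 + w = 0 →
      u * p.2 - v * p.1 = u * q.2 - v * q.1 → p = q := by
    intro p q hp hq hpq
    have h1 : (u ^ 2 + v ^ 2) * (p.1 - q.1) = 0 := by
      linear_combination u * hp - u * hq - v * hpq
    have h2 : (u ^ 2 + v ^ 2) * (p.2 - q.2) = 0 := by
      linear_combination v * hp - v * hq + u * hpq
    rcases mul_eq_zero.1 h1 with h | h
    · exact absurd h hn
    rcases mul_eq_zero.1 h2 with h' | h'
    · exact absurd h' hn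
    exact Prod.ext (by linarith) (by linarith)
  have hsq : ∀ p : ℝ × ℝ, p.1 ^ 2 + p.2 ^ 2 = R ^ 2 → u * p.1 + v * p.2 + w = 0 →
      (u * p.2 - v * p.1) ^ 2 = (u ^ 2 + v ^ 2) * R ^ 2 - w ^ 2 := by
    intro p hp hpw
    linear_combination (u ^ 2 + v ^ 2) * hp - (u * p.1 + v * p.2 - w) * hpw
  have h1 := hsq x hx ex
  have h2 := hsq y hy ey
  have h3 := hsq z hz ez
  rcases sq_eq_sq_iff_eq_or_eq_neg.1 (h1.trans h2.symm) with h | h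
  · exact hxy (hsame x y ex ey h)
  rcases sq_eq_sq_iff_eq_or_eq_neg.1 (h1.trans h3.symm) with h' | h'
  · exact hxz (hsame x z ex ez h')
  · exact hyz (hsame y z ey ez (by linarith))

/-- A function whose derivative converges grows linearly. -/
theorem tendsto_div_of_deriv {f f' : ℝ → ℝ} {l : ℝ} (hf : ∀ s, HasDerivAt f (f' s) s)
    (h : Tendsto f' atTop (𝓝 l)) : Tendsto (fun s => f s / s) atTop (𝓝 l) := by
  rw [Metric.tendsto_nhds]
  intro ε hε
  obtain ⟨T, hT⟩ := eventually_atTop.1 ((Metric.tendsto_nhds.1 h) (ε / 2) (by positivity))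
  have hbd : ∀ s ≥ T, |f s - f T - l * (s - T)| ≤ ε / 2 * (s - T) := by
    intro s hs
    have h1 := (convex_Icc T s).norm_image_sub_le_of_norm_hasDerivWithin_le
      (f := fun s => f s - l * s) (f' := fun s => f' s - l * 1) (C := ε / 2)
      (fun x _ => ((hf x).sub ((hasDerivAt_id x).const_mul l)).hasDerivWithinAt)
      (fun x hx => by
        have := hT x hx.1
        rw [Real.dist_eq] at this
        rw [mul_one, Real.norm_eq_abs]; exact this.le)
      (Set.left_mem_Icc.2 hs) (Set.right_mem_Icc.2 hs)
    simp only [Real.norm_eq_abs] at h1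
    rw [abs_of_nonneg (by linarith : 0 ≤ s - T)] at h1
    convert h1 using 2
    ring
  have hlim : Tendsto (fun s : ℝ => (|f T| + |l * T| + ε / 2 * |T|) / s) atTop (𝓝 0) :=
    tendsto_const_nhds.div_atTop tendsto_id
  filter_upwards [eventually_ge_atTop T, eventually_gt_atTop 0,
    hlim.eventually (gt_mem_nhds (by positivity : 0 < ε / 2))] with s hs hs0 h2
  rw [Real.dist_eq]
  have h3 : f s / s - l = (f s - f T - l * (s - T) + (f T - l * T)) / s := by
    field_simp; ring
  rw [h3, abs_div, abs_of_pos hs0, div_lt_iff₀ hs0]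
  rw [div_lt_iff₀ hs0] at h2
  have h4 := abs_add_le (f s - f T - l * (s - T)) (f T - l * T)
  have h5 := abs_sub (f T) (l * T)
  have h6 := hbd s hs
  have h7 := neg_abs_le T
  nlinarith

end CircleDeconv

end

/-! ### The separated transport equation: limits at infinity -/

noncomputable section

namespace CircleDeconv

open Filter Topology

/-- `α` and `β` solve the separated transport equation with drift `(m₁, m₂)`. -/
structure SeparatedSolution (m₁ m₂ : ℝ → ℝ → ℝ) (α α' β β' : ℝ → ℝ) (ρ : ℝ) : Prop where
  deriv₁ : ∀ s, HasDerivAt α (α' s) s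
  deriv₂ : ∀ s, HasDerivAt β (β' s) s
  eqn : ∀ s t, α' s + 2 * m₁ s t * α s + β' t + 2 * m₂ s t * β t + ρ = 0

theorem SeparatedSolution.swap {m₁ m₂ : ℝ → ℝ → ℝ} {α α' β β' : ℝ → ℝ} {ρ : ℝ}
    (h : SeparatedSolution m₁ m₂ α α' β β' ρ) :
    SeparatedSolution (fun s t => m₂ t s) (fun s t => m₁ t s) β β' α α' ρ where
  deriv₁ := h.deriv₂
  deriv₂ := h.deriv₁
  eqn s t := by rw [← h.eqn t s]; ring

section Dynamics

variable {R : ℝ} {m₁ m₂ : ℝ → ℝ → ℝ} {x : Fin 4 → ℝ × ℝ} {α α' β β' : ℝ → ℝ} {ρ : ℝ}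

/-- On the axis `t = 0` the equation is linear in `α` with bounded source, and it is stable since
`m₁ s 0` is eventually bounded below by a positive constant. -/
theorem SeparatedSolution.bounded (hS : SeparatedSolution m₁ m₂ α α' β β' ρ)
    (h : DriftField R m₁ m₂ x) : ∃ B, ∀ᶠ s in atTop, |α s| ≤ B := by
  obtain ⟨c, hc, hm⟩ := h.pos₁
  obtain ⟨S, hSm⟩ := eventually_atTop.1 hm
  obtain ⟨B, hB⟩ := bounded_of_stable (m := fun s => 2 * m₁ s 0)
    (g := fun s => -(β' 0 + 2 * m₂ s 0 * β 0 + ρ)) (c := c) (M := |β' 0| + 2 * R * |β 0| + |ρ|)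
    (S := S) hc hS.deriv₁ (fun s hs => by linarith [hSm s hs]) (fun s _ => by
      rw [abs_neg]
      refine (abs_add_le _ _).trans (add_le_add ((abs_add_le _ _).trans (add_le_add le_rfl ?_)) le_rfl)
      rw [abs_mul, abs_mul, abs_two]
      have := h.abs_le₂ s 0
      gcongr) (fun s _ => by linarith [hS.eqn s 0])
  exact ⟨B, eventually_atTop.2 ⟨S, hB⟩⟩

theorem SeparatedSolution.deriv_bounded (hS : SeparatedSolution m₁ m₂ α α' β β' ρ)
    (h : DriftField R m₁ m₂ x) : ∃ B, ∀ᶠ s in atTop, |α' s| ≤ B := by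
  obtain ⟨B, hB⟩ := hS.bounded h
  refine ⟨2 * R * B + |β' 0| + 2 * R * |β 0| + |ρ|, hB.mono fun s hs => ?_⟩
  have h1 : α' s = -(2 * m₁ s 0 * α s) - β' 0 - 2 * m₂ s 0 * β 0 - ρ := by linarith [hS.eqn s 0]
  have hR := h.radius_pos
  have h2 : |2 * m₁ s 0 * α s| ≤ 2 * R * B := by
    rw [abs_mul, abs_mul, abs_two]
    have := h.abs_le₁ s 0
    gcongr
  have h3 : |2 * m₂ s 0 * β 0| ≤ 2 * R * |β 0| := by
    rw [abs_mul, abs_mul, abs_two]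
    have := h.abs_le₂ s 0
    gcongr
  rw [h1]
  have e1 := abs_sub (-(2 * m₁ s 0 * α s) - β' 0 - 2 * m₂ s 0 * β 0) ρ
  have e2 := abs_sub (-(2 * m₁ s 0 * α s) - β' 0) (2 * m₂ s 0 * β 0)
  have e3 := abs_sub (-(2 * m₁ s 0 * α s)) (β' 0)
  rw [abs_neg] at e3
  linarith

theorem tendsto_mul_atTop_of_pos {c : ℝ} (hc : 0 < c) : Tendsto (fun r : ℝ => r * c) atTop atTop :=
  tendsto_id.atTop_mul_const hc

/-- Freeze `t = r * (x i).2`. On a window of fixed length before `s = r * (x i).1` the drift is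
nearly the constant `x i`, so the displayed combination relaxes to zero at rate `2 * (x i).1`. -/
theorem SeparatedSolution.ray_aux (hS : SeparatedSolution m₁ m₂ α α' β β' ρ)
    (h : DriftField R m₁ m₂ x) (i : Fin 4) :
    Tendsto (fun r => 2 * (x i).1 * α (r * (x i).1)
      + (β' (r * (x i).2) + 2 * (x i).2 * β (r * (x i).2) + ρ)) atTop (𝓝 0) := by
  obtain ⟨B₀, hB₀⟩ := hS.bounded h
  obtain ⟨B₁, hB₁⟩ := hS.swap.bounded h.swap
  obtain ⟨B₂, hB₂⟩ := hS.swap.deriv_bounded h.swap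
  set B := max (max B₀ B₁) (max B₂ 1) with hB
  have hBpos : 0 < B := lt_of_lt_of_le one_pos ((le_max_right _ _).trans (le_max_right _ _))
  have hx1 := h.fst_pos i
  have hx2 := h.snd_pos i
  set a := (x i).1
  set b := (x i).2
  set D := 2 * a * B + B + 2 * b * B + |ρ| with hD
  have hDpos : 0 < D := by positivity
  rw [Metric.tendsto_nhds]
  intro ε hε
  -- The window is long enough for the memory of the left end, bounded by `D`, to contribute less
  -- than `ε / 2`; `η` is then chosen so that the drift error `4 * η * B` equals `ε / 4`.
  obtain ⟨L, hL0, hL⟩ : ∃ L : ℝ, 0 ≤ L ∧ Real.exp (-(2 * a * L)) * D < ε / 2 := by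
    have h1 : Tendsto (fun L : ℝ => Real.exp (-(2 * a * L)) * D) atTop (𝓝 (0 * D)) := by
      refine Tendsto.mul_const _ (Real.tendsto_exp_neg_atTop_nhds_zero.comp ?_)
      exact tendsto_id.const_mul_atTop (by positivity)
    rw [zero_mul] at h1
    obtain ⟨L, hL, hL'⟩ := ((eventually_ge_atTop (0 : ℝ)).and
      (h1.eventually (gt_mem_nhds (by positivity : 0 < ε / 2)))).exists
    exact ⟨L, hL, hL'⟩
  set η := ε / (16 * B) with hη
  have hηpos : 0 < η := by positivity
  have hta := tendsto_mul_atTop_of_pos hx1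
  have htb := tendsto_mul_atTop_of_pos hx2
  obtain ⟨S, hS0⟩ := eventually_atTop.1 hB₀
  have hta' : ∀ᶠ r in atTop, S + L ≤ r * a := hta.eventually (eventually_ge_atTop _)
  filter_upwards [h.ray₁ i L η hηpos, h.ray₂ i L η hηpos, hta', htb.eventually hB₁,
    htb.eventually hB₂] with r hr1 hr2 hr3 hr4 hr5
  set κ := β' (r * b) + 2 * b * β (r * b) + ρ with hκ
  have hβ : |β (r * b)| ≤ B := hr4.trans ((le_max_right _ _).trans (le_max_left _ _))
  have hβ' : |β' (r * b)| ≤ B := hr5.trans ((le_max_left _ _).trans (le_max_right _ _))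
  have hα : ∀ s, S ≤ s → |α s| ≤ B := fun s hs =>
    (hS0 s hs).trans ((le_max_left _ _).trans (le_max_left _ _))
  have hκb : |κ| ≤ B + 2 * b * B + |ρ| := by
    refine (abs_add_le _ _).trans (add_le_add ((abs_add_le _ _).trans (add_le_add hβ' ?_)) le_rfl)
    rw [abs_mul, abs_of_pos (by positivity : 0 < 2 * b)]
    gcongr
  have hrel := abs_le_of_relaxation (z := fun s => 2 * a * α s + κ) (z' := fun s => 2 * a * α' s)
    (c := 2 * a) (η := 4 * η * B) (a := r * a - L) (b := r * a) (by linarith) (by positivity)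
    (fun s _ => ((hS.deriv₁ s).const_mul (2 * a)).add_const κ) (fun s hs => by
      have e1 := hS.eqn s (r * b)
      have e2 : 2 * a * α' s + 2 * a * (2 * a * α s + κ)
          = 2 * a * (2 * ((a - m₁ s (r * b)) * α s) + 2 * ((b - m₂ s (r * b)) * β (r * b))) := by
        rw [hκ]; linear_combination (2 * a) * e1
      have hs1 : |m₁ s (r * b) - a| ≤ η := by
        have : |m₁ (r * a + (s - r * a)) (r * b + 0) - a| ≤ η := hr1 (s - r * a) 0
          (abs_le.2 ⟨by linarith [hs.1], by linarith [hs.2]⟩) (by simpa using hL0)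
        rwa [add_sub_cancel, add_zero] at this
      have hs2 : |m₂ s (r * b) - b| ≤ η := by
        have : |m₂ (r * a + (s - r * a)) (r * b + 0) - b| ≤ η := hr2 (s - r * a) 0
          (abs_le.2 ⟨by linarith [hs.1], by linarith [hs.2]⟩) (by simpa using hL0)
        rwa [add_sub_cancel, add_zero] at this
      rw [abs_sub_comm] at hs1 hs2
      have hαs := hα s (by linarith [hs.1])
      rw [e2, abs_mul, abs_of_pos (by positivity : 0 < 2 * a)]
      refine mul_le_mul_of_nonneg_left ((abs_add_le _ _).trans ?_) (by positivity)
      rw [abs_mul, abs_mul, abs_mul 2, abs_mul, abs_two]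
      have f1 := mul_le_mul hs1 hαs (abs_nonneg _) hηpos.le
      have f2 := mul_le_mul hs2 hβ (abs_nonneg _) hηpos.le
      linarith)
  rw [Real.dist_eq, sub_zero]
  have hz : |2 * a * α (r * a - L) + κ| ≤ D := by
    refine (abs_add_le _ _).trans ?_
    rw [abs_mul, abs_of_pos (by positivity : 0 < 2 * a)]
    have := mul_le_mul_of_nonneg_left (hα (r * a - L) (by linarith)) (by positivity : 0 ≤ 2 * a)
    rw [hD]; linarith
  have h5 : Real.exp (-(2 * a * (r * a - (r * a - L)))) * |2 * a * α (r * a - L) + κ| < ε / 2 := by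
    rw [sub_sub_cancel]
    exact lt_of_le_of_lt (mul_le_mul_of_nonneg_left hz (Real.exp_pos _).le) hL
  have h6 : 4 * η * B = ε / 4 := by rw [hη]; field_simp; norm_num
  rw [h6] at hrel
  linarith

/-- At the ray points `m₁` and `m₂` may be replaced by their limits. Subtracting from the resulting
relation the one of `ray_aux`, which lacks `α'`, isolates `α'`; the relation obtained by exchanging
the coordinates then loses its derivative. -/
theorem SeparatedSolution.deriv_tendsto (hS : SeparatedSolution m₁ m₂ α α' β β' ρ)
    (h : DriftField R m₁ m₂ x) : Tendsto α' atTop (𝓝 0) ∧ ∀ i,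
      Tendsto (fun r => 2 * (x i).1 * α (r * (x i).1) + 2 * (x i).2 * β (r * (x i).2) + ρ)
        atTop (𝓝 0) := by
  obtain ⟨B₀, hB₀⟩ := hS.bounded h
  obtain ⟨B₁, hB₁⟩ := hS.swap.bounded h.swap
  have key : ∀ i, Tendsto (fun r => α' (r * (x i).1)) atTop (𝓝 0) ∧
      Tendsto (fun r => 2 * (x i).1 * α (r * (x i).1) + 2 * (x i).2 * β (r * (x i).2) + ρ)
        atTop (𝓝 0) := by
    intro i
    have hta := tendsto_mul_atTop_of_pos (h.fst_pos i)
    have htb := tendsto_mul_atTop_of_pos (h.snd_pos i)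
    have T1 := hS.ray_aux h i
    have T2 := hS.swap.ray_aux h.swap i
    simp only [Prod.fst_swap, Prod.snd_swap] at T2
    have M1 : Tendsto (fun r => m₁ (r * (x i).1) (r * (x i).2) - (x i).1) atTop (𝓝 0) := by
      rw [Metric.tendsto_nhds]
      intro ε hε
      filter_upwards [h.ray₁ i 0 (ε / 2) (by positivity)] with r hr
      have := hr 0 0 (by simp) (by simp)
      rw [Real.dist_eq]
      simp only [add_zero] at this
      rw [sub_zero]; linarith
    have M2 : Tendsto (fun r => m₂ (r * (x i).1) (r * (x i).2) - (x i).2) atTop (𝓝 0) := by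
      rw [Metric.tendsto_nhds]
      intro ε hε
      filter_upwards [h.ray₂ i 0 (ε / 2) (by positivity)] with r hr
      have := hr 0 0 (by simp) (by simp)
      rw [Real.dist_eq]
      simp only [add_zero] at this
      rw [sub_zero]; linarith
    have N1 : Tendsto (fun r => (m₁ (r * (x i).1) (r * (x i).2) - (x i).1) * α (r * (x i).1))
        atTop (𝓝 0) := by
      refine M1.zero_mul_isBoundedUnder_le ⟨B₀, ?_⟩
      exact eventually_map.2 (hta.eventually hB₀)
    have N2 : Tendsto (fun r => (m₂ (r * (x i).1) (r * (x i).2) - (x i).2) * β (r * (x i).2))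
        atTop (𝓝 0) := by
      refine M2.zero_mul_isBoundedUnder_le ⟨B₁, ?_⟩
      exact eventually_map.2 (htb.eventually hB₁)
    have T3 : Tendsto (fun r => α' (r * (x i).1) + 2 * (x i).1 * α (r * (x i).1)
        + β' (r * (x i).2) + 2 * (x i).2 * β (r * (x i).2) + ρ) atTop (𝓝 0) := by
      have := (N1.add N2).const_mul (-2)
      simp only [add_zero, mul_zero] at this
      refine this.congr fun r => ?_
      linear_combination -hS.eqn (r * (x i).1) (r * (x i).2)
    have T4 : Tendsto (fun r => α' (r * (x i).1)) atTop (𝓝 0) := by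
      have := T3.sub T1
      rw [sub_zero] at this
      refine this.congr fun r => by ring
    refine ⟨T4, ?_⟩
    have := T2.sub T4
    rw [sub_zero] at this
    refine this.congr fun r => by ring
  refine ⟨?_, fun i => (key i).2⟩
  have h1 := (key 0).1.comp (tendsto_id.atTop_div_const (h.fst_pos 0))
  refine h1.congr fun r => ?_
  have := (h.fst_pos 0).ne'
  simp [div_mul_cancel₀ _ this]

theorem DriftField.ne_swap_aux (h : DriftField R m₁ m₂ x) {i j : Fin 4} (hij : i ≠ j) :
    (x i).2 / (x i).1 ≠ (x j).2 / (x j).1 := by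
  intro he
  have hi1 := h.fst_pos i
  have hj1 := h.fst_pos j
  have hi2 := h.snd_pos i
  have hj2 := h.snd_pos j
  rw [div_eq_div_iff hi1.ne' hj1.ne'] at he
  have h1 := h.on_circle i
  have h2 := h.on_circle j
  have hR := h.radius_pos
  have e1 : R ^ 2 * ((x i).1 ^ 2 - (x j).1 ^ 2) = 0 := by
    have : ((x i).2 * (x j).1) ^ 2 = ((x j).2 * (x i).1) ^ 2 := by rw [he]
    rw [mul_pow, mul_pow] at this
    have e2 : (x i).2 ^ 2 = R ^ 2 - (x i).1 ^ 2 := by linarith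
    have e3 : (x j).2 ^ 2 = R ^ 2 - (x j).1 ^ 2 := by linarith
    rw [e2, e3] at this
    linarith
  have e2 : (x i).1 ^ 2 = (x j).1 ^ 2 := by
    rcases mul_eq_zero.1 e1 with h' | h'
    · exact absurd h' (by positivity)
    · linarith
  have e3 : (x i).1 = (x j).1 := by
    rwa [pow_left_inj₀ hi1.le hj1.le two_ne_zero] at e2
  have e4 : (x i).2 = (x j).2 := by
    rw [e3] at he
    exact mul_right_cancel₀ hj1.ne' he
  exact hij (h.inj (Prod.ext e3 e4))

theorem DriftField.snd_ne (h : DriftField R m₁ m₂ x) {i j : Fin 4} (hij : i ≠ j) :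
    (x i).2 ≠ (x j).2 := by
  intro he
  have h1 := h.on_circle i
  have h2 := h.on_circle j
  rw [he] at h1
  have e2 : (x i).1 ^ 2 = (x j).1 ^ 2 := by linarith
  rw [pow_left_inj₀ (h.fst_pos i).le (h.fst_pos j).le two_ne_zero] at e2
  exact hij (h.inj (Prod.ext e2 he))

theorem DriftField.fst_ne (h : DriftField R m₁ m₂ x) {i j : Fin 4} (hij : i ≠ j) :
    (x i).1 ≠ (x j).1 := by
  simpa using h.swap.snd_ne hij

/-- Two rays of slopes `l < k` give two asymptotic expressions of `α s`. Eliminating `α`, the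
difference of `β (k / l * s)` and `l / k * β s` converges, and a bounded function with this property
converges. -/
theorem SeparatedSolution.exists_limit (hS : SeparatedSolution m₁ m₂ α α' β β' ρ)
    (h : DriftField R m₁ m₂ x) : ∃ b, Tendsto β atTop (𝓝 b) := by
  obtain ⟨B₁, hB₁⟩ := hS.swap.bounded h.swap
  have key : ∀ i j : Fin 4, (x j).2 / (x j).1 < (x i).2 / (x i).1 →
      ∃ b, Tendsto β atTop (𝓝 b) := by
    intro i j hij
    have hray : ∀ i, Tendsto (fun s => α s + (x i).2 / (x i).1 * β ((x i).2 / (x i).1 * s)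
        + ρ / (2 * (x i).1)) atTop (𝓝 0) := by
      intro i
      have h1 := (((hS.deriv_tendsto h).2 i).comp
        (tendsto_id.atTop_div_const (h.fst_pos i))).const_mul (1 / (2 * (x i).1))
      rw [mul_zero] at h1
      refine h1.congr fun r => ?_
      have := (h.fst_pos i).ne'
      simp only [Function.comp_apply, id]
      rw [div_mul_cancel₀ _ this, show (x i).2 / (x i).1 * r = r / (x i).1 * (x i).2 by ring]
      field_simp
    set k := (x i).2 / (x i).1 with hk
    set l := (x j).2 / (x j).1 with hl
    have hlpos : 0 < l := div_pos (h.snd_pos j) (h.fst_pos j)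
    have hkpos : 0 < k := hlpos.trans hij
    have hdiff := (hray i).sub (hray j)
    have hd2 := (hdiff.comp (tendsto_id.atTop_div_const hlpos)).const_mul (1 / k)
    have hd3 := hd2.sub_const ((ρ / (2 * (x i).1) - ρ / (2 * (x j).1)) / k)
    refine ⟨_, tendsto_of_scaling (e := β) (κ := k / l) (q := l / k) (by rwa [one_lt_div hlpos])
      (by positivity) (by rwa [div_lt_one hkpos]) hB₁ (hd3.congr fun s => ?_)⟩
    simp only [Function.comp_apply, id, ← hk, ← hl]
    rw [mul_div_cancel₀ _ hlpos.ne', show k * (s / l) = k / l * s by ring]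
    field_simp
    ring
  rcases lt_or_gt_of_ne (h.ne_swap_aux (show (0 : Fin 4) ≠ 1 by decide)) with h1 | h1
  · exact key 1 0 h1
  · exact key 0 1 h1

/-- With limits `a`, `b` of `α`, `β`, all the support points `x i` lie on the line `2 a X + 2 b Y +
ρ = 0`; three points of a circle are not collinear. -/
theorem SeparatedSolution.tendsto_zero (hS : SeparatedSolution m₁ m₂ α α' β β' ρ)
    (h : DriftField R m₁ m₂ x) :
    Tendsto α atTop (𝓝 0) ∧ Tendsto β atTop (𝓝 0) ∧ ρ = 0 := by
  obtain ⟨b, hb⟩ := hS.exists_limit h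
  obtain ⟨a, ha⟩ := hS.swap.exists_limit h.swap
  have hlin : ∀ i, 2 * a * (x i).1 + 2 * b * (x i).2 + ρ = 0 := by
    intro i
    have h1 := (hS.deriv_tendsto h).2 i
    have h2 := (((ha.comp (tendsto_mul_atTop_of_pos (h.fst_pos i))).const_mul (2 * (x i).1)).add
      ((hb.comp (tendsto_mul_atTop_of_pos (h.snd_pos i))).const_mul (2 * (x i).2))).add_const ρ
    have := tendsto_nhds_unique h2 h1
    linarith
  obtain ⟨e1, e2, e3⟩ := eq_zero_of_three_points (h.on_circle 0) (h.on_circle 1) (h.on_circle 2)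
    (h.inj.ne (by decide)) (h.inj.ne (by decide)) (h.inj.ne (by decide)) (hlin 0) (hlin 1) (hlin 2)
  have ha0 : a = 0 := by linarith
  have hb0 : b = 0 := by linarith
  subst ha0 hb0
  exact ⟨ha, hb, e3⟩

end Dynamics

end CircleDeconv

end

/-! ### The separated transport equation: rates and uniqueness -/

noncomputable section

namespace CircleDeconv

open Filter Topology

section Dynamics

variable {R : ℝ} {m₁ m₂ : ℝ → ℝ → ℝ} {x : Fin 4 → ℝ × ℝ} {α α' β β' : ℝ → ℝ} {ρ : ℝ}

theorem DriftField.tendsto_ray₁ (h : DriftField R m₁ m₂ x) (i : Fin 4) :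
    Tendsto (fun r => m₁ (r * (x i).1) (r * (x i).2)) atTop (𝓝 (x i).1) := by
  rw [Metric.tendsto_nhds]
  intro ε hε
  filter_upwards [h.ray₁ i 0 (ε / 2) (by positivity)] with r hr
  have := hr 0 0 (by simp) (by simp)
  rw [Real.dist_eq]
  simp only [add_zero] at this
  linarith

theorem DriftField.tendsto_ray₂ (h : DriftField R m₁ m₂ x) (i : Fin 4) :
    Tendsto (fun r => m₂ (r * (x i).1) (r * (x i).2)) atTop (𝓝 (x i).2) := by
  simpa using h.swap.tendsto_ray₁ i

/-- A function that satisfies `|a'| ≤ K |a|` vanishes identically as soon as it vanishes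
somewhere. -/
theorem eq_zero_of_abs_deriv_le {a a' : ℝ → ℝ} {K : ℝ} (ha : ∀ s, HasDerivAt a (a' s) s)
    (hK : ∀ s, |a' s| ≤ K * |a s|) {s₀ : ℝ} (h0 : a s₀ = 0) : ∀ s, a s = 0 := by
  have hd : ∀ (c : ℝ) s, HasDerivAt (fun s => a s ^ 2 * Real.exp (c * s))
      ((2 * (a s * a' s) + c * a s ^ 2) * Real.exp (c * s)) s := by
    intro c s
    have h1 : HasDerivAt (fun s => Real.exp (c * s)) (Real.exp (c * s) * c) s := by
      simpa using ((hasDerivAt_id s).const_mul c).exp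
    exact (((ha s).pow 2).mul h1).congr_deriv (by simp only [Pi.pow_apply]; push_cast; ring)
  have hbd : ∀ s, |a s * a' s| ≤ K * a s ^ 2 := by
    intro s
    rw [abs_mul, ← sq_abs (a s)]
    nlinarith [hK s, abs_nonneg (a s)]
  -- Gronwall in both directions: the antitone weight propagates the zero at `s₀` to the right, the
  -- monotone one to the left.
  have hanti : Antitone fun s => a s ^ 2 * Real.exp (-(2 * K) * s) := by
    refine antitone_of_deriv_nonpos (fun s => (hd _ s).differentiableAt) fun s => ?_
    rw [(hd _ s).deriv]
    refine mul_nonpos_of_nonpos_of_nonneg ?_ (Real.exp_pos _).le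
    linarith [le_abs_self (a s * a' s), hbd s]
  have hmono : Monotone fun s => a s ^ 2 * Real.exp (2 * K * s) := by
    refine monotone_of_deriv_nonneg (fun s => (hd _ s).differentiableAt) fun s => ?_
    rw [(hd _ s).deriv]
    refine mul_nonneg ?_ (Real.exp_pos _).le
    linarith [neg_abs_le (a s * a' s), hbd s]
  intro s
  have key : ∀ E : ℝ, 0 < E → a s ^ 2 * E ≤ 0 → a s = 0 := by
    intro E hE hle
    have : a s ^ 2 ≤ 0 := by
      by_contra hc
      push Not at hc
      exact absurd hle (not_le.2 (mul_pos hc hE))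
    nlinarith [sq_nonneg (a s)]
  rcases le_total s₀ s with h | h
  · have := hanti h
    simp only [h0] at this
    exact key _ (Real.exp_pos _) (by simpa using this)
  · have := hmono h
    simp only [h0] at this
    exact key _ (Real.exp_pos _) (by simpa using this)

/-- As `s → ∞` with `t` fixed, every term that involves `α` disappears, as does `ρ`; only the
balance between `β' t` and the drift remains. -/
theorem SeparatedSolution.tendsto_drift (hS : SeparatedSolution m₁ m₂ α α' β β' ρ)
    (h : DriftField R m₁ m₂ x) (t : ℝ) :
    Tendsto (fun s => 2 * m₂ s t * β t) atTop (𝓝 (-β' t)) := by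
  obtain ⟨h1, _, h3⟩ := hS.tendsto_zero h
  have h2 : Tendsto (fun s => m₁ s t * α s) atTop (𝓝 0) := by
    refine isBoundedUnder_le_mul_tendsto_zero ⟨R, ?_⟩ h1
    exact eventually_map.2 (Eventually.of_forall fun s => h.abs_le₁ s t)
  have h4 := ((((hS.deriv_tendsto h).1).add (h2.const_mul 2)).neg).sub_const (β' t)
  simp only [mul_zero, add_zero, neg_zero, zero_sub] at h4
  refine h4.congr fun s => ?_
  have := hS.eqn s t
  rw [h3] at this
  linarith

/-- The limiting drift at fixed `t` is bounded by `2 * R * |β t|`, so `β` obeys `|β'| ≤ 2 R |β|`,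
which excludes isolated zeros. -/
theorem SeparatedSolution.eq_zero_or_ne_zero (hS : SeparatedSolution m₁ m₂ α α' β β' ρ)
    (h : DriftField R m₁ m₂ x) : (∀ t, β t = 0) ∨ ∀ t, β t ≠ 0 := by
  by_contra hcon
  push Not at hcon
  obtain ⟨⟨t₁, ht₁⟩, t₀, ht₀⟩ := hcon
  refine ht₁ (eq_zero_of_abs_deriv_le (K := 2 * R) hS.deriv₂ (fun t => ?_) ht₀ t₁)
  have h1 := (hS.tendsto_drift h t).abs
  rw [abs_neg] at h1
  refine le_of_tendsto h1 (Eventually.of_forall fun s => ?_)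
  rw [abs_mul, abs_mul, abs_two]
  have := h.abs_le₂ s t
  gcongr

/-- The logarithmic derivative of the second component of a nonzero solution converges at infinity
to a negative limit. -/
theorem SeparatedSolution.exists_rate (hS : SeparatedSolution m₁ m₂ α α' β β' ρ)
    (h : DriftField R m₁ m₂ x) (hne : ∀ t, β t ≠ 0) :
    ∃ (g : ℝ → ℝ) (G : ℝ), 0 < G ∧ (∀ t, β' t = -2 * g t * β t) ∧ Tendsto g atTop (𝓝 G) ∧
      ∀ t, Tendsto (fun s => m₂ s t) atTop (𝓝 (g t)) := by
  set g : ℝ → ℝ := fun t => -β' t / (2 * β t) with hg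
  have hgβ : ∀ t, β' t = -2 * g t * β t := by
    intro t
    have := hne t
    simp only [hg]
    field_simp
  have hlim : ∀ t, Tendsto (fun s => m₂ s t) atTop (𝓝 (g t)) := by
    intro t
    have h1 := (hS.tendsto_drift h t).div_const (2 * β t)
    refine h1.congr fun s => ?_
    have := hne t
    field_simp
  have hmono : Monotone g := fun t t' htt' =>
    le_of_tendsto_of_tendsto' (hlim t) (hlim t') fun s => h.mono₂ s htt'
  have hbdd : BddAbove (Set.range g) := ⟨R, by
    rintro _ ⟨t, rfl⟩
    exact le_of_tendsto' (hlim t) fun s => (le_abs_self _).trans (h.abs_le₂ s t)⟩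
  refine ⟨g, ⨆ t, g t, ?_, hgβ, tendsto_atTop_ciSup hmono hbdd, hlim⟩
  -- If `G ≤ 0` then `g ≤ 0` everywhere, so `β ^ 2` is nondecreasing. It tends to zero, hence it
  -- would vanish.
  by_contra hle
  push Not at hle
  have hgle : ∀ t, g t ≤ 0 := fun t => (le_ciSup hbdd t).trans hle
  have hd : ∀ t, HasDerivAt (fun t => β t ^ 2) (-4 * g t * β t ^ 2) t := by
    intro t
    refine ((hS.deriv₂ t).pow 2).congr_deriv ?_
    rw [hgβ t]; push_cast; ring
  have hm2 : Monotone fun t => β t ^ 2 := by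
    refine monotone_of_deriv_nonneg (fun t => (hd t).differentiableAt) fun t => ?_
    rw [(hd t).deriv]
    nlinarith [hgle t, sq_nonneg (β t)]
  have hz : Tendsto (fun t => β t ^ 2) atTop (𝓝 0) := by
    simpa using ((hS.tendsto_zero h).2.1).pow 2
  have := hm2.ge_of_tendsto hz 0
  have := hne 0
  have : 0 < β 0 ^ 2 := by positivity
  linarith

/-- `Real.log` is the logarithm of the absolute value, so the sign of `b` plays no role. -/
theorem tendsto_log_div {b b' g : ℝ → ℝ} {G : ℝ} (hb : ∀ s, HasDerivAt b (b' s) s)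
    (hne : ∀ s, b s ≠ 0) (hg : ∀ s, b' s = -2 * g s * b s) (hG : Tendsto g atTop (𝓝 G)) :
    Tendsto (fun s => Real.log (b s) / s) atTop (𝓝 (-2 * G)) := by
  refine tendsto_div_of_deriv (f' := fun s => -2 * g s) (fun s => ?_) (hG.const_mul _)
  refine ((hb s).log (hne s)).congr_deriv ?_
  rw [hg s, mul_div_assoc, div_self (hne s), mul_one]

/-- If `β` vanishes and `α` does not, `m₁` depends on `s` alone and has a single limit along all
rays. Yet its limits are the abscissas of the support points, which differ. -/
theorem SeparatedSolution.left_eq_zero_of_right (hS : SeparatedSolution m₁ m₂ α α' β β' ρ)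
    (h : DriftField R m₁ m₂ x) (hβ : ∀ t, β t = 0) : ∀ s, α s = 0 := by
  rcases hS.swap.eq_zero_or_ne_zero h.swap with h0 | h0
  · exact h0
  exfalso
  obtain ⟨g, G, hG, hgα, hgG, _⟩ := hS.swap.exists_rate h.swap h0
  have hβ' : ∀ t, β' t = 0 := by
    intro t
    have h1 : HasDerivAt β 0 t := by
      have : β = fun _ => 0 := funext hβ
      rw [this]; exact hasDerivAt_const _ _
    exact (hS.deriv₂ t).unique h1
  have hρ := (hS.tendsto_zero h).2.2
  have hm : ∀ s t, m₁ s t = g s := by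
    intro s t
    have h1 := hS.eqn s t
    rw [hβ t, hβ' t, hρ, hgα s] at h1
    have h2 : 2 * α s * (m₁ s t - g s) = 0 := by linarith
    rcases mul_eq_zero.1 h2 with h3 | h3
    · exact absurd h3 (mul_ne_zero two_ne_zero (h0 s))
    · linarith
  have hx : ∀ i, (x i).1 = G := by
    intro i
    refine tendsto_nhds_unique (h.tendsto_ray₁ i) ?_
    refine (hgG.comp (tendsto_mul_atTop_of_pos (h.fst_pos i))).congr fun r => ?_
    simp [hm]
  exact h.fst_ne (show (0 : Fin 4) ≠ 1 by decide) ((hx 0).trans (hx 1).symm)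

/-- The separated transport equation has no nonzero solution. -/
theorem SeparatedSolution.eq_zero (hS : SeparatedSolution m₁ m₂ α α' β β' ρ)
    (h : DriftField R m₁ m₂ x) : (∀ s, α s = 0) ∧ (∀ t, β t = 0) ∧ ρ = 0 := by
  have hρ := (hS.tendsto_zero h).2.2
  rcases hS.eq_zero_or_ne_zero h with hβ | hβ
  · exact ⟨hS.left_eq_zero_of_right h hβ, hβ, hρ⟩
  rcases hS.swap.eq_zero_or_ne_zero h.swap with hα | hα
  · exact ⟨hα, hS.swap.left_eq_zero_of_right h.swap hα, hρ⟩
  exfalso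
  obtain ⟨g₂, G₂, hG₂, hgβ, hgG₂, _⟩ := hS.exists_rate h hβ
  obtain ⟨g₁, G₁, hG₁, hgα, hgG₁, _⟩ := hS.swap.exists_rate h.swap hα
  have L₂ := tendsto_log_div hS.deriv₂ hβ hgβ hgG₂
  have L₁ := tendsto_log_div hS.deriv₁ hα hgα hgG₁
  -- On the ray the equation reads `α (m₁ - g₁) = -β (m₂ - g₂)`. If both brackets have nonzero
  -- limits, their logarithms are `o(r)`, and comparing `log|α| / r` with `log|β| / r` gives the
  -- third alternative.
  have key : ∀ i, (x i).1 = G₁ ∨ (x i).2 = G₂ ∨ G₁ * (x i).1 = G₂ * (x i).2 := by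
    intro i
    by_contra hcon
    push Not at hcon
    obtain ⟨c1, c2, c3⟩ := hcon
    have ta := tendsto_mul_atTop_of_pos (h.fst_pos i)
    have tb := tendsto_mul_atTop_of_pos (h.snd_pos i)
    have D₁ := (h.tendsto_ray₁ i).sub (hgG₁.comp ta)
    have D₂ := (h.tendsto_ray₂ i).sub (hgG₂.comp tb)
    have n1 : (x i).1 - G₁ ≠ 0 := sub_ne_zero.2 c1
    have n2 : (x i).2 - G₂ ≠ 0 := sub_ne_zero.2 c2
    have E₁ := ((Real.continuousAt_log n1).tendsto.comp D₁).div_atTop tendsto_id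
    have E₂ := ((Real.continuousAt_log n2).tendsto.comp D₂).div_atTop tendsto_id
    have F₁ := (L₁.comp ta).mul_const (x i).1
    have F₂ := (L₂.comp tb).mul_const (x i).2
    have H₁ := F₁.add E₁
    have H₂ := F₂.add E₂
    have heq : -2 * G₁ * (x i).1 + 0 = -2 * G₂ * (x i).2 + 0 := by
      refine tendsto_nhds_unique_of_eventuallyEq H₁ H₂ ?_
      filter_upwards [D₁.eventually_ne n1, D₂.eventually_ne n2, eventually_gt_atTop 0]
        with r hr1 hr2 hr0
      have hx1 := (h.fst_pos i).ne'
      have hx2 := (h.snd_pos i).ne'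
      simp only [Function.comp_apply, id] at hr1 hr2 ⊢
      have e := hS.eqn (r * (x i).1) (r * (x i).2)
      rw [hρ, hgα, hgβ] at e
      have e2 : α (r * (x i).1) * (m₁ (r * (x i).1) (r * (x i).2) - g₁ (r * (x i).1))
          = -(β (r * (x i).2) * (m₂ (r * (x i).1) (r * (x i).2) - g₂ (r * (x i).2))) := by
        linarith
      have e3 := congrArg Real.log e2
      rw [Real.log_neg_eq_log, Real.log_mul (hα _) hr1, Real.log_mul (hβ _) hr2] at e3
      field_simp
      exact e3
    exact c3 (by linarith)
  -- Pigeonhole: among four points two satisfy the same alternative. They share an abscissa, an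
  -- ordinate or a slope, and each of these determines a point of the open quarter circle.
  have hcls : ∀ i, ∃ c : Fin 3, (c = 0 → (x i).1 = G₁) ∧ (c = 1 → (x i).2 = G₂) ∧
      (c = 2 → (x i).2 / (x i).1 = G₁ / G₂) := by
    intro i
    rcases key i with hk | hk | hk
    · exact ⟨0, fun _ => hk, fun hh => absurd hh (by decide), fun hh => absurd hh (by decide)⟩
    · exact ⟨1, fun hh => absurd hh (by decide), fun _ => hk, fun hh => absurd hh (by decide)⟩
    · refine ⟨2, fun hh => absurd hh (by decide), fun hh => absurd hh (by decide), fun _ => ?_⟩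
      rw [div_eq_div_iff (h.fst_pos i).ne' hG₂.ne']
      linarith
  choose c hc using hcls
  obtain ⟨i, j, hij, hcij⟩ := Fintype.exists_ne_map_eq_of_card_lt c (by simp)
  have hcases : ∀ k : Fin 3, k = 0 ∨ k = 1 ∨ k = 2 := by decide
  rcases hcases (c i) with hk | hk | hk
  · exact h.fst_ne hij (((hc i).1 hk).trans ((hc j).1 (hcij ▸ hk)).symm)
  · exact h.snd_ne hij (((hc i).2.1 hk).trans ((hc j).2.1 (hcij ▸ hk)).symm)
  · exact h.ne_swap_aux hij (((hc i).2.2 hk).trans ((hc j).2.2 (hcij ▸ hk)).symm)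

end Dynamics

end CircleDeconv

end

/-! ### Exponential tilts and the drift they define -/

noncomputable section

namespace CircleDeconv

open Filter Topology

theorem abs_exponent_le {α : Type*} {X Y : α → ℝ} {K : ℝ} (hX : ∀ a, |X a| ≤ K) (hY : ∀ a, |Y a| ≤ K) (s t : ℝ) (a : α) :
    |s * X a + t * Y a| ≤ (|s| + |t|) * K := by
  refine (abs_add_le _ _).trans ?_
  rw [abs_mul, abs_mul, add_mul]
  gcongr
  · exact hX a
  · exact hY a

section Tilt

variable {α : Type*} [MeasurableSpace α]

/-- The integral of `φ` against the exponential tilt of `ν` in the direction `(s, t)`. -/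
def tilt (ν : Measure α) (X Y φ : α → ℝ) (s t : ℝ) : ℝ :=
  ∫ a, φ a * Real.exp (s * X a + t * Y a) ∂ν

/-- The mean of `φ` under the normalized exponential tilt of `ν` in the direction `(s, t)`. -/
def tiltMean (ν : Measure α) (X Y φ : α → ℝ) (s t : ℝ) : ℝ :=
  tilt ν X Y φ s t / tilt ν X Y (fun _ => 1) s t

variable {ν : Measure α} [IsFiniteMeasure ν] {X Y : α → ℝ} {K : ℝ}

theorem integrable_mul_exp {h φ : α → ℝ} {B H : ℝ} (hh : Measurable h) (hφ : Measurable φ)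
    (hH : ∀ a, |h a| ≤ H) (hB : ∀ a, |φ a| ≤ B) : Integrable (fun a => φ a * Real.exp (h a)) ν := by
  refine Integrable.of_bound (by fun_prop) (B * Real.exp H) (Eventually.of_forall fun a => ?_)
  rw [norm_mul, Real.norm_eq_abs, Real.norm_eq_abs, Real.abs_exp]
  exact mul_le_mul (hB a) (Real.exp_le_exp.2 ((le_abs_self _).trans (hH a))) (Real.exp_pos _).le
    ((abs_nonneg _).trans (hB a))

theorem integrable_tilt (hXm : Measurable X) (hYm : Measurable Y) (hX : ∀ a, |X a| ≤ K)
    (hY : ∀ a, |Y a| ≤ K) {φ : α → ℝ} {B : ℝ} (hφ : Measurable φ) (hB : ∀ a, |φ a| ≤ B)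
    (s t : ℝ) : Integrable (fun a => φ a * Real.exp (s * X a + t * Y a)) ν :=
  integrable_mul_exp (by fun_prop) hφ (abs_exponent_le hX hY s t) hB

theorem tilt_one_pos (hν : ν ≠ 0) (hXm : Measurable X) (hYm : Measurable Y)
    (hX : ∀ a, |X a| ≤ K) (hY : ∀ a, |Y a| ≤ K) (s t : ℝ) : 0 < tilt ν X Y (fun _ => 1) s t := by
  have hint : Integrable (fun a => (1 : ℝ) * Real.exp (s * X a + t * Y a)) ν :=
    integrable_tilt hXm hYm hX hY measurable_const (B := 1) (by simp) s t
  rw [tilt, integral_pos_iff_support_of_nonneg (fun a => by positivity) hint]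
  have : Function.support (fun a => (1 : ℝ) * Real.exp (s * X a + t * Y a)) = Set.univ := by
    ext a; simp
  rw [this]
  exact Measure.measure_univ_pos.2 hν

theorem abs_tiltMean_le (hν : ν ≠ 0) (hXm : Measurable X) (hYm : Measurable Y)
    (hX : ∀ a, |X a| ≤ K) (hY : ∀ a, |Y a| ≤ K) {φ : α → ℝ} {B : ℝ} (hφ : Measurable φ)
    (hB : ∀ a, |φ a| ≤ B) (s t : ℝ) : |tiltMean ν X Y φ s t| ≤ B := by
  have hpos := tilt_one_pos hν hXm hYm hX hY s t
  rw [tiltMean, abs_div, abs_of_pos hpos, div_le_iff₀ hpos, tilt, tilt, ← integral_const_mul]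
  refine (abs_integral_le_integral_abs).trans (integral_mono ?_ ?_ fun a => ?_)
  · exact (integrable_tilt hXm hYm hX hY hφ hB s t).abs
  · exact (integrable_tilt hXm hYm hX hY measurable_const (B := 1) (by simp) s t).const_mul B
  · simp only [abs_mul, Real.abs_exp, one_mul]
    exact mul_le_mul_of_nonneg_right (hB a) (Real.exp_pos _).le

theorem tilt_sub_const (hXm : Measurable X) (hYm : Measurable Y) (hX : ∀ a, |X a| ≤ K)
    (hY : ∀ a, |Y a| ≤ K) {φ : α → ℝ} {B : ℝ} (hφ : Measurable φ) (hB : ∀ a, |φ a| ≤ B)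
    (c s t : ℝ) : tilt ν X Y (fun a => φ a - c) s t
      = tilt ν X Y φ s t - c * tilt ν X Y (fun _ => 1) s t := by
  rw [tilt, tilt, tilt, ← integral_const_mul, ← integral_sub (integrable_tilt hXm hYm hX hY hφ hB s t)
    ((integrable_tilt hXm hYm hX hY measurable_const (B := 1) (by simp) s t).const_mul c)]
  congr 1; ext a; ring

/-- With `c` the mean at `t`, the factors `Y - c` and `exp ((t' - t) Y) - exp ((t' - t) c)` have the
same sign. Hence the `t'`-tilted integral of `Y - c` is at least `exp ((t' - t) c)` times the
`t`-tilted one, which is zero. -/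
theorem tiltMean_mono (hν : ν ≠ 0) (hXm : Measurable X) (hYm : Measurable Y)
    (hX : ∀ a, |X a| ≤ K) (hY : ∀ a, |Y a| ≤ K) (s : ℝ) :
    Monotone fun t => tiltMean ν X Y Y s t := by
  intro t t' htt'
  have hpos := tilt_one_pos hν hXm hYm hX hY s t
  have hpos' := tilt_one_pos hν hXm hYm hX hY s t'
  set c := tiltMean ν X Y Y s t with hc
  have h0 : tilt ν X Y (fun a => Y a - c) s t = 0 := by
    rw [tilt_sub_const hXm hYm hX hY hYm hY, hc, tiltMean]
    field_simp
    ring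
  have hsubm : Measurable fun a => Y a - c := hYm.sub_const c
  have hsubB : ∀ a, |Y a - c| ≤ K + |c| := fun a =>
    (abs_sub _ _).trans (add_le_add (hY a) le_rfl)
  have h1 : Real.exp ((t' - t) * c) * tilt ν X Y (fun a => Y a - c) s t
      ≤ tilt ν X Y (fun a => Y a - c) s t' := by
    rw [tilt, tilt, ← integral_const_mul]
    refine integral_mono ((integrable_tilt hXm hYm hX hY hsubm hsubB s t).const_mul _)
      (integrable_tilt hXm hYm hX hY hsubm hsubB s t') fun a => ?_
    have e1 : Real.exp (s * X a + t' * Y a)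
        = Real.exp ((t' - t) * Y a) * Real.exp (s * X a + t * Y a) := by
      rw [← Real.exp_add]; congr 1; ring
    simp only [e1]
    have e2 : (Y a - c) * Real.exp ((t' - t) * c) ≤ (Y a - c) * Real.exp ((t' - t) * Y a) := by
      rcases le_total c (Y a) with h | h
      · exact mul_le_mul_of_nonneg_left (Real.exp_le_exp.2
          (mul_le_mul_of_nonneg_left h (by linarith))) (by linarith)
      · exact mul_le_mul_of_nonpos_left (Real.exp_le_exp.2
          (mul_le_mul_of_nonneg_left h (by linarith))) (by linarith)
    have e3 := mul_le_mul_of_nonneg_right e2 (Real.exp_pos (s * X a + t * Y a)).le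
    linarith
  rw [h0, mul_zero, tilt_sub_const hXm hYm hX hY hYm hY] at h1
  change c ≤ tiltMean ν X Y Y s t'
  rw [tiltMean, le_div_iff₀ hpos']
  linarith

/-- Exponential tilting by a large multiple of `h` concentrates near the supremum of `h`. -/
theorem tilt_concentration {h k φ : α → ℝ} {a c B H κ η r : ℝ} (hh : Measurable h)
    (hk : Measurable k) (hφ : Measurable φ) (hH : ∀ b, |h b| ≤ H) (hκ : ∀ b, |k b| ≤ κ)
    (hB : ∀ b, |φ b| ≤ B) (hr : 0 ≤ r) (ha : ν {b | a ≤ h b} ≠ 0)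
    (hc : ∀ b, a - η < h b → c ≤ φ b) :
    (c - (B + |c|) * (Real.exp (2 * κ) * ν.real Set.univ / ν.real {b | a ≤ h b})
        * Real.exp (-(η * r))) * ∫ b, 1 * Real.exp (r * h b + k b) ∂ν
      ≤ ∫ b, φ b * Real.exp (r * h b + k b) ∂ν := by
  obtain ⟨b₀, hb₀⟩ := nonempty_of_measure_ne_zero ha
  have hB0 : 0 ≤ B := (abs_nonneg _).trans (hB b₀)
  have hexpm : Measurable fun b => r * h b + k b := by fun_prop
  have hexpb : ∀ b, |r * h b + k b| ≤ r * H + κ := fun b => by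
    refine (abs_add_le _ _).trans (add_le_add ?_ (hκ b))
    rw [abs_mul, abs_of_nonneg hr]
    exact mul_le_mul_of_nonneg_left (hH b) hr
  have i1 : Integrable (fun b => (1 : ℝ) * Real.exp (r * h b + k b)) ν :=
    integrable_mul_exp hexpm measurable_const hexpb (B := 1) (by simp)
  have i2 := integrable_mul_exp (ν := ν) hexpm hφ hexpb hB
  have hset : MeasurableSet {b | a ≤ h b} := measurableSet_le measurable_const hh
  have hapos : 0 < ν.real {b | a ≤ h b} := by
    rw [measureReal_def]
    exact ENNReal.toReal_pos ha (measure_ne_top _ _)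
  -- The mass of the cap `{a ≤ h}` alone gives a lower bound for the normalizing constant.
  have hZ : Real.exp (r * a - κ) * ν.real {b | a ≤ h b}
      ≤ ∫ b, 1 * Real.exp (r * h b + k b) ∂ν := by
    calc Real.exp (r * a - κ) * ν.real {b | a ≤ h b}
        = ∫ b in {b | a ≤ h b}, Real.exp (r * a - κ) ∂ν := by
          rw [setIntegral_const, smul_eq_mul, mul_comm]
      _ ≤ ∫ b in {b | a ≤ h b}, 1 * Real.exp (r * h b + k b) ∂ν := by
          refine setIntegral_mono_on (integrable_const _).integrableOn i1.integrableOn hset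
            fun b hb => ?_
          rw [one_mul]
          apply Real.exp_le_exp.2
          have := mul_le_mul_of_nonneg_left (show a ≤ h b from hb) hr
          linarith [neg_abs_le (k b), hκ b]
      _ ≤ _ := setIntegral_le_integral i1 (Eventually.of_forall fun b => by positivity)
  -- Inside the larger cap the integrand minus `c` is nonnegative; outside, the exponential is at
  -- most `exp (r * (a - η) + κ)`, smaller by `exp (2 * κ - η * r)` than the factor in `hZ`.
  have hlow : -((B + |c|) * Real.exp (r * (a - η) + κ)) * ν.real Set.univ
      ≤ (∫ b, φ b * Real.exp (r * h b + k b) ∂ν) - c * ∫ b, 1 * Real.exp (r * h b + k b) ∂ν := by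
    rw [← integral_const_mul, ← integral_sub i2 (i1.const_mul c)]
    have : ∫ _b, -((B + |c|) * Real.exp (r * (a - η) + κ)) ∂ν
        = -((B + |c|) * Real.exp (r * (a - η) + κ)) * ν.real Set.univ := by
      rw [integral_const, smul_eq_mul, mul_comm]
    rw [← this]
    refine integral_mono (integrable_const _) (i2.sub (i1.const_mul c)) fun b => ?_
    have hpos := Real.exp_pos (r * h b + k b)
    have hBc : 0 ≤ B + |c| := by positivity
    by_cases hb : a - η < h b
    · have h1 := mul_le_mul_of_nonneg_right (hc b hb) hpos.le
      have h2 : 0 ≤ (B + |c|) * Real.exp (r * (a - η) + κ) := by positivity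
      simp only
      linarith
    · have h1 : Real.exp (r * h b + k b) ≤ Real.exp (r * (a - η) + κ) := by
        apply Real.exp_le_exp.2
        have := mul_le_mul_of_nonneg_left (not_lt.1 hb) hr
        linarith [le_abs_self (k b), hκ b]
      have h2 : -(B + |c|) ≤ φ b - c := by
        linarith [neg_abs_le (φ b), hB b, le_abs_self c]
      have h3 := mul_le_mul_of_nonneg_right h2 hpos.le
      have h4 := mul_le_mul_of_nonneg_left h1 hBc
      simp only
      linarith
  have hkey : Real.exp (r * (a - η) + κ) * ν.real Set.univ
      ≤ Real.exp (2 * κ) * ν.real Set.univ / ν.real {b | a ≤ h b} * Real.exp (-(η * r))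
        * ∫ b, 1 * Real.exp (r * h b + k b) ∂ν := by
    have e : Real.exp (r * (a - η) + κ) * ν.real Set.univ
      = Real.exp (2 * κ) * ν.real Set.univ / ν.real {b | a ≤ h b} * Real.exp (-(η * r))
        * (Real.exp (r * a - κ) * ν.real {b | a ≤ h b}) := by
      have e' : Real.exp (r * (a - η) + κ)
          = Real.exp (2 * κ) * Real.exp (-(η * r)) * Real.exp (r * a - κ) := by
        rw [← Real.exp_add, ← Real.exp_add]
        congr 1; ring
      rw [e']
      field_simp
    rw [e]
    exact mul_le_mul_of_nonneg_left hZ (by positivity)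
  have h5 := mul_le_mul_of_nonneg_left hkey (by positivity : 0 ≤ B + |c|)
  nlinarith

/-- The bounded shift `(σ, τ)` goes into the perturbation `k` of the concentration estimate. It
enters only through its supremum, so the conclusion is uniform over shifts. -/
theorem eventually_le_tiltMean (hν : ν ≠ 0) (hXm : Measurable X) (hYm : Measurable Y)
    (hX : ∀ a, |X a| ≤ K) (hY : ∀ a, |Y a| ≤ K) {φ : α → ℝ} {u v a c c' B η L : ℝ}
    (hφ : Measurable φ) (hB : ∀ b, |φ b| ≤ B) (hη : 0 < η) (hcc' : c' < c)
    (ha : ν {b | a ≤ u * X b + v * Y b} ≠ 0) (hc : ∀ b, a - η < u * X b + v * Y b → c ≤ φ b) :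
    ∀ᶠ r in atTop, ∀ σ τ, |σ| ≤ L → |τ| ≤ L → c' ≤ tiltMean ν X Y φ (r * u + σ) (r * v + τ) := by
  have hlim : Tendsto (fun r : ℝ => (B + |c|) * (Real.exp (2 * ((L + L) * K)) * ν.real Set.univ
      / ν.real {b | a ≤ u * X b + v * Y b}) * Real.exp (-(η * r))) atTop (𝓝 0) := by
    rw [← mul_zero ((B + |c|) * (Real.exp (2 * ((L + L) * K)) * ν.real Set.univ
      / ν.real {b | a ≤ u * X b + v * Y b}))]
    refine Tendsto.const_mul _ (Real.tendsto_exp_neg_atTop_nhds_zero.comp ?_)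
    exact tendsto_id.const_mul_atTop hη
  filter_upwards [hlim.eventually (gt_mem_nhds (sub_pos.2 hcc')), eventually_ge_atTop 0]
    with r hr hr0 σ τ hσ hτ
  have hpos := tilt_one_pos hν hXm hYm hX hY (r * u + σ) (r * v + τ)
  obtain ⟨b₀, _⟩ := nonempty_of_measure_ne_zero ha
  have hK0 : 0 ≤ K := (abs_nonneg _).trans (hX b₀)
  have h1 := tilt_concentration (ν := ν) (h := fun b => u * X b + v * Y b)
    (k := fun b => σ * X b + τ * Y b) (κ := (L + L) * K) (by fun_prop) (by fun_prop) hφ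
    (abs_exponent_le hX hY u v) (fun b => (abs_exponent_le hX hY σ τ b).trans
      (mul_le_mul_of_nonneg_right (add_le_add hσ hτ) hK0)) hB hr0 ha hc
  have e : ∀ b, r * (u * X b + v * Y b) + (σ * X b + τ * Y b)
      = (r * u + σ) * X b + (r * v + τ) * Y b := fun b => by ring
  simp only [e] at h1
  rw [tiltMean, le_div_iff₀ hpos]
  refine le_trans (mul_le_mul_of_nonneg_right ?_ hpos.le) h1
  linarith

theorem eventually_abs_tiltMean_sub_le (hν : ν ≠ 0) (hXm : Measurable X) (hYm : Measurable Y)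
    (hX : ∀ a, |X a| ≤ K) (hY : ∀ a, |Y a| ≤ K) {φ : α → ℝ} {u v a l B η ε L : ℝ}
    (hφ : Measurable φ) (hB : ∀ b, |φ b| ≤ B) (hη : 0 < η) (hε : 0 < ε)
    (ha : ν {b | a ≤ u * X b + v * Y b} ≠ 0)
    (hc : ∀ b, a - η < u * X b + v * Y b → |φ b - l| ≤ ε / 2) :
    ∀ᶠ r in atTop, ∀ σ τ, |σ| ≤ L → |τ| ≤ L →
      |tiltMean ν X Y φ (r * u + σ) (r * v + τ) - l| ≤ ε := by
  have h1 := eventually_le_tiltMean hν hXm hYm hX hY (L := L) (c := l - ε / 2) (c' := l - ε)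
    hφ hB hη (by linarith) ha fun b hb => by linarith [(abs_le.1 (hc b hb)).1]
  have h2 := eventually_le_tiltMean hν hXm hYm hX hY (L := L) (φ := fun b => -φ b)
    (c := -l - ε / 2) (c' := -l - ε) hφ.neg (by simpa using hB) hη (by linarith) ha
    fun b hb => by linarith [(abs_le.1 (hc b hb)).2]
  filter_upwards [h1, h2] with r hr1 hr2 σ τ hσ hτ
  have e : tiltMean ν X Y (fun b => -φ b) (r * u + σ) (r * v + τ)
      = -tiltMean ν X Y φ (r * u + σ) (r * v + τ) := by
    simp only [tiltMean, tilt, neg_mul, integral_neg, neg_div]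
  have h3 := hr1 σ τ hσ hτ
  have h4 := hr2 σ τ hσ hτ
  rw [e] at h4
  exact abs_le.2 ⟨by linarith, by linarith⟩

/-- The gradient of the logarithm of the Laplace transform of a finite measure on a circle whose
support contains four points of the first quadrant. -/
theorem driftField_tiltMean (hXm : Measurable X) (hYm : Measurable Y) {R : ℝ} (hR : 0 < R)
    (hXY : ∀ a, X a ^ 2 + Y a ^ 2 = R ^ 2) {x : Fin 4 → ℝ × ℝ} (hinj : Function.Injective x)
    (hx1 : ∀ i, 0 < (x i).1) (hx2 : ∀ i, 0 < (x i).2)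
    (hxR : ∀ i, (x i).1 ^ 2 + (x i).2 ^ 2 = R ^ 2)
    (hsupp : ∀ i η, 0 < η → ν {a | |X a - (x i).1| < η ∧ |Y a - (x i).2| < η} ≠ 0) :
    DriftField R (tiltMean ν X Y X) (tiltMean ν X Y Y) x := by
  have hX : ∀ a, |X a| ≤ R := fun a => abs_le_of_sq_le_sq (by nlinarith [hXY a, sq_nonneg (Y a)]) hR.le
  have hY : ∀ a, |Y a| ≤ R := fun a => abs_le_of_sq_le_sq (by nlinarith [hXY a, sq_nonneg (X a)]) hR.le
  have hν : ν ≠ 0 := by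
    rintro rfl
    exact hsupp 0 1 one_pos rfl
  have hswap : ∀ φ s t, tiltMean ν X Y φ s t = tiltMean ν Y X φ t s := by
    intro φ s t; simp only [tiltMean, tilt, add_comm]
  -- On the circle the squared distance to `x i` is `2 * R ^ 2` minus twice the inner product. A cap
  -- of height `ε ^ 2 / 16` thus contains the points whose coordinates are within `ε / 4` of those
  -- of `x i`, and the cap of height `ε ^ 2 / 8` stays within distance `ε / 2`.
  have hnear : ∀ i ε, 0 < ε → ν {b | R ^ 2 - ε ^ 2 / 16 ≤ (x i).1 * X b + (x i).2 * Y b} ≠ 0 := by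
    intro i ε hε hz
    refine hsupp i (ε / 4) (by positivity) (measure_mono_null (fun b hb => ?_) hz)
    have h1 := sq_lt_sq' (abs_lt.1 hb.1).1 (abs_lt.1 hb.1).2
    have h2 := sq_lt_sq' (abs_lt.1 hb.2).1 (abs_lt.1 hb.2).2
    have := hXY b
    have := hxR i
    change R ^ 2 - ε ^ 2 / 16 ≤ (x i).1 * X b + (x i).2 * Y b
    nlinarith
  have hclose : ∀ i ε b, 0 < ε → R ^ 2 - ε ^ 2 / 16 - ε ^ 2 / 16 < (x i).1 * X b + (x i).2 * Y b →
      (X b - (x i).1) ^ 2 + (Y b - (x i).2) ^ 2 ≤ (ε / 2) ^ 2 := by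
    intro i ε b hε hb
    have := hXY b
    have := hxR i
    nlinarith
  constructor
  · exact hR
  · exact fun s t => abs_tiltMean_le hν hXm hYm hX hY hXm hX s t
  · exact fun s t => abs_tiltMean_le hν hXm hYm hX hY hYm hY s t
  · intro t
    simp only [hswap]
    exact tiltMean_mono hν hYm hXm hY hX t
  · exact tiltMean_mono hν hXm hYm hX hY
  -- In an axis direction the tilt need not concentrate at a known point; the half plane beyond `(x
  -- 0).1 / 2` has positive mass, and a lower bound is enough. The fractions satisfy `1/2 - 1/8 >
  -- 1/3 > 1/4`.
  · refine ⟨(x 0).1 / 4, by linarith [hx1 0], ?_⟩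
    have h1 := eventually_le_tiltMean (ν := ν) hν hXm hYm hX hY (L := 0) (u := 1) (v := 0)
      (φ := X) (a := (x 0).1 / 2) (η := (x 0).1 / 8) (c := (x 0).1 / 3) (c' := (x 0).1 / 4) hXm hX
      (by linarith [hx1 0]) (by linarith [hx1 0]) (fun hz =>
        hsupp 0 ((x 0).1 / 2) (by linarith [hx1 0]) (measure_mono_null (fun b hb => by
          have := (abs_lt.1 hb.1).1
          show (x 0).1 / 2 ≤ 1 * X b + 0 * Y b
          linarith) hz)) (fun b hb => by linarith [hx1 0])
    filter_upwards [h1] with s hs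
    simpa using hs 0 0 (by simp) (by simp)
  · refine ⟨(x 0).2 / 4, by linarith [hx2 0], ?_⟩
    have h1 := eventually_le_tiltMean (ν := ν) hν hXm hYm hX hY (L := 0) (u := 0) (v := 1)
      (φ := Y) (a := (x 0).2 / 2) (η := (x 0).2 / 8) (c := (x 0).2 / 3) (c' := (x 0).2 / 4) hYm hY
      (by linarith [hx2 0]) (by linarith [hx2 0]) (fun hz =>
        hsupp 0 ((x 0).2 / 2) (by linarith [hx2 0]) (measure_mono_null (fun b hb => by
          have := (abs_lt.1 hb.2).1
          show (x 0).2 / 2 ≤ 0 * X b + 1 * Y b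
          linarith) hz)) (fun b hb => by linarith [hx2 0])
    filter_upwards [h1] with s hs
    simpa using hs 0 0 (by simp) (by simp)
  · exact hinj
  · exact hx1
  · exact hx2
  · exact hxR
  · intro i L ε hε
    exact eventually_abs_tiltMean_sub_le (η := ε ^ 2 / 16) hν hXm hYm hX hY hXm hX (by positivity) hε (hnear i ε hε)
      fun b hb => abs_le_of_sq_le_sq (by nlinarith [hclose i ε b hε hb, sq_nonneg (Y b - (x i).2)])
        (by positivity)
  · intro i L ε hε
    exact eventually_abs_tiltMean_sub_le (η := ε ^ 2 / 16) hν hXm hYm hX hY hYm hY (by positivity) hε (hnear i ε hε)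
      fun b hb => abs_le_of_sq_le_sq (by nlinarith [hclose i ε b hε hb, sq_nonneg (X b - (x i).1)])
        (by positivity)

end Tilt

end CircleDeconv

end

/-! ### Charts of the circle and vanishing of Laplace transforms on lines -/

noncomputable section

namespace CircleDeconv

open Filter Topology

/-- Two coordinate functions with values on the circle of radius `R`, whose joint polynomials
separate integrable functions and whose level sets are null. -/
structure CircleChart {α : Type*} [MeasurableSpace α] (μ : Measure α) (R : ℝ) (X Y : α → ℝ) :
    Prop where
  radius_pos : 0 < R
  meas₁ : Measurable X
  meas₂ : Measurable Y
  on_circle : ∀ a, X a ^ 2 + Y a ^ 2 = R ^ 2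
  null₁ : ∀ c, μ {a | X a = c} = 0
  null₂ : ∀ c, μ {a | Y a = c} = 0
  separating : ∀ g : α → ℂ, Integrable g μ →
    (∀ n m : ℕ, ∫ a, (X a : ℂ) ^ n * (Y a : ℂ) ^ m * g a ∂μ = 0) → g =ᵐ[μ] 0

section Chart

variable {α : Type*} [MeasurableSpace α] {μ : Measure α} {R : ℝ} {X Y : α → ℝ}

theorem CircleChart.swap (h : CircleChart μ R X Y) : CircleChart μ R Y X where
  radius_pos := h.radius_pos
  meas₁ := h.meas₂
  meas₂ := h.meas₁
  on_circle a := by rw [← h.on_circle a, add_comm]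
  null₁ := h.null₂
  null₂ := h.null₁
  separating g hg h0 := h.separating g hg fun n m => by
    rw [← h0 m n]; congr 1; ext a; ring

theorem CircleChart.scale (h : CircleChart μ R X Y) {c : ℝ} (hc : 0 < c) :
    CircleChart μ (c * R) (fun a => c * X a) (fun a => c * Y a) where
  radius_pos := mul_pos hc h.radius_pos
  meas₁ := h.meas₁.const_mul c
  meas₂ := h.meas₂.const_mul c
  on_circle a := by linear_combination c ^ 2 * h.on_circle a
  null₁ d := by
    rw [← h.null₁ (d / c)]
    congr 1; ext a
    show c * X a = d ↔ X a = d / c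
    rw [eq_div_iff hc.ne', mul_comm]
  null₂ d := by
    rw [← h.null₂ (d / c)]
    congr 1; ext a
    show c * Y a = d ↔ Y a = d / c
    rw [eq_div_iff hc.ne', mul_comm]
  separating g hg h0 := h.separating g hg fun n m => by
    have h1 := h0 n m
    have e : ∀ a, ((c * X a : ℝ) : ℂ) ^ n * ((c * Y a : ℝ) : ℂ) ^ m * g a
        = ((c : ℂ) ^ n * (c : ℂ) ^ m) * ((X a : ℂ) ^ n * (Y a : ℂ) ^ m * g a) := fun a => by
      push_cast; ring
    simp only [e, integral_const_mul] at h1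
    have hc' : (c : ℂ) ≠ 0 := by exact_mod_cast hc.ne'
    exact (mul_eq_zero.1 h1).resolve_left (mul_ne_zero (pow_ne_zero _ hc') (pow_ne_zero _ hc'))

theorem CircleChart.abs_le₁ (h : CircleChart μ R X Y) (a : α) : |X a| ≤ R :=
  abs_le_of_sq_le_sq (by nlinarith [h.on_circle a, sq_nonneg (Y a)]) h.radius_pos.le

theorem CircleChart.abs_le₂ (h : CircleChart μ R X Y) (a : α) : |Y a| ≤ R := h.swap.abs_le₁ a

theorem CircleChart.sqrt_eq (h : CircleChart μ R X Y) (a : α) :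
    Real.sqrt (R ^ 2 - Y a ^ 2) = |X a| := by
  rw [← Real.sqrt_sq_eq_abs]; congr 1; linarith [h.on_circle a]

/-- A complex measure that annihilates `exp (w * Y)` for all `w` annihilates all powers of `Y`. -/
theorem CircleChart.integral_pow_mul_eq_zero (h : CircleChart μ R X Y) {k : α → ℂ}
    (hk : Integrable k μ) (h0 : ∀ w, lap μ X Y k 0 w = 0) (m : ℕ) :
    ∫ a, (Y a : ℂ) ^ m * k a ∂μ = 0 := by
  have key : ∀ m : ℕ, Integrable (fun a => (Y a : ℂ) ^ m * k a) μ ∧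
      ∀ w, lap μ X Y (fun a => (Y a : ℂ) ^ m * k a) 0 w = 0 := by
    intro m
    induction m with
    | zero => simpa using ⟨hk, h0⟩
    | succ m ih =>
      have e : (fun a => (Y a : ℂ) ^ (m + 1) * k a)
          = fun a => (Y a : ℂ) * ((Y a : ℂ) ^ m * k a) := by ext a; ring
      rw [e]
      refine ⟨integrable_ofReal_mul h.meas₂ h.abs_le₂ ih.1, fun w => ?_⟩
      have hd := hasDerivAt_lap_right h.meas₁ h.meas₂ h.abs_le₁ h.abs_le₂ ih.1 0 w
      have hz : (fun w => lap μ X Y (fun a => (Y a : ℂ) ^ m * k a) 0 w) = fun _ => 0 :=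
        funext ih.2
      rw [hz] at hd
      exact hd.unique (hasDerivAt_const w 0)
  have := (key m).2 0
  rwa [lap_zero_zero] at this

theorem integrable_comp_mul {Z : α → ℝ} (hZ : Measurable Z) {K : ℝ} (hK : ∀ a, |Z a| ≤ K)
    {φ : ℝ → ℂ} (hφ : Continuous φ) {k : α → ℂ} (hk : Integrable k μ) :
    Integrable (fun a => φ (Z a) * k a) μ := by
  obtain ⟨C, hC⟩ := (isCompact_Icc (a := -K) (b := K)).exists_bound_of_continuousOn
    hφ.continuousOn
  exact hk.bdd_mul (c := C) (hφ.measurable.comp hZ).aestronglyMeasurable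
    (Eventually.of_forall fun a => hC _ (abs_le.1 (hK a)))

/-- A complex measure that annihilates all powers of a bounded function annihilates all its
continuous functions. -/
theorem integral_comp_mul_eq_zero {Z : α → ℝ} (hZ : Measurable Z) {K : ℝ} (hK : ∀ a, |Z a| ≤ K)
    {k : α → ℂ} (hk : Integrable k μ) (h0 : ∀ m : ℕ, ∫ a, (Z a : ℂ) ^ m * k a ∂μ = 0)
    {φ : ℝ → ℂ} (hφ : Continuous φ) : ∫ a, φ (Z a) * k a ∂μ = 0 := by
  have hpow : ∀ m : ℕ, Integrable (fun a => (Z a : ℂ) ^ m * k a) μ := fun m =>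
    integrable_comp_mul hZ hK (φ := fun x => (x : ℂ) ^ m) (by fun_prop) hk
  have hpoly : ∀ p : Polynomial ℝ, ∫ a, ((p.eval (Z a) : ℝ) : ℂ) * k a ∂μ = 0 := by
    intro p
    have e : ∀ a, ((p.eval (Z a) : ℝ) : ℂ) * k a
        = ∑ i ∈ Finset.range (p.natDegree + 1), (p.coeff i : ℂ) * ((Z a : ℂ) ^ i * k a) := by
      intro a
      rw [Polynomial.eval_eq_sum_range]
      push_cast
      rw [Finset.sum_mul]
      exact Finset.sum_congr rfl fun i _ => by ring
    simp only [e]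
    rw [integral_finsetSum _ fun i _ => (hpow i).const_mul _]
    simp [integral_const_mul, h0]
  have hreal : ∀ ψ : ℝ → ℝ, Continuous ψ → ∫ a, (ψ (Z a) : ℂ) * k a ∂μ = 0 := by
    intro ψ hψ
    have hle : ∀ ε > 0, ‖∫ a, (ψ (Z a) : ℂ) * k a ∂μ‖ ≤ ε * ∫ a, ‖k a‖ ∂μ := by
      intro ε hε
      obtain ⟨p, hp⟩ := exists_polynomial_near_of_continuousOn (-K) K ψ hψ.continuousOn ε hε
      have e : ∫ a, (ψ (Z a) : ℂ) * k a ∂μ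
          = ∫ a, ((ψ (Z a) - p.eval (Z a) : ℝ) : ℂ) * k a ∂μ := by
        have i1 := integrable_comp_mul hZ hK (φ := fun x => (ψ x : ℂ)) (by fun_prop) hk
        have i2 := integrable_comp_mul hZ hK (φ := fun x => ((p.eval x : ℝ) : ℂ))
          (Complex.continuous_ofReal.comp p.continuous) hk
        simp only [Complex.ofReal_sub, sub_mul]
        rw [integral_sub i1 i2, hpoly p, sub_zero]
      rw [e, ← integral_const_mul]
      refine norm_integral_le_of_norm_le (hk.norm.const_mul _) (Eventually.of_forall fun a => ?_)
      rw [norm_mul, Complex.norm_real, Real.norm_eq_abs, abs_sub_comm]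
      exact mul_le_mul_of_nonneg_right (hp _ (abs_le.1 (hK a))).le (norm_nonneg _)
    have hlim : Tendsto (fun ε : ℝ => ε * ∫ a, ‖k a‖ ∂μ) (𝓝[>] 0) (𝓝 0) := by
      have : Tendsto (fun ε : ℝ => ε * ∫ a, ‖k a‖ ∂μ) (𝓝 0) (𝓝 (0 * ∫ a, ‖k a‖ ∂μ)) :=
        tendsto_id.mul_const _
      rw [zero_mul] at this
      exact this.mono_left nhdsWithin_le_nhds
    refine norm_le_zero_iff.1 (ge_of_tendsto hlim ?_)
    filter_upwards [self_mem_nhdsWithin] with ε hε using hle ε hε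
  have h1 := hreal (fun x => (φ x).re) (Complex.continuous_re.comp hφ)
  have h2 := hreal (fun x => (φ x).im) (Complex.continuous_im.comp hφ)
  have i1 := integrable_comp_mul hZ hK (φ := fun x => ((φ x).re : ℂ))
    (Complex.continuous_ofReal.comp (Complex.continuous_re.comp hφ)) hk
  have i2 := integrable_comp_mul hZ hK (φ := fun x => ((φ x).im : ℂ))
    (Complex.continuous_ofReal.comp (Complex.continuous_im.comp hφ)) hk
  calc ∫ a, φ (Z a) * k a ∂μ
      = ∫ a, ((φ (Z a)).re : ℂ) * k a + Complex.I * (((φ (Z a)).im : ℂ) * k a) ∂μ := by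
        congr 1; ext a
        nth_rewrite 1 [← Complex.re_add_im (φ (Z a))]
        ring
    _ = 0 := by rw [integral_add i1 (i2.const_mul _), integral_const_mul, h1, h2]; simp

/-- If the partial Laplace transform of `k` in the direction of `Y` vanishes, so does the integral
of `k` against every even continuous function of `X`. -/
theorem CircleChart.integral_even_mul_eq_zero (h : CircleChart μ R X Y) {k : α → ℂ}
    (hk : Integrable k μ) (h0 : ∀ w, lap μ X Y k 0 w = 0) {φ ψ : ℝ → ℂ} (hφ : Continuous φ)
    (hψ : Continuous ψ) (heven : ∀ x, φ (-x) = φ x) :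
    ∫ a, φ (X a) * ψ (Y a) * k a ∂μ = 0 := by
  -- On the circle an even function of `X` is a continuous function of `Y`, because `|X| = √(R² -
  -- Y²)`.
  have h1 := integral_comp_mul_eq_zero h.meas₂ h.abs_le₂ hk (h.integral_pow_mul_eq_zero hk h0)
    (φ := fun y => φ (Real.sqrt (R ^ 2 - y ^ 2)) * ψ y) (by fun_prop)
  rw [← h1]
  congr 1; ext a
  rw [h.sqrt_eq]
  rcases abs_choice (X a) with e | e
  · rw [e]
  · rw [e, heven]

/-- A function annihilated by `ψ(Y)` and by `X * ψ(Y)` for all monomials `ψ` vanishes. -/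
theorem CircleChart.ae_eq_zero_of_half (h : CircleChart μ R X Y) {k : α → ℂ} (hk : Integrable k μ)
    (h0 : ∀ ψ : ℝ → ℂ, Continuous ψ → ∫ a, ψ (Y a) * k a ∂μ = 0)
    (h1 : ∀ ψ : ℝ → ℂ, Continuous ψ → ∫ a, ψ (Y a) * (X a * k a) ∂μ = 0) : k =ᵐ[μ] 0 := by
  refine h.separating k hk fun n m => ?_
  -- Since `X ^ 2` is a polynomial in `Y`, every monomial is a function of `Y` or `X` times one.
  have hX2 : ∀ a, (X a : ℂ) ^ 2 = (R : ℂ) ^ 2 - (Y a : ℂ) ^ 2 := fun a => by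
    have : (X a : ℂ) ^ 2 + (Y a : ℂ) ^ 2 = (R : ℂ) ^ 2 := by exact_mod_cast h.on_circle a
    linear_combination this
  rcases Nat.even_or_odd' n with ⟨j, rfl | rfl⟩
  · rw [← h0 (fun y => ((R : ℂ) ^ 2 - (y : ℂ) ^ 2) ^ j * (y : ℂ) ^ m) (by fun_prop)]
    congr 1; ext a; rw [pow_mul, hX2]
  · rw [← h1 (fun y => ((R : ℂ) ^ 2 - (y : ℂ) ^ 2) ^ j * (y : ℂ) ^ m) (by fun_prop)]
    congr 1; ext a; rw [pow_succ, pow_mul, hX2]; ring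

theorem lap_eq_lap_zero (f : α → ℂ) (z w : ℂ) :
    lap μ X Y f z w = lap μ X Y (fun a => Complex.exp (z * X a) * f a) 0 w := by
  simp only [lap, zero_mul, zero_add, Complex.exp_add]
  congr 1; ext a; ring

theorem CircleChart.integrable_exp_mul (h : CircleChart μ R X Y) {f : α → ℂ}
    (hf : Integrable f μ) (z : ℂ) : Integrable (fun a => Complex.exp (z * X a) * f a) μ :=
  integrable_comp_mul h.meas₁ h.abs_le₁ (φ := fun x => Complex.exp (z * x)) (by fun_prop) hf

/-- A zero of `sinh (ζ * x)` with `x` real belongs to a countable set, and the level sets of `X` are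
null. The real part appears because the candidate zeros need not be real. -/
theorem CircleChart.null_sinh (h : CircleChart μ R X Y) {ζ : ℂ} (hζ : ζ ≠ 0) :
    ∀ᵐ a ∂μ, Complex.sinh (ζ * X a) ≠ 0 := by
  have hn : ∀ᵐ a ∂μ, ∀ n : ℤ, X a ≠ (n * (2 * Real.pi * Complex.I) / (2 * ζ)).re :=
    ae_all_iff.2 fun n => by
      have := h.null₁ (n * (2 * Real.pi * Complex.I) / (2 * ζ)).re
      rw [ae_iff]
      simpa using this
  filter_upwards [hn] with a ha h0
  have h1 : Complex.exp (2 * (ζ * X a)) = 1 := by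
    rw [Complex.sinh, div_eq_zero_iff] at h0
    have h2 := h0.resolve_right two_ne_zero
    rw [two_mul, Complex.exp_add]
    have h3 : Complex.exp (ζ * X a) = Complex.exp (-(ζ * X a)) := sub_eq_zero.1 h2
    nth_rewrite 1 [h3]
    rw [← Complex.exp_add]; simp
  obtain ⟨n, hn⟩ := Complex.exp_eq_one_iff.1 h1
  refine ha n ?_
  rw [← hn]
  have : 2 * (ζ * (X a : ℂ)) / (2 * ζ) = (X a : ℂ) := by field_simp
  rw [this, Complex.ofReal_re]

theorem CircleChart.null_cos (h : CircleChart μ R X Y) (b : ℝ) :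
    ∀ᵐ a ∂μ, Real.cos (b * X a) ≠ 0 := by
  by_cases hb : b = 0
  · exact Eventually.of_forall fun a => by simp [hb]
  have hn : ∀ᵐ a ∂μ, ∀ n : ℤ, X a ≠ ((2 * n + 1) * Real.pi / 2) / b :=
    ae_all_iff.2 fun n => by
      have := h.null₁ (((2 * n + 1) * Real.pi / 2) / b)
      rw [ae_iff]
      simpa using this
  filter_upwards [hn] with a ha h0
  obtain ⟨n, hn⟩ := Real.cos_eq_zero_iff.1 h0
  refine ha n ?_
  rw [eq_div_iff hb, ← hn, mul_comm]

variable {f : α → ℂ}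

/-- The Laplace transform of a function on the circle with non-zero integral vanishes on at most
one complex line in each coordinate direction. -/
theorem CircleChart.line_unique (h : CircleChart μ R X Y) (hf : Integrable f μ)
    (hf0 : ∫ a, f a ∂μ ≠ 0) {z₀ z₁ : ℂ} (h0 : ∀ w, lap μ X Y f z₀ w = 0)
    (h1 : ∀ w, lap μ X Y f z₁ w = 0) : z₀ = z₁ := by
  by_contra hne
  have i0 := h.integrable_exp_mul hf z₀
  have i1 := h.integrable_exp_mul hf z₁
  simp only [lap_eq_lap_zero f] at h0 h1
  have hζ : z₁ - z₀ ≠ 0 := sub_ne_zero.2 (Ne.symm hne)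
  have hk : (fun a => Complex.sinh ((z₁ - z₀) * X a) * f a) =ᵐ[μ] 0 := by
    -- Vanishing on the line `z = z₀` makes `exp (z₀ X) f` orthogonal to every product of an even
    -- function of `X` and a function of `Y`; the same holds at `z₁`. The two families of test
    -- functions are combined.
    have key : ∀ φ₀ φ₁ ψ : ℝ → ℂ, Continuous φ₀ → Continuous φ₁ → Continuous ψ →
        (∀ x, φ₀ (-x) = φ₀ x) → (∀ x, φ₁ (-x) = φ₁ x) →
        ∫ a, ψ (Y a) * ((φ₁ (X a) * Complex.exp (z₁ * X a) - φ₀ (X a) * Complex.exp (z₀ * X a))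
          * f a) ∂μ = 0 := by
      intro φ₀ φ₁ ψ hφ₀ hφ₁ hψ he₀ he₁
      have j : ∀ (φ : ℝ → ℂ), Continuous φ → ∀ k : α → ℂ, Integrable k μ →
          Integrable (fun a => φ (X a) * ψ (Y a) * k a) μ := by
        intro φ hφ k hk
        have := integrable_comp_mul h.meas₁ h.abs_le₁ hφ
          (integrable_comp_mul h.meas₂ h.abs_le₂ hψ hk)
        simpa only [mul_assoc] using this
      have e0 := h.integral_even_mul_eq_zero i0 h0 hφ₀ hψ he₀
      have e1 := h.integral_even_mul_eq_zero i1 h1 hφ₁ hψ he₁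
      rw [← sub_zero (0 : ℂ)]
      nth_rewrite 1 [← e1]
      rw [← e0, ← integral_sub (j φ₁ hφ₁ _ i1) (j φ₀ hφ₀ _ i0)]
      congr 1; ext a; ring
    refine h.ae_eq_zero_of_half
      (integrable_comp_mul h.meas₁ h.abs_le₁ (φ := fun x => Complex.sinh ((z₁ - z₀) * x))
        (by fun_prop) hf) (fun ψ hψ => ?_) fun ψ hψ => ?_
    -- `cosh (z₀ x) e^(z₁ x) - cosh (z₁ x) e^(z₀ x) = sinh ((z₁ - z₀) x)`. The second choice, with
    -- `-x sinh` in place of `cosh`, gives `x` times the same function.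
    · rw [← key (fun x => Complex.cosh (z₁ * x)) (fun x => Complex.cosh (z₀ * x)) ψ (by fun_prop)
        (by fun_prop) hψ (by simp) (by simp)]
      congr 1; ext a
      rw [sub_mul z₁ z₀, Complex.sinh_sub, ← Complex.cosh_add_sinh, ← Complex.cosh_add_sinh]
      ring
    · rw [← key (fun x => -(x * Complex.sinh (z₁ * x))) (fun x => -(x * Complex.sinh (z₀ * x))) ψ
        (by fun_prop) (by fun_prop) hψ (by simp) (by simp)]
      congr 1; ext a
      rw [sub_mul z₁ z₀, Complex.sinh_sub, ← Complex.cosh_add_sinh, ← Complex.cosh_add_sinh]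
      ring
  refine hf0 (integral_eq_zero_of_ae ?_)
  filter_upwards [hk, h.null_sinh hζ] with a ha ha'
  exact (mul_eq_zero.1 ha).resolve_left ha'

/-- The Laplace transform of a function on the circle with non-zero integral does not vanish
together with its normal derivative on a complex line in a coordinate direction. -/
theorem CircleChart.line_simple (h : CircleChart μ R X Y) (hf : Integrable f μ)
    (hf0 : ∫ a, f a ∂μ ≠ 0) {z : ℂ} (h0 : ∀ w, lap μ X Y f z w = 0)
    (h1 : ∀ w, lap μ X Y (fun a => X a * f a) z w = 0) : False := by
  have hXf := integrable_ofReal_mul h.meas₁ h.abs_le₁ hf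
  have i0 := h.integrable_exp_mul hf z
  have i1 := h.integrable_exp_mul hXf z
  replace h0 : ∀ w, lap μ X Y (fun a => Complex.exp (z * X a) * f a) 0 w = 0 := fun w => by
    rw [← lap_eq_lap_zero, h0]
  replace h1 : ∀ w, lap μ X Y (fun a => Complex.exp (z * X a) * (X a * f a)) 0 w = 0 := fun w => by
    rw [← lap_eq_lap_zero, h1]
  have key : ∀ φ₀ φ₁ ψ : ℝ → ℂ, Continuous φ₀ → Continuous φ₁ → Continuous ψ →
      (∀ x, φ₀ (-x) = φ₀ x) → (∀ x, φ₁ (-x) = φ₁ x) →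
      ∫ a, ψ (Y a) * ((φ₀ (X a) + φ₁ (X a) * X a) * Complex.exp (z * X a) * f a) ∂μ = 0 := by
    intro φ₀ φ₁ ψ hφ₀ hφ₁ hψ he₀ he₁
    have j : ∀ (φ : ℝ → ℂ), Continuous φ → ∀ k : α → ℂ, Integrable k μ →
        Integrable (fun a => φ (X a) * ψ (Y a) * k a) μ := by
      intro φ hφ k hk
      have := integrable_comp_mul h.meas₁ h.abs_le₁ hφ
        (integrable_comp_mul h.meas₂ h.abs_le₂ hψ hk)
      simpa only [mul_assoc] using this
    have e0 := h.integral_even_mul_eq_zero i0 h0 hφ₀ hψ he₀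
    have e1 := h.integral_even_mul_eq_zero i1 h1 hφ₁ hψ he₁
    rw [← add_zero (0 : ℂ)]
    nth_rewrite 1 [← e0]
    rw [← e1, ← integral_add (j φ₀ hφ₀ _ i0) (j φ₁ hφ₁ _ i1)]
    congr 1; ext a; ring
  have hexp : ∀ a, (Complex.cosh (z * X a) - Complex.sinh (z * X a)) * Complex.exp (z * X a)
      = 1 := fun a => by
    rw [Complex.cosh_sub_sinh, ← Complex.exp_add]; simp
  -- The weights are chosen so that `(cosh (z x) - sinh (z x)) e^(z x) = 1` appears, which leaves
  -- `x` in the first case and `x ^ 2` in the second.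
  have hk : (fun a => (X a : ℂ) * f a) =ᵐ[μ] 0 := by
    refine h.ae_eq_zero_of_half hXf (fun ψ hψ => ?_) fun ψ hψ => ?_
    · rw [← key (fun x => -(x * Complex.sinh (z * x))) (fun x => Complex.cosh (z * x)) ψ
        (by fun_prop) (by fun_prop) hψ (by simp) (by simp)]
      congr 1; ext a
      linear_combination (-(ψ (Y a) * X a * f a)) * hexp a
    · rw [← key (fun x => x ^ 2 * Complex.cosh (z * x)) (fun x => -(x * Complex.sinh (z * x))) ψ
        (by fun_prop) (by fun_prop) hψ (by simp) (by simp)]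
      congr 1; ext a
      linear_combination (-(ψ (Y a) * X a ^ 2 * f a)) * hexp a
  have hX0 : ∀ᵐ a ∂μ, X a ≠ 0 := by
    rw [ae_iff]; simpa using h.null₁ 0
  refine hf0 (integral_eq_zero_of_ae ?_)
  filter_upwards [hk, hX0] with a ha ha'
  exact (mul_eq_zero.1 ha).resolve_left (by exact_mod_cast ha')

/-- The Laplace transform of a non-zero positive density on the circle vanishes on no complex line
in a coordinate direction. -/
theorem CircleChart.exists_lap_ne_zero (h : CircleChart μ R X Y) {f : α → ℝ}
    (hf : Integrable f μ) (hpos : ∀ᵐ a ∂μ, 0 ≤ f a) (hf0 : ∫ a, f a ∂μ ≠ 0) (z : ℂ) :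
    ∃ w, lap μ X Y (fun a => (f a : ℂ)) z w ≠ 0 := by
  by_contra hcon
  push Not at hcon
  have hfc : Integrable (fun a => (f a : ℂ)) μ := hf.ofReal
  have i0 := h.integrable_exp_mul hfc z
  have h0 : ∀ w, lap μ X Y (fun a => Complex.exp (z * X a) * (f a : ℂ)) 0 w = 0 := fun w => by
    rw [← lap_eq_lap_zero, hcon]
  -- Testing against `cos (Im z * X)` makes the real part of the integrand equal to `exp (Re z * X)
  -- * cos ^ 2 * f`, which is nonnegative. This is where positivity of the density matters.
  have h1 := h.integral_even_mul_eq_zero i0 h0 (φ := fun x => ((Real.cos (z.im * x) : ℝ) : ℂ))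
    (ψ := fun _ => 1) (by fun_prop) continuous_const (by simp)
  have i1 : Integrable (fun a => ((Real.cos (z.im * X a) : ℝ) : ℂ) * 1 *
      (Complex.exp (z * X a) * (f a : ℂ))) μ := by
    simpa using integrable_comp_mul h.meas₁ h.abs_le₁
      (φ := fun x => ((Real.cos (z.im * x) : ℝ) : ℂ)) (by fun_prop) i0
  have h2 : ∫ a, Real.exp (z.re * X a) * Real.cos (z.im * X a) ^ 2 * f a ∂μ = 0 := by
    have := integral_re i1
    rw [h1] at this
    rw [show (0 : ℝ) = RCLike.re (0 : ℂ) by simp, ← this]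
    congr 1; ext a
    have e : z * (X a : ℂ) = ((z.re * X a : ℝ) : ℂ) + ((z.im * X a : ℝ) : ℂ) * Complex.I := by
      nth_rewrite 1 [← Complex.re_add_im z]
      push_cast; ring
    have e2 : ((Real.cos (z.im * X a) : ℝ) : ℂ) * 1 * (Complex.exp (z * X a) * (f a : ℂ))
        = ((Real.cos (z.im * X a) * f a : ℝ) : ℂ) * Complex.exp (z * X a) := by
      push_cast; ring
    change _ = Complex.re _
    rw [e2, Complex.re_ofReal_mul, e, Complex.exp_re]
    simp only [Complex.add_re, Complex.add_im, Complex.ofReal_re, Complex.ofReal_im,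
      Complex.re_ofReal_mul, Complex.im_ofReal_mul, Complex.I_re, Complex.I_im]
    simp only [mul_zero, add_zero, zero_add, mul_one]
    ring
  have i2 : Integrable (fun a => Real.exp (z.re * X a) * Real.cos (z.im * X a) ^ 2 * f a) μ := by
    have := (integrable_comp_mul h.meas₁ h.abs_le₁ (φ := fun x =>
      ((Real.exp (z.re * x) * Real.cos (z.im * x) ^ 2 : ℝ) : ℂ)) (by fun_prop) hfc).re
    refine this.congr (Eventually.of_forall fun a => ?_)
    change Complex.re _ = _
    rw [← Complex.ofReal_mul, Complex.ofReal_re]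
  have h3 := (integral_eq_zero_iff_of_nonneg_ae (by
    filter_upwards [hpos] with a ha
    exact mul_nonneg (by positivity) ha) i2).1 h2
  refine hf0 (integral_eq_zero_of_ae ?_)
  filter_upwards [h3, h.null_cos z.im] with a ha ha'
  exact (mul_eq_zero.1 ha).resolve_left (mul_ne_zero (Real.exp_pos _).ne' (pow_ne_zero 2 ha'))

end Chart

end CircleDeconv

end

/-! ### Entire quotients and the factorization of marginals -/

noncomputable section

namespace CircleDeconv

open Filter Topology

theorem eventually_ne_zero_of_entire {P : ℂ → ℂ} (hP : Differentiable ℂ P) {c : ℂ} (hc : P c ≠ 0)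
    (z₀ : ℂ) : ∀ᶠ z in 𝓝[≠] z₀, P z ≠ 0 := by
  rcases (hP.analyticAt z₀).eventually_eq_zero_or_eventually_ne_zero with h | h
  · have := AnalyticOnNhd.eq_of_eventuallyEq (f := P) (g := fun _ => 0) (z₀ := z₀)
      (fun z _ => hP.analyticAt z) (fun z _ => analyticAt_const) h
    exact absurd (congrFun this c) hc
  · exact h

theorem eq_zero_of_mul_eq_zero_of_entire {F P : ℂ → ℂ} (hF : Differentiable ℂ F)
    (hP : Differentiable ℂ P) {c : ℂ} (hc : P c ≠ 0) (h : ∀ z, F z * P z = 0) (z : ℂ) :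
    F z = 0 := by
  have h1 : Tendsto F (𝓝[≠] z) (𝓝 (F z)) := (hF z).continuousAt.tendsto.mono_left nhdsWithin_le_nhds
  refine tendsto_nhds_unique h1 (tendsto_const_nhds.congr' ?_)
  filter_upwards [eventually_ne_zero_of_entire hP hc z] with z' hz'
  exact ((mul_eq_zero.1 (h z')).resolve_right hz').symm

/-- A quotient of entire functions that is locally analytic is entire. -/
theorem exists_entire_quotient {p P : ℂ → ℂ} (hP : Differentiable ℂ P) {c : ℂ} (hc : P c ≠ 0)
    (hloc : ∀ z₀, ∃ h : ℂ → ℂ, AnalyticAt ℂ h z₀ ∧ ∀ᶠ z in 𝓝 z₀, p z = P z * h z) :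
    ∃ A : ℂ → ℂ, Differentiable ℂ A ∧ ∀ z, p z = P z * A z := by
  choose h hh hph using hloc
  have huniq : ∀ z₀ (k : ℂ → ℂ), AnalyticAt ℂ k z₀ → (∀ᶠ z in 𝓝 z₀, p z = P z * k z) →
      h z₀ z₀ = k z₀ := by
    intro z₀ k hk hpk
    have h1 : Tendsto (h z₀) (𝓝[≠] z₀) (𝓝 (h z₀ z₀)) :=
      (hh z₀).continuousAt.tendsto.mono_left nhdsWithin_le_nhds
    have h2 : Tendsto k (𝓝[≠] z₀) (𝓝 (k z₀)) := hk.continuousAt.tendsto.mono_left nhdsWithin_le_nhds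
    refine tendsto_nhds_unique h1 (h2.congr' ?_)
    filter_upwards [eventually_ne_zero_of_entire hP hc z₀,
      nhdsWithin_le_nhds hpk, nhdsWithin_le_nhds (hph z₀)] with z h3 h4 h5
    exact mul_left_cancel₀ h3 (h4.symm.trans h5)
  refine ⟨fun z => h z z, fun z₀ => ?_, fun z => (hph z).self_of_nhds⟩
  have : (fun z => h z z) =ᶠ[𝓝 z₀] h z₀ := by
    filter_upwards [(hh z₀).eventually_analyticAt, (hph z₀).eventually_nhds] with z h1 h2
    exact huniq z (h z₀) h1 h2
  exact ((hh z₀).differentiableAt).congr_of_eventuallyEq this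

/-- An entire function with at most one zero, which is simple, is the product of an affine function
and of an exponential. -/
theorem exists_linear_mul_exp {A : ℂ → ℂ} (hA : Differentiable ℂ A) (hA0 : A 0 = 1)
    (huniq : ∀ z₀ z₁, A z₀ = 0 → A z₁ = 0 → z₀ = z₁) (hsimple : ∀ z, A z = 0 → deriv A z ≠ 0) :
    ∃ (a : ℂ) (g : ℂ → ℂ), Differentiable ℂ g ∧ ∀ z, A z = (1 + a * z) * Complex.exp (g z) := by
  by_cases hz : ∃ z₀, A z₀ = 0
  · obtain ⟨z₀, hz₀⟩ := hz
    have hne : z₀ ≠ 0 := by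
      rintro rfl
      exact one_ne_zero (hA0.symm.trans hz₀)
    have hD : Differentiable ℂ (dslope A z₀) := by
      rw [← differentiableOn_univ]
      exact (Complex.differentiableOn_dslope univ_mem).2 hA.differentiableOn
    have hAD : ∀ z, A z = (z - z₀) * dslope A z₀ z := by
      intro z
      have := sub_smul_dslope A z₀ z
      rw [hz₀, sub_zero] at this
      rw [← this, smul_eq_mul]
    -- The factor `-z₀` normalizes the linear term: `z - z₀ = -z₀ * (1 - z / z₀)`.
    have hD0 : ∀ z, -z₀ * dslope A z₀ z ≠ 0 := by
      intro z
      refine mul_ne_zero (neg_ne_zero.2 hne) fun h => ?_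
      have h1 : A z = 0 := by rw [hAD, h, mul_zero]
      obtain rfl := huniq z z₀ h1 hz₀
      rw [dslope_same] at h
      exact hsimple z h1 h
    obtain ⟨g, hg, hgD⟩ := exists_entire_log (hD.const_mul (-z₀)) hD0
    refine ⟨-z₀⁻¹, g, hg, fun z => ?_⟩
    rw [← hgD, hAD]
    field_simp
    ring
  · obtain ⟨g, hg, hgA⟩ := exists_entire_log hA fun z h => hz ⟨z, h⟩
    exact ⟨0, g, hg, fun z => by rw [hgA]; ring⟩

section Factor

variable {α : Type*} [MeasurableSpace α] {μ : Measure α} {R Rs : ℝ} {X Y Xs Ys : α → ℝ}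
  {f : α → ℂ} {fs : α → ℝ}

/-- If two Laplace transforms `L`, `Ls` on circles have the same dependence structure, then the
quotient of their first marginals is the product of an affine function and of an exponential. -/
theorem exists_marginal_factor (h : CircleChart μ R X Y) (hs : CircleChart μ Rs Xs Ys)
    (hf : Integrable f μ) (hf1 : ∫ a, f a ∂μ = 1) (hfs : Integrable fs μ)
    (hfs0 : ∀ᵐ a ∂μ, 0 ≤ fs a) (hfs1 : ∫ a, fs a ∂μ = 1)
    (hG : ∀ z w, lap μ X Y f z w * lap μ Xs Ys (fun a => (fs a : ℂ)) z 0
        * lap μ Xs Ys (fun a => (fs a : ℂ)) 0 w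
      = lap μ Xs Ys (fun a => (fs a : ℂ)) z w * lap μ X Y f z 0 * lap μ X Y f 0 w) :
    ∃ a c : ℂ, (∀ z, lap μ X Y f z 0 = lap μ Xs Ys (fun a => (fs a : ℂ)) z 0
        * ((1 + a * z) * Complex.exp (c * z))) ∧
      ∀ z w, lap μ X Y f z w * lap μ Xs Ys (fun a => (fs a : ℂ)) 0 w
        = lap μ Xs Ys (fun a => (fs a : ℂ)) z w * ((1 + a * z) * Complex.exp (c * z))
          * lap μ X Y f 0 w := by
  have hfsc : Integrable (fun a => (fs a : ℂ)) μ := hfs.ofReal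
  set L := lap μ X Y f with hL
  set Ls := lap μ Xs Ys (fun a => (fs a : ℂ)) with hLs
  have L00 : L 0 0 = 1 := by rw [hL, lap_zero_zero, hf1]
  have Ls00 : Ls 0 0 = 1 := by rw [hLs, lap_zero_zero, integral_complex_ofReal, hfs1]; simp
  have dl : ∀ w, Differentiable ℂ fun z => L z w :=
    differentiable_lap_left h.meas₁ h.meas₂ h.abs_le₁ h.abs_le₂ hf
  have dr : ∀ z, Differentiable ℂ fun w => L z w :=
    differentiable_lap_right h.meas₁ h.meas₂ h.abs_le₁ h.abs_le₂ hf
  have dls : ∀ w, Differentiable ℂ fun z => Ls z w :=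
    differentiable_lap_left hs.meas₁ hs.meas₂ hs.abs_le₁ hs.abs_le₂ hfsc
  have drs : ∀ z, Differentiable ℂ fun w => Ls z w :=
    differentiable_lap_right hs.meas₁ hs.meas₂ hs.abs_le₁ hs.abs_le₂ hfsc
  -- The quotient of marginals is analytic even at zeros of the denominator: at a suitable fixed
  -- `w₀` the dependence identity expresses it with the denominator `Ls z w₀ * L 0 w₀`. Such a `w₀`
  -- exists because `Ls` vanishes on no line.
  have hloc : ∀ z₀, ∃ k : ℂ → ℂ, AnalyticAt ℂ k z₀ ∧ ∀ᶠ z in 𝓝 z₀, L z 0 = Ls z 0 * k z := by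
    intro z₀
    obtain ⟨w₀, hw₀⟩ : ∃ w, Ls z₀ w * L 0 w ≠ 0 := by
      by_contra hcon
      push Not at hcon
      obtain ⟨w, hw⟩ := hs.exists_lap_ne_zero hfs hfs0 (by rw [hfs1]; exact one_ne_zero) z₀
      exact hw (eq_zero_of_mul_eq_zero_of_entire (drs z₀) (dr 0) (c := 0)
        (by rw [L00]; exact one_ne_zero) hcon w)
    refine ⟨fun z => L z w₀ * Ls 0 w₀ / (Ls z w₀ * L 0 w₀), ?_, ?_⟩
    · exact (((dl w₀).analyticAt z₀).mul analyticAt_const).div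
        (((dls w₀).analyticAt z₀).mul analyticAt_const) hw₀
    · have hcont : ContinuousAt (fun z => Ls z w₀ * L 0 w₀) z₀ :=
        ((dls w₀ z₀).mul_const _).continuousAt
      filter_upwards [hcont.eventually_ne hw₀] with z hz
      rw [← mul_div_assoc, eq_div_iff hz]
      linear_combination -(hG z w₀)
  obtain ⟨A, hA, hpA⟩ := exists_entire_quotient (dls 0) (c := 0) (by rw [Ls00]; exact one_ne_zero) hloc
  have hA0 : A 0 = 1 := by have := hpA 0; rw [L00, Ls00, one_mul] at this; exact this.symm
  have hLA : ∀ z w, L z w * Ls 0 w = Ls z w * A z * L 0 w := by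
    intro z w
    have := eq_zero_of_mul_eq_zero_of_entire (F := fun z => L z w * Ls 0 w - Ls z w * A z * L 0 w)
      (((dl w).mul_const _).sub (((dls w).mul hA).mul_const _)) (dls 0) (c := 0)
      (by rw [Ls00]; exact one_ne_zero) (fun z => by
        have e := hG z w
        rw [hpA z] at e
        linear_combination e) z
    exact sub_eq_zero.1 this
  -- A zero of `A` forces `L` to vanish on a whole complex line, and a double zero forces its normal
  -- derivative to vanish there too. Hence `A` has at most one zero, and it is simple.
  have hline : ∀ z, A z = 0 → ∀ w, L z w = 0 := fun z hz =>
    eq_zero_of_mul_eq_zero_of_entire (dr z) (drs 0) (c := 0) (by rw [Ls00]; exact one_ne_zero)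
      fun w => by rw [hLA, hz]; ring
  have hf1' : ∫ a, f a ∂μ ≠ 0 := by rw [hf1]; exact one_ne_zero
  obtain ⟨a, g, hg, hAg⟩ := exists_linear_mul_exp hA hA0
    (fun z₀ z₁ h0 h1 => h.line_unique hf hf1' (hline z₀ h0) (hline z₁ h1)) fun z hz hz' => by
      have hXf := integrable_ofReal_mul h.meas₁ h.abs_le₁ hf
      refine h.line_simple hf hf1' (hline z hz) (eq_zero_of_mul_eq_zero_of_entire
        (differentiable_lap_right h.meas₁ h.meas₂ h.abs_le₁ h.abs_le₂ hXf z) (drs 0) (c := 0)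
        (by rw [Ls00]; exact one_ne_zero) fun w => ?_)
      have d1 := (hasDerivAt_lap_left h.meas₁ h.meas₂ h.abs_le₁ h.abs_le₂ hf z w).mul_const (Ls 0 w)
      have d2 := (((dls w z).hasDerivAt).mul (hA z).hasDerivAt).mul_const (L 0 w)
      have e : (fun z => lap μ X Y f z w * Ls 0 w) = fun z => Ls z w * A z * L 0 w :=
        funext fun z => hLA z w
      rw [e] at d1
      have := d1.unique d2
      simp only [hz, hz', mul_zero, add_zero, zero_mul] at this
      exact this
  -- A common exponential type for both marginals. The sum of the two `L¹` norms serves as `C`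
  -- because `x ≤ exp x`.
  have hbound : ∃ C K : ℝ, 0 ≤ C ∧ 0 ≤ K ∧ (∀ z, ‖L z 0‖ ≤ Real.exp (C + K * ‖z‖)) ∧
      ∀ z, ‖Ls z 0‖ ≤ Real.exp (C + K * ‖z‖) := by
    have gen : ∀ {S : ℝ} {U V : α → ℝ} {k : α → ℂ}, CircleChart μ S U V → Integrable k μ →
        (∫ a, ‖k a‖ ∂μ) ≤ (∫ a, ‖f a‖ ∂μ) + ∫ a, ‖(fs a : ℂ)‖ ∂μ → S ≤ R + Rs →
        ∀ z, ‖lap μ U V k z 0‖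
          ≤ Real.exp (((∫ a, ‖f a‖ ∂μ) + ∫ a, ‖(fs a : ℂ)‖ ∂μ) + (R + Rs) * ‖z‖) := by
      intro S U V k hS hk hle hSle z
      have h1 := norm_lap_le hS.abs_le₁ hS.abs_le₂ hk z 0
      rw [norm_zero, add_zero] at h1
      refine h1.trans ?_
      rw [Real.exp_add, mul_comm]
      refine mul_le_mul (hle.trans ?_) (Real.exp_le_exp.2
        (mul_le_mul_of_nonneg_right hSle (norm_nonneg _))) (Real.exp_pos _).le (Real.exp_pos _).le
      linarith [Real.add_one_le_exp ((∫ a, ‖f a‖ ∂μ) + ∫ a, ‖(fs a : ℂ)‖ ∂μ)]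
    have n1 : 0 ≤ ∫ a, ‖f a‖ ∂μ := integral_nonneg fun _ => norm_nonneg _
    have n2 : 0 ≤ ∫ a, ‖(fs a : ℂ)‖ ∂μ := integral_nonneg fun _ => norm_nonneg _
    exact ⟨_, _, add_nonneg n1 n2, (add_pos h.radius_pos hs.radius_pos).le,
      gen h hf (by linarith) (by linarith [hs.radius_pos]),
      gen hs hfsc (by linarith) (by linarith [h.radius_pos])⟩
  obtain ⟨C, K, hC, hK, b1, b2⟩ := hbound
  obtain ⟨c, hc⟩ := affine_of_exp_quotient (dl 0) (dls 0) hg (by rw [L00]; exact one_ne_zero)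
    (by rw [Ls00]; exact one_ne_zero) hC hK b1 b2 a fun z => by rw [hpA, hAg]
  have hg0 : Complex.exp (g 0) = 1 := by
    have := hAg 0
    rw [hA0, mul_zero, add_zero, one_mul] at this
    exact this.symm
  have hAc : ∀ z, A z = (1 + a * z) * Complex.exp (c * z) := fun z => by
    rw [hAg, hc, Complex.exp_add, hg0, one_mul]
  exact ⟨a, c, fun z => by rw [hpA, hAc], fun z w => by rw [hLA, hAc]⟩

end Factor

end CircleDeconv

end

/-! ### The Helmholtz operator and limits along rays -/

noncomputable section

namespace CircleDeconv

open Filter Topology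

theorem iteratedDeriv_two_eq {F F₁ : ℂ → ℂ} {F₂ z : ℂ} (h₁ : ∀ᶠ z' in 𝓝 z, HasDerivAt F (F₁ z') z')
    (h₂ : HasDerivAt F₁ F₂ z) : iteratedDeriv 2 F z = F₂ := by
  rw [iteratedDeriv_succ, iteratedDeriv_one]
  have : deriv F =ᶠ[𝓝 z] F₁ := h₁.mono fun z' h => h.deriv
  rw [this.deriv_eq, h₂.deriv]

theorem iteratedDeriv_two_sub_mul {F F₁ S S₁ A A₁ : ℂ → ℂ} {F₂ S₂ A₂ z b : ℂ}
    (hF₁ : ∀ z, HasDerivAt F (F₁ z) z) (hF₂ : HasDerivAt F₁ F₂ z)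
    (hS₁ : ∀ z, HasDerivAt S (S₁ z) z) (hS₂ : HasDerivAt S₁ S₂ z)
    (hA₁ : ∀ᶠ z' in 𝓝 z, HasDerivAt A (A₁ z') z') (hA₂ : HasDerivAt A₁ A₂ z) :
    iteratedDeriv 2 (fun z => F z - S z * A z * b) z
      = F₂ - (S₂ * A z + 2 * S₁ z * A₁ z + S z * A₂) * b := by
  refine iteratedDeriv_two_eq (F₁ := fun z => F₁ z - (S₁ z * A z + S z * A₁ z) * b) ?_ ?_
  · filter_upwards [hA₁] with z' hz'
    exact (hF₁ z').sub (((hS₁ z').mul hz').mul_const b)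
  · refine (hF₂.sub (((hS₂.mul hA₁.self_of_nhds).add ((hS₁ z).mul hA₂)).mul_const b)).congr_deriv ?_
    ring

section Helmholtz

variable {α : Type*} [MeasurableSpace α] {μ : Measure α} {R Rs : ℝ} {X Y Xs Ys : α → ℝ}
  {f fs : α → ℂ}

theorem CircleChart.hasDerivAt₁ (h : CircleChart μ R X Y) (hf : Integrable f μ) (z w : ℂ) :
    HasDerivAt (fun z => lap μ X Y f z w) (lap μ X Y (fun a => X a * f a) z w) z :=
  hasDerivAt_lap_left h.meas₁ h.meas₂ h.abs_le₁ h.abs_le₂ hf z w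

theorem CircleChart.hasDerivAt₂ (h : CircleChart μ R X Y) (hf : Integrable f μ) (z w : ℂ) :
    HasDerivAt (fun w => lap μ X Y f z w) (lap μ X Y (fun a => Y a * f a) z w) w :=
  hasDerivAt_lap_right h.meas₁ h.meas₂ h.abs_le₁ h.abs_le₂ hf z w

theorem CircleChart.integrable₁ (h : CircleChart μ R X Y) (hf : Integrable f μ) :
    Integrable (fun a => X a * f a) μ := integrable_ofReal_mul h.meas₁ h.abs_le₁ hf

theorem CircleChart.integrable₂ (h : CircleChart μ R X Y) (hf : Integrable f μ) :
    Integrable (fun a => Y a * f a) μ := integrable_ofReal_mul h.meas₂ h.abs_le₂ hf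

/-- The Helmholtz operator applied to the difference between a Laplace transform on the circle of
radius `R` and a perturbation `A(z) B(w)` of a Laplace transform on the circle of radius `Rs`. -/
theorem helmholtz_defect (h : CircleChart μ R X Y) (hs : CircleChart μ Rs Xs Ys)
    (hf : Integrable f μ) (hfs : Integrable fs μ) {A A₁ B B₁ : ℂ → ℂ} {A₂ B₂ z w : ℂ}
    (hA₁ : ∀ᶠ z' in 𝓝 z, HasDerivAt A (A₁ z') z') (hA₂ : HasDerivAt A₁ A₂ z)
    (hB₁ : ∀ᶠ w' in 𝓝 w, HasDerivAt B (B₁ w') w') (hB₂ : HasDerivAt B₁ B₂ w) :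
    iteratedDeriv 2 (fun z => lap μ X Y f z w - lap μ Xs Ys fs z w * A z * B w) z
      + iteratedDeriv 2 (fun w => lap μ X Y f z w - lap μ Xs Ys fs z w * A z * B w) w
      - (R : ℂ) ^ 2 * (lap μ X Y f z w - lap μ Xs Ys fs z w * A z * B w)
      = -(lap μ Xs Ys fs z w * (A₂ * B w + A z * B₂)
        + 2 * lap μ Xs Ys (fun a => Xs a * fs a) z w * A₁ z * B w
        + 2 * lap μ Xs Ys (fun a => Ys a * fs a) z w * A z * B₁ w
        - ((R : ℂ) ^ 2 - (Rs : ℂ) ^ 2) * lap μ Xs Ys fs z w * A z * B w) := by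
  have e1 := iteratedDeriv_two_sub_mul (b := B w) (fun z => h.hasDerivAt₁ hf z w)
    (h.hasDerivAt₁ (h.integrable₁ hf) z w) (fun z => hs.hasDerivAt₁ hfs z w)
    (hs.hasDerivAt₁ (hs.integrable₁ hfs) z w) hA₁ hA₂
  have e2 := iteratedDeriv_two_sub_mul (b := A z) (fun w => h.hasDerivAt₂ hf z w)
    (h.hasDerivAt₂ (h.integrable₂ hf) z w) (fun w => hs.hasDerivAt₂ hfs z w)
    (hs.hasDerivAt₂ (hs.integrable₂ hfs) z w) hB₁ hB₂
  -- The two Helmholtz equations cancel all second derivatives of the transforms and leave the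
  -- zero-order term with the difference of squared radii.
  have e3 := lap_helmholtz h.meas₁ h.meas₂ h.abs_le₁ h.abs_le₂ h.on_circle hf z w
  have e4 := lap_helmholtz hs.meas₁ hs.meas₂ hs.abs_le₁ hs.abs_le₂ hs.on_circle hfs z w
  have e : (fun w => lap μ X Y f z w - lap μ Xs Ys fs z w * A z * B w)
      = fun w => lap μ X Y f z w - lap μ Xs Ys fs z w * B w * A z := by
    ext w; ring
  rw [e, e1, e2]
  linear_combination e3 - A z * B w * e4

end Helmholtz

/-- The logarithmic derivative of an affine function along a ray. -/
theorem tendsto_mul_pole (a : ℂ) {x : ℝ} (hx : 0 < x) :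
    Tendsto (fun r : ℝ => (r : ℂ) * (a / (1 + a * ((r * x : ℝ) : ℂ)))) atTop
      (𝓝 (if a = 0 then 0 else 1 / (x : ℂ))) := by
  split_ifs with ha
  · simp [ha]
  have hinv : Tendsto (fun r : ℝ => ((r⁻¹ : ℝ) : ℂ)) atTop (𝓝 ((0 : ℝ) : ℂ)) :=
    (Complex.continuous_ofReal.tendsto 0).comp tendsto_inv_atTop_zero
  have hx' : (x : ℂ) ≠ 0 := by exact_mod_cast hx.ne'
  have h1 : Tendsto (fun r : ℝ => 1 / (a⁻¹ * ((r⁻¹ : ℝ) : ℂ) + x)) atTop (𝓝 (1 / (x : ℂ))) := by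
    have := ((hinv.const_mul a⁻¹).add_const (x : ℂ))
    rw [Complex.ofReal_zero, mul_zero, zero_add] at this
    exact tendsto_const_nhds.div this hx'
  refine h1.congr' ?_
  filter_upwards [eventually_gt_atTop 0] with r hr
  have hr' : (r : ℂ) ≠ 0 := by exact_mod_cast hr.ne'
  have e : a⁻¹ * ((r⁻¹ : ℝ) : ℂ) + x = (1 + a * ((r * x : ℝ) : ℂ)) / (a * r) := by
    push_cast; field_simp
  rw [e, one_div_div]
  ring

theorem tendsto_pole (a : ℂ) {x : ℝ} (hx : 0 < x) :
    Tendsto (fun r : ℝ => a / (1 + a * ((r * x : ℝ) : ℂ))) atTop (𝓝 0) := by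
  have hinv : Tendsto (fun r : ℝ => ((r⁻¹ : ℝ) : ℂ)) atTop (𝓝 ((0 : ℝ) : ℂ)) :=
    (Complex.continuous_ofReal.tendsto 0).comp tendsto_inv_atTop_zero
  have := hinv.mul (tendsto_mul_pole a hx)
  rw [Complex.ofReal_zero, zero_mul] at this
  refine this.congr' ?_
  filter_upwards [eventually_gt_atTop 0] with r hr
  have hr' : (r : ℂ) ≠ 0 := by exact_mod_cast hr.ne'
  push_cast; field_simp

theorem eventually_affine_ne_zero (a : ℂ) {x : ℝ} (hx : 0 < x) :
    ∀ᶠ r : ℝ in atTop, 1 + a * ((r * x : ℝ) : ℂ) ≠ 0 := by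
  by_cases ha : a = 0
  · simp [ha]
  have hx' : (x : ℂ) ≠ 0 := by exact_mod_cast hx.ne'
  filter_upwards [eventually_gt_atTop (-(1 / (a * x))).re] with r hr h0
  refine hr.ne' ?_
  have : (r : ℂ) = -(1 / (a * x)) := by
    push_cast at h0; field_simp; linear_combination h0
  rw [← this, Complex.ofReal_re]

/-- The part of the identification argument that takes place along rays. -/
theorem eq_zero_of_exp_solution {R ρ : ℝ} {m₁ m₂ : ℝ → ℝ → ℝ} {x : Fin 4 → ℝ × ℝ}
    (hm : DriftField R m₁ m₂ x) {a b c d : ℂ}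
    (h : ∀ s t : ℝ, 1 + a * (s : ℂ) ≠ 0 → 1 + b * (t : ℂ) ≠ 0 →
      (2 * c * (a / (1 + a * s)) + c ^ 2) + (2 * d * (b / (1 + b * t)) + d ^ 2)
        + 2 * m₁ s t * (a / (1 + a * s) + c) + 2 * m₂ s t * (b / (1 + b * t) + d) = ρ) :
    a = 0 ∧ b = 0 ∧ c = 0 ∧ d = 0 ∧ ρ = 0 := by
  have l1 : ∀ i, Tendsto (fun r => (m₁ (r * (x i).1) (r * (x i).2) : ℂ)) atTop (𝓝 ((x i).1 : ℂ)) :=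
    fun i => (Complex.continuous_ofReal.tendsto _).comp (hm.tendsto_ray₁ i)
  have l2 : ∀ i, Tendsto (fun r => (m₂ (r * (x i).1) (r * (x i).2) : ℂ)) atTop (𝓝 ((x i).2 : ℂ)) :=
    fun i => (Complex.continuous_ofReal.tendsto _).comp (hm.tendsto_ray₂ i)
  -- Leading order along a ray: the pole terms vanish and the drift becomes `x i`. The real and
  -- imaginary parts of the result are equations of lines through the points `x i`, which forces `c
  -- = d = 0`.
  have key : ∀ i, c ^ 2 + d ^ 2 + 2 * (x i).1 * c + 2 * (x i).2 * d = ρ := by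
    intro i
    have p1 := tendsto_pole a (hm.fst_pos i)
    have p2 := tendsto_pole b (hm.snd_pos i)
    have lim := ((((p1.const_mul (2 * c)).add_const (c ^ 2)).add
      ((p2.const_mul (2 * d)).add_const (d ^ 2))).add
      (((l1 i).const_mul 2).mul (p1.add_const c))).add
      (((l2 i).const_mul 2).mul (p2.add_const d))
    have hconst : Tendsto (fun _ : ℝ => (ρ : ℂ)) atTop (𝓝 (ρ : ℂ)) := tendsto_const_nhds
    have := tendsto_nhds_unique (lim.congr' (by
      filter_upwards [eventually_affine_ne_zero a (hm.fst_pos i),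
        eventually_affine_ne_zero b (hm.snd_pos i)] with r h1 h2
      exact h _ _ h1 h2)) hconst
    rw [← this]; ring
  have hre : ∀ i, (2 * c.re) * (x i).1 + (2 * d.re) * (x i).2 + ((c ^ 2 + d ^ 2).re - ρ) = 0 := by
    intro i
    have := congrArg Complex.re (key i)
    simp at this ⊢
    linarith
  have him : ∀ i, (2 * c.im) * (x i).1 + (2 * d.im) * (x i).2 + ((c ^ 2 + d ^ 2).im) = 0 := by
    intro i
    have := congrArg Complex.im (key i)
    simp at this ⊢
    linarith
  have n01 : x 0 ≠ x 1 := hm.inj.ne (by decide)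
  have n02 : x 0 ≠ x 2 := hm.inj.ne (by decide)
  have n12 : x 1 ≠ x 2 := hm.inj.ne (by decide)
  obtain ⟨r1, r2, _⟩ := eq_zero_of_three_points (hm.on_circle 0) (hm.on_circle 1) (hm.on_circle 2)
    n01 n02 n12 (hre 0) (hre 1) (hre 2)
  obtain ⟨i1, i2, _⟩ := eq_zero_of_three_points (hm.on_circle 0) (hm.on_circle 1) (hm.on_circle 2)
    n01 n02 n12 (him 0) (him 1) (him 2)
  have hc : c = 0 := Complex.ext (by simpa using r1) (by simpa using i1)
  have hd : d = 0 := Complex.ext (by simpa using r2) (by simpa using i2)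
  have hρ : ρ = 0 := by
    have := key 0
    rw [hc, hd] at this
    have h0 : (ρ : ℂ) = 0 := by rw [← this]; ring
    exact_mod_cast h0
  -- Next order, after multiplication by `r / 2`. Each nonzero coefficient among `a` and `b`
  -- contributes exactly `1` to the limit, which is zero.
  have lim := ((l1 0).mul (tendsto_mul_pole a (hm.fst_pos 0))).add
    ((l2 0).mul (tendsto_mul_pole b (hm.snd_pos 0)))
  have h0 := tendsto_nhds_unique (lim.congr' (by
      filter_upwards [eventually_affine_ne_zero a (hm.fst_pos 0),
        eventually_affine_ne_zero b (hm.snd_pos 0)] with r h1 h2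
      have := h _ _ h1 h2
      rw [hc, hd, hρ] at this
      change _ = (fun _ : ℝ => (0 : ℂ)) r
      simp only [Complex.ofReal_zero] at this
      linear_combination ((r : ℂ) / 2) * this)) tendsto_const_nhds
  have x1 : ((x 0).1 : ℂ) ≠ 0 := by exact_mod_cast (hm.fst_pos 0).ne'
  have x2 : ((x 0).2 : ℂ) ≠ 0 := by exact_mod_cast (hm.snd_pos 0).ne'
  have hab : a = 0 ∧ b = 0 := by
    by_cases ha : a = 0 <;> by_cases hb : b = 0
    · exact ⟨ha, hb⟩
    · simp [ha, hb, x2] at h0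
    · simp [ha, hb, x1] at h0
    · simp [ha, hb, x1, x2] at h0
  exact ⟨hab.1, hab.2, hc, hd, hρ⟩

end CircleDeconv

end

/-! ### Identification and its linearization -/

noncomputable section

namespace CircleDeconv

open Filter Topology

theorem eq_zero_of_imag {F : ℂ → ℂ} (hF : Differentiable ℂ F) {r : ℝ} (hr : 0 < r)
    (h : ∀ t ∈ Set.Icc (-r) r, F (Complex.I * t) = 0) (z : ℂ) : F z = 0 := by
  rcases (hF.analyticAt 0).eventually_eq_zero_or_eventually_ne_zero with h0 | h0
  · have := AnalyticOnNhd.eq_of_eventuallyEq (f := F) (g := fun _ => 0) (z₀ := 0)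
      (fun z _ => hF.analyticAt z) (fun z _ => analyticAt_const) h0
    exact congrFun this z
  · exfalso
    have hlim : Tendsto (fun t : ℝ => Complex.I * (t : ℂ)) (𝓝[>] 0) (𝓝[≠] 0) := by
      refine tendsto_nhdsWithin_iff.2 ⟨?_, ?_⟩
      · have : Continuous fun t : ℝ => Complex.I * (t : ℂ) := by fun_prop
        have h1 := this.tendsto 0
        simp only [Complex.ofReal_zero, mul_zero] at h1
        exact h1.mono_left nhdsWithin_le_nhds
      · filter_upwards [self_mem_nhdsWithin] with t ht
        have : (t : ℂ) ≠ 0 := by exact_mod_cast (ne_of_gt ht)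
        simpa using this
    have h1 := hlim.eventually h0
    have h2 : ∀ᶠ t : ℝ in 𝓝[>] 0, t ≤ r := nhdsWithin_le_nhds (ge_mem_nhds hr)
    obtain ⟨t, h3, h4, h5⟩ := (h1.and (h2.and self_mem_nhdsWithin)).exists
    exact h3 (h t ⟨by linarith [show (0 : ℝ) < t from h5], h4⟩)

theorem eq_zero_of_imag_square {F : ℂ → ℂ → ℂ} (h₁ : ∀ w, Differentiable ℂ fun z => F z w)
    (h₂ : ∀ z, Differentiable ℂ fun w => F z w) {r : ℝ} (hr : 0 < r)
    (h : ∀ s ∈ Set.Icc (-r) r, ∀ t ∈ Set.Icc (-r) r, F (Complex.I * s) (Complex.I * t) = 0)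
    (z w : ℂ) : F z w = 0 := by
  refine eq_zero_of_imag (h₁ w) hr (fun s hs => ?_) z
  exact eq_zero_of_imag (h₂ (Complex.I * s)) hr (fun t ht => h s hs t ht) w

section Star

variable {α : Type*} [MeasurableSpace α] {μ : Measure α} {R Rs : ℝ} {X Y Xs Ys : α → ℝ}
  {f : α → ℂ} {fs : α → ℝ} {m₁ m₂ : ℝ → ℝ → ℝ} {x : Fin 4 → ℝ × ℝ}

/-- A probability density on a circle, with the gradient `(m₁, m₂)` of the logarithm of its
Laplace transform, and four points `x i` of its support in the first quadrant. -/
structure DensityOnCircle (μ : Measure α) (Rs : ℝ) (Xs Ys fs : α → ℝ) (m₁ m₂ : ℝ → ℝ → ℝ)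
    (x : Fin 4 → ℝ × ℝ) : Prop where
  chart : CircleChart μ Rs Xs Ys
  integrable : Integrable fs μ
  nonneg : ∀ᵐ a ∂μ, 0 ≤ fs a
  integral_eq_one : ∫ a, fs a ∂μ = 1
  drift : DriftField Rs m₁ m₂ x
  ne_zero : ∀ s t : ℝ, lap μ Xs Ys (fun a => (fs a : ℂ)) s t ≠ 0
  deriv₁ : ∀ s t : ℝ, lap μ Xs Ys (fun a => Xs a * (fs a : ℂ)) s t
    = m₁ s t * lap μ Xs Ys (fun a => (fs a : ℂ)) s t
  deriv₂ : ∀ s t : ℝ, lap μ Xs Ys (fun a => Ys a * (fs a : ℂ)) s t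
    = m₂ s t * lap μ Xs Ys (fun a => (fs a : ℂ)) s t

theorem lap_ofReal_eq_tilt (hfs : AEMeasurable fs μ) (hfs0 : ∀ᵐ a ∂μ, 0 ≤ fs a) (φ : α → ℝ)
    (s t : ℝ) : lap μ Xs Ys (fun a => (φ a : ℂ) * (fs a : ℂ)) s t
      = (tilt (μ.withDensity fun a => ENNReal.ofReal (fs a)) Xs Ys φ s t : ℂ) := by
  rw [tilt, integral_withDensity_eq_integral_toReal_smul₀ hfs.ennreal_ofReal
    (Eventually.of_forall fun _ => ENNReal.ofReal_lt_top), lap, ← integral_complex_ofReal]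
  refine integral_congr_ae ?_
  filter_upwards [hfs0] with a ha
  rw [ENNReal.toReal_ofReal ha, smul_eq_mul]
  push_cast
  ring

theorem densityOnCircle_of_support (hs : CircleChart μ Rs Xs Ys) (hfs : Integrable fs μ)
    (hfs0 : ∀ᵐ a ∂μ, 0 ≤ fs a) (hfs1 : ∫ a, fs a ∂μ = 1) (hinj : Function.Injective x)
    (hx1 : ∀ i, 0 < (x i).1) (hx2 : ∀ i, 0 < (x i).2)
    (hxR : ∀ i, (x i).1 ^ 2 + (x i).2 ^ 2 = Rs ^ 2)
    (hsupp : ∀ i η, 0 < η → (μ.withDensity fun a => ENNReal.ofReal (fs a))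
      {a | |Xs a - (x i).1| < η ∧ |Ys a - (x i).2| < η} ≠ 0) :
    DensityOnCircle μ Rs Xs Ys fs
      (tiltMean (μ.withDensity fun a => ENNReal.ofReal (fs a)) Xs Ys Xs)
      (tiltMean (μ.withDensity fun a => ENNReal.ofReal (fs a)) Xs Ys Ys) x := by
  set ν := μ.withDensity fun a => ENNReal.ofReal (fs a) with hν
  have : IsFiniteMeasure ν := isFiniteMeasure_withDensity_ofReal hfs.2
  have hν0 : ν ≠ 0 := by
    intro h0
    refine hsupp 0 1 one_pos ?_
    rw [h0]; rfl
  have hpos := tilt_one_pos hν0 hs.meas₁ hs.meas₂ hs.abs_le₁ hs.abs_le₂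
  have e : ∀ s t : ℝ, lap μ Xs Ys (fun a => (fs a : ℂ)) s t = (tilt ν Xs Ys (fun _ => 1) s t : ℂ) := by
    intro s t
    rw [← lap_ofReal_eq_tilt hfs.1.aemeasurable hfs0]
    simp
  refine ⟨hs, hfs, hfs0, hfs1, driftField_tiltMean hs.meas₁ hs.meas₂ hs.radius_pos hs.on_circle
    hinj hx1 hx2 hxR hsupp, fun s t => ?_, fun s t => ?_, fun s t => ?_⟩
  · rw [e]; exact_mod_cast (hpos s t).ne'
  · rw [e, lap_ofReal_eq_tilt hfs.1.aemeasurable hfs0, ← hν, tiltMean]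
    have : (tilt ν Xs Ys (fun _ => 1) s t : ℂ) ≠ 0 := by exact_mod_cast (hpos s t).ne'
    push_cast; field_simp
  · rw [e, lap_ofReal_eq_tilt hfs.1.aemeasurable hfs0, ← hν, tiltMean]
    have : (tilt ν Xs Ys (fun _ => 1) s t : ℂ) ≠ 0 := by exact_mod_cast (hpos s t).ne'
    push_cast; field_simp

theorem hasDerivAt_affine_mul_exp (a c z : ℂ) :
    HasDerivAt (fun z => (1 + a * z) * Complex.exp (c * z))
      ((a + c * (1 + a * z)) * Complex.exp (c * z)) z := by
  have h1 : HasDerivAt (fun z : ℂ => 1 + a * z) a z := by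
    simpa using ((hasDerivAt_id z).const_mul a).const_add 1
  have h2 : HasDerivAt (fun z : ℂ => c * z) c z := by simpa using (hasDerivAt_id z).const_mul c
  exact (h1.mul h2.cexp).congr_deriv (by ring)

theorem hasDerivAt_affine_mul_exp_deriv (a c z : ℂ) :
    HasDerivAt (fun z => (a + c * (1 + a * z)) * Complex.exp (c * z))
      ((2 * a * c + c ^ 2 * (1 + a * z)) * Complex.exp (c * z)) z := by
  have h1 : HasDerivAt (fun z : ℂ => a + c * (1 + a * z)) (c * a) z := by
    simpa using ((((hasDerivAt_id z).const_mul a).const_add 1).const_mul c).const_add a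
  have h2 : HasDerivAt (fun z : ℂ => c * z) c z := by simpa using (hasDerivAt_id z).const_mul c
  exact (h1.mul h2.cexp).congr_deriv (by ring)

/-- The dependence structure of the Laplace transform of a density on a circle determines the
radius and the marginals. -/
theorem DensityOnCircle.identification (hs : DensityOnCircle μ Rs Xs Ys fs m₁ m₂ x)
    (h : CircleChart μ R X Y) (hf : Integrable f μ) (hf1 : ∫ a, f a ∂μ = 1) {r : ℝ} (hr : 0 < r)
    (hG : ∀ s ∈ Set.Icc (-r) r, ∀ t ∈ Set.Icc (-r) r,
      lap μ X Y f (Complex.I * s) (Complex.I * t)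
        * lap μ Xs Ys (fun a => (fs a : ℂ)) (Complex.I * s) 0
        * lap μ Xs Ys (fun a => (fs a : ℂ)) 0 (Complex.I * t)
      = lap μ Xs Ys (fun a => (fs a : ℂ)) (Complex.I * s) (Complex.I * t)
        * lap μ X Y f (Complex.I * s) 0 * lap μ X Y f 0 (Complex.I * t)) :
    R = Rs ∧ (∀ z, lap μ X Y f z 0 = lap μ Xs Ys (fun a => (fs a : ℂ)) z 0) ∧
      ∀ w, lap μ X Y f 0 w = lap μ Xs Ys (fun a => (fs a : ℂ)) 0 w := by
  have hfsc : Integrable (fun a => (fs a : ℂ)) μ := hs.integrable.ofReal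
  have hc := hs.chart
  have dl : ∀ w, Differentiable ℂ fun z => lap μ X Y f z w := fun w z =>
    (h.hasDerivAt₁ hf z w).differentiableAt
  have dr : ∀ z, Differentiable ℂ fun w => lap μ X Y f z w := fun z w =>
    (h.hasDerivAt₂ hf z w).differentiableAt
  have dls : ∀ w, Differentiable ℂ fun z => lap μ Xs Ys (fun a => (fs a : ℂ)) z w := fun w z =>
    (hc.hasDerivAt₁ hfsc z w).differentiableAt
  have drs : ∀ z, Differentiable ℂ fun w => lap μ Xs Ys (fun a => (fs a : ℂ)) z w := fun z w =>
    (hc.hasDerivAt₂ hfsc z w).differentiableAt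
  have hG' : ∀ z w, lap μ X Y f z w * lap μ Xs Ys (fun a => (fs a : ℂ)) z 0
        * lap μ Xs Ys (fun a => (fs a : ℂ)) 0 w
      = lap μ Xs Ys (fun a => (fs a : ℂ)) z w * lap μ X Y f z 0 * lap μ X Y f 0 w := by
    intro z w
    refine sub_eq_zero.1 (eq_zero_of_imag_square
      (F := fun z w => lap μ X Y f z w * lap μ Xs Ys (fun a => (fs a : ℂ)) z 0
        * lap μ Xs Ys (fun a => (fs a : ℂ)) 0 w
      - lap μ Xs Ys (fun a => (fs a : ℂ)) z w * lap μ X Y f z 0 * lap μ X Y f 0 w)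
      (fun w => ?_) (fun z => ?_) hr (fun s hs t ht => sub_eq_zero.2 (hG s hs t ht)) z w)
    · exact (((dl w).mul (dls 0)).mul_const _).sub (((dls w).mul (dl 0)).mul_const _)
    · exact (((dr z).mul_const _).mul (drs 0)).sub (((drs z).mul_const _).mul (dr 0))
  obtain ⟨a, c, hA, hLA⟩ := exists_marginal_factor h hc hf hf1 hs.integrable hs.nonneg
    hs.integral_eq_one hG'
  obtain ⟨b, d, hB, _⟩ := exists_marginal_factor h.swap hc.swap hf hf1 hs.integrable hs.nonneg
    hs.integral_eq_one (fun w z => by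
      simp only [lap_swap (X := Y), lap_swap (X := Ys)]
      linear_combination hG' z w)
  simp only [lap_swap (X := Y), lap_swap (X := Ys)] at hB
  have L00 : lap μ Xs Ys (fun a => (fs a : ℂ)) 0 0 ≠ 0 := by
    rw [lap_zero_zero, integral_complex_ofReal, hs.integral_eq_one]; simp
  -- Inserting the second marginal in the factorization obtained from the first gives `L = Ls * A *
  -- B` on the whole space, once the marginal `Ls 0 w` is divided out.
  have hAB : ∀ z w, lap μ X Y f z w - lap μ Xs Ys (fun a => (fs a : ℂ)) z w
      * ((1 + a * z) * Complex.exp (c * z)) * ((1 + b * w) * Complex.exp (d * w)) = 0 := by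
    intro z w
    refine eq_zero_of_mul_eq_zero_of_entire (F := fun w => lap μ X Y f z w
      - lap μ Xs Ys (fun a => (fs a : ℂ)) z w * ((1 + a * z) * Complex.exp (c * z))
        * ((1 + b * w) * Complex.exp (d * w))) ?_ (drs 0) (c := 0) L00 (fun w => ?_) w
    · exact (dr z).sub (((drs z).mul_const _).mul fun w =>
        (hasDerivAt_affine_mul_exp b d w).differentiableAt)
    · have e1 := hLA z w
      rw [hB w] at e1
      linear_combination e1
  have key := eq_zero_of_exp_solution (ρ := R ^ 2 - Rs ^ 2) hs.drift (a := a) (b := b) (c := c)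
    (d := d) fun s t h1 h2 => by
      -- The defect is identically zero, so the bracket produced by the Helmholtz operator vanishes.
      -- At real arguments it may be divided by `Ls`, whose logarithmic gradient is the drift.
      have e := helmholtz_defect h hc hf hfsc (z := s) (w := t)
        (Eventually.of_forall (hasDerivAt_affine_mul_exp a c)) (hasDerivAt_affine_mul_exp_deriv a c s)
        (Eventually.of_forall (hasDerivAt_affine_mul_exp b d)) (hasDerivAt_affine_mul_exp_deriv b d t)
      rw [funext fun z => hAB z t, funext fun w => hAB s w, hAB, hs.deriv₁, hs.deriv₂] at e
      have z0 : ∀ z, iteratedDeriv 2 (fun _ : ℂ => (0 : ℂ)) z = 0 := fun z =>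
        iteratedDeriv_two_eq (F₁ := fun _ => 0) (Eventually.of_forall fun z => hasDerivAt_const z 0)
          (hasDerivAt_const z 0)
      rw [z0, z0] at e
      have n1 := hs.ne_zero s t
      have n2 := Complex.exp_ne_zero (c * s)
      have n3 := Complex.exp_ne_zero (d * t)
      have e2 : lap μ Xs Ys (fun a => (fs a : ℂ)) s t * (Complex.exp (c * s) * Complex.exp (d * t)) *
          (((2 * a * c + c ^ 2 * (1 + a * s)) * (1 + b * t) + (1 + a * s) *
            (2 * b * d + d ^ 2 * (1 + b * t))) + 2 * m₁ s t * (a + c * (1 + a * s)) * (1 + b * t)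
            + 2 * m₂ s t * (1 + a * s) * (b + d * (1 + b * t))
            - ((R : ℂ) ^ 2 - (Rs : ℂ) ^ 2) * (1 + a * s) * (1 + b * t)) = 0 := by
        linear_combination e
      have e3 := (mul_eq_zero.1 e2).resolve_left (mul_ne_zero n1 (mul_ne_zero n2 n3))
      push_cast
      field_simp
      linear_combination e3
  obtain ⟨rfl, rfl, rfl, rfl, hρ⟩ := key
  refine ⟨?_, fun z => by simpa using hA z, fun w => by simpa using hB w⟩
  exact (sq_eq_sq₀ h.radius_pos.le hc.radius_pos.le).1 (by linarith)

/-- The linearization of the identification problem has only the trivial solution. -/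
theorem DensityOnCircle.linearized_identification (hs : DensityOnCircle μ Rs Xs Ys fs m₁ m₂ x)
    {ρ r : ℝ} {α₂ β₂ : ℂ} {W W' V V' : ℂ → ℂ} (hr : 0 < r)
    (hW : ∀ z, HasDerivAt W (W' z) z) (hV : ∀ w, HasDerivAt V (V' w) w)
    (hW' : ∀ z, W' z = -lap μ Xs Ys (fun a => (fs a : ℂ)) z 0
      * (lap μ Xs Ys (fun a => (fs a : ℂ)) z 0 * β₂
        + 2 * lap μ Xs Ys (fun a => Ys a * (fs a : ℂ)) z 0 * V 0
        - ρ * lap μ Xs Ys (fun a => (fs a : ℂ)) z 0))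
    (hV' : ∀ w, V' w = -lap μ Xs Ys (fun a => (fs a : ℂ)) 0 w
      * (lap μ Xs Ys (fun a => (fs a : ℂ)) 0 w * α₂
        + 2 * lap μ Xs Ys (fun a => Xs a * (fs a : ℂ)) 0 w * W 0
        - ρ * lap μ Xs Ys (fun a => (fs a : ℂ)) 0 w))
    (heq : ∀ s ∈ Set.Icc (-r) r, ∀ t ∈ Set.Icc (-r) r, ∀ z w, z = Complex.I * s →
      w = Complex.I * t →
      lap μ Xs Ys (fun a => (fs a : ℂ)) z w
        * ((W' z * lap μ Xs Ys (fun a => (fs a : ℂ)) z 0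
              - 2 * W z * lap μ Xs Ys (fun a => Xs a * (fs a : ℂ)) z 0)
            * lap μ Xs Ys (fun a => (fs a : ℂ)) 0 w ^ 3
          + (V' w * lap μ Xs Ys (fun a => (fs a : ℂ)) 0 w
              - 2 * V w * lap μ Xs Ys (fun a => Ys a * (fs a : ℂ)) 0 w)
            * lap μ Xs Ys (fun a => (fs a : ℂ)) z 0 ^ 3)
        + 2 * lap μ Xs Ys (fun a => Xs a * (fs a : ℂ)) z w * W z
          * lap μ Xs Ys (fun a => (fs a : ℂ)) z 0 * lap μ Xs Ys (fun a => (fs a : ℂ)) 0 w ^ 3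
        + 2 * lap μ Xs Ys (fun a => Ys a * (fs a : ℂ)) z w * V w
          * lap μ Xs Ys (fun a => (fs a : ℂ)) 0 w * lap μ Xs Ys (fun a => (fs a : ℂ)) z 0 ^ 3
        - ρ * lap μ Xs Ys (fun a => (fs a : ℂ)) z w
          * lap μ Xs Ys (fun a => (fs a : ℂ)) z 0 ^ 3 * lap μ Xs Ys (fun a => (fs a : ℂ)) 0 w ^ 3
        = 0) :
    W 0 = 0 ∧ V 0 = 0 ∧ α₂ = 0 ∧ β₂ = 0 ∧ ρ = 0 := by
  have hfsc : Integrable (fun a => (fs a : ℂ)) μ := hs.integrable.ofReal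
  have hc := hs.chart
  set L := lap μ Xs Ys (fun a => (fs a : ℂ)) with hL
  set L₁ := lap μ Xs Ys (fun a => Xs a * (fs a : ℂ)) with hL₁
  set L₂ := lap μ Xs Ys (fun a => Ys a * (fs a : ℂ)) with hL₂
  have dl : ∀ w, Differentiable ℂ fun z => L z w := fun w z =>
    (hc.hasDerivAt₁ hfsc z w).differentiableAt
  have dr : ∀ z, Differentiable ℂ fun w => L z w := fun z w =>
    (hc.hasDerivAt₂ hfsc z w).differentiableAt
  have dl₁ : ∀ w, Differentiable ℂ fun z => L₁ z w := fun w z =>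
    (hc.hasDerivAt₁ (hc.integrable₁ hfsc) z w).differentiableAt
  have dr₁ : ∀ z, Differentiable ℂ fun w => L₁ z w := fun z w =>
    (hc.hasDerivAt₂ (hc.integrable₁ hfsc) z w).differentiableAt
  have dl₂ : ∀ w, Differentiable ℂ fun z => L₂ z w := fun w z =>
    (hc.hasDerivAt₁ (hc.integrable₂ hfsc) z w).differentiableAt
  have dr₂ : ∀ z, Differentiable ℂ fun w => L₂ z w := fun z w =>
    (hc.hasDerivAt₂ (hc.integrable₂ hfsc) z w).differentiableAt
  have dW : Differentiable ℂ W := fun z => (hW z).differentiableAt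
  have dV : Differentiable ℂ V := fun z => (hV z).differentiableAt
  have dW' : Differentiable ℂ W' := by
    rw [funext hW']
    exact (dl 0).neg.mul ((((dl 0).mul_const _).add (((dl₂ 0).const_mul 2).mul_const _)).sub
      ((dl 0).const_mul _))
  have dV' : Differentiable ℂ V' := by
    rw [funext hV']
    exact (dr 0).neg.mul ((((dr 0).mul_const _).add (((dr₁ 0).const_mul 2).mul_const _)).sub
      ((dr 0).const_mul _))
  -- The relation is known on an imaginary square, where characteristic functions live, and is
  -- needed at real points, where tilts live; the identity theorem in each variable connects them.
  have hF : ∀ z w, L z w * ((W' z * L z 0 - 2 * W z * L₁ z 0) * L 0 w ^ 3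
      + (V' w * L 0 w - 2 * V w * L₂ 0 w) * L z 0 ^ 3)
      + 2 * L₁ z w * W z * L z 0 * L 0 w ^ 3 + 2 * L₂ z w * V w * L 0 w * L z 0 ^ 3
      - ρ * L z w * L z 0 ^ 3 * L 0 w ^ 3 = 0 := by
    have aux : ∀ (u u₁ u₂ p p₁ W W' : ℂ → ℂ) (q q₂ v v' : ℂ), Differentiable ℂ u →
        Differentiable ℂ u₁ → Differentiable ℂ u₂ → Differentiable ℂ p → Differentiable ℂ p₁ →
        Differentiable ℂ W → Differentiable ℂ W' →
        Differentiable ℂ fun z => u z * ((W' z * p z - 2 * W z * p₁ z) * q ^ 3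
          + (v' * q - 2 * v * q₂) * p z ^ 3)
          + 2 * u₁ z * W z * p z * q ^ 3 + 2 * u₂ z * v * q * p z ^ 3
          - ρ * u z * p z ^ 3 * q ^ 3 := by
      intros; fun_prop
    refine eq_zero_of_imag_square (fun w => ?_) (fun z => ?_) hr fun s hs t ht =>
      heq s hs t ht _ _ rfl rfl
    · exact aux _ _ _ _ _ _ _ _ (L₂ 0 w) (V w) (V' w) (dl w) (dl₁ w) (dl₂ w) (dl 0) (dl₁ 0) dW dW'
    · have := aux _ _ _ _ _ _ _ (L z 0) (L₁ z 0) (W z) (W' z) (dr z) (dr₂ z) (dr₁ z) (dr 0) (dr₂ 0)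
        dV dV'
      convert this using 2
      ring
  have L00 : L 0 0 = 1 := by
    rw [hL, lap_zero_zero, integral_complex_ofReal, hs.integral_eq_one]; simp
  have np : ∀ s : ℝ, L s 0 ≠ 0 := fun s => by simpa using hs.ne_zero s 0
  have nq : ∀ t : ℝ, L 0 t ≠ 0 := fun t => by simpa using hs.ne_zero 0 t
  -- `W / L(·, 0) ^ 2` is the linearized logarithmic derivative of the quotient of marginals. In
  -- these unknowns the relation becomes the separated transport equation.
  have hx : ∀ s : ℝ, HasDerivAt (fun z => W z / L z 0 ^ 2)
      ((W' s * L s 0 - 2 * W s * L₁ s 0) / L s 0 ^ 3) (s : ℂ) := by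
    intro s
    have hp : HasDerivAt (fun z => L z 0) (L₁ s 0) (s : ℂ) := hc.hasDerivAt₁ hfsc s 0
    refine ((hW s).div (hp.fun_pow 2) (pow_ne_zero 2 (np s))).congr_deriv ?_
    have := np s
    field_simp
    ring
  have hy : ∀ t : ℝ, HasDerivAt (fun w => V w / L 0 w ^ 2)
      ((V' t * L 0 t - 2 * V t * L₂ 0 t) / L 0 t ^ 3) (t : ℂ) := by
    intro t
    have hq : HasDerivAt (fun w => L 0 w) (L₂ 0 t) (t : ℂ) := hc.hasDerivAt₂ hfsc 0 t
    refine ((hV t).div (hq.fun_pow 2) (pow_ne_zero 2 (nq t))).congr_deriv ?_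
    have := nq t
    field_simp
    ring
  have heqn : ∀ s t : ℝ, (W' s * L s 0 - 2 * W s * L₁ s 0) / L s 0 ^ 3
      + 2 * m₁ s t * (W s / L s 0 ^ 2) + (V' t * L 0 t - 2 * V t * L₂ 0 t) / L 0 t ^ 3
      + 2 * m₂ s t * (V t / L 0 t ^ 2) + -ρ = 0 := by
    intro s t
    have e := hF s t
    have e1 : L₁ s t = m₁ s t * L s t := hs.deriv₁ s t
    have e2 : L₂ s t = m₂ s t * L s t := hs.deriv₂ s t
    rw [e1, e2] at e
    have n := hs.ne_zero s t
    have n1 := np s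
    have n2 := nq t
    have e3 : L s t * ((W' s * L s 0 - 2 * W s * L₁ s 0) * L 0 t ^ 3
      + (V' t * L 0 t - 2 * V t * L₂ 0 t) * L s 0 ^ 3
      + 2 * m₁ s t * W s * L s 0 * L 0 t ^ 3 + 2 * m₂ s t * V t * L 0 t * L s 0 ^ 3
      - ρ * L s 0 ^ 3 * L 0 t ^ 3) = 0 := by linear_combination e
    have e4 := (mul_eq_zero.1 e3).resolve_left n
    field_simp
    linear_combination e4
  -- The drift is real, so the real part of any complex multiple of a solution is a real solution.
  -- The multiples `1` and `-Complex.I` recover both parts.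
  have hsol : ∀ κ : ℂ, (∀ s : ℝ, (κ * (W s / L s 0 ^ 2)).re = 0)
      ∧ (∀ t : ℝ, (κ * (V t / L 0 t ^ 2)).re = 0) ∧ (κ * (-ρ : ℂ)).re = 0
      ∧ (κ * ((W' (0 : ℝ) * L (0 : ℝ) 0 - 2 * W (0 : ℝ) * L₁ (0 : ℝ) 0) / L (0 : ℝ) 0 ^ 3)).re = 0
      ∧ (κ * ((V' (0 : ℝ) * L 0 (0 : ℝ) - 2 * V (0 : ℝ) * L₂ 0 (0 : ℝ)) / L 0 (0 : ℝ) ^ 3)).re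
        = 0 := by
    intro κ
    have d1 : ∀ s : ℝ, HasDerivAt (fun s : ℝ => (κ * (W s / L s 0 ^ 2)).re)
        (κ * ((W' s * L s 0 - 2 * W s * L₁ s 0) / L s 0 ^ 3)).re s := fun s =>
      ((hx s).const_mul κ).real_of_complex
    have d2 : ∀ t : ℝ, HasDerivAt (fun t : ℝ => (κ * (V t / L 0 t ^ 2)).re)
        (κ * ((V' t * L 0 t - 2 * V t * L₂ 0 t) / L 0 t ^ 3)).re t := fun t =>
      ((hy t).const_mul κ).real_of_complex
    have hS : SeparatedSolution m₁ m₂ _ _ _ _ (κ * (-ρ : ℂ)).re := ⟨d1, d2, fun s t => by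
      have e := congrArg Complex.re (congrArg (κ * ·) (heqn s t))
      rw [mul_zero, Complex.zero_re] at e
      rw [← e]
      have r1 : ∀ (m : ℝ) (u : ℂ), 2 * m * (κ * u).re = (κ * (2 * m * u)).re := fun m u => by
        rw [show κ * (2 * (m : ℂ) * u) = ((2 * m : ℝ) : ℂ) * (κ * u) by push_cast; ring,
          Complex.re_ofReal_mul]
      rw [r1, r1]
      simp only [← Complex.add_re]
      congr 1; ring⟩
    obtain ⟨z1, z2, z3⟩ := hS.eq_zero hs.drift
    refine ⟨z1, z2, z3, ?_, ?_⟩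
    · have := d1 0
      rw [funext z1] at this
      exact this.unique (hasDerivAt_const 0 0)
    · have := d2 0
      rw [funext z2] at this
      exact this.unique (hasDerivAt_const 0 0)
  have hre : ∀ u : ℂ, (1 * u).re = 0 → (-Complex.I * u).re = 0 → u = 0 := by
    intro u h1 h2
    refine Complex.ext (by simpa using h1) (by simpa using h2)
  obtain ⟨a1, a2, a3, a4, a5⟩ := hsol 1
  obtain ⟨b1, b2, b3, b4, b5⟩ := hsol (-Complex.I)
  have hW0 := hre _ (a1 0) (b1 0)
  have hV0 := hre _ (a2 0) (b2 0)
  have hW1 := hre _ a4 b4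
  have hV1 := hre _ a5 b5
  have hρ : ρ = 0 := by simpa using a3
  simp only [Complex.ofReal_zero, L00, one_pow, div_one, mul_one] at hW0 hV0 hW1 hV1
  rw [hW0, hW', L00, hV0, hρ] at hW1
  rw [hV0, hV', L00, hW0, hρ] at hV1
  simp at hW1 hV1
  exact ⟨hW0, hV0, hV1, hW1, hρ⟩

end Star

end CircleDeconv

end

/-! ### The trigonometric chart and reflections of the circle -/

noncomputable section

namespace CircleDeconv

open Filter Topology

section Reflect

variable {α : Type*} [MeasurableSpace α] {μ : Measure α} {R : ℝ} {X Y : α → ℝ}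

theorem CircleChart.neg₁ (h : CircleChart μ R X Y) : CircleChart μ R (fun a => -X a) Y where
  radius_pos := h.radius_pos
  meas₁ := h.meas₁.neg
  meas₂ := h.meas₂
  on_circle a := by rw [neg_sq, h.on_circle a]
  null₁ c := by simpa only [neg_eq_iff_eq_neg] using h.null₁ (-c)
  null₂ := h.null₂
  separating g hg h0 := h.separating g hg fun n m => by
    have h1 := h0 n m
    have e : ∀ a, ((-X a : ℝ) : ℂ) ^ n * (Y a : ℂ) ^ m * g a
        = (-1) ^ n * ((X a : ℂ) ^ n * (Y a : ℂ) ^ m * g a) := fun a => by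
      push_cast; rw [neg_pow]; ring
    simp only [e, integral_const_mul] at h1
    exact (mul_eq_zero.1 h1).resolve_left (pow_ne_zero _ (by norm_num))

theorem CircleChart.sign_mul (h : CircleChart μ R X Y) {σ τ : ℝ} (hσ : σ = 1 ∨ σ = -1)
    (hτ : τ = 1 ∨ τ = -1) : CircleChart μ R (fun a => σ * X a) (fun a => τ * Y a) := by
  rcases hσ with rfl | rfl <;> rcases hτ with rfl | rfl <;>
    simp only [one_mul, neg_mul]
  · exact h
  · exact h.swap.neg₁.swap
  · exact h.neg₁
  · exact h.neg₁.swap.neg₁.swap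

end Reflect

theorem volume_setOf_cos_eq (c : ℝ) : volume {u : ℝ | Real.cos (2 * Real.pi * u) = c} = 0 := by
  refine Set.Countable.measure_zero ?_ _
  by_cases hne : ∃ v, Real.cos (2 * Real.pi * v) = c
  · obtain ⟨v, rfl⟩ := hne
    have hc : (Set.range (fun k : ℤ => (k : ℝ) + v) ∪ Set.range fun k : ℤ => (k : ℝ) - v).Countable :=
      (Set.countable_range _).union (Set.countable_range _)
    refine hc.mono fun u hu => ?_
    have hu' : Real.cos (2 * Real.pi * u) = Real.cos (2 * Real.pi * v) := hu
    obtain ⟨k, hk⟩ := Real.cos_eq_cos_iff.1 hu'.symm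
    have hpi := Real.pi_ne_zero
    rcases hk with hk | hk
    · exact Or.inl ⟨k, by field_simp at hk; linarith⟩
    · exact Or.inr ⟨k, by field_simp at hk; linarith⟩
  · convert Set.countable_empty
    ext u
    exact ⟨fun hu => hne ⟨u, hu⟩, fun hu => hu.elim⟩

theorem volume_setOf_sin_eq (c : ℝ) : volume {u : ℝ | Real.sin (2 * Real.pi * u) = c} = 0 := by
  have e : {u : ℝ | Real.sin (2 * Real.pi * u) = c}
      = (fun u => u + (-(1 / 4))) ⁻¹' {u : ℝ | Real.cos (2 * Real.pi * u) = c} := by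
    ext u
    show _ = c ↔ Real.cos (2 * Real.pi * (u + (-(1 / 4)))) = c
    rw [show 2 * Real.pi * (u + (-(1 / 4))) = 2 * Real.pi * u - Real.pi / 2 by ring,
      Real.cos_sub_pi_div_two]
  rw [e, measure_preimage_add_right, volume_setOf_cos_eq]

/-- An integrable function on `(0, 1)` that is orthogonal to all trigonometric polynomials
vanishes. -/
theorem ae_eq_zero_of_fourier {g : ℝ → ℂ} (hg : IntegrableOn g (Set.Ioo 0 1))
    (h : ∀ k : ℤ, ∫ u in Set.Ioo (0 : ℝ) 1, fourier k (u : AddCircle (1 : ℝ)) * g u = 0) :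
    g =ᵐ[volume.restrict (Set.Ioo 0 1)] 0 := by
  have : Fact ((0 : ℝ) < 1) := ⟨one_pos⟩
  have hint : ∀ φ : C(AddCircle (1 : ℝ), ℂ),
      IntegrableOn (fun u : ℝ => φ (u : AddCircle (1 : ℝ)) * g u) (Set.Ioo 0 1) := fun φ =>
    Integrable.bdd_mul (c := ‖φ‖) hg
      (φ.continuous.comp (AddCircle.continuous_mk' 1)).aestronglyMeasurable
      (Eventually.of_forall fun u => φ.norm_coe_le_norm _)
  have hall : ∀ φ : C(AddCircle (1 : ℝ), ℂ),
      ∫ u in Set.Ioo (0 : ℝ) 1, φ (u : AddCircle (1 : ℝ)) * g u = 0 := by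
    intro φ
    have hφ : φ ∈ (Submodule.span ℂ (Set.range (@fourier 1))).topologicalClosure := by
      rw [span_fourier_closure_eq_top]; trivial
    have hcont : Continuous fun φ : C(AddCircle (1 : ℝ), ℂ) =>
        ∫ u in Set.Ioo (0 : ℝ) 1, φ (u : AddCircle (1 : ℝ)) * g u := by
      refine continuous_iff_continuousAt.2 fun φ₀ => ?_
      refine continuousAt_of_dominated (bound := fun u => (‖φ₀‖ + 1) * ‖g u‖)
        (Eventually.of_forall fun φ => (hint φ).aestronglyMeasurable) ?_ (hg.norm.const_mul _)
        (Eventually.of_forall fun u => by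
          have : Continuous fun φ : C(AddCircle (1 : ℝ), ℂ) => φ (u : AddCircle (1 : ℝ)) :=
            continuous_eval_const _
          exact (this.mul continuous_const).continuousAt)
      filter_upwards [Metric.ball_mem_nhds φ₀ one_pos] with φ hφ
      refine Eventually.of_forall fun u => ?_
      rw [norm_mul]
      refine mul_le_mul_of_nonneg_right ((φ.norm_coe_le_norm _).trans ?_) (norm_nonneg _)
      have h1 := norm_le_norm_add_norm_sub' φ φ₀
      have h2 : ‖φ - φ₀‖ < 1 := by simpa [dist_eq_norm] using hφ
      linarith
    have hcl : IsClosed {φ : C(AddCircle (1 : ℝ), ℂ) |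
        ∫ u in Set.Ioo (0 : ℝ) 1, φ (u : AddCircle (1 : ℝ)) * g u = 0} :=
      isClosed_eq hcont continuous_const
    refine closure_minimal (fun ψ hψ => ?_) hcl hφ
    refine Submodule.span_induction (p := fun ψ _ =>
      ∫ u in Set.Ioo (0 : ℝ) 1, ψ (u : AddCircle (1 : ℝ)) * g u = 0) ?_ ?_ ?_ ?_ hψ
    · rintro _ ⟨k, rfl⟩; exact h k
    · simp
    · intro a b _ _ ha hb
      simp only [ContinuousMap.add_apply, add_mul]
      rw [integral_add (hint a) (hint b), ha, hb, add_zero]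
    · intro c a _ ha
      simp only [ContinuousMap.smul_apply, smul_eq_mul, mul_assoc]
      rw [integral_const_mul, ha, mul_zero]
  have key := isOpen_Ioo.ae_eq_zero_of_integral_contDiff_smul_eq_zero (μ := volume) (f := g)
    (U := Set.Ioo (0 : ℝ) 1) hg.locallyIntegrableOn fun ψ hψ _ hsupp => by
      have h0 : ∀ u ∉ Set.Ioo (0 : ℝ) 1, ψ u = 0 := fun u hu => by
        by_contra hne
        exact hu (hsupp (subset_tsupport _ hne))
      -- A test function supported inside the open interval vanishes at both ends, so it descends to
      -- a continuous function on the circle.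
      let φ : C(AddCircle (1 : ℝ), ℂ) := ⟨AddCircle.liftIco 1 0 fun u => (ψ u : ℂ),
        AddCircle.liftIco_zero_continuous (by rw [h0 0 (by simp), h0 1 (by simp)])
          (Complex.continuous_ofReal.comp hψ.continuous).continuousOn⟩
      rw [← hall φ, ← integral_indicator measurableSet_Ioo]
      congr 1; ext u
      by_cases hu : u ∈ Set.Ioo (0 : ℝ) 1
      · rw [Set.indicator_of_mem hu, Complex.real_smul]
        congr 1
        exact (AddCircle.liftIco_zero_coe_apply (f := fun u => (ψ u : ℂ))
          (Set.Ioo_subset_Ico_self hu)).symm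
      · rw [Set.indicator_of_notMem hu, h0 u hu, zero_smul]
  rw [EventuallyEq, ae_restrict_iff' measurableSet_Ioo]
  exact key

/-- For separation, powers of `cos ± i sin` are the Fourier characters. By the binomial formula they
are combinations of the monomials, so a function orthogonal to all monomials has zero Fourier
coefficients. -/
theorem circleChart_cos_sin : CircleChart (volume.restrict (Set.Ioo (0 : ℝ) 1)) 1
    (fun u => Real.cos (2 * Real.pi * u)) (fun u => Real.sin (2 * Real.pi * u)) where
  radius_pos := one_pos
  meas₁ := by fun_prop
  meas₂ := by fun_prop
  on_circle u := by rw [Real.cos_sq_add_sin_sq, one_pow]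
  null₁ c := Measure.absolutelyContinuous_of_le Measure.restrict_le_self (volume_setOf_cos_eq c)
  null₂ c := Measure.absolutelyContinuous_of_le Measure.restrict_le_self (volume_setOf_sin_eq c)
  separating g hg h0 := by
    have hint : ∀ n m : ℕ, Integrable (fun u => (Real.cos (2 * Real.pi * u) : ℂ) ^ n *
        (Real.sin (2 * Real.pi * u) : ℂ) ^ m * g u) (volume.restrict (Set.Ioo (0 : ℝ) 1)) :=
      fun n m => hg.bdd_mul (c := 1) (by fun_prop) (Eventually.of_forall fun u => by
        rw [norm_mul, norm_pow, norm_pow, Complex.norm_real, Complex.norm_real]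
        exact mul_le_one₀ (pow_le_one₀ (norm_nonneg _) (Real.abs_cos_le_one _)) (by positivity)
          (pow_le_one₀ (norm_nonneg _) (Real.abs_sin_le_one _)))
    have hexp : ∀ (κ : ℂ) (n : ℕ), ∫ u in Set.Ioo (0 : ℝ) 1, ((Real.cos (2 * Real.pi * u) : ℂ)
        + κ * (Real.sin (2 * Real.pi * u) : ℂ)) ^ n * g u = 0 := by
      intro κ n
      have e : ∀ u : ℝ, ((Real.cos (2 * Real.pi * u) : ℂ)
          + κ * (Real.sin (2 * Real.pi * u) : ℂ)) ^ n * g u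
          = ∑ j ∈ Finset.range (n + 1), (κ ^ (n - j) * (n.choose j : ℂ)) *
            ((Real.cos (2 * Real.pi * u) : ℂ) ^ j * (Real.sin (2 * Real.pi * u) : ℂ) ^ (n - j)
              * g u) := by
        intro u
        rw [add_pow, Finset.sum_mul]
        exact Finset.sum_congr rfl fun j _ => by rw [mul_pow]; ring
      simp only [e]
      rw [integral_finsetSum _ fun j _ => (hint _ _).const_mul _]
      simp only [integral_const_mul, h0, mul_zero, Finset.sum_const_zero]
    refine ae_eq_zero_of_fourier hg fun k => ?_
    rcases Int.eq_nat_or_neg k with ⟨n, rfl | rfl⟩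
    · rw [← hexp Complex.I n]
      congr 1; ext u
      rw [fourier_coe_apply]
      congr 1
      have : Complex.exp (2 * Real.pi * Complex.I * ((n : ℤ) : ℂ) * u / (1 : ℝ))
          = Complex.exp (((2 * Real.pi * u : ℝ) : ℂ) * Complex.I) ^ n := by
        rw [← Complex.exp_nat_mul]; congr 1; push_cast; ring
      rw [this, Complex.exp_mul_I, Complex.ofReal_cos, Complex.ofReal_sin]
      ring
    · rw [← hexp (-Complex.I) n]
      congr 1; ext u
      rw [fourier_coe_apply]
      congr 1
      have : Complex.exp (2 * Real.pi * Complex.I * ((-(n : ℤ) : ℤ) : ℂ) * u / (1 : ℝ))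
          = Complex.exp ((-(2 * Real.pi * u : ℝ) : ℂ) * Complex.I) ^ n := by
        rw [← Complex.exp_nat_mul]; congr 1; push_cast; ring
      rw [this, Complex.exp_mul_I, Complex.cos_neg, Complex.sin_neg, Complex.ofReal_cos,
        Complex.ofReal_sin]
      ring

/-- After a reflection, every probability density on a circle has four points of its support in
the first quadrant. -/
theorem exists_densityOnCircle {fs : ℝ → ℝ} {Rs : ℝ} (hRs : 0 < Rs)
    (hfs : Integrable fs (volume.restrict (Set.Ioo (0 : ℝ) 1)))
    (hfs0 : ∀ᵐ u ∂(volume.restrict (Set.Ioo (0 : ℝ) 1)), 0 ≤ fs u)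
    (hfs1 : ∫ u in Set.Ioo (0 : ℝ) 1, fs u = 1) :
    ∃ σ τ : ℝ, (σ = 1 ∨ σ = -1) ∧ (τ = 1 ∨ τ = -1) ∧ ∃ m₁ m₂ x,
      DensityOnCircle (volume.restrict (Set.Ioo (0 : ℝ) 1)) Rs
        (fun u => Rs * (σ * Real.cos (2 * Real.pi * u)))
        (fun u => Rs * (τ * Real.sin (2 * Real.pi * u))) fs m₁ m₂ x := by
  set ν := (volume.restrict (Set.Ioo (0 : ℝ) 1)).withDensity fun u => ENNReal.ofReal (fs u) with hν
  have hac : ν ≪ volume := (withDensity_absolutelyContinuous _ _).trans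
    (Measure.absolutelyContinuous_of_le Measure.restrict_le_self)
  have hfin : IsFiniteMeasure ν := isFiniteMeasure_withDensity_ofReal hfs.2
  have hν1 : ν (Set.Ioo 0 1) ≠ 0 := by
    intro h0
    rw [hν, withDensity_apply _ measurableSet_Ioo, Measure.restrict_restrict measurableSet_Ioo,
      Set.inter_self, ← ofReal_integral_eq_lintegral_ofReal hfs hfs0, hfs1] at h0
    simp at h0
  let O : ℝ → ℝ → Set ℝ := fun σ τ => {u | u ∈ Set.Ioo (0 : ℝ) 1 ∧
    0 < σ * Real.cos (2 * Real.pi * u) ∧ 0 < τ * Real.sin (2 * Real.pi * u)}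
  -- The four open quadrants and two null sets cover the circle, so some quadrant is charged. The
  -- signs reflect it onto the first one.
  obtain ⟨σ, τ, hσ, hτ, hO⟩ : ∃ σ τ : ℝ, (σ = 1 ∨ σ = -1) ∧ (τ = 1 ∨ τ = -1) ∧ ν (O σ τ) ≠ 0 := by
    by_contra hcon
    push Not at hcon
    refine hν1 (measure_mono_null (t := ((O 1 1 ∪ O 1 (-1)) ∪ (O (-1) 1 ∪ O (-1) (-1))) ∪
      ({u | Real.cos (2 * Real.pi * u) = 0} ∪ {u | Real.sin (2 * Real.pi * u) = 0})) ?_ ?_)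
    · intro u hu
      rcases lt_trichotomy (Real.cos (2 * Real.pi * u)) 0 with h1 | h1 | h1
      · rcases lt_trichotomy (Real.sin (2 * Real.pi * u)) 0 with h2 | h2 | h2
        · exact Or.inl (Or.inr (Or.inr ⟨hu, by linarith, by linarith⟩))
        · exact Or.inr (Or.inr h2)
        · exact Or.inl (Or.inr (Or.inl ⟨hu, by linarith, by linarith⟩))
      · exact Or.inr (Or.inl h1)
      · rcases lt_trichotomy (Real.sin (2 * Real.pi * u)) 0 with h2 | h2 | h2
        · exact Or.inl (Or.inl (Or.inr ⟨hu, by linarith, by linarith⟩))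
        · exact Or.inr (Or.inr h2)
        · exact Or.inl (Or.inl (Or.inl ⟨hu, by linarith, by linarith⟩))
    · refine measure_union_null (measure_union_null (measure_union_null ?_ ?_)
        (measure_union_null ?_ ?_)) (measure_union_null (hac (volume_setOf_cos_eq 0))
        (hac (volume_setOf_sin_eq 0))) <;> apply hcon <;> simp
  -- The law is absolutely continuous, so finitely many points cannot carry the mass of the
  -- quadrant. Its support there is infinite, and four points can be picked.
  have hinf : (O σ τ ∩ ν.support).Infinite := by
    intro hf
    refine hO (measure_mono_null (t := (O σ τ ∩ ν.support) ∪ ν.supportᶜ) (fun u hu => ?_)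
      (measure_union_null (hac (hf.measure_zero _)) Measure.measure_compl_support))
    by_cases h : u ∈ ν.support
    · exact Or.inl ⟨hu, h⟩
    · exact Or.inr h
  let e := hinf.natEmbedding
  let v : Fin 4 → ℝ := fun i => e i
  have hv : ∀ i, v i ∈ O σ τ ∩ ν.support := fun i => (e i).2
  have hvinj : Function.Injective v := fun i j hij =>
    Fin.ext (e.injective (Subtype.ext hij))
  have hσ2 : σ ^ 2 = 1 := by rcases hσ with rfl | rfl <;> norm_num
  have hτ2 : τ ^ 2 = 1 := by rcases hτ with rfl | rfl <;> norm_num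
  refine ⟨σ, τ, hσ, hτ, _, _, fun i => (Rs * (σ * Real.cos (2 * Real.pi * v i)),
    Rs * (τ * Real.sin (2 * Real.pi * v i))), densityOnCircle_of_support ?_ hfs hfs0 hfs1 ?_ ?_ ?_ ?_ ?_⟩
  · have := (circleChart_cos_sin.sign_mul hσ hτ).scale hRs
    rwa [mul_one] at this
  · intro i j hij
    apply hvinj
    have h1 : Rs * (σ * Real.cos (2 * Real.pi * v i)) = Rs * (σ * Real.cos (2 * Real.pi * v j)) :=
      congrArg Prod.fst hij
    have h2 : Rs * (τ * Real.sin (2 * Real.pi * v i)) = Rs * (τ * Real.sin (2 * Real.pi * v j)) :=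
      congrArg Prod.snd hij
    have hσ0 : σ ≠ 0 := by rintro rfl; norm_num at hσ2
    have hτ0 : τ ≠ 0 := by rintro rfl; norm_num at hτ2
    have h3 := mul_left_cancel₀ hσ0 (mul_left_cancel₀ hRs.ne' h1)
    have h4 := mul_left_cancel₀ hτ0 (mul_left_cancel₀ hRs.ne' h2)
    -- Equality of sine and cosine gives `cos` of the difference equal to `1`; two angles from the
    -- open unit interval differ by less than a full turn.
    have h5 : Real.cos (2 * Real.pi * v i - 2 * Real.pi * v j) = 1 := by
      rw [Real.cos_sub, h3, h4, ← sq, ← sq, Real.cos_sq_add_sin_sq]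
    have hi := (hv i).1.1
    have hj := (hv j).1.1
    have hpi := Real.pi_pos
    have h6 := (Real.cos_eq_one_iff_of_lt_of_lt (by nlinarith [hi.1, hi.2, hj.1, hj.2])
      (by nlinarith [hi.1, hi.2, hj.1, hj.2])).1 h5
    have h7 : 2 * Real.pi * (v i - v j) = 0 := by linarith
    have h8 := (mul_eq_zero.1 h7).resolve_left (by positivity)
    linarith
  · exact fun i => mul_pos hRs (hv i).1.2.1
  · exact fun i => mul_pos hRs (hv i).1.2.2
  · intro i
    simp only [mul_pow, hσ2, hτ2, one_mul, ← mul_add, Real.cos_sq_add_sin_sq, mul_one]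
  · intro i η hη
    have hs := (Measure.mem_support_iff_forall _).1 (hv i).2
    refine (hs _ (IsOpen.mem_nhds ?_ ?_)).ne'
    · have c₁ : Continuous fun u => |Rs * (σ * Real.cos (2 * Real.pi * u))
          - Rs * (σ * Real.cos (2 * Real.pi * v i))| := by fun_prop
      have c₂ : Continuous fun u => |Rs * (τ * Real.sin (2 * Real.pi * u))
          - Rs * (τ * Real.sin (2 * Real.pi * v i))| := by fun_prop
      exact (isOpen_lt c₁ continuous_const).inter (isOpen_lt c₂ continuous_const)
    · show |_| < η ∧ |_| < η
      simp [hη]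

end CircleDeconv

end

/-! ### Dependence defect, marginal Wronskians and continuity in the parameters -/

noncomputable section

namespace CircleDeconv

open Filter Topology

section Defect

variable {α : Type*} [MeasurableSpace α]

/-- The difference between a Laplace transform `L` and the Laplace transform with the marginals of
`L` and the dependence structure of a reference Laplace transform. -/
def dependenceDefect (μ : Measure α) (X Y : α → ℝ) (f : α → ℂ) (Xs Ys : α → ℝ) (fs : α → ℂ)
    (z w : ℂ) : ℂ :=
  lap μ X Y f z w - lap μ Xs Ys fs z w * (lap μ X Y f z 0 / lap μ Xs Ys fs z 0)
    * (lap μ X Y f 0 w / lap μ Xs Ys fs 0 w)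

/-- The Helmholtz operator applied to `dependenceDefect`. -/
def helmholtzDefect (μ : Measure α) (R : ℝ) (X Y : α → ℝ) (f : α → ℂ) (Xs Ys : α → ℝ)
    (fs : α → ℂ) (z w : ℂ) : ℂ :=
  iteratedDeriv 2 (fun z => dependenceDefect μ X Y f Xs Ys fs z w) z
    + iteratedDeriv 2 (fun w => dependenceDefect μ X Y f Xs Ys fs z w) w
    - (R : ℂ) ^ 2 * dependenceDefect μ X Y f Xs Ys fs z w

/-- The Wronskian of the first marginals of two Laplace transforms. -/
def marginalWronskian (μ : Measure α) (X Y : α → ℝ) (f : α → ℂ) (Xs Ys : α → ℝ) (fs : α → ℂ)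
    (z : ℂ) : ℂ :=
  lap μ X Y (fun a => X a * f a) z 0 * lap μ Xs Ys fs z 0
    - lap μ X Y f z 0 * lap μ Xs Ys (fun a => Xs a * fs a) z 0

/-- The derivative of `marginalWronskian`. -/
def marginalWronskianDeriv (μ : Measure α) (X Y : α → ℝ) (f : α → ℂ) (Xs Ys : α → ℝ) (fs : α → ℂ)
    (z : ℂ) : ℂ :=
  lap μ X Y (fun a => X a * (X a * f a)) z 0 * lap μ Xs Ys fs z 0
    - lap μ X Y f z 0 * lap μ Xs Ys (fun a => Xs a * (Xs a * fs a)) z 0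

variable {μ : Measure α} {R Rs : ℝ} {X Y Xs Ys : α → ℝ} {f fs : α → ℂ}

theorem dependenceDefect_swap (z w : ℂ) :
    dependenceDefect μ Y X f Ys Xs fs z w = dependenceDefect μ X Y f Xs Ys fs w z := by
  simp only [dependenceDefect, lap_swap (X := Y), lap_swap (X := Ys)]
  ring

theorem helmholtzDefect_swap (z w : ℂ) :
    helmholtzDefect μ R Y X f Ys Xs fs z w = helmholtzDefect μ R X Y f Xs Ys fs w z := by
  simp only [helmholtzDefect, dependenceDefect_swap (X := X)]
  ring

theorem hasDerivAt_marginalWronskian (h : CircleChart μ R X Y) (hs : CircleChart μ Rs Xs Ys)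
    (hf : Integrable f μ) (hfs : Integrable fs μ) (z : ℂ) :
    HasDerivAt (marginalWronskian μ X Y f Xs Ys fs) (marginalWronskianDeriv μ X Y f Xs Ys fs z) z := by
  refine (((h.hasDerivAt₁ (h.integrable₁ hf) z 0).mul (hs.hasDerivAt₁ hfs z 0)).sub
    ((h.hasDerivAt₁ hf z 0).mul (hs.hasDerivAt₁ (hs.integrable₁ hfs) z 0))).congr_deriv ?_
  rw [marginalWronskianDeriv]
  ring

theorem differentiable_marginalWronskianDeriv (h : CircleChart μ R X Y)
    (hs : CircleChart μ Rs Xs Ys) (hf : Integrable f μ) (hfs : Integrable fs μ) :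
    Differentiable ℂ (marginalWronskianDeriv μ X Y f Xs Ys fs) := fun z =>
  ((((h.hasDerivAt₁ (h.integrable₁ (h.integrable₁ hf)) z 0).mul (hs.hasDerivAt₁ hfs z 0)).sub
    ((h.hasDerivAt₁ hf z 0).mul (hs.hasDerivAt₁ (hs.integrable₁ (hs.integrable₁ hfs)) z 0))).differentiableAt)

theorem hasDerivAt_marginal_quotient (h : CircleChart μ R X Y) (hs : CircleChart μ Rs Xs Ys)
    (hf : Integrable f μ) (hfs : Integrable fs μ) {z : ℂ} (hz : lap μ Xs Ys fs z 0 ≠ 0) :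
    (∀ᶠ z in 𝓝 z, HasDerivAt (fun z => lap μ X Y f z 0 / lap μ Xs Ys fs z 0)
      (marginalWronskian μ X Y f Xs Ys fs z / lap μ Xs Ys fs z 0 ^ 2) z) ∧
    HasDerivAt (fun z => marginalWronskian μ X Y f Xs Ys fs z / lap μ Xs Ys fs z 0 ^ 2)
      ((marginalWronskianDeriv μ X Y f Xs Ys fs z * lap μ Xs Ys fs z 0
        - 2 * marginalWronskian μ X Y f Xs Ys fs z * lap μ Xs Ys (fun a => Xs a * fs a) z 0)
        / lap μ Xs Ys fs z 0 ^ 3) z := by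
  constructor
  · filter_upwards [(hs.hasDerivAt₁ hfs z 0).continuousAt.eventually_ne hz] with z' hz'
    exact (h.hasDerivAt₁ hf z' 0).div (hs.hasDerivAt₁ hfs z' 0) hz'
  · refine ((hasDerivAt_marginalWronskian h hs hf hfs z).div
      ((hs.hasDerivAt₁ hfs z 0).fun_pow 2) (pow_ne_zero 2 hz)).congr_deriv ?_
    field_simp
    ring

/-- The quotients of marginals have derivatives with denominators the square and the cube of the
reference marginal. Clearing them yields a relation between Wronskians that is polynomial and linear
in `helmholtzDefect`. -/
theorem helmholtzDefect_mul (h : CircleChart μ R X Y) (hs : CircleChart μ Rs Xs Ys)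
    (hf : Integrable f μ) (hfs : Integrable fs μ) {z w : ℂ} (hz : lap μ Xs Ys fs z 0 ≠ 0)
    (hw : lap μ Xs Ys fs 0 w ≠ 0) :
    helmholtzDefect μ R X Y f Xs Ys fs z w * (lap μ Xs Ys fs z 0 ^ 3 * lap μ Xs Ys fs 0 w ^ 3)
      = -(lap μ Xs Ys fs z w
        * ((marginalWronskianDeriv μ X Y f Xs Ys fs z * lap μ Xs Ys fs z 0
            - 2 * marginalWronskian μ X Y f Xs Ys fs z * lap μ Xs Ys (fun a => Xs a * fs a) z 0)
            * (lap μ X Y f 0 w * lap μ Xs Ys fs 0 w ^ 2)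
          + (marginalWronskianDeriv μ Y X f Ys Xs fs w * lap μ Xs Ys fs 0 w
            - 2 * marginalWronskian μ Y X f Ys Xs fs w * lap μ Xs Ys (fun a => Ys a * fs a) 0 w)
            * (lap μ X Y f z 0 * lap μ Xs Ys fs z 0 ^ 2))
        + 2 * lap μ Xs Ys (fun a => Xs a * fs a) z w * marginalWronskian μ X Y f Xs Ys fs z
          * lap μ Xs Ys fs z 0 * (lap μ X Y f 0 w * lap μ Xs Ys fs 0 w ^ 2)
        + 2 * lap μ Xs Ys (fun a => Ys a * fs a) z w * marginalWronskian μ Y X f Ys Xs fs w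
          * lap μ Xs Ys fs 0 w * (lap μ X Y f z 0 * lap μ Xs Ys fs z 0 ^ 2)
        - ((R : ℂ) ^ 2 - (Rs : ℂ) ^ 2) * lap μ Xs Ys fs z w
          * (lap μ X Y f z 0 * lap μ Xs Ys fs z 0 ^ 2)
          * (lap μ X Y f 0 w * lap μ Xs Ys fs 0 w ^ 2)) := by
  obtain ⟨a1, a2⟩ := hasDerivAt_marginal_quotient h hs hf hfs hz
  obtain ⟨b1, b2⟩ := hasDerivAt_marginal_quotient h.swap hs.swap hf hfs (z := w)
    (by rwa [lap_swap])
  simp only [lap_swap (X := Y), lap_swap (X := Ys)] at b1 b2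
  have e := helmholtz_defect h hs hf hfs a1 a2 b1 b2
  have e' : helmholtzDefect μ R X Y f Xs Ys fs z w = _ := e
  rw [e']
  field_simp

/-- On the axis `w = 0` the relation gives the derivative of the Wronskian from the marginals and
from finitely many numbers: the values at `0` of the other Wronskian and its derivative, and the
difference of squared radii. This reduces compactness of the Wronskians to that of numbers. -/
theorem helmholtzDefect_zero_right (h : CircleChart μ R X Y) (hs : CircleChart μ Rs Xs Ys)
    (hf : Integrable f μ) (hfs : Integrable fs μ) (hf1 : ∫ a, f a ∂μ = 1) (hfs1 : ∫ a, fs a ∂μ = 1)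
    {z : ℂ} (hz : lap μ Xs Ys fs z 0 ≠ 0) :
    marginalWronskianDeriv μ X Y f Xs Ys fs z
      = -(lap μ Xs Ys fs z 0 * helmholtzDefect μ R X Y f Xs Ys fs z 0)
        - lap μ X Y f z 0 * (lap μ Xs Ys fs z 0
          * (marginalWronskianDeriv μ Y X f Ys Xs fs 0 - 2 * marginalWronskian μ Y X f Ys Xs fs 0
            * lap μ Xs Ys (fun a => Ys a * fs a) 0 0)
          + 2 * lap μ Xs Ys (fun a => Ys a * fs a) z 0 * marginalWronskian μ Y X f Ys Xs fs 0
          - ((R : ℂ) ^ 2 - (Rs : ℂ) ^ 2) * lap μ Xs Ys fs z 0) := by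
  have L0 : lap μ X Y f 0 0 = 1 := by rw [lap_zero_zero, hf1]
  have Ls0 : lap μ Xs Ys fs 0 0 = 1 := by rw [lap_zero_zero, hfs1]
  have e := helmholtzDefect_mul h hs hf hfs hz (w := 0) (by rw [Ls0]; exact one_ne_zero)
  rw [L0, Ls0] at e
  have hz2 : lap μ Xs Ys fs z 0 ^ 2 ≠ 0 := pow_ne_zero 2 hz
  apply mul_left_cancel₀ hz2
  linear_combination e

end Defect

/-! ### Limits of primitives and joint continuity in density and radius -/

section Limits

theorem integral_primitive_imag {W W' : ℂ → ℂ} (hW : ∀ z, HasDerivAt W (W' z) z)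
    (hW' : Continuous W') (s : ℝ) :
    W (Complex.I * s) = W 0 + ∫ u in (0 : ℝ)..s, Complex.I * W' (Complex.I * u) := by
  have hd : ∀ u : ℝ, HasDerivAt (fun u : ℝ => W (Complex.I * u)) (Complex.I * W' (Complex.I * u)) u := by
    intro u
    have h1 : HasDerivAt (fun u : ℝ => Complex.I * (u : ℂ)) Complex.I u := by
      simpa using (Complex.ofRealCLM.hasDerivAt (x := u)).const_mul Complex.I
    exact ((hW (Complex.I * u)).comp u h1).congr_deriv (mul_comm _ _)
  have := intervalIntegral.integral_eq_sub_of_hasDerivAt (a := 0) (b := s) (fun u _ => hd u)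
    (Continuous.intervalIntegrable (by fun_prop) _ _)
  rw [this]
  simp

theorem tendsto_of_tendsto_deriv_imag {ι : Type*} {l : Filter ι} [l.IsCountablyGenerated]
    {w w' : ι → ℂ → ℂ} {W W' : ℂ → ℂ} {M r : ℝ} (hw : ∀ k z, HasDerivAt (w k) (w' k z) z)
    (hw' : ∀ k, Continuous (w' k)) (hW : ∀ z, HasDerivAt W (W' z) z) (hW' : Continuous W')
    (h0 : Tendsto (fun k => w k 0) l (𝓝 (W 0)))
    (hlim : ∀ s ∈ Set.Icc (-r) r, Tendsto (fun k => w' k (Complex.I * s)) l (𝓝 (W' (Complex.I * s))))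
    (hM : ∀ k, ∀ s ∈ Set.Icc (-r) r, ‖w' k (Complex.I * s)‖ ≤ M) {s : ℝ} (hs : s ∈ Set.Icc (-r) r) :
    Tendsto (fun k => w k (Complex.I * s)) l (𝓝 (W (Complex.I * s))) := by
  simp only [integral_primitive_imag (hw _) (hw' _), integral_primitive_imag hW hW']
  have hr : 0 ≤ r := by linarith [hs.1, hs.2]
  have hsub : Set.uIoc 0 s ⊆ Set.Icc (-r) r :=
    Set.uIoc_subset_uIcc.trans (Set.uIcc_subset_Icc ⟨by linarith, hr⟩ hs)
  refine h0.add (intervalIntegral.tendsto_integral_filter_of_dominated_convergence (fun _ => M)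
    (Eventually.of_forall fun k => ?_) (Eventually.of_forall fun k => ?_)
    intervalIntegrable_const ?_)
  · have := hw' k
    exact Continuous.aestronglyMeasurable (by fun_prop)
  · refine Eventually.of_forall fun u hu => ?_
    rw [norm_mul, Complex.norm_I, one_mul]
    exact hM k u (hsub hu)
  · refine Eventually.of_forall fun u hu => ?_
    exact (hlim u (hsub hu)).const_mul _

variable {α : Type*} [MeasurableSpace α] {μ : Measure α} {X Y : α → ℝ}

theorem lap_scale (R : ℝ) (f : α → ℂ) (z w : ℂ) :
    lap μ (fun a => R * X a) (fun a => R * Y a) f z w = lap μ X Y f (R * z) (R * w) := by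
  simp only [lap]
  congr 1; ext a
  push_cast
  ring_nf

theorem exists_integral_norm_le [IsFiniteMeasure μ] :
    ∃ C : ℝ, 0 ≤ C ∧ ∀ f : Lp ℝ 2 μ, Integrable (fun a => ((f a : ℝ) : ℂ)) μ ∧ ∫ a, ‖((f a : ℝ) : ℂ)‖ ∂μ ≤ C * ‖f‖ := by
  refine ⟨((μ Set.univ) ^ (1 / (1 : ENNReal).toReal - 1 / (2 : ENNReal).toReal)).toReal,
    ENNReal.toReal_nonneg, fun f => ?_⟩
  have hf : MemLp f 2 μ := Lp.memLp f
  have hf1 : Integrable f μ := hf.integrable (by norm_num)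
  refine ⟨hf1.ofReal, ?_⟩
  have h1 := eLpNorm_le_eLpNorm_mul_rpow_measure_univ (μ := μ) (p := 1) (q := 2) (by norm_num)
    hf.aestronglyMeasurable
  have hfin : (μ Set.univ) ^ (1 / (1 : ENNReal).toReal - 1 / (2 : ENNReal).toReal) ≠ ⊤ :=
    ENNReal.rpow_ne_top_of_nonneg (by norm_num) (measure_ne_top _ _)
  have h2 := ENNReal.toReal_mono (ENNReal.mul_ne_top hf.eLpNorm_ne_top hfin) h1
  rw [ENNReal.toReal_mul] at h2
  have e : ∫ a, ‖((f a : ℝ) : ℂ)‖ ∂μ = (eLpNorm f 1 μ).toReal := by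
    simp only [Complex.norm_real]
    rw [eLpNorm_one_eq_lintegral_enorm, integral_norm_eq_lintegral_enorm hf1.1]
  rw [e, Lp.norm_def, mul_comm]
  exact h2

/-- The radius is moved into the arguments by scaling, where the transform of a fixed density is
continuous. The change of density costs at most its `L²` distance, locally uniformly in the radius.
-/
theorem continuous_lap_density [IsFiniteMeasure μ] (hXm : Measurable X) (hYm : Measurable Y) {K : ℝ}
    (hX : ∀ a, |X a| ≤ K) (hY : ∀ a, |Y a| ≤ K) (z w : ℂ) :
    Continuous fun q : Lp ℝ 2 μ × ℝ =>
      lap μ (fun a => q.2 * X a) (fun a => q.2 * Y a) (fun a => ((q.1 a : ℝ) : ℂ)) z w := by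
  obtain ⟨C, hC, hCf⟩ := exists_integral_norm_le (μ := μ)
  simp only [lap_scale]
  refine continuous_iff_continuousAt.2 fun q₀ => ?_
  have h1 : Tendsto (fun q : Lp ℝ 2 μ × ℝ =>
      lap μ X Y (fun a => ((q₀.1 a : ℝ) : ℂ)) (q.2 * z) (q.2 * w)) (𝓝 q₀)
      (𝓝 (lap μ X Y (fun a => ((q₀.1 a : ℝ) : ℂ)) (q₀.2 * z) (q₀.2 * w))) := by
    have hc := continuous_lap hXm hYm hX hY (hCf q₀.1).1
    have hp : Continuous fun q : Lp ℝ 2 μ × ℝ => ((q.2 : ℂ) * z, (q.2 : ℂ) * w) := by fun_prop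
    exact (hc.comp hp).tendsto q₀
  have h2 : Tendsto (fun q : Lp ℝ 2 μ × ℝ =>
      lap μ X Y (fun a => (((q.1 - q₀.1 : Lp ℝ 2 μ) a : ℝ) : ℂ)) (q.2 * z) (q.2 * w))
      (𝓝 q₀) (𝓝 0) := by
    have hb : Tendsto (fun q : Lp ℝ 2 μ × ℝ =>
        Real.exp (K * (‖(q.2 : ℂ) * z‖ + ‖(q.2 : ℂ) * w‖)) * (C * ‖q.1 - q₀.1‖)) (𝓝 q₀) (𝓝 0) := by
      have hc : Continuous fun q : Lp ℝ 2 μ × ℝ =>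
        Real.exp (K * (‖(q.2 : ℂ) * z‖ + ‖(q.2 : ℂ) * w‖)) * (C * ‖q.1 - q₀.1‖) := by fun_prop
      have := hc.tendsto q₀
      simpa using this
    refine squeeze_zero_norm (fun q => ?_) hb
    refine (norm_lap_le hX hY (hCf (q.1 - q₀.1)).1 _ _).trans ?_
    exact mul_le_mul_of_nonneg_left (hCf _).2 (Real.exp_pos _).le
  have h3 := h1.add h2
  rw [add_zero] at h3
  refine h3.congr fun q => ?_
  rw [← lap_add hXm hYm hX hY (hCf q₀.1).1 (hCf (q.1 - q₀.1)).1]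
  refine integral_congr_ae ?_
  filter_upwards [Lp.coeFn_sub q.1 q₀.1] with a ha
  rw [ha]
  simp

end Limits

end CircleDeconv

end

/-! ### Compactness of normalized almost-solutions -/

noncomputable section

namespace CircleDeconv

open Filter Topology

theorem tendsto_div_zero_of_le {E : Type*} [NormedAddCommGroup E] [NormedSpace ℝ E] {H : ℕ → E}
    {η N : ℕ → ℝ} (hN : ∀ k, 0 < N k) (hη : ∀ k : ℕ, ((k : ℝ) + 1) * η k ≤ N k) (hH : ∀ k, ‖H k‖ ≤ η k) :
    Tendsto (fun k => (N k)⁻¹ • H k) atTop (𝓝 0) := by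
  refine squeeze_zero_norm (fun k => ?_) tendsto_one_div_add_atTop_nhds_zero_nat
  have hk : (0 : ℝ) < (k : ℝ) + 1 := by positivity
  have hn := hN k
  rw [norm_smul, norm_inv, Real.norm_of_nonneg hn.le, inv_mul_le_iff₀ hn, mul_one_div,
    le_div_iff₀ hk]
  have := mul_le_mul_of_nonneg_left (hH k) hk.le
  linarith [hη k]

/-- Compactness of normalized almost solutions of the identification equation. -/
theorem exists_linearized_limit {L L₁ L₂ : ℂ → ℂ → ℂ} {p q W W' V V' : ℕ → ℂ → ℂ}
    {H : ℕ → ℂ → ℂ → ℂ} {a₂ b₂ : ℕ → ℂ} {ρ η : ℕ → ℝ} {r M : ℝ}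
    (hp : Differentiable ℂ fun z => L z 0) (hq : Differentiable ℂ fun w => L 0 w)
    (hL₁ : Differentiable ℂ fun w => L₁ 0 w) (hL₂ : Differentiable ℂ fun z => L₂ z 0)
    (hpM : ∀ k, ∀ s ∈ Set.Icc (-r) r, ‖p k (Complex.I * s)‖ ≤ M)
    (hqM : ∀ k, ∀ s ∈ Set.Icc (-r) r, ‖q k (Complex.I * s)‖ ≤ M)
    (hpl : ∀ s ∈ Set.Icc (-r) r, Tendsto (fun k => p k (Complex.I * s)) atTop
      (𝓝 (L (Complex.I * s) 0)))
    (hql : ∀ s ∈ Set.Icc (-r) r, Tendsto (fun k => q k (Complex.I * s)) atTop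
      (𝓝 (L 0 (Complex.I * s))))
    (hW : ∀ k z, HasDerivAt (W k) (W' k z) z) (hV : ∀ k z, HasDerivAt (V k) (V' k z) z)
    (hWc : ∀ k, Continuous (W' k)) (hVc : ∀ k, Continuous (V' k)) (hr : 0 < r)
    (hN : ∀ k, 0 < ‖W k 0‖ + ‖V k 0‖ + ‖a₂ k‖ + ‖b₂ k‖ + |ρ k|)
    (hηN : ∀ k : ℕ, ((k : ℝ) + 1) * η k ≤ ‖W k 0‖ + ‖V k 0‖ + ‖a₂ k‖ + ‖b₂ k‖ + |ρ k|)
    (hη : ∀ k, ∀ s ∈ Set.Icc (-r) r, ∀ t ∈ Set.Icc (-r) r,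
      ‖H k (Complex.I * s) (Complex.I * t)‖ ≤ η k)
    (hW' : ∀ k, ∀ s ∈ Set.Icc (-r) r, ∀ z, z = Complex.I * s → W' k z = -(L z 0 * H k z 0)
      - p k z * (L z 0 * b₂ k + 2 * L₂ z 0 * V k 0 - ρ k * L z 0))
    (hV' : ∀ k, ∀ s ∈ Set.Icc (-r) r, ∀ z, z = Complex.I * s → V' k z = -(L 0 z * H k 0 z)
      - q k z * (L 0 z * a₂ k + 2 * L₁ 0 z * W k 0 - ρ k * L 0 z))
    (heq : ∀ k, ∀ s ∈ Set.Icc (-r) r, ∀ t ∈ Set.Icc (-r) r, ∀ z w, z = Complex.I * s →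
      w = Complex.I * t → H k z w * (L z 0 ^ 3 * L 0 w ^ 3)
      = -(L z w * ((W' k z * L z 0 - 2 * W k z * L₁ z 0) * (q k w * L 0 w ^ 2)
          + (V' k w * L 0 w - 2 * V k w * L₂ 0 w) * (p k z * L z 0 ^ 2))
        + 2 * L₁ z w * W k z * L z 0 * (q k w * L 0 w ^ 2)
        + 2 * L₂ z w * V k w * L 0 w * (p k z * L z 0 ^ 2)
        - ρ k * L z w * (p k z * L z 0 ^ 2) * (q k w * L 0 w ^ 2))) :
    ∃ (W₀ W₀' V₀ V₀' : ℂ → ℂ) (α₂ β₂ : ℂ) (ρ₀ : ℝ),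
      (∀ z, HasDerivAt W₀ (W₀' z) z) ∧ (∀ w, HasDerivAt V₀ (V₀' w) w) ∧
      (∀ z, W₀' z = -L z 0 * (L z 0 * β₂ + 2 * L₂ z 0 * V₀ 0 - ρ₀ * L z 0)) ∧
      (∀ w, V₀' w = -L 0 w * (L 0 w * α₂ + 2 * L₁ 0 w * W₀ 0 - ρ₀ * L 0 w)) ∧
      (∀ s ∈ Set.Icc (-r) r, ∀ t ∈ Set.Icc (-r) r, ∀ z w, z = Complex.I * s → w = Complex.I * t →
        L z w * ((W₀' z * L z 0 - 2 * W₀ z * L₁ z 0) * L 0 w ^ 3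
          + (V₀' w * L 0 w - 2 * V₀ w * L₂ 0 w) * L z 0 ^ 3)
        + 2 * L₁ z w * W₀ z * L z 0 * L 0 w ^ 3 + 2 * L₂ z w * V₀ w * L 0 w * L z 0 ^ 3
        - ρ₀ * L z w * L z 0 ^ 3 * L 0 w ^ 3 = 0) ∧
      ¬ (W₀ 0 = 0 ∧ V₀ 0 = 0 ∧ α₂ = 0 ∧ β₂ = 0 ∧ ρ₀ = 0) := by
  -- Five numbers drive the two differential equations. Dividing by their total size keeps the data
  -- bounded, while the forcing `H` becomes `O(1 / (k + 1))`.
  set N : ℕ → ℝ := fun k => ‖W k 0‖ + ‖V k 0‖ + ‖a₂ k‖ + ‖b₂ k‖ + |ρ k| with hNdef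
  have hle : ∀ k, ‖W k 0‖ ≤ N k ∧ ‖V k 0‖ ≤ N k ∧ ‖a₂ k‖ ≤ N k ∧ ‖b₂ k‖ ≤ N k ∧ |ρ k| ≤ N k := by
    intro k
    have := norm_nonneg (W k 0)
    have := norm_nonneg (V k 0)
    have := norm_nonneg (a₂ k)
    have := norm_nonneg (b₂ k)
    have := abs_nonneg (ρ k)
    refine ⟨?_, ?_, ?_, ?_, ?_⟩ <;> simp only [hNdef] <;> linarith
  have hnorm : ∀ {E : Type} [NormedAddCommGroup E] [NormedSpace ℝ E] (u : E) (k : ℕ), ‖u‖ ≤ N k →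
      ‖(N k)⁻¹ • u‖ ≤ 1 := by
    intro E _ _ u k hu
    have hn : 0 < N k := hN k
    rw [norm_smul, norm_inv, Real.norm_of_nonneg hn.le, inv_mul_le_iff₀ hn, mul_one]
    exact hu
  let c : ℕ → ℂ × ℂ × ℂ × ℂ × ℝ := fun k =>
    ((N k)⁻¹ • W k 0, (N k)⁻¹ • V k 0, (N k)⁻¹ • a₂ k, (N k)⁻¹ • b₂ k, (N k)⁻¹ • ρ k)
  have hcb : ∀ k, c k ∈ Metric.closedBall (0 : ℂ × ℂ × ℂ × ℂ × ℝ) 1 := by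
    intro k
    obtain ⟨h1, h2, h3, h4, h5⟩ := hle k
    rw [mem_closedBall_zero_iff]
    simp only [c, norm_prod_le_iff]
    exact ⟨hnorm _ k h1, hnorm _ k h2, hnorm _ k h3, hnorm _ k h4, hnorm _ k h5⟩
  obtain ⟨⟨w₀, v₀, α₂, β₂, ρ₀⟩, _, φ, hφ, hlim⟩ := (isCompact_closedBall _ _).tendsto_subseq hcb
  have hφt := hφ.tendsto_atTop
  have lw : Tendsto (fun k => (N (φ k))⁻¹ • W (φ k) 0) atTop (𝓝 w₀) :=
    (continuous_fst.tendsto _).comp hlim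
  have lim2 := (continuous_snd.tendsto _).comp hlim
  have lv : Tendsto (fun k => (N (φ k))⁻¹ • V (φ k) 0) atTop (𝓝 v₀) :=
    (continuous_fst.tendsto _).comp lim2
  have lim3 := (continuous_snd.tendsto _).comp lim2
  have la : Tendsto (fun k => (N (φ k))⁻¹ • a₂ (φ k)) atTop (𝓝 α₂) :=
    (continuous_fst.tendsto _).comp lim3
  have lim4 := (continuous_snd.tendsto _).comp lim3
  have lb : Tendsto (fun k => (N (φ k))⁻¹ • b₂ (φ k)) atTop (𝓝 β₂) :=
    (continuous_fst.tendsto _).comp lim4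
  have lρ : Tendsto (fun k => (N (φ k))⁻¹ • ρ (φ k)) atTop (𝓝 ρ₀) :=
    (continuous_snd.tendsto _).comp lim4
  have lρc : Tendsto (fun k => (N (φ k))⁻¹ • (ρ (φ k) : ℂ)) atTop (𝓝 (ρ₀ : ℂ)) := by
    refine ((Complex.continuous_ofReal.tendsto _).comp lρ).congr fun k => ?_
    simp
  -- The normalization survives in the limit since the data are finite dimensional; this is what
  -- makes the limit nonzero.
  have hsum : ‖w₀‖ + ‖v₀‖ + ‖α₂‖ + ‖β₂‖ + |ρ₀| = 1 := by
    refine tendsto_nhds_unique ((((lw.norm.add lv.norm).add la.norm).add lb.norm).add lρ.abs)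
      (tendsto_const_nhds.congr fun k => ?_)
    have hn : 0 < N (φ k) := hN _
    simp only [norm_smul, norm_inv, Real.norm_of_nonneg hn.le, smul_eq_mul, abs_mul, abs_inv,
      abs_of_pos hn, ← mul_add]
    exact (inv_mul_cancel₀ hn.ne').symm
  have dW₀' : Differentiable ℂ fun z => -L z 0 * (L z 0 * β₂ + 2 * L₂ z 0 * v₀ - ρ₀ * L z 0) :=
    hp.neg.mul (((hp.mul_const _).add ((hL₂.const_mul 2).mul_const _)).sub (hp.const_mul _))
  have dV₀' : Differentiable ℂ fun w => -L 0 w * (L 0 w * α₂ + 2 * L₁ 0 w * w₀ - ρ₀ * L 0 w) :=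
    hq.neg.mul (((hq.mul_const _).add ((hL₁.const_mul 2).mul_const _)).sub (hq.const_mul _))
  -- The limiting equations have known entire right-hand sides, so the limits are defined as
  -- primitives. Convergence to them is needed on the imaginary segment only.
  obtain ⟨W₀, hW₀0, hW₀⟩ := dW₀'.isExactOn_univ.with_val_at 0 w₀
  obtain ⟨V₀, hV₀0, hV₀⟩ := dV₀'.isExactOn_univ.with_val_at 0 v₀
  replace hW₀ := fun z => hW₀ z (Set.mem_univ z)
  replace hV₀ := fun z => hV₀ z (Set.mem_univ z)
  have h0r : (0 : ℝ) ∈ Set.Icc (-r) r := ⟨by linarith, hr.le⟩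
  have lH : ∀ s ∈ Set.Icc (-r) r, ∀ t ∈ Set.Icc (-r) r,
      Tendsto (fun k => (N (φ k))⁻¹ • H (φ k) (Complex.I * s) (Complex.I * t)) atTop (𝓝 0) :=
    fun s hs t ht => (tendsto_div_zero_of_le hN hηN fun k => hη k s hs t ht).comp hφt
  have I0 : Complex.I * ((0 : ℝ) : ℂ) = 0 := by simp
  have hHb : ∀ k, ∀ s ∈ Set.Icc (-r) r, ∀ t ∈ Set.Icc (-r) r,
      ‖(N k)⁻¹ • H k (Complex.I * s) (Complex.I * t)‖ ≤ 1 := by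
    intro k s hs t ht
    refine hnorm _ k ((hη k s hs t ht).trans ?_)
    have h1 := hηN k
    have h2 : 0 ≤ η k := (norm_nonneg _).trans (hη k s hs t ht)
    have h3 : (0 : ℝ) ≤ k := Nat.cast_nonneg k
    change _ ≤ N k at h1
    nlinarith
  -- the normalized derivatives converge, and are bounded, on the imaginary segment
  have hmain : ∀ (P P₂ : ℂ → ℂ) (π w w' : ℕ → ℂ → ℂ) (G : ℕ → ℂ → ℂ) (d v : ℕ → ℂ) (d₀ v₀ : ℂ)
      (W₀ : ℂ → ℂ), Continuous P → Continuous P₂ →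
      (∀ k, ∀ s ∈ Set.Icc (-r) r, ‖π k (Complex.I * s)‖ ≤ M) →
      (∀ s ∈ Set.Icc (-r) r, Tendsto (fun k => π (φ k) (Complex.I * s)) atTop
        (𝓝 (P (Complex.I * s)))) →
      (∀ k z, HasDerivAt (w k) (w' k z) z) → (∀ k, Continuous (w' k)) →
      (∀ s ∈ Set.Icc (-r) r, Tendsto (fun k => (N (φ k))⁻¹ • G (φ k) (Complex.I * s)) atTop (𝓝 0)) →
      (∀ k, ∀ s ∈ Set.Icc (-r) r, ‖(N k)⁻¹ • G k (Complex.I * s)‖ ≤ 1) →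
      Tendsto (fun k => (N (φ k))⁻¹ • d (φ k)) atTop (𝓝 d₀) → (∀ k, ‖(N k)⁻¹ • d k‖ ≤ 1) →
      Tendsto (fun k => (N (φ k))⁻¹ • v (φ k)) atTop (𝓝 v₀) → (∀ k, ‖(N k)⁻¹ • v k‖ ≤ 1) →
      (∀ k, ∀ s ∈ Set.Icc (-r) r, ∀ z, z = Complex.I * s → w' k z = -(P z * G k z)
        - π k z * (P z * d k + 2 * P₂ z * v k - ρ k * P z)) →
      Tendsto (fun k => (N (φ k))⁻¹ • w (φ k) 0) atTop (𝓝 (W₀ 0)) →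
      (∀ z, HasDerivAt W₀ (-P z * (P z * d₀ + 2 * P₂ z * v₀ - ρ₀ * P z)) z) →
      ∀ s ∈ Set.Icc (-r) r,
        Tendsto (fun k => (N (φ k))⁻¹ • w' (φ k) (Complex.I * s)) atTop
          (𝓝 (-P (Complex.I * s) * (P (Complex.I * s) * d₀ + 2 * P₂ (Complex.I * s) * v₀
            - ρ₀ * P (Complex.I * s)))) ∧
        Tendsto (fun k => (N (φ k))⁻¹ • w (φ k) (Complex.I * s)) atTop (𝓝 (W₀ (Complex.I * s))) := by
    intro P P₂ π w w' G d v d₀ v₀ W₀ hP hP₂ hπM hπ hw hw' hG hGb hd hdb hv hvb hw'e hw0 hW₀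
    have hρb : ∀ k, ‖(N k)⁻¹ • (ρ k : ℂ)‖ ≤ 1 := fun k =>
      hnorm _ k (by rw [Complex.norm_real]; exact (hle k).2.2.2.2)
    have e : ∀ k, ∀ s ∈ Set.Icc (-r) r, (N k)⁻¹ • w' k (Complex.I * s)
        = -(P (Complex.I * s) * ((N k)⁻¹ • G k (Complex.I * s)))
        - π k (Complex.I * s) * (P (Complex.I * s) * ((N k)⁻¹ • d k)
          + 2 * P₂ (Complex.I * s) * ((N k)⁻¹ • v k)
          - ((N k)⁻¹ • (ρ k : ℂ)) * P (Complex.I * s)) := by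
      intro k s hs
      rw [hw'e k s hs _ rfl]
      simp only [Complex.real_smul]
      ring
    have hlim1 : ∀ s ∈ Set.Icc (-r) r, Tendsto (fun k => (N (φ k))⁻¹ • w' (φ k) (Complex.I * s))
        atTop (𝓝 (-P (Complex.I * s) * (P (Complex.I * s) * d₀ + 2 * P₂ (Complex.I * s) * v₀
            - ρ₀ * P (Complex.I * s)))) := by
      intro s hs
      have := ((((hG s hs).const_mul (P (Complex.I * s))).neg).sub ((hπ s hs).mul
        ((((hd.const_mul (P (Complex.I * s))).add (hv.const_mul (2 * P₂ (Complex.I * s)))).sub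
          (lρc.mul_const (P (Complex.I * s)))))))
      rw [mul_zero, neg_zero, zero_sub, ← neg_mul] at this
      exact this.congr fun k => (e (φ k) s hs).symm
    obtain ⟨B, hB⟩ := (isCompact_Icc (a := -r) (b := r)).exists_bound_of_continuousOn
      (f := fun s : ℝ => P (Complex.I * s)) (Continuous.continuousOn (by fun_prop))
    obtain ⟨B₂, hB₂⟩ := (isCompact_Icc (a := -r) (b := r)).exists_bound_of_continuousOn
      (f := fun s : ℝ => P₂ (Complex.I * s)) (Continuous.continuousOn (by fun_prop))
    refine fun s hs => ⟨hlim1 s hs, ?_⟩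
    refine tendsto_of_tendsto_deriv_imag (w := fun k z => (N (φ k))⁻¹ • w (φ k) z)
      (w' := fun k z => (N (φ k))⁻¹ • w' (φ k) z) (M := B * 1 + M * (B * 1 + 2 * B₂ * 1 + 1 * B))
      (fun k z => (hw (φ k) z).fun_const_smul _) (fun k => (hw' (φ k)).fun_const_smul _) hW₀
      (by fun_prop) hw0 hlim1 (fun k u hu => ?_) hs
    have b1 := hB u hu
    have b2 := hB₂ u hu
    have B0 : 0 ≤ B := (norm_nonneg _).trans b1
    have B20 : 0 ≤ B₂ := (norm_nonneg _).trans b2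
    have M0 : 0 ≤ M := (norm_nonneg _).trans (hπM 0 u hu)
    rw [e (φ k) u hu]
    refine (norm_sub_le _ _).trans (add_le_add ?_ ?_)
    · rw [norm_neg, norm_mul]
      exact mul_le_mul b1 (hGb _ u hu) (norm_nonneg _) B0
    · rw [norm_mul]
      refine mul_le_mul (hπM _ u hu) ((norm_sub_le _ _).trans (add_le_add ((norm_add_le _ _).trans
        (add_le_add ?_ ?_)) ?_)) (norm_nonneg _) M0
      · rw [norm_mul]
        exact mul_le_mul b1 (hdb _) (norm_nonneg _) B0
      · rw [norm_mul, norm_mul, Complex.norm_two]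
        exact mul_le_mul (mul_le_mul_of_nonneg_left b2 (by norm_num)) (hvb _) (norm_nonneg _)
          (by positivity)
      · rw [norm_mul]
        exact mul_le_mul (hρb _) b1 (norm_nonneg _) zero_le_one
  have hWlim := hmain (fun z => L z 0) (fun z => L₂ z 0) p W W' (fun k z => H k z 0) b₂
    (fun k => V k 0) β₂ v₀ W₀ hp.continuous hL₂.continuous hpM (fun s hs => (hpl s hs).comp hφt) hW hWc
    (fun s hs => by simpa only [I0] using lH s hs 0 h0r)
    (fun k s hs => by simpa only [I0] using hHb k s hs 0 h0r)
    lb (fun k => hnorm _ k (hle k).2.2.2.1) lv (fun k => hnorm _ k (hle k).2.1) hW'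
    (by rw [hW₀0]; exact lw) hW₀
  have hVlim := hmain (fun z => L 0 z) (fun z => L₁ 0 z) q V V' (fun k z => H k 0 z) a₂
    (fun k => W k 0) α₂ w₀ V₀ hq.continuous hL₁.continuous hqM (fun s hs => (hql s hs).comp hφt) hV hVc
    (fun s hs => by simpa only [I0] using lH 0 h0r s hs)
    (fun k s hs => by simpa only [I0] using hHb k 0 h0r s hs)
    la (fun k => hnorm _ k (hle k).2.2.1) lw (fun k => hnorm _ k (hle k).1) hV'
    (by rw [hV₀0]; exact lv) hV₀
  refine ⟨W₀, _, V₀, _, α₂, β₂, ρ₀, hW₀, hV₀, fun z => by rw [hV₀0], fun z => by rw [hW₀0], ?_, ?_⟩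
  · rintro s hs t ht _ _ rfl rfl
    obtain ⟨lW', lW⟩ := hWlim s hs
    obtain ⟨lV', lV⟩ := hVlim t ht
    have lp := (hpl s hs).comp hφt
    have lq := (hql t ht).comp hφt
    have left := (lH s hs t ht).mul_const
      (L (Complex.I * s) 0 ^ 3 * L 0 (Complex.I * t) ^ 3)
    rw [zero_mul] at left
    have right := (((((((lW'.mul_const (L (Complex.I * s) 0)).sub
      ((lW.const_mul 2).mul_const (L₁ (Complex.I * s) 0))).mul
        (lq.mul_const (L 0 (Complex.I * t) ^ 2))).add
      (((lV'.mul_const (L 0 (Complex.I * t))).sub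
      ((lV.const_mul 2).mul_const (L₂ 0 (Complex.I * t)))).mul
        (lp.mul_const (L (Complex.I * s) 0 ^ 2)))).const_mul
          (L (Complex.I * s) (Complex.I * t))).add
      (((lW.const_mul (2 * L₁ (Complex.I * s) (Complex.I * t))).mul_const
        (L (Complex.I * s) 0)).mul (lq.mul_const (L 0 (Complex.I * t) ^ 2)))).add
      (((lV.const_mul (2 * L₂ (Complex.I * s) (Complex.I * t))).mul_const
        (L 0 (Complex.I * t))).mul (lp.mul_const (L (Complex.I * s) 0 ^ 2)))).sub
      (((lρc.mul_const (L (Complex.I * s) (Complex.I * t))).mul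
        (lp.mul_const (L (Complex.I * s) 0 ^ 2))).mul (lq.mul_const (L 0 (Complex.I * t) ^ 2)))
    have h0 := tendsto_nhds_unique (left.neg.congr fun k => ?_) right
    · rw [neg_zero] at h0
      rw [← sub_eq_zero, zero_sub, neg_eq_zero] at h0
      linear_combination h0
    · have := heq (φ k) s hs t ht _ _ rfl rfl
      simp only [Complex.real_smul, Function.comp_apply]
      linear_combination (-(((N (φ k))⁻¹ : ℝ) : ℂ)) * this
  · rintro ⟨h1, h2, h3, h4, h5⟩
    rw [hW₀0] at h1
    rw [hV₀0] at h2
    rw [h1, h2, h3, h4, h5] at hsum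
    simp at hsum

end CircleDeconv

end

/-! ### Stability of the center -/

noncomputable section

namespace CircleDeconv

open Filter Topology

variable {α : Type*} [MeasurableSpace α] {μ : Measure α} [IsFiniteMeasure μ] {Rs : ℝ}
  {X Y : α → ℝ} {fs : α → ℝ} {m₁ m₂ : ℝ → ℝ → ℝ} {x : Fin 4 → ℝ × ℝ}

/-- The difference of the centers of two distributions on circles is controlled by the defect of
dependence and its image by the Helmholtz operator on a neighborhood of the origin. -/
theorem DensityOnCircle.stability (hc : CircleChart μ 1 X Y)
    (hs : DensityOnCircle μ Rs (fun a => Rs * X a) (fun a => Rs * Y a) fs m₁ m₂ x)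
    {F : Set (Lp ℝ 2 μ)} (hF : IsCompact F) (hF1 : ∀ f ∈ F, ∫ a, (f a : ℝ) ∂μ = 1)
    {Rmin Rmax r : ℝ} (hRmin : 0 < Rmin) (hr : 0 < r)
    (hp0 : ∀ s ∈ Set.Icc (-r) r, lap μ (fun a => Rs * X a) (fun a => Rs * Y a)
      (fun a => (fs a : ℂ)) (Complex.I * s) 0 ≠ 0)
    (hq0 : ∀ s ∈ Set.Icc (-r) r, lap μ (fun a => Rs * X a) (fun a => Rs * Y a)
      (fun a => (fs a : ℂ)) 0 (Complex.I * s) ≠ 0) :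
    ∃ C : ℝ, 0 ≤ C ∧ ∀ f ∈ F, ∀ R ∈ Set.Icc Rmin Rmax, ∀ η : ℝ, 0 ≤ η →
      (∀ s ∈ Set.Icc (-r) r, ∀ t ∈ Set.Icc (-r) r,
        ‖dependenceDefect μ (fun a => R * X a) (fun a => R * Y a) (fun a => ((f a : ℝ) : ℂ))
          (fun a => Rs * X a) (fun a => Rs * Y a) (fun a => (fs a : ℂ))
          (Complex.I * s) (Complex.I * t)‖ ≤ η ∧
        ‖helmholtzDefect μ R (fun a => R * X a) (fun a => R * Y a) (fun a => ((f a : ℝ) : ℂ))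
          (fun a => Rs * X a) (fun a => Rs * Y a) (fun a => (fs a : ℂ))
          (Complex.I * s) (Complex.I * t)‖ ≤ η) →
      ‖marginalWronskian μ (fun a => R * X a) (fun a => R * Y a) (fun a => ((f a : ℝ) : ℂ))
          (fun a => Rs * X a) (fun a => Rs * Y a) (fun a => (fs a : ℂ)) 0‖ ≤ C * η ∧
      ‖marginalWronskian μ (fun a => R * Y a) (fun a => R * X a) (fun a => ((f a : ℝ) : ℂ))
          (fun a => Rs * Y a) (fun a => Rs * X a) (fun a => (fs a : ℂ)) 0‖ ≤ C * η := by
  -- A failure with constant `k + 1` for every `k` gives a sequence in the compact set `F × [Rmin,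
  -- Rmax]`.
  by_contra hcon
  push Not at hcon
  choose f' hf' R' hR' η' hη0' hη' hgt' using fun k : ℕ => hcon (k + 1) (by positivity)
  obtain ⟨⟨f₀, R₀⟩, ⟨hf₀, hR₀⟩, φ, hφ, hlim⟩ := (hF.prod (isCompact_Icc (a := Rmin) (b := Rmax))).tendsto_subseq
    (x := fun k => (f' k, R' k)) fun k => ⟨hf' k, hR' k⟩
  obtain ⟨f, hfdef⟩ : ∃ f : ℕ → Lp ℝ 2 μ, f = fun k => f' (φ k) := ⟨_, rfl⟩
  obtain ⟨R, hRdef⟩ : ∃ R : ℕ → ℝ, R = fun k => R' (φ k) := ⟨_, rfl⟩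
  obtain ⟨η, hηdef⟩ : ∃ η : ℕ → ℝ, η = fun k => η' (φ k) := ⟨_, rfl⟩
  have hf : ∀ k, f k ∈ F := fun k => by rw [hfdef]; exact hf' _
  have hR : ∀ k, R k ∈ Set.Icc Rmin Rmax := fun k => by rw [hRdef]; exact hR' _
  have hη0 : ∀ k, 0 ≤ η k := fun k => by rw [hηdef]; exact hη0' _
  set W : ℕ → ℂ → ℂ := fun k => marginalWronskian μ (fun a => R k * X a) (fun a => R k * Y a)
    (fun a => ((f k a : ℝ) : ℂ)) (fun a => Rs * X a) (fun a => Rs * Y a) (fun a => (fs a : ℂ))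
    with hWdef
  set V : ℕ → ℂ → ℂ := fun k => marginalWronskian μ (fun a => R k * Y a) (fun a => R k * X a)
    (fun a => ((f k a : ℝ) : ℂ)) (fun a => Rs * Y a) (fun a => Rs * X a) (fun a => (fs a : ℂ))
    with hVdef
  set W' : ℕ → ℂ → ℂ := fun k => marginalWronskianDeriv μ (fun a => R k * X a) (fun a => R k * Y a)
    (fun a => ((f k a : ℝ) : ℂ)) (fun a => Rs * X a) (fun a => Rs * Y a) (fun a => (fs a : ℂ))
    with hWdef'
  set V' : ℕ → ℂ → ℂ := fun k => marginalWronskianDeriv μ (fun a => R k * Y a) (fun a => R k * X a)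
    (fun a => ((f k a : ℝ) : ℂ)) (fun a => Rs * Y a) (fun a => Rs * X a) (fun a => (fs a : ℂ))
    with hVdef'
  set Q : ℕ → ℂ → ℂ → ℂ := fun k => dependenceDefect μ (fun a => R k * X a) (fun a => R k * Y a)
    (fun a => ((f k a : ℝ) : ℂ)) (fun a => Rs * X a) (fun a => Rs * Y a) (fun a => (fs a : ℂ))
    with hQdef
  set H : ℕ → ℂ → ℂ → ℂ := fun k => helmholtzDefect μ (R k) (fun a => R k * X a)
    (fun a => R k * Y a) (fun a => ((f k a : ℝ) : ℂ)) (fun a => Rs * X a) (fun a => Rs * Y a)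
    (fun a => (fs a : ℂ)) with hHdef
  set Λ : ℕ → ℂ → ℂ → ℂ := fun k => lap μ (fun a => R k * X a) (fun a => R k * Y a)
    (fun a => ((f k a : ℝ) : ℂ)) with hΛdef
  set L := lap μ (fun a => Rs * X a) (fun a => Rs * Y a) (fun a => (fs a : ℂ)) with hL
  have hη : ∀ k, ∀ s ∈ Set.Icc (-r) r, ∀ t ∈ Set.Icc (-r) r,
      ‖Q k (Complex.I * s) (Complex.I * t)‖ ≤ η k ∧ ‖H k (Complex.I * s) (Complex.I * t)‖ ≤ η k := by
    intro k s hs t ht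
    simp only [hQdef, hHdef, hfdef, hRdef, hηdef]
    exact hη' _ s hs t ht
  -- A strictly increasing extraction satisfies `k ≤ φ k`, so the violation with factor `k + 1`
  -- persists along the subsequence.
  have hgt : ∀ k : ℕ, ((k : ℝ) + 1) * η k < ‖W k 0‖ ∨ ((k : ℝ) + 1) * η k < ‖V k 0‖ := by
    intro k
    have h1 := hgt' (φ k)
    have h2 : ((k : ℝ) + 1) * η k ≤ ((φ k : ℝ) + 1) * η' (φ k) := by
      have h3 : (k : ℝ) ≤ φ k := by exact_mod_cast hφ.id_le k
      have h4 := hη0 k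
      simp only [hηdef] at h4 ⊢
      gcongr
    simp only [hWdef, hVdef, hfdef, hRdef]
    by_cases hle : ‖W k 0‖ ≤ ((φ k : ℝ) + 1) * η' (φ k)
    · refine Or.inr (lt_of_le_of_lt h2 (h1 ?_))
      simpa only [hWdef, hfdef, hRdef] using hle
    · refine Or.inl (lt_of_le_of_lt h2 ?_)
      simpa only [hWdef, hfdef, hRdef, not_le] using hle
  have hRpos : ∀ k, 0 < R k := fun k => hRmin.trans_le (hR k).1
  have chart : ∀ k, CircleChart μ (R k) (fun a => R k * X a) (fun a => R k * Y a) := fun k => by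
    simpa using hc.scale (hRpos k)
  have chart₀ : CircleChart μ R₀ (fun a => R₀ * X a) (fun a => R₀ * Y a) := by
    simpa using hc.scale (hRmin.trans_le hR₀.1)
  obtain ⟨C₁, hC₁, hCf⟩ := exists_integral_norm_le (μ := μ)
  have hint : ∀ k, Integrable (fun a => ((f k a : ℝ) : ℂ)) μ := fun k => (hCf (f k)).1
  have hsint : Integrable (fun a => (fs a : ℂ)) μ := hs.integrable.ofReal
  have hone : ∀ k, ∫ a, ((f k a : ℝ) : ℂ) ∂μ = 1 := fun k => by
    rw [integral_complex_ofReal, hF1 _ (hf k)]; simp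
  have hone₀ : ∫ a, ((f₀ a : ℝ) : ℂ) ∂μ = 1 := by
    rw [integral_complex_ofReal, hF1 _ hf₀]; simp
  have hones : ∫ a, (fs a : ℂ) ∂μ = 1 := by
    rw [integral_complex_ofReal, hs.integral_eq_one]; simp
  have Λ00 : ∀ k, Λ k 0 0 = 1 := fun k => by rw [hΛdef]; simp only; rw [lap_zero_zero, hone]
  have L00 : L 0 0 = 1 := by rw [hL, lap_zero_zero, hones]
  obtain ⟨BF, hBF⟩ := hF.isBounded.exists_norm_le
  have hfM : ∀ k, ∫ a, ‖((f k a : ℝ) : ℂ)‖ ∂μ ≤ C₁ * BF := fun k =>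
    (hCf (f k)).2.trans (mul_le_mul_of_nonneg_left (hBF _ (hf k)) hC₁)
  have hfM0 : 0 ≤ C₁ * BF := (integral_nonneg fun _ => norm_nonneg _).trans (hfM 0)
  -- boundedness of the gap
  have hbd : ∀ k, ‖Λ k 0 0‖ ≤ 1 := fun k => by rw [Λ00, norm_one]
  have hΛ₁ : ∀ k (Z : α → ℝ), (∀ a, |Z a| ≤ 1) → Measurable Z →
      ‖lap μ (fun a => R k * X a) (fun a => R k * Y a)
        (fun a => ((R k * Z a : ℝ) : ℂ) * ((f k a : ℝ) : ℂ)) 0 0‖ ≤ Rmax * (C₁ * BF) := by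
    intro k Z hZ hZm
    rw [lap_zero_zero]
    refine (norm_integral_le_of_norm_le ((hint k).norm.const_mul Rmax)
      (Eventually.of_forall fun a => ?_)).trans ?_
    · rw [norm_mul, Complex.norm_real, Real.norm_eq_abs, abs_mul, abs_of_pos (hRpos k)]
      refine mul_le_mul_of_nonneg_right ?_ (norm_nonneg _)
      calc R k * |Z a| ≤ R k * 1 := mul_le_mul_of_nonneg_left (hZ a) (hRpos k).le
        _ ≤ Rmax := by rw [mul_one]; exact (hR k).2
    · rw [integral_const_mul]
      exact mul_le_mul_of_nonneg_left (hfM k) ((hRpos k).le.trans (hR k).2)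
  obtain ⟨B, hB⟩ : ∃ B, ∀ k, ‖W k 0‖ ≤ B ∧ ‖V k 0‖ ≤ B := by
    refine ⟨Rmax * (C₁ * BF) + (‖lap μ (fun a => Rs * X a) (fun a => Rs * Y a)
      (fun a => ((Rs * X a : ℝ) : ℂ) * (fs a : ℂ)) 0 0‖ + ‖lap μ (fun a => Rs * X a)
      (fun a => Rs * Y a) (fun a => ((Rs * Y a : ℝ) : ℂ) * (fs a : ℂ)) 0 0‖), fun k => ⟨?_, ?_⟩⟩
    · have e1 : lap μ (fun a => R k * X a) (fun a => R k * Y a) (fun a => ((f k a : ℝ) : ℂ)) 0 0 = 1 :=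
        Λ00 k
      simp only [hWdef, marginalWronskian]
      rw [← hL, L00, e1, mul_one, one_mul]
      refine (norm_sub_le _ _).trans (add_le_add (hΛ₁ k X hc.abs_le₁ hc.meas₁) ?_)
      exact le_add_of_nonneg_right (norm_nonneg _)
    · have e1 : lap μ (fun a => R k * X a) (fun a => R k * Y a) (fun a => ((f k a : ℝ) : ℂ)) 0 0 = 1 :=
        Λ00 k
      simp only [hVdef, marginalWronskian]
      simp only [lap_swap (X := fun a => R k * Y a), lap_swap (X := fun a => Rs * Y a)]
      rw [← hL, L00, e1, mul_one, one_mul]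
      refine (norm_sub_le _ _).trans (add_le_add (hΛ₁ k Y hc.abs_le₂ hc.meas₂) ?_)
      exact le_add_of_nonneg_left (norm_nonneg _)
  -- The Wronskians at `0` are uniformly bounded, and one of them exceeds `(k + 1) * η k`.
  have hηlim : Tendsto η atTop (𝓝 0) := by
    have h1 : Tendsto (fun k : ℕ => B * (1 / ((k : ℝ) + 1))) atTop (𝓝 0) := by
      simpa using tendsto_one_div_add_atTop_nhds_zero_nat.const_mul B
    refine squeeze_zero hη0 (fun k => ?_) h1
    have hk : (0 : ℝ) < (k : ℝ) + 1 := by positivity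
    rw [mul_one_div, le_div_iff₀ hk, mul_comm]
    rcases hgt k with h | h
    · exact h.le.trans (hB k).1
    · exact h.le.trans (hB k).2
  -- the limit
  have hΛlim : ∀ z w, Tendsto (fun k => Λ k z w) atTop (𝓝 (lap μ (fun a => R₀ * X a)
      (fun a => R₀ * Y a) (fun a => ((f₀ a : ℝ) : ℂ)) z w)) := by
    intro z w
    have h1 := ((continuous_lap_density (μ := μ) hc.meas₁ hc.meas₂ hc.abs_le₁ hc.abs_le₂ z w).tendsto
      (f₀, R₀)).comp hlim
    simp only [hΛdef, hfdef, hRdef]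
    exact h1
  -- The defect tends to zero, so the limit pair has the dependence structure of the reference. It
  -- therefore has the same radius and marginals, which are the coefficients required by the
  -- linearization.
  have hid := hs.identification chart₀ (hCf f₀).1 hone₀ hr fun s hs' t ht => by
    have h1 : Tendsto (fun k => Q k (Complex.I * s) (Complex.I * t)) atTop (𝓝 0) :=
      squeeze_zero_norm (fun k => (hη k s hs' t ht).1) hηlim
    have h2 := (hΛlim (Complex.I * s) (Complex.I * t)).sub
      ((((hΛlim (Complex.I * s) 0).div_const (L (Complex.I * s) 0)).const_mul
        (L (Complex.I * s) (Complex.I * t))).mul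
        ((hΛlim 0 (Complex.I * t)).div_const (L 0 (Complex.I * t))))
    have h3 := tendsto_nhds_unique h1 h2
    have n1 := hp0 s hs'
    have n2 := hq0 t ht
    rw [← hL]
    change L (Complex.I * s) 0 ≠ 0 at n1
    change L 0 (Complex.I * t) ≠ 0 at n2
    field_simp at h3
    linear_combination -h3
  obtain ⟨rfl, hpe, hqe⟩ := hid
  have hsc := hs.chart
  refine absurd (exists_linearized_limit
    (L := L) (L₁ := lap μ (fun a => R₀ * X a) (fun a => R₀ * Y a)
      (fun a => ((R₀ * X a : ℝ) : ℂ) * (fs a : ℂ)))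
    (L₂ := lap μ (fun a => R₀ * X a) (fun a => R₀ * Y a)
      (fun a => ((R₀ * Y a : ℝ) : ℂ) * (fs a : ℂ)))
    (p := fun k z => Λ k z 0) (q := fun k w => Λ k 0 w) (W := W) (W' := W') (V := V) (V' := V')
    (H := H) (a₂ := fun k => W' k 0 - 2 * W k 0 * lap μ (fun a => R₀ * X a) (fun a => R₀ * Y a)
      (fun a => ((R₀ * X a : ℝ) : ℂ) * (fs a : ℂ)) 0 0)
    (b₂ := fun k => V' k 0 - 2 * V k 0 * lap μ (fun a => R₀ * X a) (fun a => R₀ * Y a)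
      (fun a => ((R₀ * Y a : ℝ) : ℂ) * (fs a : ℂ)) 0 0)
    (ρ := fun k => R k ^ 2 - R₀ ^ 2) (η := η) (r := r) (M := Real.exp (Rmax * r) * (C₁ * BF))
    (fun z => (hsc.hasDerivAt₁ hsint z 0).differentiableAt)
    (fun w => (hsc.hasDerivAt₂ hsint 0 w).differentiableAt)
    (fun w => (hsc.hasDerivAt₂ (hsc.integrable₁ hsint) 0 w).differentiableAt)
    (fun z => (hsc.hasDerivAt₁ (hsc.integrable₂ hsint) z 0).differentiableAt)
    (fun k s hs' => ?_) (fun k s hs' => ?_) (fun s hs' => ?_) (fun s hs' => ?_)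
    (fun k z => hasDerivAt_marginalWronskian (chart k) hsc (hint k) hsint z)
    (fun k z => hasDerivAt_marginalWronskian (chart k).swap hsc.swap (hint k) hsint z)
    (fun k => (differentiable_marginalWronskianDeriv (chart k) hsc (hint k) hsint).continuous)
    (fun k => (differentiable_marginalWronskianDeriv (chart k).swap hsc.swap (hint k) hsint).continuous)
    hr (fun k => ?_) (fun k => ?_) (fun k s hs' t ht => (hη k s hs' t ht).2)
    (fun k s hs' z hz => ?_) (fun k s hs' z hz => ?_) (fun k s hs' t ht z w hz hw => ?_)) ?_
  · have := norm_lap_le (chart k).abs_le₁ (chart k).abs_le₂ (hint k) (Complex.I * s) 0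
    refine this.trans (mul_le_mul (Real.exp_le_exp.2 ?_) (hfM k)
      (integral_nonneg fun _ => norm_nonneg _) (Real.exp_pos _).le)
    simp only [norm_mul, Complex.norm_I, Complex.norm_real, norm_zero, one_mul, add_zero]
    exact mul_le_mul (hR k).2 (abs_le.2 hs') (norm_nonneg _) ((hRpos k).le.trans (hR k).2)
  · have := norm_lap_le (chart k).abs_le₁ (chart k).abs_le₂ (hint k) 0 (Complex.I * s)
    refine this.trans (mul_le_mul (Real.exp_le_exp.2 ?_) (hfM k)
      (integral_nonneg fun _ => norm_nonneg _) (Real.exp_pos _).le)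
    simp only [norm_mul, Complex.norm_I, Complex.norm_real, norm_zero, one_mul, zero_add]
    exact mul_le_mul (hR k).2 (abs_le.2 hs') (norm_nonneg _) ((hRpos k).le.trans (hR k).2)
  · rw [hL, ← hpe]; exact hΛlim _ _
  · rw [hL, ← hqe]; exact hΛlim _ _
  · have n1 := norm_nonneg (W k 0)
    have n2 := norm_nonneg (V k 0)
    have h1 : 0 ≤ ((k : ℝ) + 1) * η k := mul_nonneg (by positivity) (hη0 k)
    have h2 : 0 < ‖W k 0‖ + ‖V k 0‖ := by
      rcases hgt k with h | h <;> linarith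
    positivity
  · have n1 := norm_nonneg (W k 0)
    have n2 := norm_nonneg (V k 0)
    have h2 : ((k : ℝ) + 1) * η k ≤ ‖W k 0‖ + ‖V k 0‖ := by
      rcases hgt k with h | h <;> linarith
    refine h2.trans ?_
    rw [add_assoc, add_assoc]
    exact le_add_of_nonneg_right (by positivity)
  · have h1 := hp0 s hs'
    rw [← hz] at h1
    have := helmholtzDefect_zero_right (chart k) hsc (hint k) hsint (hone k) hones h1
    push_cast at this ⊢
    exact this
  · have h1 := hq0 s hs'
    rw [← hz] at h1
    have := helmholtzDefect_zero_right (chart k).swap hsc.swap (hint k) hsint (hone k) hones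
      (z := z) (by rwa [lap_swap])
    simp only [lap_swap (X := fun a => R k * Y a), lap_swap (X := fun a => R₀ * Y a),
      helmholtzDefect_swap (X := fun a => R k * X a)] at this
    push_cast at this ⊢
    exact this
  · have h1 := hp0 s hs'
    have h2 := hq0 t ht
    rw [← hz] at h1
    rw [← hw] at h2
    have := helmholtzDefect_mul (chart k) hsc (hint k) hsint h1 h2
    push_cast at this ⊢
    exact this
  · rintro ⟨W₀, W₀', V₀, V₀', α₂, β₂, ρ₀, c1, c2, c3, c4, c5, c6⟩
    exact c6 (hs.linearized_identification hr c1 c2 c3 c4 c5)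

end CircleDeconv

end

/-! ### From the integrated contrast to the center -/

noncomputable section

namespace CircleDeconv

open Filter Topology

/-- A function of two complex variables that is analytic in each variable and bounded near the
origin is controlled, together with its pure second derivatives, by its mean on an imaginary
square. -/
theorem analytic_interpolation_two {r δ : ℝ} (hr : 0 < r) (hδ : 0 < δ) {M D : ℝ} (hM : 0 ≤ M) (hD : 0 ≤ D) :
    ∃ C : ℝ, 0 ≤ C ∧ ∀ (Q : ℂ → ℂ → ℂ) (g : ℝ → ℝ → ℝ) (ε : ℝ),
      (∀ w ∈ Metric.ball (0 : ℂ) (2 * r), DifferentiableOn ℂ (fun z => Q z w) (Metric.ball 0 (2 * r))) →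
      (∀ z ∈ Metric.ball (0 : ℂ) (2 * r), DifferentiableOn ℂ (fun w => Q z w) (Metric.ball 0 (2 * r))) →
      (∀ z ∈ Metric.ball (0 : ℂ) (2 * r), ∀ w ∈ Metric.ball (0 : ℂ) (2 * r), ‖Q z w‖ ≤ M) →
      Continuous (Function.uncurry g) →
      (∀ s ∈ Set.Icc (-r) r, ∀ t ∈ Set.Icc (-r) r, ‖Q (Complex.I * s) (Complex.I * t)‖ ≤ g s t) →
      0 < ε → ε ≤ 1 →
      (∫ s in (-r)..r, ∫ t in (-r)..r, g s t) ≤ D * ε →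
      ∀ s ∈ Set.Icc (-r) r, ∀ t ∈ Set.Icc (-r) r, ∀ k ≤ 2,
        ‖iteratedDeriv k (fun z => Q z (Complex.I * t)) (Complex.I * s)‖ ≤ C * ε ^ (1 - δ) := by
  -- The one-variable estimate is used once in each variable, so each use may lose only `δ / 2`.
  obtain ⟨C, hC, hint⟩ := analytic_interpolation hr (half_pos hδ) 2
  refine ⟨C * (C * (D + 2 * r * M) + M), by positivity, ?_⟩
  intro Q g ε h₁ h₂ hQM hg hQg hε hε1 hJ s hs t ht k hk
  have hball : ∀ t ∈ Set.Icc (-r) r, Complex.I * (t : ℂ) ∈ Metric.ball (0 : ℂ) (2 * r) := by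
    intro t ht
    rw [mem_ball_zero_iff, norm_mul, Complex.norm_I, one_mul, Complex.norm_real, Real.norm_eq_abs]
    have := abs_le.2 ht
    linarith
  have hrr : -r ≤ r := by linarith
  have e1 : 1 ≤ ε ^ (-(δ / 2)) := by
    rw [Real.rpow_neg hε.le]
    exact (one_le_inv₀ (by positivity)).2 (Real.rpow_le_one hε.le hε1 (by positivity))
  have hIc : ∀ (k : ℂ → ℂ), DifferentiableOn ℂ k (Metric.ball 0 (2 * r)) →
      IntervalIntegrable (fun v : ℝ => ‖k (Complex.I * v)‖) volume (-r) r := fun k hk => by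
    refine ContinuousOn.intervalIntegrable ?_
    rw [Set.uIcc_of_le hrr]
    exact (hk.continuousOn.comp (by fun_prop : Continuous fun v : ℝ => Complex.I * (v : ℂ)).continuousOn
      fun v hv => hball v hv).norm
  have hgc : ∀ u, Continuous fun v => g u v := fun u =>
    hg.comp (by fun_prop : Continuous fun v : ℝ => ((u, v) : ℝ × ℝ))
  have hc3 : Continuous fun u : ℝ => ∫ v in (-r)..r, g u v :=
    intervalIntegral.continuous_parametric_intervalIntegral_of_continuous' hg _ _
  -- On each line parallel to the second axis the value at `t` is bounded by the mean over that
  -- line; integrating over the lines gives the mean needed in the first variable.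
  have hrow : ∫ u in (-r)..r, ‖Q (Complex.I * u) (Complex.I * t)‖
      ≤ C * ε ^ (-(δ / 2)) * (D * ε + 2 * r * M * ε) := by
    calc ∫ u in (-r)..r, ‖Q (Complex.I * u) (Complex.I * t)‖
        ≤ ∫ u in (-r)..r, C * ε ^ (-(δ / 2)) * ((∫ v in (-r)..r, g u v) + M * ε) := by
          refine intervalIntegral.integral_mono_on hrr (hIc _ (h₁ _ (hball t ht)))
            (Continuous.intervalIntegrable (by fun_prop) _ _) fun u hu => ?_
          have h4 := hint (fun w => Q (Complex.I * u) w) M ε (h₂ _ (hball u hu))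
            (fun w hw => hQM _ (hball u hu) w hw) hε hε1 0 (by norm_num) t ht
          rw [iteratedDeriv_zero] at h4
          refine h4.trans ?_
          gcongr
          exact intervalIntegral.integral_mono_on hrr (hIc _ (h₂ _ (hball u hu)))
            ((hgc u).intervalIntegrable _ _) fun v hv => hQg u hu v hv
      _ = C * ε ^ (-(δ / 2)) * ((∫ u in (-r)..r, ∫ v in (-r)..r, g u v) + 2 * r * M * ε) := by
          rw [intervalIntegral.integral_const_mul, intervalIntegral.integral_add
            (hc3.intervalIntegrable _ _) intervalIntegrable_const, intervalIntegral.integral_const,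
            smul_eq_mul]
          ring
      _ ≤ _ := by gcongr
  have h3 := hint (fun z => Q z (Complex.I * t)) M ε (h₁ _ (hball t ht))
    (fun z hz => hQM z hz _ (hball t ht)) hε hε1 k hk s hs
  refine h3.trans ?_
  have e2 : ε ^ (1 - δ) = ε ^ (-(δ / 2)) * (ε ^ (-(δ / 2)) * ε) := by
    rw [← Real.rpow_add_one hε.ne', ← Real.rpow_add hε]
    congr 1; ring
  have hE : 0 ≤ ε ^ (-(δ / 2)) := by positivity
  calc C * ε ^ (-(δ / 2)) * ((∫ u in (-r)..r, ‖Q (Complex.I * u) (Complex.I * t)‖) + M * ε)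
      ≤ C * ε ^ (-(δ / 2)) * (C * ε ^ (-(δ / 2)) * (D * ε + 2 * r * M * ε)
          + M * (ε ^ (-(δ / 2)) * ε)) := by
        gcongr
        exact le_mul_of_one_le_left hε.le e1
    _ = C * (C * (D + 2 * r * M) + M) * ε ^ (1 - δ) := by rw [e2]; ring

/-- Pointwise `g ≤ g ^ 2 / (2 ε) + ε / 2`. The square has area `4 * r ^ 2`, and `c ^ 2` is the lower
bound of the denominators by which `g` will be divided. -/
theorem integral_square_le {r ε κ c : ℝ} {g : ℝ → ℝ → ℝ} (hr : 0 < r) (hε : 0 < ε) (hc : 0 < c)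
    (hg : Continuous (Function.uncurry g))
    (h : (∫ s in (-r)..r, ∫ t in (-r)..r, g s t ^ 2) ≤ κ * ε ^ 2) :
    (∫ s in (-r)..r, ∫ t in (-r)..r, g s t / c ^ 2) ≤ (κ + 4 * r ^ 2) / (2 * c ^ 2) * ε := by
  have hrr : -r ≤ r := by linarith
  have cg : Continuous (Function.uncurry fun s t : ℝ => g s t / c ^ 2) := hg.div_const _
  have cg2 : Continuous (Function.uncurry fun s t : ℝ => g s t ^ 2) := hg.pow 2
  have hsec : ∀ (k : ℝ → ℝ → ℝ), Continuous (Function.uncurry k) → ∀ s, Continuous fun t => k s t :=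
    fun k hk s => hk.comp (by fun_prop : Continuous fun v : ℝ => ((s, v) : ℝ × ℝ))
  have i1 := intervalIntegral.continuous_parametric_intervalIntegral_of_continuous' (μ := volume)
    cg (-r) r
  have i2 := intervalIntegral.continuous_parametric_intervalIntegral_of_continuous' (μ := volume)
    cg2 (-r) r
  calc (∫ s in (-r)..r, ∫ t in (-r)..r, g s t / c ^ 2)
      ≤ ∫ s in (-r)..r, ((∫ t in (-r)..r, g s t ^ 2)
          * (1 / (2 * ε * c ^ 2)) + 2 * r * (ε / (2 * c ^ 2))) := by
        refine intervalIntegral.integral_mono_on hrr (i1.intervalIntegrable _ _)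
          (((i2.mul_const _).add_const _).intervalIntegrable _ _) fun s _ => ?_
        rw [← intervalIntegral.integral_mul_const]
        have : 2 * r * (ε / (2 * c ^ 2)) = ∫ _t in (-r)..r, ε / (2 * c ^ 2) := by
          rw [intervalIntegral.integral_const, smul_eq_mul]; ring
        rw [this, ← intervalIntegral.integral_add
          (((hsec _ cg2 s).mul_const _).intervalIntegrable _ _) intervalIntegrable_const]
        refine intervalIntegral.integral_mono_on hrr ((hsec _ cg s).intervalIntegrable _ _)
          ((((hsec _ cg2 s).mul_const _).add_const _).intervalIntegrable _ _) fun t _ => ?_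
        have : g s t ^ 2 * (1 / (2 * ε * c ^ 2)) + ε / (2 * c ^ 2) - g s t / c ^ 2
            = (g s t - ε) ^ 2 / (2 * ε * c ^ 2) := by
          field_simp; ring
        have h2 : 0 ≤ (g s t - ε) ^ 2 / (2 * ε * c ^ 2) := by positivity
        linarith
    _ = (∫ s in (-r)..r, ∫ t in (-r)..r, g s t ^ 2)
          * (1 / (2 * ε * c ^ 2)) + 2 * r * (2 * r * (ε / (2 * c ^ 2))) := by
        rw [intervalIntegral.integral_add ((i2.mul_const _).intervalIntegrable _ _)
          intervalIntegrable_const, intervalIntegral.integral_mul_const,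
          intervalIntegral.integral_const, smul_eq_mul]
        ring
    _ ≤ κ * ε ^ 2 * (1 / (2 * ε * c ^ 2)) + 2 * r * (2 * r * (ε / (2 * c ^ 2))) := by gcongr
    _ = (κ + 4 * r ^ 2) / (2 * c ^ 2) * ε := by field_simp; ring

variable {α : Type*} [MeasurableSpace α] {μ : Measure α}

/-- The vanishing of this function expresses that two Laplace transforms have the same dependence
structure. -/
def crossDefect (μ : Measure α) (X Y : α → ℝ) (f : α → ℂ) (Xs Ys : α → ℝ) (fs : α → ℂ)
    (z w : ℂ) : ℂ :=
  lap μ X Y f z w * lap μ Xs Ys fs z 0 * lap μ Xs Ys fs 0 w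
    - lap μ Xs Ys fs z w * lap μ X Y f z 0 * lap μ X Y f 0 w

variable [IsFiniteMeasure μ] {Rs : ℝ} {X Y : α → ℝ} {fs : α → ℝ} {m₁ m₂ : ℝ → ℝ → ℝ}
  {x : Fin 4 → ℝ × ℝ}

set_option maxHeartbeats 1000000 in
-- Division by the reference marginals turns the cross defect into the dependence defect,
-- interpolation bounds the latter and its second derivatives, and stability transfers the bound to
-- the Wronskians at `0`.
theorem DensityOnCircle.center_le (hc : CircleChart μ 1 X Y)
    (hs : DensityOnCircle μ Rs (fun a => Rs * X a) (fun a => Rs * Y a) fs m₁ m₂ x)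
    {F : Set (Lp ℝ 2 μ)} (hF : IsCompact F) (hF1 : ∀ f ∈ F, ∫ a, (f a : ℝ) ∂μ = 1)
    {Rmin Rmax r δ : ℝ} (hRmin : 0 < Rmin) (hr : 0 < r) (hδ : 0 < δ)
    (hp0 : ∀ z ∈ Metric.closedBall (0 : ℂ) (2 * r), lap μ (fun a => Rs * X a) (fun a => Rs * Y a)
      (fun a => (fs a : ℂ)) z 0 ≠ 0)
    (hq0 : ∀ w ∈ Metric.closedBall (0 : ℂ) (2 * r), lap μ (fun a => Rs * X a) (fun a => Rs * Y a)
      (fun a => (fs a : ℂ)) 0 w ≠ 0) (κ : ℝ) (hκ : 0 < κ) :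
    ∃ C : ℝ, 0 ≤ C ∧ ∀ f ∈ F, ∀ R ∈ Set.Icc Rmin Rmax, ∀ ε : ℝ, 0 < ε → ε ≤ 1 →
      (∫ s in (-r)..r, ∫ t in (-r)..r,
        ‖crossDefect μ (fun a => R * X a) (fun a => R * Y a) (fun a => ((f a : ℝ) : ℂ))
          (fun a => Rs * X a) (fun a => Rs * Y a) (fun a => (fs a : ℂ))
          (Complex.I * s) (Complex.I * t)‖ ^ 2) ≤ κ * ε ^ 2 →
      ‖marginalWronskian μ (fun a => R * X a) (fun a => R * Y a) (fun a => ((f a : ℝ) : ℂ))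
          (fun a => Rs * X a) (fun a => Rs * Y a) (fun a => (fs a : ℂ)) 0‖ ≤ C * ε ^ (1 - δ) ∧
      ‖marginalWronskian μ (fun a => R * Y a) (fun a => R * X a) (fun a => ((f a : ℝ) : ℂ))
          (fun a => Rs * Y a) (fun a => Rs * X a) (fun a => (fs a : ℂ)) 0‖ ≤ C * ε ^ (1 - δ) := by
  obtain ⟨C₁, hC₁, hCf⟩ := exists_integral_norm_le (μ := μ)
  obtain ⟨BF, hBF⟩ := hF.isBounded.exists_norm_le
  have hfM : ∀ f ∈ F, ∫ a, ‖((f a : ℝ) : ℂ)‖ ∂μ ≤ C₁ * BF := fun f hf =>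
    (hCf f).2.trans (mul_le_mul_of_nonneg_left (hBF _ hf) hC₁)
  have hsc := hs.chart
  have hsint : Integrable (fun a => (fs a : ℂ)) μ := hs.integrable.ofReal
  set Ls := lap μ (fun a => Rs * X a) (fun a => Rs * Y a) (fun a => (fs a : ℂ)) with hLs
  have dls : ∀ w, Differentiable ℂ fun z => Ls z w := fun w z =>
    (hsc.hasDerivAt₁ hsint z w).differentiableAt
  have drs : ∀ z, Differentiable ℂ fun w => Ls z w := fun z w =>
    (hsc.hasDerivAt₂ hsint z w).differentiableAt
  have hball0 : (Metric.closedBall (0 : ℂ) (2 * r)).Nonempty := ⟨0, by simp [hr.le]⟩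
  obtain ⟨z₁, hz₁, hmin₁⟩ := (isCompact_closedBall (0 : ℂ) (2 * r)).exists_isMinOn hball0
    (dls 0).continuous.norm.continuousOn
  obtain ⟨z₂, hz₂, hmin₂⟩ := (isCompact_closedBall (0 : ℂ) (2 * r)).exists_isMinOn hball0
    (drs 0).continuous.norm.continuousOn
  obtain ⟨c, hc0, hcp, hcq⟩ : ∃ c : ℝ, 0 < c ∧ (∀ z ∈ Metric.closedBall (0 : ℂ) (2 * r), c ≤ ‖Ls z 0‖) ∧
      ∀ w ∈ Metric.closedBall (0 : ℂ) (2 * r), c ≤ ‖Ls 0 w‖ :=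
    ⟨min ‖Ls z₁ 0‖ ‖Ls 0 z₂‖, lt_min (norm_pos_iff.2 (hp0 _ hz₁)) (norm_pos_iff.2 (hq0 _ hz₂)),
      fun z hz => (min_le_left _ _).trans (hmin₁ hz), fun w hw => (min_le_right _ _).trans (hmin₂ hw)⟩
  have hsub : Metric.ball (0 : ℂ) (2 * r) ⊆ Metric.closedBall 0 (2 * r) := Metric.ball_subset_closedBall
  have hnorm : ∀ z ∈ Metric.ball (0 : ℂ) (2 * r), ‖z‖ ≤ 2 * r := fun z hz => by
    simpa using hsub hz
  have h00 : (0 : ℂ) ∈ Metric.ball (0 : ℂ) (2 * r) := by simp [hr]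
  set ML := Real.exp (Rmax * (2 * r + 2 * r)) * (C₁ * BF) with hML
  set MS := Real.exp (Rs * (2 * r + 2 * r)) * ∫ a, ‖(fs a : ℂ)‖ ∂μ with hMS
  have hLsb : ∀ z ∈ Metric.ball (0 : ℂ) (2 * r), ∀ w ∈ Metric.ball (0 : ℂ) (2 * r), ‖Ls z w‖ ≤ MS := by
    intro z hz w hw
    refine (norm_lap_le hsc.abs_le₁ hsc.abs_le₂ hsint z w).trans ?_
    refine mul_le_mul_of_nonneg_right (Real.exp_le_exp.2 ?_) (integral_nonneg fun _ => norm_nonneg _)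
    exact mul_le_mul_of_nonneg_left (add_le_add (hnorm z hz) (hnorm w hw)) hsc.radius_pos.le
  have hMS0 : 0 ≤ MS := mul_nonneg (Real.exp_pos _).le (integral_nonneg fun _ => norm_nonneg _)
  -- If `F` is empty its norm bound `BF` may be negative; otherwise an element shows that the
  -- constants are nonnegative.
  by_cases hne : F.Nonempty
  swap
  · exact ⟨0, le_rfl, fun f hf => absurd ⟨f, hf⟩ hne⟩
  obtain ⟨f₁, hf₁⟩ := hne
  have hML0 : 0 ≤ ML := mul_nonneg (Real.exp_pos _).le
    ((integral_nonneg fun _ => norm_nonneg _).trans (hfM f₁ hf₁))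
  -- This bound of `Q` on the bidisc does not depend on `(f, R)`, so neither does the interpolation
  -- constant.
  set M := ML + MS * (ML / c) * (ML / c) with hM
  have hM0 : 0 ≤ M := by positivity
  set D := (κ + 4 * r ^ 2) / (2 * c ^ 2) with hD
  have hD0 : 0 ≤ D := by positivity
  obtain ⟨C₂, hC₂, hinterp⟩ := analytic_interpolation_two hr hδ hM0 hD0
  have hrange : ∀ s ∈ Set.Icc (-r) r, Complex.I * (s : ℂ) ∈ Metric.closedBall (0 : ℂ) (2 * r) := by
    intro t ht
    rw [mem_closedBall_zero_iff, norm_mul, Complex.norm_I, one_mul, Complex.norm_real,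
      Real.norm_eq_abs]
    have := abs_le.2 ht
    linarith
  obtain ⟨C₃, hC₃, hstab⟩ := hs.stability hc hF hF1 (Rmax := Rmax) hRmin hr
    (fun s hs => hp0 _ (hrange s hs)) (fun s hs => hq0 _ (hrange s hs))
  refine ⟨C₃ * (C₂ * (2 + Rmax ^ 2)), by positivity, fun f hf R hR ε hε hε1 hG => ?_⟩
  have hRpos : 0 < R := hRmin.trans_le hR.1
  have chart : CircleChart μ R (fun a => R * X a) (fun a => R * Y a) := by
    simpa using hc.scale hRpos
  have hint := (hCf f).1
  set L := lap μ (fun a => R * X a) (fun a => R * Y a) (fun a => ((f a : ℝ) : ℂ)) with hL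
  have dl : ∀ w, Differentiable ℂ fun z => L z w := fun w z =>
    (chart.hasDerivAt₁ hint z w).differentiableAt
  have dr : ∀ z, Differentiable ℂ fun w => L z w := fun z w =>
    (chart.hasDerivAt₂ hint z w).differentiableAt
  have hLb : ∀ z ∈ Metric.ball (0 : ℂ) (2 * r), ∀ w ∈ Metric.ball (0 : ℂ) (2 * r), ‖L z w‖ ≤ ML := by
    intro z hz w hw
    refine (norm_lap_le chart.abs_le₁ chart.abs_le₂ hint z w).trans ?_
    refine mul_le_mul (Real.exp_le_exp.2 ?_) (hfM f hf) (integral_nonneg fun _ => norm_nonneg _)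
      (Real.exp_pos _).le
    exact mul_le_mul hR.2 (add_le_add (hnorm z hz) (hnorm w hw)) (by positivity)
      (hRpos.le.trans hR.2)
  obtain ⟨Q, hQ⟩ : ∃ Q : ℂ → ℂ → ℂ, Q = dependenceDefect μ (fun a => R * X a) (fun a => R * Y a)
    (fun a => ((f a : ℝ) : ℂ)) (fun a => Rs * X a) (fun a => Rs * Y a) (fun a => (fs a : ℂ)) :=
    ⟨_, rfl⟩
  obtain ⟨G, hGdef⟩ : ∃ G : ℂ → ℂ → ℂ, G = crossDefect μ (fun a => R * X a) (fun a => R * Y a)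
    (fun a => ((f a : ℝ) : ℂ)) (fun a => Rs * X a) (fun a => Rs * Y a) (fun a => (fs a : ℂ)) :=
    ⟨_, rfl⟩
  rw [← hGdef] at hG
  have eQ : ∀ z w, Q z w = L z w - Ls z w * (L z 0 / Ls z 0) * (L 0 w / Ls 0 w) := fun z w => by
    rw [hQ]; rfl
  have eG : ∀ z w, G z w = L z w * Ls z 0 * Ls 0 w - Ls z w * L z 0 * L 0 w := fun z w => by
    rw [hGdef]; rfl
  have hQM : ∀ z ∈ Metric.ball (0 : ℂ) (2 * r), ∀ w ∈ Metric.ball (0 : ℂ) (2 * r), ‖Q z w‖ ≤ M := by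
    intro z hz w hw
    rw [eQ]
    refine (norm_sub_le _ _).trans (add_le_add (hLb z hz w hw) ?_)
    rw [norm_mul, norm_mul, norm_div, norm_div]
    have h1 := div_le_div₀ hML0 (hLb z hz 0 h00) hc0 (hcp z (hsub hz))
    have h2 := div_le_div₀ hML0 (hLb 0 h00 w hw) hc0 (hcq w (hsub hw))
    exact mul_le_mul (mul_le_mul (hLsb z hz w hw) h1 (by positivity) hMS0) h2 (by positivity)
      (by positivity)
  have hQd₁ : ∀ w ∈ Metric.ball (0 : ℂ) (2 * r),
      DifferentiableOn ℂ (fun z => Q z w) (Metric.ball 0 (2 * r)) := fun w _ => by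
    simp only [eQ]
    exact (dl w).differentiableOn.sub (((dls w).differentiableOn.mul
      ((dl 0).differentiableOn.div (dls 0).differentiableOn fun z hz => hp0 z (hsub hz))).mul_const _)
  have hQd₂ : ∀ z ∈ Metric.ball (0 : ℂ) (2 * r),
      DifferentiableOn ℂ (fun w => Q z w) (Metric.ball 0 (2 * r)) := fun z _ => by
    simp only [eQ]
    exact (dr z).differentiableOn.sub (((drs z).differentiableOn.mul_const _).mul
      ((dr 0).differentiableOn.div (drs 0).differentiableOn fun w hw => hq0 w (hsub hw)))
  have cL : Continuous fun u : ℂ × ℂ => L u.1 u.2 :=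
    continuous_lap chart.meas₁ chart.meas₂ chart.abs_le₁ chart.abs_le₂ hint
  have cLs : Continuous fun u : ℂ × ℂ => Ls u.1 u.2 :=
    continuous_lap hsc.meas₁ hsc.meas₂ hsc.abs_le₁ hsc.abs_le₂ hsint
  have cG : Continuous fun u : ℝ × ℝ => G (Complex.I * u.1) (Complex.I * u.2) := by
    have c1 : Continuous fun u : ℝ × ℝ => L (Complex.I * u.1) (Complex.I * u.2) :=
      cL.comp (by fun_prop : Continuous fun u : ℝ × ℝ =>
        ((Complex.I * u.1, Complex.I * u.2) : ℂ × ℂ))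
    have c2 : Continuous fun u : ℝ × ℝ => Ls (Complex.I * u.1) (Complex.I * u.2) :=
      cLs.comp (by fun_prop : Continuous fun u : ℝ × ℝ =>
        ((Complex.I * u.1, Complex.I * u.2) : ℂ × ℂ))
    have c3 := (dl 0).continuous
    have c4 := (dls 0).continuous
    have c5 := (dr 0).continuous
    have c6 := (drs 0).continuous
    have k3 : Continuous fun u : ℝ × ℝ => L (Complex.I * u.1) 0 := c3.comp (by fun_prop)
    have k4 : Continuous fun u : ℝ × ℝ => Ls (Complex.I * u.1) 0 := c4.comp (by fun_prop)
    have k5 : Continuous fun u : ℝ × ℝ => L 0 (Complex.I * u.2) := c5.comp (by fun_prop)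
    have k6 : Continuous fun u : ℝ × ℝ => Ls 0 (Complex.I * u.2) := c6.comp (by fun_prop)
    simp only [eG]
    exact ((c1.mul k4).mul k6).sub ((c2.mul k3).mul k5)
  have hQG : ∀ s ∈ Set.Icc (-r) r, ∀ t ∈ Set.Icc (-r) r, ‖Q (Complex.I * s) (Complex.I * t)‖
      ≤ ‖G (Complex.I * s) (Complex.I * t)‖ / c ^ 2 := by
    intro s hs t ht
    have n1 := hcp _ (hrange s hs)
    have n2 := hcq _ (hrange t ht)
    have e : G (Complex.I * s) (Complex.I * t) = Q (Complex.I * s) (Complex.I * t)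
        * (Ls (Complex.I * s) 0 * Ls 0 (Complex.I * t)) := by
      have n3 : Ls (Complex.I * s) 0 ≠ 0 := hp0 _ (hrange s hs)
      have n4 : Ls 0 (Complex.I * t) ≠ 0 := hq0 _ (hrange t ht)
      rw [eQ, eG]
      field_simp
    rw [le_div_iff₀ (by positivity), e, norm_mul, norm_mul, sq]
    exact mul_le_mul_of_nonneg_left (mul_le_mul n1 n2 hc0.le (norm_nonneg _)) (norm_nonneg _)
  have hrr : -r ≤ r := by linarith
  have cg : Continuous (Function.uncurry fun s t : ℝ =>
      ‖G (Complex.I * s) (Complex.I * t)‖ / c ^ 2) := by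
    exact (cG.norm.div_const _)
  have hJ : (∫ s in (-r)..r, ∫ t in (-r)..r, ‖G (Complex.I * s) (Complex.I * t)‖ / c ^ 2) ≤ D * ε :=
    integral_square_le hr hε hc0 cG.norm hG
  have hJ' : (∫ t in (-r)..r, ∫ s in (-r)..r, ‖G (Complex.I * s) (Complex.I * t)‖ / c ^ 2) ≤ D * ε := by
    rw [intervalIntegral_intervalIntegral_swap]
    · exact hJ
    · exact (cg.comp continuous_swap).continuousOn.integrableOn_compact
        (isCompact_uIcc.prod isCompact_uIcc) |>.mono_set
          (Set.prod_mono Set.uIoc_subset_uIcc Set.uIoc_subset_uIcc)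
  have b1 := hinterp Q (fun s t => ‖G (Complex.I * s) (Complex.I * t)‖ / c ^ 2) ε hQd₁ hQd₂ hQM cg hQG hε hε1 hJ
  have b2 := hinterp (fun w z => Q z w) (fun t s => ‖G (Complex.I * s) (Complex.I * t)‖ / c ^ 2) ε
    hQd₂ hQd₁ (fun z hz w hw => hQM w hw z hz) (cg.comp continuous_swap)
    (fun s hs t ht => hQG t ht s hs) hε hε1 hJ'
  have hEpos : 0 ≤ ε ^ (1 - δ) := by positivity
  have hE2 : C₂ * ε ^ (1 - δ) ≤ C₂ * (2 + Rmax ^ 2) * ε ^ (1 - δ) := by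
    have : 0 ≤ C₂ * ε ^ (1 - δ) * (1 + Rmax ^ 2) := by positivity
    linarith
  have hst := hstab f hf R hR
  simp only [helmholtzDefect, ← hQ] at hst
  -- The factor `2 + Rmax ^ 2` covers two second derivatives and the term with `R ^ 2`; it also
  -- exceeds `1`, as the defect itself requires.
  have key := hst (C₂ * (2 + Rmax ^ 2) * ε ^ (1 - δ)) (by positivity)
    fun s hs t ht => ⟨?_, ?_⟩
  · rw [mul_assoc C₃]
    exact key
  · have := b1 s hs t ht 0 (by norm_num)
    rw [iteratedDeriv_zero] at this
    exact this.trans hE2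
  · have h0 := b1 s hs t ht 0 (by norm_num)
    rw [iteratedDeriv_zero] at h0
    have h1 := b1 s hs t ht 2 le_rfl
    have h2 := b2 t ht s hs 2 le_rfl
    refine (norm_sub_le _ _).trans ?_
    have h3 := norm_add_le (iteratedDeriv 2 (fun z => Q z (Complex.I * t)) (Complex.I * s))
      (iteratedDeriv 2 (fun w => Q (Complex.I * s) w) (Complex.I * t))
    have h4 : ‖(R : ℂ) ^ 2 * Q (Complex.I * s) (Complex.I * t)‖
        ≤ Rmax ^ 2 * (C₂ * ε ^ (1 - δ)) := by
      rw [norm_mul, norm_pow, Complex.norm_real, Real.norm_of_nonneg hRpos.le]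
      have := hR.2
      exact mul_le_mul (by gcongr) h0 (norm_nonneg _) (by positivity)
    refine (add_le_add h3 h4).trans ?_
    linarith

end CircleDeconv

end

/-! ### Means of orthogonal random vectors -/

noncomputable section

namespace CircleDeconv

open Filter Topology

section Orthogonal

theorem integrable_inner_of_memLp {Ω : Type*} [MeasurableSpace Ω] {P : Measure Ω} {E : Type*}
    [NormedAddCommGroup E] [InnerProductSpace ℝ E] {f g : Ω → E} (hf : MemLp f 2 P)
    (hg : MemLp g 2 P) : Integrable (fun ω => inner ℝ (f ω) (g ω)) P := by
  refine (hf.norm.integrable_mul hg.norm).mono' (hf.1.inner hg.1) (Eventually.of_forall fun ω => ?_)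
  exact norm_inner_le_norm _ _

variable {Ω : Type*} [MeasurableSpace Ω] {P : Measure Ω} {E : Type*}
  [NormedAddCommGroup E] [InnerProductSpace ℝ E]

/-- The second moment of a sum of orthogonal random vectors. -/
theorem integral_norm_sum_sq_le {Z : ℕ → Ω → E} (hZ : ∀ l, MemLp (Z l) 2 P)
    (horth : ∀ i j, i ≠ j → ∫ ω, inner ℝ (Z i ω) (Z j ω) ∂P = 0) {c : ℝ}
    (hc : ∀ l, ∫ ω, ‖Z l ω‖ ^ 2 ∂P ≤ c) (n : ℕ) :
    ∫ ω, ‖∑ l ∈ Finset.range n, Z l ω‖ ^ 2 ∂P ≤ n * c := by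
  have e : ∀ ω, ‖∑ l ∈ Finset.range n, Z l ω‖ ^ 2
      = ∑ i ∈ Finset.range n, ∑ j ∈ Finset.range n, inner ℝ (Z i ω) (Z j ω) := fun ω => by
    rw [← real_inner_self_eq_norm_sq, sum_inner]
    simp only [inner_sum]
  simp only [e]
  rw [integral_finsetSum _ fun i _ => integrable_finsetSum _ fun j _ =>
    integrable_inner_of_memLp (hZ i) (hZ j)]
  have : ∀ i ∈ Finset.range n, ∫ ω, ∑ j ∈ Finset.range n, inner ℝ (Z i ω) (Z j ω) ∂P ≤ c := by
    intro i hi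
    rw [integral_finsetSum _ fun j _ => integrable_inner_of_memLp (hZ i) (hZ j),
      Finset.sum_eq_single i (fun j _ hj => horth i j hj.symm) (fun h => absurd hi h)]
    simpa only [real_inner_self_eq_norm_sq] using hc i
  exact (Finset.sum_le_sum this).trans (by simp)

theorem integral_norm_mean_sq_le {Z : ℕ → Ω → E} (hZ : ∀ l, MemLp (Z l) 2 P)
    (horth : ∀ i j, i ≠ j → ∫ ω, inner ℝ (Z i ω) (Z j ω) ∂P = 0) {c : ℝ}
    (hc : ∀ l, ∫ ω, ‖Z l ω‖ ^ 2 ∂P ≤ c) {n : ℕ} (hn : 1 ≤ n) :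
    ∫ ω, ((1 / (n : ℝ)) * ‖∑ l ∈ Finset.range n, Z l ω‖) ^ 2 ∂P ≤ c / n := by
  have hn' : (0 : ℝ) < n := by exact_mod_cast hn
  simp only [mul_pow]
  rw [integral_const_mul]
  calc (1 / (n : ℝ)) ^ 2 * ∫ ω, ‖∑ l ∈ Finset.range n, Z l ω‖ ^ 2 ∂P
      ≤ (1 / (n : ℝ)) ^ 2 * (n * c) := by
        gcongr
        exact integral_norm_sum_sq_le hZ horth hc n
    _ = c / n := by field_simp

/-- The mean of orthogonal random vectors is of order `n ^ (-1 / 2)` in probability. -/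
theorem measure_mean_gt_le [IsFiniteMeasure P] {Z : ℕ → Ω → E} (hZ : ∀ l, MemLp (Z l) 2 P)
    (horth : ∀ i j, i ≠ j → ∫ ω, inner ℝ (Z i ω) (Z j ω) ∂P = 0) {c : ℝ}
    (hc : ∀ l, ∫ ω, ‖Z l ω‖ ^ 2 ∂P ≤ c) {η : ℝ} (hη : 0 < η) :
    ∃ K : ℝ, 0 < K ∧ ∀ n : ℕ, 1 ≤ n →
      P {ω | K * (n : ℝ) ^ (-(1 / 2) : ℝ) < (1 / (n : ℝ)) * ‖∑ l ∈ Finset.range n, Z l ω‖}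
        ≤ ENNReal.ofReal η := by
  have hc0 : 0 ≤ c := (integral_nonneg fun ω => sq_nonneg _).trans (hc 0)
  -- Chebyshev's inequality requires `c ≤ η * K ^ 2`; the summand `1` keeps `K` positive when `c =
  -- 0`.
  refine ⟨Real.sqrt (c / η) + 1, by positivity, fun n hn => ?_⟩
  set K := Real.sqrt (c / η) + 1 with hK
  have hK0 : 0 < K := by positivity
  have hKc : c ≤ η * K ^ 2 := by
    have h1 : Real.sqrt (c / η) ^ 2 = c / η := Real.sq_sqrt (by positivity)
    have h2 : c / η ≤ K ^ 2 := by
      rw [hK]; nlinarith [Real.sqrt_nonneg (c / η)]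
    rwa [div_le_iff₀ hη, mul_comm] at h2
  have hn' : (0 : ℝ) < n := by exact_mod_cast hn
  have hpow : ((n : ℝ) ^ (-(1 / 2) : ℝ)) ^ 2 = 1 / n := by
    rw [← Real.rpow_natCast, ← Real.rpow_mul hn'.le]
    norm_num [Real.rpow_neg_one]
  have hS : MemLp (fun ω => ∑ l ∈ Finset.range n, Z l ω) 2 P := memLp_finsetSum _ fun l _ => hZ l
  have hint : Integrable (fun ω => ((1 / (n : ℝ)) * ‖∑ l ∈ Finset.range n, Z l ω‖) ^ 2) P := by
    simp only [mul_pow]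
    exact (hS.integrable_norm_pow (by norm_num)).const_mul _
  have h1 := mul_meas_ge_le_integral_of_nonneg (Eventually.of_forall fun ω => sq_nonneg _) hint
    (K ^ 2 * (1 / n))
  have h2 := integral_norm_mean_sq_le hZ horth hc hn
  have h3 : P.real {ω | K ^ 2 * (1 / n) ≤ ((1 / (n : ℝ)) * ‖∑ l ∈ Finset.range n, Z l ω‖) ^ 2} ≤ η := by
    have h4 := h1.trans h2
    have h5 : c / n ≤ K ^ 2 * (1 / n) * η := by
      rw [mul_one_div, div_mul_eq_mul_div]
      gcongr
      linarith
    exact le_of_mul_le_mul_left (h4.trans h5) (by positivity)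
  refine (measure_mono fun ω hω => ?_).trans (ENNReal.le_ofReal_iff_toReal_le (measure_ne_top _ _)
    hη.le |>.2 h3)
  have h6 : K * (n : ℝ) ^ (-(1 / 2) : ℝ) < (1 / (n : ℝ)) * ‖∑ l ∈ Finset.range n, Z l ω‖ := hω
  have h7 : K ^ 2 * (1 / n) = (K * (n : ℝ) ^ (-(1 / 2) : ℝ)) ^ 2 := by rw [mul_pow, hpow]
  show K ^ 2 * (1 / n) ≤ (1 / (n : ℝ) * ‖∑ l ∈ Finset.range n, Z l ω‖) ^ 2
  rw [h7]
  exact pow_le_pow_left₀ (by positivity) h6.le 2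

end Orthogonal

/-! ### Comparison of the empirical and population contrasts -/

section Contrast

theorem integrableOn_square {g : ℝ × ℝ → ℝ} (hg : Continuous g) (ν : ℝ) :
    IntegrableOn g (Set.Icc (-ν) ν ×ˢ Set.Icc (-ν) ν) :=
  hg.continuousOn.integrableOn_compact (isCompact_Icc.prod isCompact_Icc)

/-- The squared error of an estimator `E` of `ψ`, together with those of its marginals. -/
def sqError (E ψ : ℝ → ℝ → ℂ) (t : ℝ × ℝ) : ℝ :=
  ‖E t.1 t.2 - ψ t.1 t.2‖ ^ 2 + ‖E t.1 0 - ψ t.1 0‖ ^ 2 + ‖E 0 t.2 - ψ 0 t.2‖ ^ 2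

theorem continuous_sqError {E ψ : ℝ → ℝ → ℂ} (hE : Continuous fun t : ℝ × ℝ => E t.1 t.2)
    (hψ : Continuous fun t : ℝ × ℝ => ψ t.1 t.2) : Continuous (sqError E ψ) := by
  have a : Continuous fun t : ℝ × ℝ => ((t.1, 0) : ℝ × ℝ) := by fun_prop
  have b : Continuous fun t : ℝ × ℝ => ((0, t.2) : ℝ × ℝ) := by fun_prop
  exact (((hE.sub hψ).norm.pow 2).add (((hE.comp a).sub (hψ.comp a)).norm.pow 2)).add
    (((hE.comp b).sub (hψ.comp b)).norm.pow 2)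

/-- The difference telescopes into three terms, each with one error factor. Since `1 ≤ B`, all
coefficients are at most `B ^ 2`, and the square of a sum of three costs a factor `3`. -/
theorem norm_sq_contrast_sub_le {B : ℝ} (hB : 1 ≤ B) {p p₁ p₂ e e₁ e₂ q q₁ q₂ : ℂ} (hp : ‖p‖ ≤ B)
    (hp₁ : ‖p₁‖ ≤ B) (hp₂ : ‖p₂‖ ≤ B) (he₁ : ‖e₁‖ ≤ 1) (hq₂ : ‖q₂‖ ≤ 1) :
    ‖(p * e₁ * e₂ - e * p₁ * p₂) - (p * q₁ * q₂ - q * p₁ * p₂)‖ ^ 2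
      ≤ 3 * B ^ 4 * (‖e - q‖ ^ 2 + ‖e₁ - q₁‖ ^ 2 + ‖e₂ - q₂‖ ^ 2) := by
  have e0 : (p * e₁ * e₂ - e * p₁ * p₂) - (p * q₁ * q₂ - q * p₁ * p₂)
      = p * (e₁ * (e₂ - q₂)) + p * ((e₁ - q₁) * q₂) - (e - q) * (p₁ * p₂) := by ring
  have hB0 : 0 ≤ B := by linarith
  have hBB : B ≤ B ^ 2 := by nlinarith
  have n1 : ‖p * (e₁ * (e₂ - q₂))‖ ≤ B ^ 2 * ‖e₂ - q₂‖ := by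
    rw [norm_mul, norm_mul]
    calc ‖p‖ * (‖e₁‖ * ‖e₂ - q₂‖) ≤ B * (1 * ‖e₂ - q₂‖) := by gcongr
      _ ≤ _ := by rw [one_mul]; gcongr
  have n2 : ‖p * ((e₁ - q₁) * q₂)‖ ≤ B ^ 2 * ‖e₁ - q₁‖ := by
    rw [norm_mul, norm_mul]
    calc ‖p‖ * (‖e₁ - q₁‖ * ‖q₂‖) ≤ B * (‖e₁ - q₁‖ * 1) := by gcongr
      _ ≤ _ := by rw [mul_one]; gcongr
  have n3 : ‖(e - q) * (p₁ * p₂)‖ ≤ B ^ 2 * ‖e - q‖ := by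
    rw [norm_mul, norm_mul, mul_comm]
    calc ‖p₁‖ * ‖p₂‖ * ‖e - q‖ ≤ B * B * ‖e - q‖ := by gcongr
      _ = _ := by ring
  have h1 : ‖(p * e₁ * e₂ - e * p₁ * p₂) - (p * q₁ * q₂ - q * p₁ * p₂)‖
      ≤ B ^ 2 * (‖e - q‖ + ‖e₁ - q₁‖ + ‖e₂ - q₂‖) := by
    rw [e0]
    refine (norm_sub_le _ _).trans ?_
    have := norm_add_le (p * (e₁ * (e₂ - q₂))) (p * ((e₁ - q₁) * q₂))
    linarith
  calc _ ≤ (B ^ 2 * (‖e - q‖ + ‖e₁ - q₁‖ + ‖e₂ - q₂‖)) ^ 2 := by gcongr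
    _ = B ^ 4 * (‖e - q‖ + ‖e₁ - q₁‖ + ‖e₂ - q₂‖) ^ 2 := by ring
    _ ≤ B ^ 4 * (3 * (‖e - q‖ ^ 2 + ‖e₁ - q₁‖ ^ 2 + ‖e₂ - q₂‖ ^ 2)) := by
        gcongr
        nlinarith [sq_nonneg (‖e - q‖ - ‖e₁ - q₁‖), sq_nonneg (‖e - q‖ - ‖e₂ - q₂‖),
          sq_nonneg (‖e₁ - q₁‖ - ‖e₂ - q₂‖)]
    _ = _ := by ring

/-- A near minimizer of the empirical contrast makes the population contrast small. -/
theorem integral_crossDefect_le {B ν r τ : ℝ} (hB : 1 ≤ B) (hrν : r ≤ ν) {p ps E ψ w : ℝ → ℝ → ℂ}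
    (cp : Continuous fun t : ℝ × ℝ => p t.1 t.2) (cps : Continuous fun t : ℝ × ℝ => ps t.1 t.2)
    (cE : Continuous fun t : ℝ × ℝ => E t.1 t.2) (cψ : Continuous fun t : ℝ × ℝ => ψ t.1 t.2)
    (hp : ∀ s t, ‖p s t‖ ≤ B) (hps : ∀ s t, ‖ps s t‖ ≤ B) (hE : ∀ s t, ‖E s t‖ ≤ 1)
    (hψ : ∀ s t, ‖ψ s t‖ ≤ 1) (hw : ∀ s t, ψ s t = w s t * ps s t)
    (hw' : ∀ s t, ψ s 0 * ψ 0 t = w s t * (ps s 0 * ps 0 t))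
    (hwr : ∀ s ∈ Set.Icc (-r) r, ∀ t ∈ Set.Icc (-r) r, 1 / 2 ≤ ‖w s t‖)
    (hmin : ∫ t in Set.Icc (-ν) ν ×ˢ Set.Icc (-ν) ν,
        ‖p t.1 t.2 * E t.1 0 * E 0 t.2 - E t.1 t.2 * p t.1 0 * p 0 t.2‖ ^ 2
      ≤ (∫ t in Set.Icc (-ν) ν ×ˢ Set.Icc (-ν) ν,
        ‖ps t.1 t.2 * E t.1 0 * E 0 t.2 - E t.1 t.2 * ps t.1 0 * ps 0 t.2‖ ^ 2) + τ) :
    ∫ t in Set.Icc (-r) r ×ˢ Set.Icc (-r) r,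
        ‖p t.1 t.2 * ps t.1 0 * ps 0 t.2 - ps t.1 t.2 * p t.1 0 * p 0 t.2‖ ^ 2
      ≤ 48 * B ^ 4 * (∫ t in Set.Icc (-ν) ν ×ˢ Set.Icc (-ν) ν, sqError E ψ t) + 8 * τ := by
  have a : Continuous fun t : ℝ × ℝ => ((t.1, 0) : ℝ × ℝ) := by fun_prop
  have b : Continuous fun t : ℝ × ℝ => ((0, t.2) : ℝ × ℝ) := by fun_prop
  have cc : ∀ {k l : ℝ → ℝ → ℂ}, Continuous (fun t : ℝ × ℝ => k t.1 t.2) →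
      Continuous (fun t : ℝ × ℝ => l t.1 t.2) → Continuous fun t : ℝ × ℝ =>
        ‖k t.1 t.2 * l t.1 0 * l 0 t.2 - l t.1 t.2 * k t.1 0 * k 0 t.2‖ ^ 2 := by
    intro k l hk hl
    exact ((((hk.mul (hl.comp a)).mul (hl.comp b)).sub ((hl.mul (hk.comp a)).mul (hk.comp b))).norm.pow 2)
  have iz := integrableOn_square (continuous_sqError cE cψ) ν
  have ipE := integrableOn_square (cc cp cE) ν
  have ipsE := integrableOn_square (cc cps cE) ν
  have ipψ := integrableOn_square (cc cp cψ) ν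
  have hsubset : Set.Icc (-r) r ×ˢ Set.Icc (-r) r ⊆ Set.Icc (-ν) ν ×ˢ Set.Icc (-ν) ν :=
    Set.prod_mono (Set.Icc_subset_Icc (by linarith) hrν) (Set.Icc_subset_Icc (by linarith) hrν)
  have hsq : MeasurableSet (Set.Icc (-r) r ×ˢ Set.Icc (-r) r) := measurableSet_Icc.prod measurableSet_Icc
  set S := Set.Icc (-ν) ν ×ˢ Set.Icc (-ν) ν with hS
  -- The noise factor `w` comes out of both products, because it is itself a product of a function
  -- of `s` and one of `t`.
  have hD : ∀ t : ℝ × ℝ, p t.1 t.2 * ψ t.1 0 * ψ 0 t.2 - ψ t.1 t.2 * p t.1 0 * p 0 t.2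
      = w t.1 t.2 * (p t.1 t.2 * ps t.1 0 * ps 0 t.2 - ps t.1 t.2 * p t.1 0 * p 0 t.2) := fun t => by
    rw [hw t.1 t.2]
    linear_combination p t.1 t.2 * hw' t.1 t.2
  -- At the true parameters the population contrast vanishes, so the empirical one is pure
  -- estimation error.
  have h1 : ∫ t in S, ‖ps t.1 t.2 * E t.1 0 * E 0 t.2 - E t.1 t.2 * ps t.1 0 * ps 0 t.2‖ ^ 2
      ≤ 3 * B ^ 4 * ∫ t in S, sqError E ψ t := by
    rw [← integral_const_mul]
    refine integral_mono ipsE (iz.const_mul _) fun t => ?_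
    have h2 := norm_sq_contrast_sub_le hB (hps t.1 t.2) (hps t.1 0) (hps 0 t.2) (hE t.1 0) (hψ 0 t.2)
      (e := E t.1 t.2) (e₂ := E 0 t.2) (q := ψ t.1 t.2) (q₁ := ψ t.1 0)
    have h3 : ps t.1 t.2 * ψ t.1 0 * ψ 0 t.2 - ψ t.1 t.2 * ps t.1 0 * ps 0 t.2 = 0 := by
      rw [hw t.1 t.2]
      linear_combination ps t.1 t.2 * hw' t.1 t.2
    rw [h3, sub_zero] at h2
    exact h2
  have h4 : ∫ t in S, ‖p t.1 t.2 * ψ t.1 0 * ψ 0 t.2 - ψ t.1 t.2 * p t.1 0 * p 0 t.2‖ ^ 2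
      ≤ 2 * (∫ t in S, ‖p t.1 t.2 * E t.1 0 * E 0 t.2 - E t.1 t.2 * p t.1 0 * p 0 t.2‖ ^ 2)
        + 6 * B ^ 4 * ∫ t in S, sqError E ψ t := by
    rw [← integral_const_mul, ← integral_const_mul, ← integral_add (ipE.const_mul 2) (iz.const_mul _)]
    refine integral_mono ipψ ((ipE.const_mul 2).add (iz.const_mul _)) fun t => ?_
    have h2 := norm_sq_contrast_sub_le hB (hp t.1 t.2) (hp t.1 0) (hp 0 t.2) (hE t.1 0) (hψ 0 t.2)
      (e := E t.1 t.2) (e₂ := E 0 t.2) (q := ψ t.1 t.2) (q₁ := ψ t.1 0)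
    set u := p t.1 t.2 * E t.1 0 * E 0 t.2 - E t.1 t.2 * p t.1 0 * p 0 t.2 with hu
    set v := p t.1 t.2 * ψ t.1 0 * ψ 0 t.2 - ψ t.1 t.2 * p t.1 0 * p 0 t.2 with hv
    have h5 : ‖v‖ ≤ ‖u‖ + ‖u - v‖ := by
      have := norm_sub_le u (u - v)
      rwa [sub_sub_cancel] at this
    have h6 : ‖v‖ ^ 2 ≤ 2 * ‖u‖ ^ 2 + 2 * ‖u - v‖ ^ 2 := by
      have h7 : ‖v‖ ^ 2 ≤ (‖u‖ + ‖u - v‖) ^ 2 := by gcongr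
      nlinarith [sq_nonneg (‖u‖ - ‖u - v‖)]
    change ‖v‖ ^ 2 ≤ 2 * ‖u‖ ^ 2 + 6 * B ^ 4 * sqError E ψ t
    have h8 : ‖u - v‖ ^ 2 ≤ 3 * B ^ 4 * sqError E ψ t := h2
    linarith
  -- On the small square `‖w‖ ^ 2 ≥ 1 / 4`, hence the factor `4`. The final constants are `4 * (2 *
  -- 3 + 6) = 48` and `4 * 2 = 8`.
  have h9 : ∫ t in Set.Icc (-r) r ×ˢ Set.Icc (-r) r,
        ‖p t.1 t.2 * ps t.1 0 * ps 0 t.2 - ps t.1 t.2 * p t.1 0 * p 0 t.2‖ ^ 2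
      ≤ 4 * ∫ t in S, ‖p t.1 t.2 * ψ t.1 0 * ψ 0 t.2 - ψ t.1 t.2 * p t.1 0 * p 0 t.2‖ ^ 2 := by
    calc _ ≤ ∫ t in Set.Icc (-r) r ×ˢ Set.Icc (-r) r,
          4 * ‖p t.1 t.2 * ψ t.1 0 * ψ 0 t.2 - ψ t.1 t.2 * p t.1 0 * p 0 t.2‖ ^ 2 := by
          refine setIntegral_mono_on (integrableOn_square (cc cp cps) r)
            ((ipψ.mono_set hsubset).const_mul 4) hsq fun t ht => ?_
          rw [hD, norm_mul, mul_pow]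
          have h10 := hwr t.1 ht.1 t.2 ht.2
          have h11 : (1 / 2 : ℝ) ^ 2 ≤ ‖w t.1 t.2‖ ^ 2 := by gcongr
          nlinarith [sq_nonneg ‖p t.1 t.2 * ps t.1 0 * ps 0 t.2 - ps t.1 t.2 * p t.1 0 * p 0 t.2‖]
      _ = 4 * ∫ t in Set.Icc (-r) r ×ˢ Set.Icc (-r) r,
          ‖p t.1 t.2 * ψ t.1 0 * ψ 0 t.2 - ψ t.1 t.2 * p t.1 0 * p 0 t.2‖ ^ 2 :=
          integral_const_mul _ _
      _ ≤ _ := by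
          exact mul_le_mul_of_nonneg_left (setIntegral_mono_set ipψ
            (Eventually.of_forall fun t => sq_nonneg _) (Eventually.of_forall hsubset))
            (by norm_num)
  linarith

end Contrast

end CircleDeconv

end

/-! ### Independence and the empirical characteristic function -/

noncomputable section

namespace CircleDeconv

open Filter Topology

section Independence

variable {Ω : Type*} [MeasurableSpace Ω] {P : Measure Ω}

/-- Rectangles form a generating π-system, on which the required factorization is a regrouping of
four factors. It gives independence of two observations from independence within the angles, within
the noise, and between them. -/
theorem indepFun_prodMk_prodMk_of_indepFun [IsProbabilityMeasure P] {α β : Type*} [MeasurableSpace α] [MeasurableSpace β]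
    {A B : Ω → α} {C D : Ω → β} (hA : Measurable A) (hB : Measurable B) (hC : Measurable C)
    (hD : Measurable D) (hAB : IndepFun A B P) (hCD : IndepFun C D P)
    (h : IndepFun (fun ω => (A ω, B ω)) (fun ω => (C ω, D ω)) P) :
    IndepFun (fun ω => (A ω, C ω)) (fun ω => (B ω, D ω)) P := by
  have hAC : IndepFun A C P := h.comp measurable_fst measurable_fst
  have hBD : IndepFun B D P := h.comp measurable_snd measurable_snd
  have hgen : ∀ {K : Ω → α} {L : Ω → β}, MeasurableSpace.comap (fun ω => (K ω, L ω)) Prod.instMeasurableSpace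
      = MeasurableSpace.generateFrom (Set.preimage (fun ω => (K ω, L ω)) ''
        Set.image2 (· ×ˢ ·) {s : Set α | MeasurableSet s} {t : Set β | MeasurableSet t}) := by
    intro K L
    rw [← MeasurableSpace.comap_generateFrom, generateFrom_prod]
  have hpi : ∀ {K : Ω → α} {L : Ω → β}, IsPiSystem (Set.preimage (fun ω => (K ω, L ω)) ''
        Set.image2 (· ×ˢ ·) {s : Set α | MeasurableSet s} {t : Set β | MeasurableSet t}) := by
    intro K L
    have := (isPiSystem_prod (α := α) (β := β)).comap fun ω => (K ω, L ω)
    exact this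
  rw [IndepFun_iff_Indep]
  refine IndepSets.indep (hA.prodMk hC).comap_le (hB.prodMk hD).comap_le hpi hpi hgen hgen ?_
  rw [IndepSets_iff]
  rintro _ _ ⟨_, ⟨s, hs, t, ht, rfl⟩, rfl⟩ ⟨_, ⟨s', hs', t', ht', rfl⟩, rfl⟩
  have hs : MeasurableSet s := hs
  have ht : MeasurableSet t := ht
  have hs' : MeasurableSet s' := hs'
  have ht' : MeasurableSet t' := ht'
  have e1 : (fun ω => (A ω, C ω)) ⁻¹' (s ×ˢ t) = A ⁻¹' s ∩ C ⁻¹' t := rfl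
  have e2 : (fun ω => (B ω, D ω)) ⁻¹' (s' ×ˢ t') = B ⁻¹' s' ∩ D ⁻¹' t' := rfl
  have e3 : (fun ω => (A ω, B ω)) ⁻¹' (s ×ˢ s') = A ⁻¹' s ∩ B ⁻¹' s' := rfl
  have e4 : (fun ω => (C ω, D ω)) ⁻¹' (t ×ˢ t') = C ⁻¹' t ∩ D ⁻¹' t' := rfl
  have h1 := h.measure_inter_preimage_eq_mul _ _ (hs.prod hs') (ht.prod ht')
  rw [e3, e4, hAB.measure_inter_preimage_eq_mul _ _ hs hs',
    hCD.measure_inter_preimage_eq_mul _ _ ht ht'] at h1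
  simp only [e1, e2]
  rw [Set.inter_inter_inter_comm, h1, hAC.measure_inter_preimage_eq_mul _ _ hs ht,
    hBD.measure_inter_preimage_eq_mul _ _ hs' ht']
  ring

theorem integral_inner_eq_zero {E : Type*} [NormedAddCommGroup E] [InnerProductSpace ℝ E]
    [CompleteSpace E] [MeasurableSpace E] [BorelSpace E] {X Y : Ω → E} (h : IndepFun X Y P)
    (hX : Integrable X P) (hY : Integrable Y P) (hX0 : ∫ ω, X ω ∂P = 0) :
    ∫ ω, inner ℝ (X ω) (Y ω) ∂P = 0 := by
  have := h.integral_bilin hX hY (innerSL ℝ)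
  rw [hX0, map_zero] at this
  exact this

end Independence

section EmpiricalCharacteristic

/-- The character `y ↦ exp (i ⟨t, y⟩)` of the plane. -/
def planeChar (t₁ t₂ : ℝ) (y : Plane) : ℂ :=
  Complex.exp (Complex.I * ((t₁ * y 0 + t₂ * y 1 : ℝ) : ℂ))

theorem norm_planeChar (t₁ t₂ : ℝ) (y : Plane) : ‖planeChar t₁ t₂ y‖ = 1 := by
  rw [planeChar, mul_comm, Complex.norm_exp_ofReal_mul_I]

theorem planeChar_add (t₁ t₂ : ℝ) (x y : Plane) :
    planeChar t₁ t₂ (x + y) = planeChar t₁ t₂ x * planeChar t₁ t₂ y := by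
  rw [planeChar, planeChar, planeChar, ← Complex.exp_add]
  congr 1
  simp only [PiLp.add_apply]
  push_cast
  ring

theorem continuous_planeChar : Continuous fun q : (ℝ × ℝ) × Plane => planeChar q.1.1 q.1.2 q.2 := by
  unfold planeChar
  fun_prop

theorem empChar_eq (y : ℕ → Plane) (n : ℕ) (t₁ t₂ : ℝ) :
    empChar y n t₁ t₂ = (1 / (n : ℂ)) * ∑ l ∈ Finset.range n, planeChar t₁ t₂ (y l) := rfl

theorem continuous_empChar (y : ℕ → Plane) (n : ℕ) :
    Continuous fun t : ℝ × ℝ => empChar y n t.1 t.2 := by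
  unfold empChar
  fun_prop

theorem norm_empChar_le (y : ℕ → Plane) (n : ℕ) (t₁ t₂ : ℝ) : ‖empChar y n t₁ t₂‖ ≤ 1 := by
  rw [empChar_eq, norm_mul]
  have h1 : ‖∑ l ∈ Finset.range n, planeChar t₁ t₂ (y l)‖ ≤ n :=
    (norm_sum_le _ _).trans (by simp [norm_planeChar])
  have h2 : ‖(1 / (n : ℂ))‖ = 1 / (n : ℝ) := by simp
  rw [h2]
  calc 1 / (n : ℝ) * _ ≤ 1 / (n : ℝ) * n := by gcongr
    _ ≤ 1 := by
      rw [one_div]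
      exact inv_mul_le_one

variable {Ω : Type*} [MeasurableSpace Ω] {P : Measure Ω} [IsProbabilityMeasure P]

theorem continuous_integral_planeChar {Y : Ω → Plane} (hY : Measurable Y) :
    Continuous fun t : ℝ × ℝ => ∫ ω, planeChar t.1 t.2 (Y ω) ∂P := by
  refine continuous_of_dominated (bound := fun _ => 1) (fun t => ?_) (fun t => ?_)
    (integrable_const _) ?_
  · exact ((continuous_planeChar.comp (Continuous.prodMk_right t)).measurable.comp hY).aestronglyMeasurable
  · exact Eventually.of_forall fun ω => (norm_planeChar _ _ _).le
  · exact Eventually.of_forall fun ω => continuous_planeChar.comp (Continuous.prodMk_left (Y ω))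

theorem norm_integral_planeChar_le (Y : Ω → Plane) (t₁ t₂ : ℝ) :
    ‖∫ ω, planeChar t₁ t₂ (Y ω) ∂P‖ ≤ 1 := by
  refine (norm_integral_le_of_norm_le_const (C := 1)
    (Eventually.of_forall fun ω => (norm_planeChar _ _ _).le)).trans ?_
  simp

/-- The mean squared error of the empirical characteristic function. -/
theorem integral_norm_empChar_sub_sq_le {Y : ℕ → Ω → Plane} (hY : ∀ l, Measurable (Y l))
    (hindep : ∀ i j, i ≠ j → IndepFun (Y i) (Y j) P) {t₁ t₂ : ℝ} {ψ : ℂ}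
    (hψ : ∀ l, ∫ ω, planeChar t₁ t₂ (Y l ω) ∂P = ψ) {n : ℕ} (hn : 1 ≤ n) :
    ∫ ω, ‖empChar (fun i => Y i ω) n t₁ t₂ - ψ‖ ^ 2 ∂P ≤ 4 / n := by
  have hn' : (n : ℂ) ≠ 0 := by exact_mod_cast (by omega : n ≠ 0)
  have hm : Measurable (planeChar t₁ t₂) :=
    (continuous_planeChar.comp (Continuous.prodMk_right (t₁, t₂))).measurable
  have hψ1 : ‖ψ‖ ≤ 1 := by rw [← hψ 0]; exact norm_integral_planeChar_le _ _ _
  have hZb : ∀ l ω, ‖planeChar t₁ t₂ (Y l ω) - ψ‖ ≤ 2 := fun l ω => by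
    have := norm_sub_le (planeChar t₁ t₂ (Y l ω)) ψ
    rw [norm_planeChar] at this
    linarith
  have hZ : ∀ l, MemLp (fun ω => planeChar t₁ t₂ (Y l ω) - ψ) 2 P := fun l =>
    MemLp.of_bound ((hm.comp (hY l)).sub_const ψ).aestronglyMeasurable 2
      (Eventually.of_forall (hZb l))
  have hint : ∀ l, Integrable (fun ω => planeChar t₁ t₂ (Y l ω) - ψ) P := fun l =>
    (hZ l).integrable (by norm_num)
  have hint' : ∀ l, Integrable (fun ω => planeChar t₁ t₂ (Y l ω)) P := fun l =>
    Integrable.of_bound (hm.comp (hY l)).aestronglyMeasurable 1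
      (Eventually.of_forall fun ω => (norm_planeChar _ _ _).le)
  have h := integral_norm_mean_sq_le (c := 4) hZ (fun i j hij => ?_) (fun l => ?_) hn
  · refine le_trans (le_of_eq ?_) h
    refine integral_congr_ae (Eventually.of_forall fun ω => ?_)
    have e : empChar (fun i => Y i ω) n t₁ t₂ - ψ
        = (1 / (n : ℂ)) * ∑ l ∈ Finset.range n, (planeChar t₁ t₂ (Y l ω) - ψ) := by
      rw [empChar_eq, Finset.sum_sub_distrib, Finset.sum_const, Finset.card_range, nsmul_eq_mul]
      field_simp
    show ‖empChar (fun i => Y i ω) n t₁ t₂ - ψ‖ ^ 2 = _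
    rw [e, norm_mul]
    simp
  · refine integral_inner_eq_zero ((hindep i j hij).comp (hm.sub_const ψ) (hm.sub_const ψ))
      (hint i) (hint j) ?_
    change ∫ ω, (planeChar t₁ t₂ (Y i ω) - ψ) ∂P = 0
    rw [integral_sub (hint' i) (integrable_const _), hψ i]
    simp
  · calc ∫ ω, ‖planeChar t₁ t₂ (Y l ω) - ψ‖ ^ 2 ∂P ≤ ∫ _, 4 ∂P := by
          refine integral_mono ((hZ l).integrable_norm_pow (by norm_num)) (integrable_const _)
            fun ω => ?_
          have := hZb l ω
          have h0 := norm_nonneg (planeChar t₁ t₂ (Y l ω) - ψ)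
          show ‖planeChar t₁ t₂ (Y l ω) - ψ‖ ^ 2 ≤ 4
          nlinarith
      _ = 4 := by simp

/-- The integrated squared error of the empirical characteristic function is of order `1 / n` in
probability. -/
theorem measure_integral_sqError_gt_le {Y : ℕ → Ω → Plane} (hY : ∀ l, Measurable (Y l))
    (hindep : ∀ i j, i ≠ j → IndepFun (Y i) (Y j) P) {ψ : ℝ → ℝ → ℂ}
    (hψ : ∀ l s t, ∫ ω, planeChar s t (Y l ω) ∂P = ψ s t) (ν : ℝ) {η : ℝ} (hη : 0 < η) :
    ∃ K : ℝ, 0 < K ∧ ∀ n : ℕ, 1 ≤ n →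
      P {ω | K * (1 / (n : ℝ)) < ∫ t in Set.Icc (-ν) ν ×ˢ Set.Icc (-ν) ν,
        sqError (empChar (fun i => Y i ω) n) ψ t} ≤ ENNReal.ofReal η := by
  set S : Set (ℝ × ℝ) := Set.Icc (-ν) ν ×ˢ Set.Icc (-ν) ν with hS
  have hSfin : volume S < ⊤ := (isCompact_Icc.prod isCompact_Icc).measure_lt_top
  have : IsFiniteMeasure (volume.restrict S) := ⟨by simpa using hSfin⟩
  have cψ : Continuous fun t : ℝ × ℝ => ψ t.1 t.2 := by
    simp only [← hψ 0]; exact continuous_integral_planeChar (hY 0)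
  have hψ1 : ∀ s t, ‖ψ s t‖ ≤ 1 := fun s t => by
    rw [← hψ 0]; exact norm_integral_planeChar_le _ _ _
  set V : ℝ := volume.real S with hV
  -- Each of the three squared errors has expectation at most `4 / n`, so Fubini gives `12 * V / n`
  -- and Markov divides by `η`; the summand `1` keeps the constant positive when `V = 0`.
  refine ⟨(12 * V + 1) / η, by positivity, fun n hn => ?_⟩
  have hn' : (0 : ℝ) < n := by exact_mod_cast hn
  have hEm : ∀ a : ℝ × ℝ → ℝ × ℝ, Continuous a →
      Measurable fun q : Ω × (ℝ × ℝ) => empChar (fun i => Y i q.1) n (a q.2).1 (a q.2).2 := by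
    intro a ha
    simp only [empChar_eq]
    refine Measurable.const_mul (Finset.measurable_fun_sum _ fun l _ => ?_) _
    exact continuous_planeChar.measurable.comp
      ((ha.measurable.comp measurable_snd).prodMk ((hY l).comp measurable_fst))
  have hm1 : ∀ a : ℝ × ℝ → ℝ × ℝ, Continuous a → Measurable fun q : Ω × (ℝ × ℝ) =>
      ‖empChar (fun i => Y i q.1) n (a q.2).1 (a q.2).2 - ψ (a q.2).1 (a q.2).2‖ ^ 2 := by
    intro a ha
    exact ((hEm a ha).sub ((cψ.comp ha).measurable.comp measurable_snd)).norm.pow_const 2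
  have hb1 : ∀ ω s t, ‖empChar (fun i => Y i ω) n s t - ψ s t‖ ^ 2 ≤ 4 := by
    intro ω s t
    have h1 := norm_sub_le (empChar (fun i => Y i ω) n s t) (ψ s t)
    have h2 := norm_empChar_le (fun i => Y i ω) n s t
    have h3 := hψ1 s t
    have h0 := norm_nonneg (empChar (fun i => Y i ω) n s t - ψ s t)
    nlinarith
  have hm : Measurable fun q : Ω × (ℝ × ℝ) => sqError (empChar (fun i => Y i q.1) n) ψ q.2 :=
    ((hm1 id continuous_id).add (hm1 (fun t => (t.1, 0)) (by fun_prop))).add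
      (hm1 (fun t => (0, t.2)) (by fun_prop))
  have hb : ∀ ω t, sqError (empChar (fun i => Y i ω) n) ψ t ≤ 12 := fun ω t => by
    have h1 := hb1 ω t.1 t.2
    have h2 := hb1 ω t.1 0
    have h3 := hb1 ω 0 t.2
    rw [sqError]; linarith
  have hb0 : ∀ ω t, 0 ≤ sqError (empChar (fun i => Y i ω) n) ψ t := fun ω t => by
    rw [sqError]; positivity
  have hi : Integrable (Function.uncurry fun (ω : Ω) (t : ℝ × ℝ) =>
      sqError (empChar (fun i => Y i ω) n) ψ t) (P.prod (volume.restrict S)) :=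
    Integrable.of_bound hm.aestronglyMeasurable 12 (Eventually.of_forall fun q => by
      rw [Real.norm_eq_abs]; exact (abs_of_nonneg (hb0 q.1 q.2)).trans_le (hb q.1 q.2))
  have hfub : ∫ ω, (∫ t in S, sqError (empChar (fun i => Y i ω) n) ψ t) ∂P ≤ 12 / n * V := by
    rw [integral_integral_swap hi]
    have h1 : ∀ t, ∫ ω, sqError (empChar (fun i => Y i ω) n) ψ t ∂P ≤ 12 / n := by
      intro t
      have hi1 : ∀ a b : ℝ, Integrable (fun ω => ‖empChar (fun i => Y i ω) n a b - ψ a b‖ ^ 2) P := by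
        intro a b
        refine Integrable.of_bound ((hm1 (fun _ => (a, b)) continuous_const).comp
          (measurable_id.prodMk (measurable_const (a := t)))).aestronglyMeasurable 4 (Eventually.of_forall fun ω => ?_)
        rw [Real.norm_eq_abs]
        exact (abs_of_nonneg (sq_nonneg _)).trans_le (hb1 ω a b)
      have h2 := fun a b => integral_norm_empChar_sub_sq_le hY hindep (fun l => hψ l a b) hn
      simp only [sqError]
      rw [integral_add ((hi1 t.1 t.2).fun_add (hi1 t.1 0)) (hi1 0 t.2),
        integral_add (hi1 t.1 t.2) (hi1 t.1 0)]
      have := h2 t.1 t.2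
      have := h2 t.1 0
      have := h2 0 t.2
      have e : (12 : ℝ) / n = 4 / n + 4 / n + 4 / n := by ring
      linarith
    calc _ ≤ ∫ _ in S, 12 / (n : ℝ) :=
          integral_mono hi.integral_prod_right (integrable_const _) h1
      _ = _ := by
        rw [setIntegral_const, smul_eq_mul, mul_comm]
  have hmk := mul_meas_ge_le_integral_of_nonneg (Eventually.of_forall fun ω =>
    integral_nonneg (hb0 ω)) hi.integral_prod_left ((12 * V + 1) / η * (1 / n))
  have h3 : P.real {ω | (12 * V + 1) / η * (1 / n) ≤ ∫ t in S,
      sqError (empChar (fun i => Y i ω) n) ψ t} ≤ η := by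
    have h4 := hmk.trans hfub
    have h5 : 12 / n * V ≤ (12 * V + 1) / η * (1 / n) * η := by
      have e : (12 * V + 1) / η * (1 / n) * η = (12 * V + 1) / n := by field_simp
      rw [e, div_mul_eq_mul_div]
      gcongr
      linarith
    exact le_of_mul_le_mul_left (h4.trans h5) (by positivity)
  refine (measure_mono fun ω hω => ?_).trans (ENNReal.le_ofReal_iff_toReal_le (measure_ne_top _ _)
    hη.le |>.2 h3)
  exact (show (12 * V + 1) / η * (1 / (n : ℝ)) < _ from hω).le

end EmpiricalCharacteristic

end CircleDeconv

end

/-! ### First moments of circular laws and the bias of the center -/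

noncomputable section

namespace CircleDeconv

open Filter Topology

section CirclePoint

theorem circlePoint_zero (u : ℝ) : circlePoint u 0 = Real.cos (2 * Real.pi * u) := by
  simp [circlePoint]

theorem circlePoint_one (u : ℝ) : circlePoint u 1 = Real.sin (2 * Real.pi * u) := by
  simp [circlePoint]

theorem norm_circlePoint (u : ℝ) : ‖circlePoint u‖ = 1 := by
  rw [EuclideanSpace.norm_eq, Fin.sum_univ_two, circlePoint_zero, circlePoint_one]
  simp

theorem continuous_circlePoint : Continuous circlePoint := by
  unfold circlePoint
  exact (PiLp.continuous_toLp 2 _).comp (continuous_pi fun i => by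
    fin_cases i <;> simp <;> fun_prop)

theorem norm_plane_le (v : Plane) : ‖v‖ ≤ |v 0| + |v 1| := by
  rw [EuclideanSpace.norm_eq, Fin.sum_univ_two, Real.sqrt_le_left (by positivity)]
  simp only [Real.norm_eq_abs]
  nlinarith [abs_nonneg (v 0), abs_nonneg (v 1)]

theorem integrable_density (f : L2) : Integrable f (volume.restrict (Set.Ioo (0 : ℝ) 1)) :=
  (Lp.memLp f).integrable (by norm_num)

theorem integrable_smul_circlePoint (f : L2) :
    Integrable (fun u => (f u : ℝ) • circlePoint u) (volume.restrict (Set.Ioo (0 : ℝ) 1)) := by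
  refine (integrable_density f).norm.mono' ((integrable_density f).aestronglyMeasurable.smul
    continuous_circlePoint.aestronglyMeasurable) (Eventually.of_forall fun u => ?_)
  rw [norm_smul, norm_circlePoint, mul_one]

theorem integral_smul_circlePoint_apply (f : L2) (i : Fin 2) :
    (∫ u in Set.Ioo (0 : ℝ) 1, (f u : ℝ) • circlePoint u) i
      = ∫ u in Set.Ioo (0 : ℝ) 1, f u * circlePoint u i := by
  have h := (EuclideanSpace.proj i : Plane →L[ℝ] ℝ).integral_comp_comm
    (integrable_smul_circlePoint f)
  exact h.symm

/-- Reflecting the circle is the same as changing the signs of the arguments. This lets the analysis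
choose a quadrant although the contrast is written in the original coordinates. -/
theorem charCircle_eq_lap (f : L2) (R σ τ s t : ℝ) :
    lap (volume.restrict (Set.Ioo (0 : ℝ) 1)) (fun u => R * (σ * Real.cos (2 * Real.pi * u)))
      (fun u => R * (τ * Real.sin (2 * Real.pi * u))) (fun u => ((f u : ℝ) : ℂ))
      (Complex.I * s) (Complex.I * t) = charCircle f R (σ * s) (τ * t) := by
  rw [lap, charCircle]
  refine integral_congr_ae (Eventually.of_forall fun u => ?_)
  simp only [circlePoint_zero, circlePoint_one]
  congr 2
  push_cast
  ring

theorem charCircle_eq_lap_one (f : L2) (R s t : ℝ) :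
    charCircle f R s t = lap (volume.restrict (Set.Ioo (0 : ℝ) 1))
      (fun u => R * (1 * Real.cos (2 * Real.pi * u))) (fun u => R * (1 * Real.sin (2 * Real.pi * u)))
      (fun u => ((f u : ℝ) : ℂ)) (Complex.I * s) (Complex.I * t) := by
  rw [charCircle_eq_lap, one_mul, one_mul]

theorem continuous_charCircle (f : L2) (R : ℝ) :
    Continuous fun t : ℝ × ℝ => charCircle f R t.1 t.2 := by
  simp only [charCircle_eq_lap_one]
  have h := continuous_lap (μ := volume.restrict (Set.Ioo (0 : ℝ) 1)) (K := |R|)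
    (X := fun u => R * (1 * Real.cos (2 * Real.pi * u)))
    (Y := fun u => R * (1 * Real.sin (2 * Real.pi * u))) (by fun_prop) (by fun_prop)
    (fun u => by
      rw [abs_mul, one_mul]; exact mul_le_of_le_one_right (abs_nonneg _) (Real.abs_cos_le_one _))
    (fun u => by
      rw [abs_mul, one_mul]; exact mul_le_of_le_one_right (abs_nonneg _) (Real.abs_sin_le_one _))
    (integrable_density f).ofReal
  have hp : Continuous fun t : ℝ × ℝ => (Complex.I * (t.1 : ℂ), Complex.I * (t.2 : ℂ)) := by fun_prop
  exact h.comp hp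

theorem norm_charCircle_le (f : L2) (R s t : ℝ) :
    ‖charCircle f R s t‖ ≤ ∫ u in Set.Ioo (0 : ℝ) 1, ‖((f u : ℝ) : ℂ)‖ := by
  refine norm_integral_le_of_norm_le (integrable_density f).ofReal.norm
    (Eventually.of_forall fun u => ?_)
  rw [norm_mul, mul_comm Complex.I, Complex.norm_exp_ofReal_mul_I, one_mul]

/-- The characteristic functions `charCircle f R`, `f ∈ F`, are uniformly bounded. -/
theorem exists_norm_charCircle_le {F : Set L2} (hF : IsCompact F) :
    ∃ B : ℝ, 1 ≤ B ∧ ∀ f ∈ F, ∀ R s t, ‖charCircle f R s t‖ ≤ B := by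
  obtain ⟨C, hC, hCf⟩ := exists_integral_norm_le (μ := volume.restrict (Set.Ioo (0 : ℝ) 1))
  obtain ⟨D, hD⟩ := hF.isBounded.exists_norm_le
  refine ⟨max 1 (C * D), le_max_left _ _, fun f hf R s t => ?_⟩
  refine (norm_charCircle_le f R s t).trans ((hCf f).2.trans ?_)
  exact (mul_le_mul_of_nonneg_left (hD f hf) hC).trans (le_max_right _ _)

end CirclePoint

section Square

theorem integral_comp_sign_mul (g : ℝ → ℝ) {σ : ℝ} (hσ : σ = 1 ∨ σ = -1) (r : ℝ) :
    ∫ s in (-r)..r, g (σ * s) = ∫ s in (-r)..r, g s := by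
  rcases hσ with rfl | rfl
  · simp
  · simp only [neg_one_mul]
    rw [intervalIntegral.integral_comp_neg, neg_neg]

theorem setIntegral_square {G : ℝ → ℝ → ℝ} (hG : Continuous fun t : ℝ × ℝ => G t.1 t.2) {r : ℝ}
    (hr : 0 ≤ r) {σ τ : ℝ} (hσ : σ = 1 ∨ σ = -1) (hτ : τ = 1 ∨ τ = -1) :
    ∫ t in Set.Icc (-r) r ×ˢ Set.Icc (-r) r, G t.1 t.2
      = ∫ s in (-r)..r, ∫ t in (-r)..r, G (σ * s) (τ * t) := by
  have h1 := integral_comp_sign_mul (fun s => ∫ t in (-r)..r, G s t) hσ r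
  have h2 : ∀ s, ∫ t in (-r)..r, G (σ * s) (τ * t) = ∫ t in (-r)..r, G (σ * s) t := fun s =>
    integral_comp_sign_mul (fun t => G (σ * s) t) hτ r
  have h3 : -r ≤ r := by linarith
  simp only [h2]
  rw [h1, Measure.volume_eq_prod, setIntegral_prod _ (by
    rw [← Measure.volume_eq_prod]
    exact hG.continuousOn.integrableOn_compact (isCompact_Icc.prod isCompact_Icc))]
  simp only [intervalIntegral.integral_of_le h3, integral_Icc_eq_integral_Ioc]

end Square

section Center

/-- Both densities have integral one, so the Wronskian at the origin reduces to a difference of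
first moments. It is the link between the analytic estimates and the center. -/
theorem marginalWronskian_zero (f fs : L2) (R Rs : ℝ) (x y y' : ℝ → ℝ)
    (hf1 : ∫ u in Set.Ioo (0 : ℝ) 1, (f u : ℝ) = 1)
    (hfs1 : ∫ u in Set.Ioo (0 : ℝ) 1, (fs u : ℝ) = 1) (σ : ℝ) :
    marginalWronskian (volume.restrict (Set.Ioo (0 : ℝ) 1)) (fun u => R * (σ * x u)) y
        (fun u => ((f u : ℝ) : ℂ)) (fun u => Rs * (σ * x u)) y' (fun u => ((fs u : ℝ) : ℂ)) 0
      = ((σ * (R * (∫ u in Set.Ioo (0 : ℝ) 1, f u * x u)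
        - Rs * ∫ u in Set.Ioo (0 : ℝ) 1, fs u * x u) : ℝ) : ℂ) := by
  have h0 : ∀ (X Y : ℝ → ℝ) (g : ℝ → ℂ), lap (volume.restrict (Set.Ioo (0 : ℝ) 1)) X Y g 0 0
      = ∫ u in Set.Ioo (0 : ℝ) 1, g u := fun X Y g => by simp [lap]
  have h1 : ∀ (R : ℝ) (f : L2), ∫ u in Set.Ioo (0 : ℝ) 1, ((R * (σ * x u) : ℝ) : ℂ) * ((f u : ℝ) : ℂ)
      = ((σ * (R * ∫ u in Set.Ioo (0 : ℝ) 1, f u * x u) : ℝ) : ℂ) := fun R f => by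
    rw [← integral_const_mul, ← integral_const_mul, ← integral_complex_ofReal]
    refine integral_congr_ae (Eventually.of_forall fun u => ?_)
    simp only
    push_cast
    ring
  rw [marginalWronskian]
  simp only [h0, h1]
  rw [integral_complex_ofReal, integral_complex_ofReal, hf1, hfs1]
  push_cast
  ring

/-- A small population contrast forces the first moments of the two circular distributions to be
close. -/
theorem exists_center_bias_le {Rmin Rmax : ℝ} (hRmin : 0 < Rmin) {F : Set L2} (hF : IsCompact F)
    (hFint : ∀ f ∈ F, ∫ u in Set.Ioo (0 : ℝ) 1, (f u : ℝ) = 1) {Rs : ℝ} (hRs : 0 < Rs) {fs : L2}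
    (hfs : fs ∈ F) (hfs0 : ∀ᵐ u ∂(volume.restrict (Set.Ioo (0 : ℝ) 1)), 0 ≤ fs u) {δ : ℝ}
    (hδ : 0 < δ) :
    ∃ r₀ : ℝ, 0 < r₀ ∧ ∀ r, 0 < r → r ≤ r₀ → ∀ κ : ℝ, 0 < κ → ∃ C : ℝ, 0 ≤ C ∧
      ∀ f ∈ F, ∀ R ∈ Set.Icc Rmin Rmax, ∀ ε : ℝ, 0 < ε → ε ≤ 1 →
        (∫ t in Set.Icc (-r) r ×ˢ Set.Icc (-r) r,
          ‖charCircle f R t.1 t.2 * charCircle fs Rs t.1 0 * charCircle fs Rs 0 t.2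
            - charCircle fs Rs t.1 t.2 * charCircle f R t.1 0 * charCircle f R 0 t.2‖ ^ 2)
          ≤ κ * ε ^ 2 →
        ‖(R • ∫ u in Set.Ioo (0 : ℝ) 1, (f u : ℝ) • circlePoint u)
          - Rs • ∫ u in Set.Ioo (0 : ℝ) 1, (fs u : ℝ) • circlePoint u‖ ≤ C * ε ^ (1 - δ) := by
  obtain ⟨σ, τ, hσ, hτ, m₁, m₂, x, hs⟩ := exists_densityOnCircle hRs (integrable_density fs) hfs0
    (hFint fs hfs)
  have hc := circleChart_cos_sin.sign_mul hσ hτ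
  set μ : Measure ℝ := volume.restrict (Set.Ioo (0 : ℝ) 1) with hμ
  have cl := continuous_lap hs.chart.meas₁ hs.chart.meas₂ hs.chart.abs_le₁ hs.chart.abs_le₂
    ((integrable_density fs).ofReal (𝕜 := ℂ))
  have hone : lap μ (fun u => Rs * (σ * Real.cos (2 * Real.pi * u)))
      (fun u => Rs * (τ * Real.sin (2 * Real.pi * u))) (fun u => ((fs u : ℝ) : ℂ)) 0 0 ≠ 0 := by
    have : lap μ (fun u => Rs * (σ * Real.cos (2 * Real.pi * u)))
      (fun u => Rs * (τ * Real.sin (2 * Real.pi * u))) (fun u => ((fs u : ℝ) : ℂ)) 0 0 = 1 := by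
      have h1 := hFint fs hfs
      simp only [lap, zero_mul, add_zero, Complex.exp_zero, one_mul]
      rw [integral_complex_ofReal, h1, Complex.ofReal_one]
    rw [this]; exact one_ne_zero
  have hnear : ∀ᶠ z : ℂ in 𝓝 0, lap μ (fun u => Rs * (σ * Real.cos (2 * Real.pi * u)))
        (fun u => Rs * (τ * Real.sin (2 * Real.pi * u))) (fun u => ((fs u : ℝ) : ℂ)) z 0 ≠ 0
      ∧ lap μ (fun u => Rs * (σ * Real.cos (2 * Real.pi * u)))
        (fun u => Rs * (τ * Real.sin (2 * Real.pi * u))) (fun u => ((fs u : ℝ) : ℂ)) 0 z ≠ 0 := by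
    refine Eventually.and ?_ ?_
    · exact ((cl.comp (Continuous.prodMk_left (0 : ℂ))).tendsto 0).eventually_ne hone
    · exact ((cl.comp (Continuous.prodMk_right (0 : ℂ))).tendsto 0).eventually_ne hone
  obtain ⟨ρ, hρ, hball⟩ := Metric.eventually_nhds_iff_ball.1 hnear
  -- The marginals must not vanish on the closed disc of radius `2 * r`, which lies in the ball of
  -- radius `ρ`. The threshold does not depend on `κ`, so only `C` depends on the probability level.
  refine ⟨ρ / 4, by positivity, fun r hr hrρ κ hκ => ?_⟩
  have hsub : ∀ z ∈ Metric.closedBall (0 : ℂ) (2 * r), z ∈ Metric.ball (0 : ℂ) ρ := fun z hz =>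
    Metric.closedBall_subset_ball (by linarith) hz
  obtain ⟨C, hC, hCf⟩ := hs.center_le hc hF hFint hRmin hr hδ (fun z hz => (hball z (hsub z hz)).1)
    (fun z hz => (hball z (hsub z hz)).2) κ hκ (Rmax := Rmax)
  refine ⟨2 * C, by positivity, fun f hf R hR ε hε hε1 hint => ?_⟩
  have hcont : Continuous fun t : ℝ × ℝ =>
      ‖charCircle f R t.1 t.2 * charCircle fs Rs t.1 0 * charCircle fs Rs 0 t.2
        - charCircle fs Rs t.1 t.2 * charCircle f R t.1 0 * charCircle f R 0 t.2‖ ^ 2 := by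
    have a : Continuous fun t : ℝ × ℝ => ((t.1, 0) : ℝ × ℝ) := by fun_prop
    have b : Continuous fun t : ℝ × ℝ => ((0, t.2) : ℝ × ℝ) := by fun_prop
    have c1 := continuous_charCircle f R
    have c2 := continuous_charCircle fs Rs
    exact ((((c1.mul (c2.comp a)).mul (c2.comp b)).sub
      ((c2.mul (c1.comp a)).mul (c1.comp b))).norm.pow 2)
  rw [setIntegral_square (G := fun s t =>
      ‖charCircle f R s t * charCircle fs Rs s 0 * charCircle fs Rs 0 t
        - charCircle fs Rs s t * charCircle f R s 0 * charCircle f R 0 t‖ ^ 2) hcont hr.le hσ hτ] at hint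
  have hcd : ∀ s t : ℝ, crossDefect μ (fun u => R * (σ * Real.cos (2 * Real.pi * u)))
      (fun u => R * (τ * Real.sin (2 * Real.pi * u))) (fun u => ((f u : ℝ) : ℂ))
      (fun u => Rs * (σ * Real.cos (2 * Real.pi * u)))
      (fun u => Rs * (τ * Real.sin (2 * Real.pi * u))) (fun u => ((fs u : ℝ) : ℂ))
      (Complex.I * s) (Complex.I * t)
      = charCircle f R (σ * s) (τ * t) * charCircle fs Rs (σ * s) 0 * charCircle fs Rs 0 (τ * t)
        - charCircle fs Rs (σ * s) (τ * t) * charCircle f R (σ * s) 0 * charCircle f R 0 (τ * t) := by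
    intro s t
    have h1 := charCircle_eq_lap f R σ τ s 0
    have h2 := charCircle_eq_lap f R σ τ 0 t
    have h3 := charCircle_eq_lap fs Rs σ τ s 0
    have h4 := charCircle_eq_lap fs Rs σ τ 0 t
    rw [Complex.ofReal_zero, mul_zero, mul_zero] at h1 h2 h3 h4
    rw [crossDefect, charCircle_eq_lap, charCircle_eq_lap, h1, h2, h3, h4]
  have h := hCf f hf R hR ε hε hε1 (by simpa only [hcd] using hint)
  have e1 := marginalWronskian_zero f fs R Rs (fun u => Real.cos (2 * Real.pi * u))
    (fun u => R * (τ * Real.sin (2 * Real.pi * u)))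
    (fun u => Rs * (τ * Real.sin (2 * Real.pi * u))) (hFint f hf) (hFint fs hfs) σ
  have e2 := marginalWronskian_zero f fs R Rs (fun u => Real.sin (2 * Real.pi * u))
    (fun u => R * (σ * Real.cos (2 * Real.pi * u)))
    (fun u => Rs * (σ * Real.cos (2 * Real.pi * u))) (hFint f hf) (hFint fs hfs) τ
  rw [e1, e2] at h
  have habs : ∀ {ρ a : ℝ}, ρ = 1 ∨ ρ = -1 → ‖((ρ * a : ℝ) : ℂ)‖ = |a| := by
    rintro ρ a (rfl | rfl) <;> rw [Complex.norm_real, Real.norm_eq_abs] <;> simp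
  rw [habs hσ, habs hτ] at h
  refine (norm_plane_le _).trans ?_
  simp only [PiLp.sub_apply, PiLp.smul_apply, smul_eq_mul, integral_smul_circlePoint_apply,
    circlePoint_zero, circlePoint_one]
  linarith [h.1, h.2]

end Center

end CircleDeconv

end

/-! ### The statistical model -/

noncomputable section

namespace CircleDeconv

open Filter Topology

section Model

variable {Ω : Type*} [MeasurableSpace Ω] {P : Measure Ω}

theorem integral_comp_of_map_eq_withDensity {E : Type*} [NormedAddCommGroup E] [NormedSpace ℝ E]
    {V : Ω → ℝ} (hV : Measurable V) {μ : Measure ℝ} {f : ℝ → ℝ} (hf : AEMeasurable f μ)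
    (hf0 : ∀ᵐ u ∂μ, 0 ≤ f u) (hlaw : P.map V = μ.withDensity fun u => ENNReal.ofReal (f u))
    {g : ℝ → E} (hg : StronglyMeasurable g) : ∫ ω, g (V ω) ∂P = ∫ u, f u • g u ∂μ := by
  rw [← integral_map hV.aemeasurable hg.aestronglyMeasurable, hlaw,
    integral_withDensity_eq_integral_toReal_smul₀ hf.ennreal_ofReal
      (Eventually.of_forall fun _ => ENNReal.ofReal_lt_top)]
  refine integral_congr_ae ?_
  filter_upwards [hf0] with u hu
  rw [ENNReal.toReal_ofReal hu]

theorem measurable_planeChar (s t : ℝ) : Measurable (planeChar s t) :=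
  (continuous_planeChar.comp (Continuous.prodMk_right (s, t))).measurable

theorem planeChar_circlePoint (R s t u : ℝ) : planeChar s t (R • circlePoint u)
    = Complex.exp (Complex.I * ((R * (s * circlePoint u 0 + t * circlePoint u 1) : ℝ) : ℂ)) := by
  rw [planeChar]
  congr 2
  simp only [PiLp.smul_apply, smul_eq_mul]
  push_cast
  ring

/-- Characters are multiplicative and the angle is independent of the noise, so the expectation
splits; the density of the angle turns the signal factor into `charCircle`. -/
theorem integral_planeChar_obs {V : Ω → ℝ} (hV : Measurable V) {f : L2}
    (hf0 : ∀ᵐ u ∂(volume.restrict (Set.Ioo (0 : ℝ) 1)), 0 ≤ f u)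
    (hlaw : P.map V =
      (volume.restrict (Set.Ioo (0 : ℝ) 1)).withDensity (fun u => ENNReal.ofReal (f u)))
    {e : Ω → Plane} (he : Measurable e) (hVe : IndepFun V e P) (C : Plane) (R s t : ℝ) :
    ∫ ω, planeChar s t (C + R • circlePoint (V ω) + e ω) ∂P
      = planeChar s t C * (∫ ω, planeChar s t (e ω) ∂P) * charCircle f R s t := by
  have hm : Measurable fun u => planeChar s t (R • circlePoint u) :=
    (measurable_planeChar s t).comp (continuous_circlePoint.const_smul R).measurable
  have h1 : ∫ ω, planeChar s t (R • circlePoint (V ω)) ∂P = charCircle f R s t := by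
    rw [integral_comp_of_map_eq_withDensity hV (integrable_density f).aemeasurable hf0 hlaw
      (g := fun u => planeChar s t (R • circlePoint u)) hm.stronglyMeasurable, charCircle]
    refine integral_congr_ae (Eventually.of_forall fun u => ?_)
    simp only
    rw [planeChar_circlePoint, Complex.real_smul, mul_comm]
  have h2 := hVe.integral_fun_comp_mul_comp hV.aemeasurable he.aemeasurable
    (f := fun u => planeChar s t (R • circlePoint u)) (g := planeChar s t)
    hm.aestronglyMeasurable (measurable_planeChar s t).aestronglyMeasurable
  simp only [planeChar_add, mul_assoc]
  rw [integral_const_mul, h2, h1]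
  ring

theorem integral_planeChar_of_indepFun {e : Ω → Plane} (he : Measurable e)
    (hcoord : IndepFun (fun ω => e ω 0) (fun ω => e ω 1) P) (s t : ℝ) :
    ∫ ω, planeChar s t (e ω) ∂P
      = (∫ ω, planeChar s 0 (e ω) ∂P) * ∫ ω, planeChar 0 t (e ω) ∂P := by
  have m0 : Measurable fun ω => e ω 0 := (by fun_prop : Measurable fun y : Plane => y 0).comp he
  have m1 : Measurable fun ω => e ω 1 := (by fun_prop : Measurable fun y : Plane => y 1).comp he
  have h := hcoord.integral_fun_comp_mul_comp m0.aemeasurable m1.aemeasurable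
    (f := fun a : ℝ => Complex.exp (Complex.I * ((s * a : ℝ) : ℂ)))
    (g := fun a : ℝ => Complex.exp (Complex.I * ((t * a : ℝ) : ℂ)))
    (Continuous.aestronglyMeasurable (by fun_prop)) (Continuous.aestronglyMeasurable (by fun_prop))
  have e1 : ∀ ω, planeChar s t (e ω) = Complex.exp (Complex.I * ((s * e ω 0 : ℝ) : ℂ))
      * Complex.exp (Complex.I * ((t * e ω 1 : ℝ) : ℂ)) := fun ω => by
    rw [planeChar, ← Complex.exp_add]; push_cast; ring_nf
  have e2 : ∀ ω, planeChar s 0 (e ω) = Complex.exp (Complex.I * ((s * e ω 0 : ℝ) : ℂ)) := fun ω => by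
    rw [planeChar, zero_mul, add_zero]
  have e3 : ∀ ω, planeChar 0 t (e ω) = Complex.exp (Complex.I * ((t * e ω 1 : ℝ) : ℂ)) := fun ω => by
    rw [planeChar, zero_mul, zero_add]
  simp only [e1, e2, e3]
  exact h

theorem planeChar_mul_planeChar (s t : ℝ) (y : Plane) :
    planeChar s 0 y * planeChar 0 t y = planeChar s t y := by
  simp only [planeChar, ← Complex.exp_add]
  congr 1
  push_cast
  ring

theorem planeChar_zero_zero (y : Plane) : planeChar 0 0 y = 1 := by simp [planeChar]

/-- Near the origin, the characteristic function of the noise stays away from zero. -/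
theorem exists_half_le_norm_planeChar [IsProbabilityMeasure P] {e : Ω → Plane} (he : Measurable e)
    (C : Plane) : ∃ r : ℝ, 0 < r ∧ ∀ s ∈ Set.Icc (-r) r, ∀ t ∈ Set.Icc (-r) r,
      1 / 2 ≤ ‖planeChar s t C * ∫ ω, planeChar s t (e ω) ∂P‖ := by
  have hc : Continuous fun t : ℝ × ℝ => ‖planeChar t.1 t.2 C * ∫ ω, planeChar t.1 t.2 (e ω) ∂P‖ :=
    ((continuous_planeChar.comp (Continuous.prodMk_left C)).mul
      (continuous_integral_planeChar he)).norm
  have h0 : 1 / 2 < ‖planeChar (0 : ℝ × ℝ).1 (0 : ℝ × ℝ).2 C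
      * ∫ ω, planeChar (0 : ℝ × ℝ).1 (0 : ℝ × ℝ).2 (e ω) ∂P‖ := by
    simp only [Prod.fst_zero, Prod.snd_zero, planeChar_zero_zero]
    norm_num
  obtain ⟨ρ, hρ, hb⟩ := Metric.eventually_nhds_iff_ball.1 ((hc.tendsto 0).eventually_const_lt h0)
  refine ⟨ρ / 2, by positivity, fun s hs t ht => (hb (s, t) ?_).le⟩
  rw [mem_ball_zero_iff, Prod.norm_def, max_lt_iff, Real.norm_eq_abs, Real.norm_eq_abs, abs_lt,
    abs_lt]
  have := hs.1
  have := hs.2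
  have := ht.1
  have := ht.2
  exact ⟨⟨by linarith, by linarith⟩, by linarith, by linarith⟩

/-- The centered directions have mean of order `n ^ (-1 / 2)`. -/
theorem measure_mean_circlePoint_gt_le [IsProbabilityMeasure P] {U : ℕ → Ω → ℝ}
    (hU : ∀ i, Measurable (U i)) (hindep : iIndepFun U P) {f : L2}
    (hf0 : ∀ᵐ u ∂(volume.restrict (Set.Ioo (0 : ℝ) 1)), 0 ≤ f u)
    (hlaw : ∀ i, P.map (U i) =
      (volume.restrict (Set.Ioo (0 : ℝ) 1)).withDensity (fun u => ENNReal.ofReal (f u)))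
    (R : ℝ) {η : ℝ} (hη : 0 < η) :
    ∃ K : ℝ, 0 < K ∧ ∀ n : ℕ, 1 ≤ n →
      P {ω | K * (n : ℝ) ^ (-(1 / 2) : ℝ) < (1 / (n : ℝ)) * ‖∑ l ∈ Finset.range n,
        R • (circlePoint (U l ω) - ∫ u in Set.Ioo (0 : ℝ) 1, (f u : ℝ) • circlePoint u)‖}
        ≤ ENNReal.ofReal η := by
  set m : Plane := ∫ u in Set.Ioo (0 : ℝ) 1, (f u : ℝ) • circlePoint u with hm
  have hmean : ∀ l, ∫ ω, circlePoint (U l ω) ∂P = m := fun l =>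
    integral_comp_of_map_eq_withDensity (hU l) (integrable_density f).aemeasurable hf0 (hlaw l)
      continuous_circlePoint.stronglyMeasurable
  have hmeas : Measurable fun u => R • (circlePoint u - m) :=
    ((continuous_circlePoint.sub continuous_const).const_smul R).measurable
  have hb : ∀ l ω, ‖R • (circlePoint (U l ω) - m)‖ ≤ |R| * (1 + ‖m‖) := fun l ω => by
    rw [norm_smul, Real.norm_eq_abs]
    gcongr
    refine (norm_sub_le _ _).trans ?_
    rw [norm_circlePoint]
  have hZ : ∀ l, MemLp (fun ω => R • (circlePoint (U l ω) - m)) 2 P := fun l =>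
    MemLp.of_bound (hmeas.comp (hU l)).aestronglyMeasurable _ (Eventually.of_forall (hb l))
  have hint : ∀ l, Integrable (fun ω => R • (circlePoint (U l ω) - m)) P := fun l =>
    (hZ l).integrable (by norm_num)
  have hcp : ∀ l, Integrable (fun ω => circlePoint (U l ω)) P := fun l =>
    Integrable.of_bound (continuous_circlePoint.measurable.comp (hU l)).aestronglyMeasurable 1
      (Eventually.of_forall fun ω => (norm_circlePoint _).le)
  refine measure_mean_gt_le hZ (fun i j hij => ?_) (c := (|R| * (1 + ‖m‖)) ^ 2) (fun l => ?_) hη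
  · refine integral_inner_eq_zero ((hindep.indepFun hij).comp hmeas hmeas) (hint i) (hint j) ?_
    change ∫ ω, R • (circlePoint (U i ω) - m) ∂P = 0
    rw [integral_smul, integral_sub (hcp i) (integrable_const _), hmean i]
    simp
  · calc ∫ ω, ‖R • (circlePoint (U l ω) - m)‖ ^ 2 ∂P ≤ ∫ _, (|R| * (1 + ‖m‖)) ^ 2 ∂P :=
          integral_mono ((hZ l).integrable_norm_pow (by norm_num)) (integrable_const _)
            fun ω => pow_le_pow_left₀ (norm_nonneg _) (hb l ω) 2
      _ = _ := by simp

theorem measure_mean_noise_gt_le [IsProbabilityMeasure P] {ε : ℕ → Ω → Plane}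
    (hindep : iIndepFun ε P) (hident : ∀ i, IdentDistrib (ε i) (ε 0) P P) (hvar : MemLp (ε 0) 2 P)
    (hcentered : ∫ ω, ε 0 ω ∂P = 0) {η : ℝ} (hη : 0 < η) :
    ∃ K : ℝ, 0 < K ∧ ∀ n : ℕ, 1 ≤ n →
      P {ω | K * (n : ℝ) ^ (-(1 / 2) : ℝ) < (1 / (n : ℝ)) * ‖∑ l ∈ Finset.range n, ε l ω‖}
        ≤ ENNReal.ofReal η := by
  have hZ : ∀ l, MemLp (ε l) 2 P := fun l => (hident l).memLp_iff.2 hvar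
  have hint : ∀ l, Integrable (ε l) P := fun l => (hZ l).integrable (by norm_num)
  refine measure_mean_gt_le hZ (fun i j hij => ?_) (c := ∫ ω, ‖ε 0 ω‖ ^ 2 ∂P) (fun l => ?_) hη
  · exact integral_inner_eq_zero (hindep.indepFun hij) (hint i) (hint j)
      ((hident i).integral_eq.trans hcentered)
  · exact ((hident l).comp (u := fun y : Plane => ‖y‖ ^ 2) (by fun_prop)).integral_eq.le

/-- The error splits into the fluctuation of the signal, the mean noise, and the error in the
estimated first moment of the circular law. The first two are controlled by second moments, the last
by the contrast. -/
theorem centerEst_sub_eq {y : ℕ → Plane} {C : Plane} {R : ℝ} {u : ℕ → ℝ} {e : ℕ → Plane}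
    (hy : ∀ i, y i = C + R • circlePoint (u i) + e i) (m : Plane) {n : ℕ} (hn : 1 ≤ n) (f : L2)
    (R' : ℝ) : centerEst y n f R' - C
      = (1 / (n : ℝ)) • (∑ l ∈ Finset.range n, R • (circlePoint (u l) - m))
        + (1 / (n : ℝ)) • (∑ l ∈ Finset.range n, e l)
        - ((R' • ∫ u in Set.Ioo (0 : ℝ) 1, (f u : ℝ) • circlePoint u) - R • m) := by
  have hn' : (n : ℝ) ≠ 0 := by exact_mod_cast (by omega : n ≠ 0)
  have e1 : ∀ v : Plane, (1 / (n : ℝ)) • ((n : ℕ) • v) = v := fun v => by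
    rw [← Nat.cast_smul_eq_nsmul ℝ, smul_smul, one_div, inv_mul_cancel₀ hn', one_smul]
  rw [centerEst]
  simp only [hy, smul_sub, Finset.sum_add_distrib, Finset.sum_sub_distrib, Finset.sum_const,
    Finset.card_range, smul_add, e1]
  abel

end Model

end CircleDeconv

end

/-! ### Tightness of the rescaled error -/

theorem theorem5
    {Ω : Type*} [MeasurableSpace Ω] (P : Measure Ω) [IsProbabilityMeasure P]
    -- parameters of the estimation method
    (νest Rmin Rmax : ℝ) (hνest : 0 < νest) (hRmin : 0 < Rmin) (hRminmax : Rmin < Rmax)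
    (F : Set CircleDeconv.L2) (hFcompact : IsCompact F)
    (hFint : ∀ f ∈ F, ∫ u in Set.Ioo (0 : ℝ) 1, (f u : ℝ) = 1)
    -- the unknown center, radius and density of the angles
    (Cstar : CircleDeconv.Plane) (Rstar : ℝ) (hRstar : Rstar ∈ Set.Ioo Rmin Rmax)
    (fstar : CircleDeconv.L2) (hfstar : fstar ∈ F)
    -- the angles are i.i.d. with density `fstar`
    (U : ℕ → Ω → ℝ) (hUmeas : ∀ i, Measurable (U i)) (hUindep : iIndepFun U P)
    (hfstar_nonneg : ∀ᵐ u ∂(volume.restrict (Set.Ioo (0 : ℝ) 1)), 0 ≤ fstar u)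
    (hUlaw : ∀ i, P.map (U i) =
      (volume.restrict (Set.Ioo (0 : ℝ) 1)).withDensity (fun u => ENNReal.ofReal (fstar u)))
    -- the noise is i.i.d., with independent coordinates, centered, with finite variance
    (ε : ℕ → Ω → CircleDeconv.Plane) (hεmeas : ∀ i, Measurable (ε i)) (hεindep : iIndepFun ε P)
    (hεident : ∀ i, IdentDistrib (ε i) (ε 0) P P)
    (hεcoord : IndepFun (fun ω => ε 0 ω 0) (fun ω => ε 0 ω 1) P)
    (hεvar : MemLp (ε 0) 2 P) (hεcentered : ∫ ω, ε 0 ω ∂P = 0)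
    -- the noise is independent of the signal
    (hUε : IndepFun (fun ω i => U i ω) (fun ω i => ε i ω) P)
    -- the observations
    (Y : ℕ → Ω → CircleDeconv.Plane)
    (hY : ∀ i ω, Y i ω = Cstar + Rstar • CircleDeconv.circlePoint (U i ω) + ε i ω)
    -- any measurable choice of the estimators of the density and of the radius
    (fhat : ℕ → Ω → CircleDeconv.L2) (Rhat : ℕ → Ω → ℝ)
    (hfhat : ∀ n, StronglyMeasurable (fhat n)) (hRhat : ∀ n, Measurable (Rhat n))
    (hmin : ∀ n, 1 ≤ n → ∀ᵐ ω ∂P, CircleDeconv.IsNearMinimizer νest F Rmin Rmax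
      (fun i => Y i ω) n (fhat n ω) (Rhat n ω))
    (δ : ℝ) (hδ : 0 < δ) :
    CircleDeconv.IsBigOInProb P
      (fun n ω => CircleDeconv.centerEst (fun i => Y i ω) n (fhat n ω) (Rhat n ω) - Cstar)
      (fun n => (n : ℝ) ^ (-(1 / 2 : ℝ) + δ)) := by
  have hRs : 0 < Rstar := hRmin.trans hRstar.1
  have hRs' : Rstar ∈ Set.Icc Rmin Rmax := ⟨hRstar.1.le, hRstar.2.le⟩
  have hYobs : ∀ i, Measurable (Y i) := fun i => by
    have e : Y i = fun ω => Cstar + Rstar • CircleDeconv.circlePoint (U i ω) + ε i ω :=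
      funext (hY i)
    rw [e]
    exact (((CircleDeconv.continuous_circlePoint.measurable.comp (hUmeas i)).const_smul
      Rstar).const_add Cstar).add (hεmeas i)
  have hYindep : ∀ i j, i ≠ j → IndepFun (Y i) (Y j) P := by
    intro i j hij
    have h1 := CircleDeconv.indepFun_prodMk_prodMk_of_indepFun (hUmeas i) (hUmeas j) (hεmeas i)
      (hεmeas j) (hUindep.indepFun hij) (hεindep.indepFun hij)
      (hUε.comp ((measurable_pi_apply i).prodMk (measurable_pi_apply j))
        ((measurable_pi_apply i).prodMk (measurable_pi_apply j)))
    have hg : Measurable fun p : ℝ × CircleDeconv.Plane =>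
        Cstar + Rstar • CircleDeconv.circlePoint p.1 + p.2 :=
      (((CircleDeconv.continuous_circlePoint.measurable.comp measurable_fst).const_smul
        Rstar).const_add Cstar).add measurable_snd
    have h2 := h1.comp hg hg
    have e : ∀ k, Y k = (fun p : ℝ × CircleDeconv.Plane =>
        Cstar + Rstar • CircleDeconv.circlePoint p.1 + p.2) ∘ fun ω => (U k ω, ε k ω) :=
      fun k => funext (hY k)
    rw [e i, e j]
    exact h2
  obtain ⟨w, hw⟩ : ∃ w : ℝ → ℝ → ℂ, w = fun s t => CircleDeconv.planeChar s t Cstar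
    * ∫ ω, CircleDeconv.planeChar s t (ε 0 ω) ∂P := ⟨_, rfl⟩
  obtain ⟨ψ, hψ⟩ : ∃ ψ : ℝ → ℝ → ℂ, ψ = fun s t => ∫ ω, CircleDeconv.planeChar s t (Y 0 ω) ∂P :=
    ⟨_, rfl⟩
  have hψw : ∀ l s t, ∫ ω, CircleDeconv.planeChar s t (Y l ω) ∂P
      = w s t * CircleDeconv.charCircle fstar Rstar s t := by
    intro l s t
    simp only [hY l]
    rw [CircleDeconv.integral_planeChar_obs (hUmeas l) hfstar_nonneg (hUlaw l) (hεmeas l)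
      (hUε.comp (measurable_pi_apply l) (measurable_pi_apply l)), hw]
    have := ((hεident l).comp (CircleDeconv.measurable_planeChar s t)).integral_eq
    simp only [Function.comp_apply] at this
    rw [this]
  have hψw0 : ∀ s t, ψ s t = w s t * CircleDeconv.charCircle fstar Rstar s t := fun s t => by
    rw [hψ]; exact hψw 0 s t
  have hψl : ∀ l s t, ∫ ω, CircleDeconv.planeChar s t (Y l ω) ∂P = ψ s t := fun l s t => by
    rw [hψw, hψw0]
  -- Independence of the coordinates of the noise enters here: it makes the nuisance factor a
  -- product of its marginals.
  have hww : ∀ s t, w s 0 * w 0 t = w s t := fun s t => by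
    rw [hw]
    simp only
    rw [CircleDeconv.integral_planeChar_of_indepFun (hεmeas 0) hεcoord s t,
      ← CircleDeconv.planeChar_mul_planeChar s t Cstar]
    ring
  obtain ⟨r₁, hr₁, hwr⟩ := CircleDeconv.exists_half_le_norm_planeChar (P := P) (hεmeas 0) Cstar
  obtain ⟨B, hB, hFB⟩ := CircleDeconv.exists_norm_charCircle_le hFcompact
  -- With `ε = n ^ (-1/2)`, the bound `ε ^ (1 - 2 * δ)` is `n ^ (-1/2 + δ)`; hence the parameter `2
  -- * δ`.
  obtain ⟨r₀, hr₀, hbias⟩ := CircleDeconv.exists_center_bias_le (Rmax := Rmax) hRmin hFcompact hFint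
    hRs hfstar hfstar_nonneg (δ := 2 * δ) (by positivity)
  obtain ⟨r, hr, hrr₀, hrr₁, hrν⟩ : ∃ r, 0 < r ∧ r ≤ r₀ ∧ r ≤ r₁ ∧ r ≤ νest :=
    ⟨min r₀ (min r₁ νest), by positivity, min_le_left _ _, (min_le_right _ _).trans (min_le_left _ _),
      (min_le_right _ _).trans (min_le_right _ _)⟩
  intro η hη
  obtain ⟨K₁, hK₁, hA₁⟩ := CircleDeconv.measure_mean_circlePoint_gt_le hUmeas hUindep hfstar_nonneg
    hUlaw Rstar (η := η / 3) (by positivity)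
  obtain ⟨K₂, hK₂, hA₂⟩ := CircleDeconv.measure_mean_noise_gt_le hεindep hεident hεvar hεcentered
    (η := η / 3) (by positivity)
  obtain ⟨K₃, hK₃, hA₃⟩ := CircleDeconv.measure_integral_sqError_gt_le hYobs hYindep hψl νest
    (η := η / 3) (by positivity)
  -- The constant `48 * B ^ 4 * K₃ + 8` collects the integrated squared error at level `K₃ / n` and
  -- the optimization tolerance `1 / n`.
  obtain ⟨C, hC, hCf⟩ := hbias r hr hrr₀ (48 * B ^ 4 * K₃ + 8) (by positivity)
  refine ⟨K₁ + K₂ + C, by positivity, fun n hn => ?_⟩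
  have hn' : (0 : ℝ) < n := by exact_mod_cast hn
  have hn1 : (1 : ℝ) ≤ n := by exact_mod_cast hn
  have hA₁ := hA₁ n hn
  have hA₂ := hA₂ n hn
  have hA₃ := hA₃ n hn
  -- Outside three events of probability at most `η / 3` each, all three error terms are controlled.
  -- The comparison is almost sure because near minimality is.
  refine (measure_mono_ae (t := ({ω | K₁ * (n : ℝ) ^ (-(1 / 2) : ℝ) < _} ∪
    {ω | K₂ * (n : ℝ) ^ (-(1 / 2) : ℝ) < _}) ∪ {ω | K₃ * (1 / (n : ℝ)) < _}) ?_).trans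
    ((measure_union_le _ _).trans ((add_le_add ((measure_union_le _ _).trans
      (add_le_add hA₁ hA₂)) hA₃).trans (le_of_eq ?_)))
  swap
  · rw [← ENNReal.ofReal_add (by positivity) (by positivity),
      ← ENNReal.ofReal_add (by positivity) (by positivity)]
    congr 1
    ring
  filter_upwards [hmin n hn] with ω hω hlarge
  by_contra hnot
  have h1 : (1 / (n : ℝ)) * ‖∑ l ∈ Finset.range n, Rstar • (CircleDeconv.circlePoint (U l ω)
      - ∫ u in Set.Ioo (0 : ℝ) 1, (fstar u : ℝ) • CircleDeconv.circlePoint u)‖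
      ≤ K₁ * (n : ℝ) ^ (-(1 / 2) : ℝ) := not_lt.1 fun h => hnot (Or.inl (Or.inl h))
  have h2 : (1 / (n : ℝ)) * ‖∑ l ∈ Finset.range n, ε l ω‖ ≤ K₂ * (n : ℝ) ^ (-(1 / 2) : ℝ) :=
    not_lt.1 fun h => hnot (Or.inl (Or.inr h))
  have h3 : ∫ t in Set.Icc (-νest) νest ×ˢ Set.Icc (-νest) νest,
      CircleDeconv.sqError (CircleDeconv.empChar (fun i => Y i ω) n) ψ t ≤ K₃ * (1 / (n : ℝ)) :=
    not_lt.1 fun h => hnot (Or.inr h)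
  obtain ⟨hfF, hRI, hbest⟩ := hω
  have cψ : Continuous fun t : ℝ × ℝ => ψ t.1 t.2 := by
    rw [hψ]; exact CircleDeconv.continuous_integral_planeChar (hYobs 0)
  have h4 := CircleDeconv.integral_crossDefect_le hB hrν (τ := 1 / (n : ℝ)) (w := w)
    (CircleDeconv.continuous_charCircle (fhat n ω) (Rhat n ω))
    (CircleDeconv.continuous_charCircle fstar Rstar)
    (CircleDeconv.continuous_empChar (fun i => Y i ω) n) cψ (hFB _ hfF _) (hFB _ hfstar _)
    (CircleDeconv.norm_empChar_le _ n)
    (fun s t => by rw [hψ]; exact CircleDeconv.norm_integral_planeChar_le _ s t) hψw0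
    (fun s t => by rw [hψw0, hψw0, ← hww s t]; ring)
    (fun s hs t ht => by
      rw [hw]
      exact hwr s ⟨by linarith [hs.1], hs.2.trans hrr₁⟩ t ⟨by linarith [ht.1], ht.2.trans hrr₁⟩)
    (hbest fstar hfstar Rstar hRs')
  have hpow : ((n : ℝ) ^ (-(1 / 2) : ℝ)) ^ 2 = 1 / n := by
    rw [← Real.rpow_natCast, ← Real.rpow_mul hn'.le]
    norm_num [Real.rpow_neg_one]
  have h5 := hCf _ hfF _ hRI ((n : ℝ) ^ (-(1 / 2) : ℝ)) (by positivity)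
    (Real.rpow_le_one_of_one_le_of_nonpos hn1 (by norm_num)) (by
      rw [hpow]
      refine h4.trans ?_
      have := mul_le_mul_of_nonneg_left h3 (show 0 ≤ 48 * B ^ 4 by positivity)
      linarith)
  rw [← Real.rpow_mul hn'.le,
    show (-(1 / 2) : ℝ) * (1 - 2 * δ) = -(1 / 2 : ℝ) + δ by ring] at h5
  have h6 : (n : ℝ) ^ (-(1 / 2) : ℝ) ≤ (n : ℝ) ^ (-(1 / 2 : ℝ) + δ) :=
    Real.rpow_le_rpow_of_exponent_le hn1 (by linarith)
  refine not_le.2 (show (K₁ + K₂ + C) * (n : ℝ) ^ (-(1 / 2 : ℝ) + δ) < ‖CircleDeconv.centerEst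
    (fun i => Y i ω) n (fhat n ω) (Rhat n ω) - Cstar‖ from hlarge) ?_
  rw [CircleDeconv.centerEst_sub_eq (fun i => hY i ω)
    (∫ u in Set.Ioo (0 : ℝ) 1, (fstar u : ℝ) • CircleDeconv.circlePoint u) hn]
  have hsm : ∀ v : CircleDeconv.Plane, ‖(1 / (n : ℝ)) • v‖ = (1 / (n : ℝ)) * ‖v‖ := fun v => by
    rw [norm_smul, Real.norm_of_nonneg (by positivity)]
  refine (norm_sub_le _ _).trans ((add_le_add_left (norm_add_le _ _) _).trans ?_)
  rw [hsm, hsm]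
  have h7 := mul_le_mul_of_nonneg_left h6 hK₁.le
  have h8 := mul_le_mul_of_nonneg_left h6 hK₂.le
  linarith
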